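/- **Conventions.** All languages are finite first-order languages with equality. $\mathcal L$ is the language of set theory with the symbols $\in,0,S,+,\times$, where $0=\varnothing$, $Sx=x\cup\{x\}$ and $+,\times$ are addition and multiplication on $\mathbb N$ (with value $0$ at other arguments); $\mathsf{ZF}$ is formulated in $\mathcal L$ and includes these defining axioms. $L_{\mathsf{Uni},\mathsf{Mod}}$ is $L$ augmented with a unary symbol $\mathsf{Uni}$ and a ternary symbol $\mathsf{Mod}$. $\underline n$ is the numeral of $n$ and $\ulcorner\phi\urcorner$ the (numeral of the) Gödel code of $\phi$. $\vdash$ is first-order provability. A structure is a pair $\langle D,I\rangle$ of a nonempty domain and an interpretation of the symbols; $\mathrm{VA}^{\mathcal U}$ is the set of variable assignments into the domain of $\mathcal U$; $\mathcal U\models\phi$ means that $\mathcal U\models(\phi,f)$ for all $f\in\mathrm{VA}^{\mathcal U}$. These notions are also expressed by $\mathcal L$-formulas inside set theory. **Revision parameters.** Let $\mathcal L\subseteq\mathcal L^{\mathrm{Rev}}\subseteq\mathcal L^{\mathrm T}$, where $\mathsf{Uni},\mathsf{Mod}$ are not in $\mathcal L^{\mathrm T}$. Let $(\mathbf T_n)_{n\in\mathbb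 N}$ be $\mathcal L^{\mathrm T}$-theories with $\mathbf T_{n+1}\vdash\mathbf T_n$ for all $n$, and put $\mathbf T_\omega=\bigcup_n\mathbf T_n$. Let $\mathrm{Uni}_n(\mathcal U)$ and $\mathrm{Mod}_0(\mathcal U,\phi,f)$ be $\mathcal L$-formulas with free variables among $n,\mathcal U$ and among $\mathcal U,\phi,f$, respectively, such that $\mathbf T_\omega$ proves: * $\mathrm{Uni}_0(\mathcal U)\to$ "$\mathcal U$ is an $\mathcal L^{\mathrm T}$-structure"; * $\mathrm{Uni}_{n+1}(\mathcal U)\to\mathrm{Uni}_n(\mathcal U)$ for all $n\in\mathbb N$; * $\mathrm{Mod}_0(\mathcal U,\phi,f)\to\mathrm{Uni}_0(\mathcal U)\wedge\phi\in\mathcal L^{\mathrm{Rev}}_{\mathsf{Uni},\mathsf{Mod}}\wedge f\in\mathrm{VA}^{\mathcal U}$. The parameters *admit* $\mathsf{NEC}^*$ if for all $n\in\mathbb N$ and $\phi\in\mathcal L^{\mathrm{Rev}}$, $\mathbf T_n\vdash\phi$ implies $\mathbf T_{n+1}\vdash\forall\mathcal U\,(\mathrm{Uni}_{\underline{n+1}}(\mathcal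 U)\to\mathcal U\models\ulcorner\phi\urcorner)$. They *admit* $\mathsf{CONEC}^*$ if for all such $n,\phi$, $\mathbf T_{n+1}\vdash\forall\mathcal U\,(\mathrm{Uni}_{\underline{n+1}}(\mathcal U)\to\mathcal U\models\ulcorner\phi\urcorner)$ implies $\mathbf T_{n+2}\vdash\phi$. **Revision formula.** An $\mathcal L$-formula $\mathrm{Mod}_n(\mathcal U,\phi,f)$ in the free variables $n,\mathcal U,\phi,f$ is a *revision formula over* a theory $T$ if $T$ proves $$(\dagger)\quad \mathrm{Mod}_n(\mathcal U,\phi,f)\leftrightarrow\Big(n\in\mathbb N\wedge\mathrm{Uni}_n(\mathcal U)\wedge\phi\in\mathcal L^{\mathrm{Rev}}_{\mathsf{Uni},\mathsf{Mod}}\wedge f\in\mathrm{VA}^{\mathcal U}\wedge(n=0\to\mathrm{Mod}_0(\mathcal U,\phi,f))\wedge\big(n>0\to\langle\mathcal U{\restriction}_{\mathcal L^{\mathrm{Rev}}},\ulcorner\mathrm{Uni}_{\underline{n-1}}\urcorner^{\mathcal U},\ulcorner\mathrm{Mod}_{\underline{n-1}}\urcorner^{\mathcal U}\rangle\models(\phi,f)\big)\Big),$$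 where $\ulcorner\chi\urcorner^{\mathcal U}$ is the extension in $\mathcal U$ of the coded formula $\chi$. Given such a formula, $\mathcal I_{\underline k}$ is the interpretation that replaces $\mathsf{Uni}$ by $\mathrm{Uni}_{\underline k}$ and $\mathsf{Mod}$ by $\mathrm{Mod}_{\underline k}$ and fixes all other symbols, and $\mathfrak F=\{\mathcal I_{\underline k}\mid k\in\mathbb N\}$. **Systems.** For $\mathcal L\subseteq\mathcal L'$, $\mathsf{CM}^-(\mathcal L')$ consists of $\mathsf{ZF}$, Separation and Replacement for $\mathcal L_{\mathsf{Uni},\mathsf{Mod}}$-formulas, and the axioms, for all $\mathcal U$ with $\mathsf{Uni}(\mathcal U)$, all $f\in\mathrm{VA}^{\mathcal U}$, all variables $x,y,u$ and all $\phi,\psi\in\mathcal L'_{\mathsf{Uni},\mathsf{Mod}}$ (quantified inside the theory): $\mathsf{Mod}(\mathcal U,\ulcorner x=y\urcorner,f)\leftrightarrow f(x)=f(y)$; $\mathsf{Mod}(\mathcal U,\neg\phi,f)\leftrightarrow\neg\mathsf{Mod}(\mathcal U,\phi,f)$; $\mathsf{Mod}(\mathcal U,\phi\wedge\psi,f)\leftrightarrow\mathsf{Mod}(\mathcal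 U,\phi,f)\wedge\mathsf{Mod}(\mathcal U,\psi,f)$; $\mathsf{Mod}(\mathcal U,\forall u\,\phi,f)\leftrightarrow\mathsf{Mod}(\mathcal U,\phi,g)$ for all $g\in\mathrm{VA}^{\mathcal U}$ that agree with $f$ off $u$. $\mathsf{CM}^-$ is $\mathsf{CM}^-(\mathcal L)$. Let $\mathsf{Tr}^\Box(\phi)$ be $\forall\mathcal U\,(\mathsf{Uni}(\mathcal U)\to\forall f\in\mathrm{VA}^{\mathcal U}\,\mathsf{Mod}(\mathcal U,\phi,f))$. $\mathsf{NEC}$ is the rule "from $\phi$ infer $\mathsf{Tr}^\Box(\ulcorner\phi\urcorner)$" and $\mathsf{CONEC}$ the rule "from $\mathsf{Tr}^\Box(\ulcorner\phi\urcorner)$ infer $\phi$", for sentences $\phi$ of $\mathcal L'_{\mathsf{Uni},\mathsf{Mod}}$; they may be applied anywhere in a proof. $\mathsf{MS}^-(\mathcal L')=\mathsf{CM}^-(\mathcal L')+\mathsf{NEC}+\mathsf{CONEC}$, and $\mathsf{MS}^-=\mathsf{MS}^-(\mathcal L)$. $\mathbf T_\omega$ *locally interprets* a system by $\mathfrak F$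 if for every finite set $\Phi$ of theorems of the system there is $\mathcal I\in\mathfrak F$ such that $\mathbf T_\omega\vdash\mathcal I(\phi)$ for every $\phi$ with $\Phi\vdash\phi$. **Main Lemma.** Let $\mathrm T,\mathrm{Uni},\mathrm{Mod}_0$ be revision parameters such that $\mathbf T_\omega\vdash\mathsf{ZF}$. There is a revision formula over $\mathsf{ZF}$. Moreover, let $\mathrm{Mod}_n$ be any revision formula over $\mathbf T_\omega$, let $\mathcal L\subseteq\mathcal L'\subseteq\mathcal L^{\mathrm{Rev}}$ (for instance $\mathcal L'=\mathcal L$), and let $S$ be an $\mathcal L^{\mathrm{Rev}}_{\mathsf{Uni},\mathsf{Mod}}$-theory such that for every finite $\Gamma\subseteq S$ there is $A\in\mathbb N$ with $\mathbf T_k\vdash\mathcal I_{\underline k}(\Gamma)$ for all $k\ge A$. Then: (a) If the parameters admit $\mathsf{NEC}^*$, then $\mathbf T_\omega$ locally interprets $\mathsf{CM}^-(\mathcal L')+\mathsf{NEC}+S$ by $\mathfrak F$. (b) If they admit $\mathsf{CONEC}^*$, then $\mathbf T_\omega$ locally interprets $\mathsf{CM}^-(\mathcal L')+\mathsf{CONEC}+S$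 by $\mathfrak F$. (c) If they admit $\mathsf{NEC}^*$ and $\mathsf{CONEC}^*$, then $\mathbf T_\omega$ locally interprets $\mathsf{MS}^-(\mathcal L')+S$ by $\mathfrak F$. (d) If they admit $\mathsf{NEC}^*$ and $\mathsf{CONEC}^*$, then for every finite set $\Gamma$ of axioms of $\mathsf{CM}^-(\mathcal L')+S$ there is $A'\ge1$ such that $\mathbf T_k\vdash\mathcal I_{\underline k}(\Gamma)$ for all $k\ge A'$, and such that, whenever $\psi$ has a proof in $\mathsf{MS}^-(\mathcal L')+S$ with axioms from $\Gamma$ in which all $N$ applications of $\mathsf{NEC}$ precede all $C$ applications of $\mathsf{CONEC}$, $$\mathbf T_{2C+k+A'}\vdash\mathcal I_{\underline{k+A'}}(\psi)\quad\text{for all }k\ge N+1;$$ in particular $\mathbf T_{2C+N+1+A'}\vdash\mathcal I_{\underline{N+1+A'}}(\psi)$. -/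

import Mathlib

open FirstOrder

namespace Multiverse

/-! ### First-order syntax with named variables

All languages are finite sets of symbols drawn from one universal alphabet that has, for every arity,
function symbols and relation symbols numbered by `ℕ`. Terms are Mathlib's terms over that alphabet.
The variables are `x₀, x₁, x₂, …`. -/

/-- The universal alphabet. -/
abbrev alphabet : Language := ⟨fun _ => ℕ, fun _ => ℕ⟩

/-- Terms, with variables named by natural numbers. -/
abbrev Tm : Type := alphabet.Term ℕ

/-- The variable `xₙ`. -/
abbrev v (n : ℕ) : Tm := Language.Term.var n

/-- The function symbol number `f` of arity `a`, applied to `ts`. -/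
abbrev fn (a f : ℕ) (ts : Fin a → Tm) : Tm := Language.Term.func (L := alphabet) (l := a) f ts

/-- Formulas; the primitive logical symbols are `=`, `¬`, `∧`, `∀`. -/
inductive Fml : Type
  | eq (t s : Tm) : Fml
  | rel (a R : ℕ) (ts : Fin a → Tm) : Fml
  | neg (φ : Fml) : Fml
  | and (φ ψ : Fml) : Fml
  | all (x : ℕ) (φ : Fml) : Fml

namespace Fml

def imp (φ ψ : Fml) : Fml := neg (and φ (neg ψ))
def or (φ ψ : Fml) : Fml := neg (and (neg φ) (neg ψ))
def iff (φ ψ : Fml) : Fml := and (imp φ ψ) (imp ψ φ)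
def ex (x : ℕ) (φ : Fml) : Fml := neg (all x (neg φ))

/-- The free variables. -/
def fv : Fml → Finset ℕ
  | eq t s => t.varFinset ∪ s.varFinset
  | rel a _ ts => (Finset.univ : Finset (Fin a)).biUnion fun i => (ts i).varFinset
  | neg φ => φ.fv
  | and φ ψ => φ.fv ∪ ψ.fv
  | all x φ => φ.fv.erase x

def IsSentence (φ : Fml) : Prop := φ.fv = ∅

end Fml

/-- A number greater than all elements of `s`. -/
def fresh (s : Finset ℕ) : ℕ := s.sup Nat.succ

/-- Simultaneous capture-avoiding substitution: every bound variable is renamed to a variable that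
is fresh for the terms substituted for the free variables below the quantifier. -/
def Fml.subst : Fml → (ℕ → Tm) → Fml
  | .eq t s, σ => .eq (t.subst σ) (s.subst σ)
  | .rel a R ts, σ => .rel a R fun i => (ts i).subst σ
  | .neg φ, σ => .neg (φ.subst σ)
  | .and φ ψ, σ => .and (φ.subst σ) (ψ.subst σ)
  | .all x φ, σ =>
      let z := fresh ((φ.fv.erase x).biUnion fun y => (σ y).varFinset)
      .all z (φ.subst (Function.update σ x (v z)))

/-- `φ[t/x]` -/
def Fml.subst1 (φ : Fml) (x : ℕ) (t : Tm) : Fml := φ.subst (Function.update v x t)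

/-- `φ.at ts` is `φ` with the terms `t₀, t₁, …` of the list `ts` in place of `x₀, x₁, …`. -/
def Fml.at (φ : Fml) (ts : List Tm) : Fml := φ.subst fun i => ts.getD i (v i)

/-! ### Languages -/

/-- A finite language: lists of function symbols and of relation symbols, each symbol being a pair
`(arity, number)`. -/
structure Lang where
  funs : List (ℕ × ℕ)
  rels : List (ℕ × ℕ)

/-- Inclusion of languages. -/
def Lang.Sub (K L : Lang) : Prop := (∀ s ∈ K.funs, s ∈ L.funs) ∧ ∀ s ∈ K.rels, s ∈ L.rels

/-- `t` is a term of the language `L`. -/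
def InLangT (L : Lang) : Tm → Prop
  | .var _ => True
  | @Language.Term.func _ _ a f ts => (a, f) ∈ L.funs ∧ ∀ i, InLangT L (ts i)

/-- `φ` is a formula of the language `L`. -/
def Fml.In (L : Lang) : Fml → Prop
  | .eq t s => InLangT L t ∧ InLangT L s
  | .rel a R ts => (a, R) ∈ L.rels ∧ ∀ i, InLangT L (ts i)
  | .neg φ => φ.In L
  | .and φ ψ => φ.In L ∧ ψ.In L
  | .all _ φ => φ.In L

/-- The language of set theory: the relation symbol `∈` and the arithmetical symbols
`0, S, +, ×` (constant, unary, binary, binary). -/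
def baseLang : Lang := ⟨[(0, 0), (1, 0), (2, 0), (2, 1)], [(2, 0)]⟩

/-- The symbol `Uni`, unary. -/
def uniSym : ℕ × ℕ := (1, 0)
/-- The symbol `Mod`, ternary. -/
def modSym : ℕ × ℕ := (3, 0)

/-- `L` augmented with the symbols `Uni` and `Mod`. -/
def Lang.um (L : Lang) : Lang := ⟨L.funs, uniSym :: modSym :: L.rels⟩

/-! ### First-order provability -/

/-- `φ` is a propositional tautology. -/
def IsTaut (φ : Fml) : Prop :=
  ∀ e : Fml → Prop, (∀ α, e (.neg α) ↔ ¬ e α) → (∀ α β, e (.and α β) ↔ (e α ∧ e β)) → e φ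

/-- Logical axioms of first-order logic with equality. -/
inductive LogicalAx : Fml → Prop
  | taut (φ : Fml) : IsTaut φ → LogicalAx φ
  | inst (φ : Fml) (x : ℕ) (t : Tm) : LogicalAx (.imp (.all x φ) (φ.subst1 x t))
  | inst_self (φ : Fml) (x : ℕ) : LogicalAx (.imp (.all x φ) φ)
  | dist (φ ψ : Fml) (x : ℕ) : x ∉ φ.fv →
      LogicalAx (.imp (.all x (.imp φ ψ)) (.imp φ (.all x ψ)))
  | eq_refl (t : Tm) : LogicalAx (.eq t t)
  | eq_subst (φ : Fml) (x : ℕ) (t s : Tm) :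
      LogicalAx (.imp (.eq t s) (.imp (φ.subst1 x t) (φ.subst1 x s)))

/-- `Proves L T φ`: there is a first-order (Hilbert-style) derivation, consisting of `L`-formulas,
of `φ` from the theory `T`. The rules are modus ponens and generalization, so that an axiom with
free variables has the force of its universal closure. -/
inductive Proves (L : Lang) (T : Set Fml) : Fml → Prop
  | ax (φ : Fml) : φ ∈ T → φ.In L → Proves L T φ
  | logic (φ : Fml) : LogicalAx φ → φ.In L → Proves L T φ
  | mp (φ ψ : Fml) : Proves L T φ → Proves L T (.imp φ ψ) → Proves L T ψ
  | gen (φ : Fml) (x : ℕ) : Proves L T φ → Proves L T (.all x φ)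

/-! ### Notation for object-level formulas -/

infix:70 " ≐ " => Fml.eq
infixr:65 " ⋏ " => Fml.and
infixr:64 " ⋎ " => Fml.or
infixr:60 " ⇛ " => Fml.imp
infix:58 " ⟚ " => Fml.iff

/-- `t ∈ s` -/
def mem (t s : Tm) : Fml := .rel 2 0 ![t, s]
infix:70 " ∊ " => mem

/-- The atomic formula `Uni(t)`. -/
def uniR (t : Tm) : Fml := .rel 1 0 ![t]
/-- The atomic formula `Mod(t, s, r)`. -/
def modR (t s r : Tm) : Fml := .rel 3 0 ![t, s, r]

def zeroT : Tm := fn 0 0 ![]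
def succT (t : Tm) : Tm := fn 1 0 ![t]
def addT (t s : Tm) : Tm := fn 2 0 ![t, s]
def mulT (t s : Tm) : Tm := fn 2 1 ![t, s]

/-- The numeral of `n`: the term `S(S(…S(0)))`. -/
def num : ℕ → Tm
  | 0 => zeroT
  | n + 1 => succT (num n)

/-- The variables `x_s, …, x_{s+n-1}`. -/
def vs (s n : ℕ) : List Tm := (List.range n).map fun j => v (s + j)

/-- `∀ x_s … ∀ x_{s+n-1} φ` -/
def alls (s n : ℕ) (φ : Fml) : Fml := (List.range n).foldr (fun j ψ => .all (s + j) ψ) φ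
/-- `∃ x_s … ∃ x_{s+n-1} φ` -/
def exs (s n : ℕ) (φ : Fml) : Fml := (List.range n).foldr (fun j ψ => .ex (s + j) ψ) φ

def topF : Fml := zeroT ≐ zeroT
/-- Finite conjunctions. -/
def conjs (l : List Fml) : Fml := l.foldr Fml.and topF
/-- Finite disjunctions. -/
def disjs (l : List Fml) : Fml := l.foldr Fml.or (.neg topF)

/-! ### Gödel codes

Codes are natural numbers, built with the injective pairing function `(a + b)² + a`. Each syntactic
operation on codes is therefore given by a term of the language of set theory. -/

/-- Pairing of natural numbers. -/
def pr (a b : ℕ) : ℕ := (a + b) * (a + b) + a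

def listCode : List ℕ → ℕ
  | [] => 0
  | a :: l => pr a (listCode l) + 1

def codeT : Tm → ℕ
  | .var n => pr 0 n
  | @Language.Term.func _ _ a f ts =>
      pr 1 (pr (pr a f) (listCode (List.ofFn fun i => codeT (ts i))))

/-- The Gödel code of a formula. -/
def code : Fml → ℕ
  | .eq t s => pr 0 (pr (codeT t) (codeT s))
  | .rel a R ts => pr 1 (pr (pr a R) (listCode (List.ofFn fun i => codeT (ts i))))
  | .neg φ => pr 2 (code φ)
  | .and φ ψ => pr 3 (pr (code φ) (code ψ))
  | .all x φ => pr 4 (pr x (code φ))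

/-- The codes of the symbols of a language. -/
def funSymCode (s : ℕ × ℕ) : ℕ := pr 0 (pr s.1 s.2)
def relSymCode (s : ℕ × ℕ) : ℕ := pr 1 (pr s.1 s.2)

/-- The same operations on codes, as terms of the language of set theory. -/
def prT (t s : Tm) : Tm := addT (mulT (addT t s) (addT t s)) t

def listT : List Tm → Tm
  | [] => zeroT
  | t :: l => succT (prT t (listT l))

def varC (n : Tm) : Tm := prT (num 0) n
def appC (a f : ℕ) (ts : List Tm) : Tm := prT (num 1) (prT (prT (num a) (num f)) (listT ts))
def eqC (t s : Tm) : Tm := prT (num 0) (prT t s)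
def relC (a R : ℕ) (ts : List Tm) : Tm := prT (num 1) (prT (prT (num a) (num R)) (listT ts))
def negC (t : Tm) : Tm := prT (num 2) t
def andC (t s : Tm) : Tm := prT (num 3) (prT t s)
def allC (x t : Tm) : Tm := prT (num 4) (prT x t)
def impC (t s : Tm) : Tm := negC (andC t (negC s))

/-! ### Basic notions of set theory as formulas

A formula that defines an `m`-ary notion has the free variables `x₀, …, x_{m-1}`, its arguments. -/

/-- `x₀` is a natural number (an element of every inductive set). -/
def isNat : Fml :=
  .all 1 (zeroT ∊ v 1 ⋏ .all 2 (v 2 ∊ v 1 ⇛ succT (v 2) ∊ v 1) ⇛ v 0 ∊ v 1)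

/-- `x₀ = ⟨x₁, x₂⟩ = {{x₁}, {x₁, x₂}}` -/
def isPair : Fml :=
  .all 3 (v 3 ∊ v 0 ⟚
    (.all 4 (v 4 ∊ v 3 ⟚ v 4 ≐ v 1) ⋎ .all 4 (v 4 ∊ v 3 ⟚ (v 4 ≐ v 1 ⋎ v 4 ≐ v 2))))

/-- `⟨x₀, x₁⟩ ∈ x₂` -/
def pairMem : Fml := .ex 3 (isPair.at [v 3, v 0, v 1] ⋏ v 3 ∊ v 2)

/-- `⟨⟨x₀, x₁⟩, x₂⟩ ∈ x₃` -/
def tripleMem : Fml := .ex 4 (isPair.at [v 4, v 0, v 1] ⋏ pairMem.at [v 4, v 2, v 3])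

/-- `x₀` is the `a`-tuple `⟨x₁, ⟨x₂, … ⟨x_a, 0⟩⟩⟩`. -/
def isTuple : ℕ → Fml
  | 0 => v 0 ≐ zeroT
  | a + 1 => .ex (a + 2)
      ((isTuple a).at (v (a + 2) :: vs 2 a) ⋏ isPair.at [v 0, v 1, v (a + 2)])

/-- `x₀` is a variable assignment into the set `x₁`: a function from `ℕ` to `x₁`
(the variable `xₙ` being identified with its index `n`). -/
def isVA : Fml :=
  .all 2 (v 2 ∊ v 0 ⇛
    .ex 3 (.ex 4 (isNat.at [v 3] ⋏ v 4 ∊ v 1 ⋏ isPair.at [v 2, v 3, v 4]))) ⋏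
  .all 3 (isNat.at [v 3] ⇛ .ex 4 (.all 5 (pairMem.at [v 3, v 5, v 0] ⟚ v 5 ≐ v 4)))

/-- `x₀` is a variable assignment into the domain of the structure `x₁`; a structure is a pair
`⟨D, I⟩` of a domain and an interpretation function. -/
def isVAof : Fml := .ex 2 (.ex 3 (isPair.at [v 1, v 2, v 3] ⋏ isVA.at [v 0, v 2]))

/-- The assignments `x₀`, `x₁` agree at all variables other than `x₂`. -/
def agreeOff : Fml :=
  .all 3 (isNat.at [v 3] ⋏ .neg (v 3 ≐ v 2) ⇛
    .all 4 (pairMem.at [v 3, v 4, v 0] ⟚ pairMem.at [v 3, v 4, v 1]))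

/-! ### Internal syntax and model theory, for a finite language `K` -/

/-- The set `x₀` contains the codes of variables and is closed under the function symbols of `K`. -/
def closedTerms (K : Lang) : Fml :=
  .all 1 (isNat.at [v 1] ⇛ varC (v 1) ∊ v 0) ⋏
  conjs (K.funs.map fun s =>
    alls 1 s.1 (conjs ((vs 1 s.1).map fun t => t ∊ v 0) ⇛ appC s.1 s.2 (vs 1 s.1) ∊ v 0))

/-- `x₀` is (the code of) a term of `K`. -/
def isTerm (K : Lang) : Fml := .all 1 ((closedTerms K).at [v 1] ⇛ v 0 ∊ v 1)

/-- The set `x₀` contains the codes of the atomic formulas of `K` and is closed under the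
formation of negations, conjunctions and universal quantifications. -/
def closedForms (K : Lang) : Fml :=
  .all 1 (.all 2 ((isTerm K).at [v 1] ⋏ (isTerm K).at [v 2] ⇛ eqC (v 1) (v 2) ∊ v 0)) ⋏
  conjs (K.rels.map fun s =>
    alls 1 s.1 (conjs ((vs 1 s.1).map fun t => (isTerm K).at [t]) ⇛
      relC s.1 s.2 (vs 1 s.1) ∊ v 0)) ⋏
  .all 1 (v 1 ∊ v 0 ⇛ negC (v 1) ∊ v 0) ⋏
  .all 1 (.all 2 (v 1 ∊ v 0 ⋏ v 2 ∊ v 0 ⇛ andC (v 1) (v 2) ∊ v 0)) ⋏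
  .all 1 (.all 2 (isNat.at [v 1] ⋏ v 2 ∊ v 0 ⇛ allC (v 1) (v 2) ∊ v 0))

/-- `x₀` is (the code of) a formula of `K`. -/
def isForm (K : Lang) : Fml := .all 1 ((closedForms K).at [v 1] ⇛ v 0 ∊ v 1)

/-- `x₀` is an `a`-ary operation on the set `x₁`. -/
def isOp (a : ℕ) : Fml :=
  .all 2 (v 2 ∊ v 0 ⇛ .ex 3 (.ex 4 (exs 5 a
    (conjs ((vs 5 a).map fun t => t ∊ v 1) ⋏ v 4 ∊ v 1 ⋏ (isTuple a).at (v 3 :: vs 5 a) ⋏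
      isPair.at [v 2, v 3, v 4])))) ⋏
  alls 5 a (.all 3 (conjs ((vs 5 a).map fun t => t ∊ v 1) ⋏ (isTuple a).at (v 3 :: vs 5 a) ⇛
    .ex 4 (.all 2 (pairMem.at [v 3, v 2, v 0] ⟚ v 2 ≐ v 4))))

/-- `x₀` is an `a`-ary relation on the set `x₁`. -/
def isRel (a : ℕ) : Fml :=
  .all 2 (v 2 ∊ v 0 ⇛ exs 3 a
    (conjs ((vs 3 a).map fun t => t ∊ v 1) ⋏ (isTuple a).at (v 2 :: vs 3 a)))

/-- `x₀` is a `K`-structure: a pair `⟨D, I⟩` of a nonempty set `D` and a function `I` whose domain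
is the set of the codes of the symbols of `K`, and which assigns to each symbol an operation or a
relation on `D` of the same arity. -/
def isStruct (K : Lang) : Fml :=
  .ex 1 (.ex 2 (isPair.at [v 0, v 1, v 2] ⋏ .ex 3 (v 3 ∊ v 1) ⋏
    .all 3 (v 3 ∊ v 2 ⇛ .ex 4 (.ex 5 (isPair.at [v 3, v 4, v 5] ⋏
      disjs ((K.funs.map funSymCode ++ K.rels.map relSymCode).map fun c => v 4 ≐ num c)))) ⋏
    conjs (K.funs.map fun s => .ex 3 (
      .all 4 (pairMem.at [num (funSymCode s), v 4, v 2] ⟚ v 4 ≐ v 3) ⋏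
        (isOp s.1).at [v 3, v 1])) ⋏
    conjs (K.rels.map fun s => .ex 3 (
      .all 4 (pairMem.at [num (relSymCode s), v 4, v 2] ⟚ v 4 ≐ v 3) ⋏
        (isRel s.1).at [v 3, v 1]))))

/-- Given a domain `x₀` and an interpretation function `x₁`, the set `x₂` satisfies the recursive
conditions on the value of a term under an assignment (`⟨⟨t, f⟩, d⟩ ∈ x₂` says that `t` has the
value `d` under `f`). -/
def evalClauses (K : Lang) : Fml :=
  .all 3 (isVA.at [v 3, v 0] ⇛
    .all 4 (.all 5 (isNat.at [v 4] ⇛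
      (tripleMem.at [varC (v 4), v 3, v 5, v 2] ⟚ pairMem.at [v 4, v 5, v 3]))) ⋏
    conjs (K.funs.map fun s =>
      let a := s.1
      let q := v (6 + 2 * a)
      let y := v (7 + 2 * a)
      alls 6 a (conjs ((vs 6 a).map fun t => (isTerm K).at [t]) ⇛
        .all 4 (tripleMem.at [appC a s.2 (vs 6 a), v 3, v 4, v 2] ⟚
          exs (6 + a) a (
            conjs ((List.range a).map fun j =>
              tripleMem.at [v (6 + j), v 3, v (6 + a + j), v 2]) ⋏
            .ex (6 + 2 * a) (.ex (7 + 2 * a) ((isTuple a).at (q :: vs (6 + a) a) ⋏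
              pairMem.at [num (funSymCode s), y, v 1] ⋏ pairMem.at [q, v 4, y])))))))

/-- Given a domain `x₀`, an interpretation function `x₁` and the evaluation `x₂` of terms, the
set `x₃` satisfies Tarski's conditions on satisfaction (`⟨φ, f⟩ ∈ x₃` says that `φ` is satisfied
under the assignment `f`). -/
def satClauses (K : Lang) : Fml :=
  .all 4 (isVA.at [v 4, v 0] ⇛
    .all 5 (.all 6 ((isTerm K).at [v 5] ⋏ (isTerm K).at [v 6] ⇛
      (pairMem.at [eqC (v 5) (v 6), v 4, v 3] ⟚
        .ex 7 (tripleMem.at [v 5, v 4, v 7, v 2] ⋏ tripleMem.at [v 6, v 4, v 7, v 2])))) ⋏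
    conjs (K.rels.map fun s =>
      let a := s.1
      let q := v (7 + 2 * a)
      let y := v (8 + 2 * a)
      alls 7 a (conjs ((vs 7 a).map fun t => (isTerm K).at [t]) ⇛
        (pairMem.at [relC a s.2 (vs 7 a), v 4, v 3] ⟚
          exs (7 + a) a (
            conjs ((List.range a).map fun j =>
              tripleMem.at [v (7 + j), v 4, v (7 + a + j), v 2]) ⋏
            .ex (7 + 2 * a) (.ex (8 + 2 * a) ((isTuple a).at (q :: vs (7 + a) a) ⋏
              pairMem.at [num (relSymCode s), y, v 1] ⋏ q ∊ y)))))) ⋏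
    .all 5 ((isForm K).at [v 5] ⇛
      (pairMem.at [negC (v 5), v 4, v 3] ⟚ .neg (pairMem.at [v 5, v 4, v 3]))) ⋏
    .all 5 (.all 6 ((isForm K).at [v 5] ⋏ (isForm K).at [v 6] ⇛
      (pairMem.at [andC (v 5) (v 6), v 4, v 3] ⟚
        (pairMem.at [v 5, v 4, v 3] ⋏ pairMem.at [v 6, v 4, v 3])))) ⋏
    .all 5 (.all 6 ((isForm K).at [v 5] ⋏ isNat.at [v 6] ⇛
      (pairMem.at [allC (v 6) (v 5), v 4, v 3] ⟚
        .all 7 (isVA.at [v 7, v 0] ⋏ agreeOff.at [v 7, v 4, v 6] ⇛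
          pairMem.at [v 5, v 7, v 3])))))

/-- `x₀ ⊨ (x₁, x₂)`: the formula `x₁` of `K` is true in the structure `x₀` under the variable
assignment `x₂`. -/
def sat (K : Lang) : Fml :=
  .ex 3 (.ex 4 (.ex 5 (.ex 6 (isPair.at [v 0, v 3, v 4] ⋏ (isForm K).at [v 1] ⋏
    isVA.at [v 2, v 3] ⋏ (evalClauses K).at [v 3, v 4, v 5] ⋏
    (satClauses K).at [v 3, v 4, v 5, v 6] ⋏ pairMem.at [v 1, v 2, v 6]))))

/-- `x₀ ⊨ x₁`: the formula `x₁` is true in the structure `x₀` under all variable assignments. -/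
def models (K : Lang) : Fml := .all 2 (isVAof.at [v 2, v 0] ⇛ (sat K).at [v 0, v 1, v 2])

/-! ### The theory ZF and the systems of satisfaction for the multiverse -/

/-- Separation for the property `φ` of `x`: `∃ b ∀ x (x ∈ b ↔ x ∈ a ∧ φ)`. -/
def sepAx (φ : Fml) (x a b : ℕ) : Fml :=
  .all a (.ex b (.all x (v x ∊ v b ⟚ (v x ∊ v a ⋏ φ))))

/-- Replacement for the functional relation `φ` between `x` and `y`. -/
def repAx (φ : Fml) (x y a b : ℕ) : Fml :=
  .all a (.all x (v x ∊ v a ⇛ .ex b (.all y (φ ⟚ v y ≐ v b))) ⇛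
    .ex b (.all y (v y ∊ v b ⟚ .ex x (v x ∊ v a ⋏ φ))))

/-- The Separation schema for the formulas of `L` (parameters allowed). -/
def Sep (L : Lang) : Set Fml :=
  {θ | ∃ φ x a b, φ.In L ∧ [x, a, b].Nodup ∧ a ∉ φ.fv ∧ b ∉ φ.fv ∧ θ = sepAx φ x a b}

/-- The Replacement schema for the formulas of `L` (parameters allowed). -/
def Rep (L : Lang) : Set Fml :=
  {θ | ∃ φ x y a b, φ.In L ∧ [x, y, a, b].Nodup ∧ a ∉ φ.fv ∧ b ∉ φ.fv ∧ θ = repAx φ x y a b}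

def extAx : Fml := .all 0 (.all 1 (.all 2 (v 2 ∊ v 0 ⟚ v 2 ∊ v 1) ⇛ v 0 ≐ v 1))
def pairAx : Fml := .all 0 (.all 1 (.ex 2 (.all 3 (v 3 ∊ v 2 ⟚ (v 3 ≐ v 0 ⋎ v 3 ≐ v 1)))))
def unionAx : Fml := .all 0 (.ex 1 (.all 2 (v 2 ∊ v 1 ⟚ .ex 3 (v 3 ∊ v 0 ⋏ v 2 ∊ v 3))))
def powerAx : Fml := .all 0 (.ex 1 (.all 2 (v 2 ∊ v 1 ⟚ .all 3 (v 3 ∊ v 2 ⇛ v 3 ∊ v 0))))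
def infAx : Fml := .ex 0 (zeroT ∊ v 0 ⋏ .all 1 (v 1 ∊ v 0 ⇛ succT (v 1) ∊ v 0))
def foundAx : Fml :=
  .all 0 (.ex 1 (v 1 ∊ v 0) ⇛ .ex 1 (v 1 ∊ v 0 ⋏ .all 2 (v 2 ∊ v 1 ⇛ .neg (v 2 ∊ v 0))))

/-- The axioms that define `0` (the empty set), `S` (`S x = x ∪ {x}`), and `+`, `×` (addition and
multiplication of natural numbers, with the value `0` at other arguments). -/
def arithAx : List Fml :=
  [.all 0 (.neg (v 0 ∊ zeroT)),
   .all 0 (.all 1 (v 1 ∊ succT (v 0) ⟚ (v 1 ∊ v 0 ⋎ v 1 ≐ v 0))),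
   .all 0 (isNat ⇛ addT (v 0) zeroT ≐ v 0),
   .all 0 (.all 1 (isNat ⋏ isNat.at [v 1] ⇛
     addT (v 0) (succT (v 1)) ≐ succT (addT (v 0) (v 1)))),
   .all 0 (isNat ⇛ mulT (v 0) zeroT ≐ zeroT),
   .all 0 (.all 1 (isNat ⋏ isNat.at [v 1] ⇛
     mulT (v 0) (succT (v 1)) ≐ addT (mulT (v 0) (v 1)) (v 0))),
   .all 0 (.all 1 (.neg (isNat ⋏ isNat.at [v 1]) ⇛
     addT (v 0) (v 1) ≐ zeroT ⋏ mulT (v 0) (v 1) ≐ zeroT))]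

/-- Zermelo–Fraenkel set theory, in the language `baseLang`. -/
def ZF : Set Fml :=
  {θ | θ ∈ [extAx, pairAx, unionAx, powerAx, infAx, foundAx] ∨ θ ∈ arithAx} ∪
    Sep baseLang ∪ Rep baseLang

/-- The compositional axiom for equality. -/
def cmEq : Fml :=
  .all 1 (uniR (v 1) ⇛ .all 3 (isVAof.at [v 3, v 1] ⇛
    .all 4 (.all 5 (isNat.at [v 4] ⋏ isNat.at [v 5] ⇛
      (modR (v 1) (eqC (varC (v 4)) (varC (v 5))) (v 3) ⟚
        .ex 6 (pairMem.at [v 4, v 6, v 3] ⋏ pairMem.at [v 5, v 6, v 3]))))))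

/-- The compositional axiom for negation, for the formulas of `K`. -/
def cmNeg (K : Lang) : Fml :=
  .all 1 (uniR (v 1) ⇛ .all 2 ((isForm K).at [v 2] ⇛ .all 3 (isVAof.at [v 3, v 1] ⇛
    (modR (v 1) (negC (v 2)) (v 3) ⟚ .neg (modR (v 1) (v 2) (v 3))))))

/-- The compositional axiom for conjunction, for the formulas of `K`. -/
def cmAnd (K : Lang) : Fml :=
  .all 1 (uniR (v 1) ⇛ .all 2 (.all 4 ((isForm K).at [v 2] ⋏ (isForm K).at [v 4] ⇛
    .all 3 (isVAof.at [v 3, v 1] ⇛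
      (modR (v 1) (andC (v 2) (v 4)) (v 3) ⟚
        (modR (v 1) (v 2) (v 3) ⋏ modR (v 1) (v 4) (v 3)))))))

/-- The compositional axiom for universal quantification, for the formulas of `K`. -/
def cmAll (K : Lang) : Fml :=
  .all 1 (uniR (v 1) ⇛ .all 2 ((isForm K).at [v 2] ⇛ .all 3 (isVAof.at [v 3, v 1] ⇛
    .all 4 (isNat.at [v 4] ⇛
      (modR (v 1) (allC (v 4) (v 2)) (v 3) ⟚
        .all 5 (isVAof.at [v 5, v 1] ⋏ agreeOff.at [v 5, v 3, v 4] ⇛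
          modR (v 1) (v 2) (v 5)))))))

/-- The system `CM⁻(L')`: ZF with Separation and Replacement extended to the formulas with the
symbols `Uni` and `Mod`, and the compositional axioms for the formulas of `L'` augmented with
`Uni` and `Mod`. The system `CM⁻` is `CM⁻(baseLang)`. -/
def CMminus (L' : Lang) : Set Fml :=
  ZF ∪ Sep baseLang.um ∪ Rep baseLang.um ∪ {cmEq, cmNeg L'.um, cmAnd L'.um, cmAll L'.um}

/-- `Tr^□(⌜φ⌝)`: the formula `φ` is true in all universes under all variable assignments. -/
def box (φ : Fml) : Fml :=
  .all 1 (uniR (v 1) ⇛ .all 3 (isVAof.at [v 3, v 1] ⇛ modR (v 1) (num (code φ)) (v 3)))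

/-- The sentences of the language `L`. -/
def Sent (L : Lang) : Set Fml := {φ | φ.In L ∧ φ.IsSentence}

/-- Labels of the lines of a proof, recording how a line is obtained. -/
inductive Label : Type
  | ax
  | logic
  | nec
  | conec

/-- `IsProof L Ax Nec Conec ρ`: the list `ρ` of labelled `L`-formulas, **whose last line stands
first**, is a Hilbert-style proof from the axioms `Ax`, in which the rule of necessitation
(from `φ` infer `Tr^□(⌜φ⌝)`) may be applied to the sentences in `Nec` and the rule of
co-necessitation (from `Tr^□(⌜φ⌝)` infer `φ`) may be applied to infer the sentences in `Conec`. -/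
inductive IsProof (L : Lang) (Ax Nec Conec : Set Fml) : List (Fml × Label) → Prop
  | nil : IsProof L Ax Nec Conec []
  | ax (ρ φ) : IsProof L Ax Nec Conec ρ → φ ∈ Ax → φ.In L → IsProof L Ax Nec Conec ((φ, .ax) :: ρ)
  | logic (ρ φ) : IsProof L Ax Nec Conec ρ → LogicalAx φ → φ.In L →
      IsProof L Ax Nec Conec ((φ, .logic) :: ρ)
  | mp (ρ φ ψ) : IsProof L Ax Nec Conec ρ → φ ∈ ρ.map Prod.fst → Fml.imp φ ψ ∈ ρ.map Prod.fst →
      IsProof L Ax Nec Conec ((ψ, .logic) :: ρ)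
  | gen (ρ φ x) : IsProof L Ax Nec Conec ρ → φ ∈ ρ.map Prod.fst →
      IsProof L Ax Nec Conec ((.all x φ, .logic) :: ρ)
  | nec (ρ φ) : IsProof L Ax Nec Conec ρ → φ ∈ ρ.map Prod.fst → φ ∈ Nec →
      IsProof L Ax Nec Conec ((box φ, .nec) :: ρ)
  | conec (ρ φ) : IsProof L Ax Nec Conec ρ → box φ ∈ ρ.map Prod.fst → φ ∈ Conec →
      IsProof L Ax Nec Conec ((φ, .conec) :: ρ)

/-- The theorems of the system with axioms `Ax` and the rules of necessitation and co-necessitation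
for `Nec` and `Conec`, respectively. -/
def SystemThms (L : Lang) (Ax Nec Conec : Set Fml) : Set Fml :=
  {φ | ∃ l ρ, IsProof L Ax Nec Conec ((φ, l) :: ρ)}

/-- All applications of necessitation in `ρ` come before all applications of co-necessitation
(recall that the last line of the proof stands first in the list). -/
def NecBeforeConec (ρ : List (Fml × Label)) : Prop :=
  ∀ ρ₁ φ ρ₂, ρ = ρ₁ ++ (φ, Label.nec) :: ρ₂ → ∀ ψ, (ψ, Label.conec) ∉ ρ₂

/-- The number of applications of necessitation in `ρ`. -/
def numNec (ρ : List (Fml × Label)) : ℕ :=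
  ρ.countP fun p => match p.2 with | .nec => true | _ => false

/-- The number of applications of co-necessitation in `ρ`. -/
def numConec (ρ : List (Fml × Label)) : ℕ :=
  ρ.countP fun p => match p.2 with | .conec => true | _ => false

/-! ### Revision-semantics -/

/-- The instance of the formula `χ` at the numeral of `k` for its variable `x₀`, written
`∀ x₀ (x₀ = k → χ)`. -/
def stage (k : ℕ) (χ : Fml) : Fml := .all 0 (v 0 ≐ num k ⇛ χ)

/-- `x₁` is the code of the numeral of the natural number `x₀`: there is a function that takes
each `i ≤ x₀` to the code of the numeral of `i`, and it takes `x₀` to `x₁`. -/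
def isNumCode : Fml :=
  .ex 2 (
    .all 3 (.all 4 (.all 5 (pairMem.at [v 3, v 4, v 2] ⋏ pairMem.at [v 3, v 5, v 2] ⇛
      v 4 ≐ v 5))) ⋏
    pairMem.at [zeroT, appC 0 0 [], v 2] ⋏
    .all 3 (.all 4 (v 3 ∊ v 0 ⋏ pairMem.at [v 3, v 4, v 2] ⇛
      pairMem.at [succT (v 3), appC 1 0 [v 4], v 2])) ⋏
    pairMem.at [v 0, v 1, v 2])

/-- The code of `stage m χ`, as a term, where the term `c` stands for the code of the numeral of
`m`. -/
def stageC (χ : Fml) (c : Tm) : Tm :=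
  allC (num 0) (impC (eqC (varC (num 0)) c) (num (code χ)))

/-- `x₂` is the structure `⟨x₀↾LR, ⌜Uni_m⌝^{x₀}, ⌜Mod_m⌝^{x₀}⟩` where `m = x₁`: the expansion of
the reduct to `LR` of the `LT`-structure `x₀` that interprets `Uni` and `Mod` by the extensions in
`x₀` of the formulas `Uni` and `Mod` at stage `m`. -/
def isExpansion (LT LR : Lang) (Uni Mod : Fml) : Fml :=
  .ex 3 (.ex 4 (.ex 5 (.ex 6 (isPair.at [v 0, v 3, v 4] ⋏ isPair.at [v 2, v 3, v 5] ⋏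
    isNumCode.at [v 1, v 6] ⋏ (isStruct LR.um).at [v 2] ⋏
    conjs ((LR.funs.map funSymCode ++ LR.rels.map relSymCode).map fun c =>
      .all 7 (pairMem.at [num c, v 7, v 4] ⟚ pairMem.at [num c, v 7, v 5])) ⋏
    .all 7 (pairMem.at [num (relSymCode uniSym), v 7, v 5] ⇛
      .all 8 (.all 9 (v 8 ∊ v 3 ⋏ (isTuple 1).at [v 9, v 8] ⇛
        (v 9 ∊ v 7 ⟚ .ex 10 (isVA.at [v 10, v 3] ⋏ pairMem.at [num 1, v 8, v 10] ⋏
          (sat LT).at [v 0, stageC Uni (v 6), v 10]))))) ⋏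
    .all 7 (pairMem.at [num (relSymCode modSym), v 7, v 5] ⇛
      alls 8 3 (.all 11 (conjs ((vs 8 3).map fun t => t ∊ v 3) ⋏ (isTuple 3).at (v 11 :: vs 8 3) ⇛
        (v 11 ∊ v 7 ⟚ .ex 12 (isVA.at [v 12, v 3] ⋏ pairMem.at [num 1, v 8, v 12] ⋏
          pairMem.at [num 2, v 9, v 12] ⋏ pairMem.at [num 3, v 10, v 12] ⋏
          (sat LT).at [v 0, stageC Mod (v 6), v 12])))))))))

/-- The equivalence that determines the formula `Mod`, in the variables
`n = x₀`, `U = x₁`, `φ = x₂`, `f = x₃`, by self-reference (`Mod` occurs on the right-hand side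
through its code). -/
def revisionEquiv (LT LR : Lang) (Uni Mod₀ Mod : Fml) : Fml :=
  Mod ⟚ (isNat.at [v 0] ⋏ Uni ⋏ (isForm LR.um).at [v 2] ⋏ isVAof.at [v 3, v 1] ⋏
    (v 0 ≐ zeroT ⇛ Mod₀) ⋏
    .all 4 (isNat.at [v 4] ⋏ v 0 ≐ succT (v 4) ⇛
      .ex 5 ((isExpansion LT LR Uni Mod).at [v 1, v 4, v 5] ⋏
        (sat LR.um).at [v 5, v 2, v 3])))

/-- The union `T_ω` of the theories `T_n`. -/
def unionTheory (T : ℕ → Set Fml) : Set Fml := {φ | ∃ n, φ ∈ T n}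

/-- Revision parameters in the languages `LT`, `LR`: a sequence of theories `T_n`, and formulas
`Uni` (in the variables `n = x₀`, `U = x₁`) and `Mod₀` (in the variables `U = x₁`, `φ = x₂`,
`f = x₃`) of the language of set theory. -/
structure IsRevisionParameters (LT LR : Lang) (T : ℕ → Set Fml) (Uni Mod₀ : Fml) : Prop where
  base_sub : baseLang.Sub LR
  sub : LR.Sub LT
  uni_notMem : uniSym ∉ LT.rels
  mod_notMem : modSym ∉ LT.rels
  theory_in : ∀ n, ∀ φ ∈ T n, φ.In LT
  theory_succ : ∀ n, ∀ φ ∈ T n, Proves LT (T (n + 1)) φ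
  uni_in : Uni.In baseLang
  uni_fv : Uni.fv ⊆ {0, 1}
  mod_in : Mod₀.In baseLang
  mod_fv : Mod₀.fv ⊆ {1, 2, 3}
  /-- `Uni₀(U)` implies that `U` is an `LT`-structure. -/
  uni_struct : Proves LT (unionTheory T) (Uni.at [num 0, v 1] ⇛ (isStruct LT).at [v 1])
  /-- `Uni_{n+1} ⊆ Uni_n` for all natural numbers `n`. -/
  uni_anti : Proves LT (unionTheory T)
    (isNat.at [v 0] ⋏ Uni.at [succT (v 0), v 1] ⇛ Uni.at [v 0, v 1])
  /-- `Mod₀(U, φ, f)` implies `Uni₀(U)`, that `φ` is a formula of `LR` augmented with `Uni` and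
  `Mod`, and that `f` is a variable assignment into `U`. -/
  mod_spec : Proves LT (unionTheory T)
    (Mod₀ ⇛ Uni.at [num 0, v 1] ⋏ (isForm LR.um).at [v 2] ⋏ isVAof.at [v 3, v 1])

/-- `Mod` is a formula of the language of set theory in the variables `x₀, x₁, x₂, x₃` for which the
equivalence `revisionEquiv` is provable in the theory `T` of the language `L`. -/
def IsRevisionFormula (L : Lang) (T : Set Fml) (LT LR : Lang) (Uni Mod₀ Mod : Fml) : Prop :=
  Mod.In baseLang ∧ Mod.fv ⊆ {0, 1, 2, 3} ∧ Proves L T (revisionEquiv LT LR Uni Mod₀ Mod)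

/-- The sentence `∀ U ∈ Uni_k (U ⊨ ⌜φ⌝)`. -/
def allModel (LT : Lang) (Uni : Fml) (k : ℕ) (φ : Fml) : Fml :=
  .all 1 (stage k Uni ⇛ (models LT).at [v 1, num (code φ)])

/-- The parameters admit the rule `NEC*`. -/
def AdmitsNec (LT LR : Lang) (T : ℕ → Set Fml) (Uni : Fml) : Prop :=
  ∀ (n : ℕ) (φ : Fml), φ.In LR → Proves LT (T n) φ →
    Proves LT (T (n + 1)) (allModel LT Uni (n + 1) φ)

/-- The parameters admit the rule `CONEC*`. -/
def AdmitsConec (LT LR : Lang) (T : ℕ → Set Fml) (Uni : Fml) : Prop :=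
  ∀ (n : ℕ) (φ : Fml), φ.In LR → Proves LT (T (n + 1)) (allModel LT Uni (n + 1) φ) →
    Proves LT (T (n + 2)) φ

/-- The interpretation `I_k`, which replaces the symbols `Uni` and `Mod` by the formulas `Uni_k` and
`Mod_k` and leaves everything else unchanged. -/
def interp (Uni Mod : Fml) (k : ℕ) : Fml → Fml
  | .eq t s => .eq t s
  | .rel 1 0 ts => (stage k Uni).at [v 0, ts 0]
  | .rel 3 0 ts => (stage k Mod).at [v 0, ts 0, ts 1, ts 2]
  | .rel a R ts => .rel a R ts
  | .neg φ => .neg (interp Uni Mod k φ)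
  | .and φ ψ => .and (interp Uni Mod k φ) (interp Uni Mod k ψ)
  | .all x φ => .all x (interp Uni Mod k φ)

/-- The `L₁`-theory `T₁` locally interprets the system with the set `Thms` of theorems in the
language `L₀` by the family `F`: every finite set of theorems is interpreted in `T₁`, that is, its
logical consequences are translated to theorems of `T₁`, by a member of `F`. -/
def LocallyInterprets (L₁ : Lang) (T₁ : Set Fml) (L₀ : Lang) (Thms : Set Fml)
    (F : Set (Fml → Fml)) : Prop :=
  ∀ Φ : Set Fml, Φ.Finite → Φ ⊆ Thms →
    ∃ I ∈ F, ∀ φ, Proves L₀ Φ φ → Proves L₁ T₁ (I φ)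

end Multiverse

open Multiverse

/-! Provability is treated through models. A completeness theorem for the given calculus
(`proves_of_valid`), together with soundness, turns a claim "this theory proves this formula" into a
claim about arbitrary structures, where internal set theory becomes ordinary reasoning about a
membership relation. A revision formula exists by diagonalization: the right-hand side of the
defining equivalence mentions `Mod` only through its code, so the code can be replaced by a variable
and a fixed point taken (`exists_diagonal`).

The central point is that `Mod` at stage k+1 is satisfaction in a universe expanded by its own
stage-k meanings of `Uni` and `Mod`. A standard sentence φ is true in that expansion exactly if
I_k(φ) is true in the universe (`satI_expansion`). Hence I_{k+1}(Tr^□⌜φ⌝) is equivalent to "every U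
in Uni_{k+1} satisfies I_k(φ)" (`valid_interp_box`). So NEC* leads from T_k ⊢ I_k(φ) to T_{k+1} ⊢
I_{k+1}(Tr^□⌜φ⌝) (`nec_step`). Since Uni_m ⊆ Uni_{k+1} for m ≥ k+1, CONEC* leads from T_m ⊢
I_{k+1}(Tr^□⌜φ⌝) to T_{m+1} ⊢ I_k(φ) (`conec_step`).

Two uniformity problems arise because only the union T_ω is known to prove ZF. The equivalence above
has to be available in T_k itself; everything it needs is collected in a finite list `facts`, which
all late T_k prove by compactness. For an axiom θ of CM⁻, compactness applied to each I_k(θ) would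
give a bound depending on k; so T_ω is shown to prove one formula about all positive stages, with
the stage as a variable (`interpV`, `exists_stage_interp`), and the numeral is inserted afterwards.
Separation and Replacement translate into instances with the stage as a parameter. The compositional
axioms are Tarski's clauses, because the expansion at a successor stage is unique (`modAt_suc`).

The four claims are inductions along a proof with different invariants. For (a): T_k ⊢ I_k(φ) for
all large k. For (b): T_ω ⊢ I_k(φ) for all large k. For (d): the indices are counted exactly. For
(c) these invariants fail, because CONEC moves the theory above the stage and NEC* then speaks about
the wrong universes. The remedy is to postpone CONEC*: the invariant is T_{k+j} ⊢ "I_k(φ) holds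
after descending through universes of the stages k+j, …, k+1" (`nested`). An application of NEC
keeps j, an application of CONEC raises j by one by logic alone, and CONEC* is used only at the end
to remove the j layers (`nested_strip`). Every layer also asserts the facts, so that the equivalence
for Tr^□ can be used inside it. -/

namespace Multiverse

/-! ### Semantics -/

/-- An interpretation of the universal alphabet. -/
structure Str (M : Type) where
  fnI : ∀ a : ℕ, ℕ → (Fin a → M) → M
  relI : ∀ a : ℕ, ℕ → (Fin a → M) → Prop

variable {M : Type}

/-- The value of a term under an assignment. -/
def Str.val (S : Str M) (s : ℕ → M) : Tm → M
  | .var n => s n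
  | @Language.Term.func _ _ a f ts => S.fnI a f fun i => S.val s (ts i)

/-- Satisfaction. -/
def Str.Sat (S : Str M) : (ℕ → M) → Fml → Prop
  | s, .eq t u => S.val s t = S.val s u
  | s, .rel a R ts => S.relI a R fun i => S.val s (ts i)
  | s, .neg φ => ¬ S.Sat s φ
  | s, .and φ ψ => S.Sat s φ ∧ S.Sat s ψ
  | s, .all x φ => ∀ d, S.Sat (Function.update s x d) φ

/-- Truth under all assignments. -/
def Str.Valid (S : Str M) (φ : Fml) : Prop := ∀ s, S.Sat s φ

section basics
variable (S : Str M) (s : ℕ → M)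

@[simp] theorem Str.val_var (n : ℕ) : S.val s (v n) = s n := rfl
theorem Str.val_fn (a f : ℕ) (ts : Fin a → Tm) :
    S.val s (fn a f ts) = S.fnI a f fun i => S.val s (ts i) := rfl

@[simp] theorem Str.sat_eq (t u : Tm) : S.Sat s (.eq t u) ↔ S.val s t = S.val s u := Iff.rfl
theorem Str.sat_rel (a R : ℕ) (ts : Fin a → Tm) :
    S.Sat s (.rel a R ts) ↔ S.relI a R fun i => S.val s (ts i) := Iff.rfl
@[simp] theorem Str.sat_neg (φ : Fml) : S.Sat s (.neg φ) ↔ ¬ S.Sat s φ := Iff.rfl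
@[simp] theorem Str.sat_and (φ ψ : Fml) : S.Sat s (.and φ ψ) ↔ S.Sat s φ ∧ S.Sat s ψ := Iff.rfl
@[simp] theorem Str.sat_all (x : ℕ) (φ : Fml) :
    S.Sat s (.all x φ) ↔ ∀ d, S.Sat (Function.update s x d) φ := Iff.rfl
@[simp] theorem Str.sat_imp (φ ψ : Fml) : S.Sat s (.imp φ ψ) ↔ (S.Sat s φ → S.Sat s ψ) := by
  simp [Fml.imp]
@[simp] theorem Str.sat_or (φ ψ : Fml) : S.Sat s (.or φ ψ) ↔ (S.Sat s φ ∨ S.Sat s ψ) := by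
  simp only [Fml.or, sat_neg, sat_and]; tauto
@[simp] theorem Str.sat_iff (φ ψ : Fml) : S.Sat s (.iff φ ψ) ↔ (S.Sat s φ ↔ S.Sat s ψ) := by
  simp only [Fml.iff, sat_imp, sat_and]; tauto
@[simp] theorem Str.sat_ex (x : ℕ) (φ : Fml) :
    S.Sat s (.ex x φ) ↔ ∃ d, S.Sat (Function.update s x d) φ := by
  simp [Fml.ex]

end basics

theorem Str.val_congr (S : Str M) {s s' : ℕ → M} (t : Tm)
    (h : ∀ n ∈ t.varFinset, s n = s' n) : S.val s t = S.val s' t := by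
  induction t with
  | var n => exact h n (by simp [Language.Term.varFinset])
  | func f ts ih =>
    simp only [Str.val]
    congr 1
    funext i
    exact ih i fun n hn => h n (by
      simp only [Language.Term.varFinset, Finset.mem_biUnion]
      exact ⟨i, Finset.mem_univ _, hn⟩)

theorem Str.sat_congr (S : Str M) (φ : Fml) : ∀ {s s' : ℕ → M},
    (∀ n ∈ φ.fv, s n = s' n) → (S.Sat s φ ↔ S.Sat s' φ) := by
  induction φ with
  | eq t u =>
    intro s s' h
    rw [Str.sat_eq, Str.sat_eq, S.val_congr t fun n hn => h n (by simp [Fml.fv, hn]),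
      S.val_congr u fun n hn => h n (by simp [Fml.fv, hn])]
  | rel a R ts =>
    intro s s' h
    rw [Str.sat_rel, Str.sat_rel]
    have : (fun i => S.val s (ts i)) = fun i => S.val s' (ts i) := by
      funext i
      exact S.val_congr _ fun n hn => h n (by
        simp only [Fml.fv, Finset.mem_biUnion]; exact ⟨i, Finset.mem_univ _, hn⟩)
    rw [this]
  | neg φ ih =>
    intro s s' h
    rw [Str.sat_neg, Str.sat_neg, ih h]
  | and φ ψ ih1 ih2 =>
    intro s s' h
    rw [Str.sat_and, Str.sat_and, ih1 fun n hn => h n (by simp [Fml.fv, hn]),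
      ih2 fun n hn => h n (by simp [Fml.fv, hn])]
  | all x φ ih =>
    intro s s' h
    rw [Str.sat_all, Str.sat_all]
    refine forall_congr' fun d => ih fun n hn => ?_
    by_cases hx : n = x
    · subst hx; simp
    · simp only [Function.update_of_ne hx]
      exact h n (by simp [Fml.fv, hn, hx])

theorem Str.val_subst (S : Str M) (s : ℕ → M) (t : Tm) (σ : ℕ → Tm) :
    S.val s (t.subst σ) = S.val (fun i => S.val s (σ i)) t := by
  induction t with
  | var n => rfl
  | func f ts ih => simp only [Language.Term.subst, Str.val, ih]

theorem lt_fresh {s : Finset ℕ} {n : ℕ} (h : n ∈ s) : n < fresh s :=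
  Nat.lt_of_succ_le (Finset.le_sup (f := Nat.succ) h)

theorem fresh_notMem (s : Finset ℕ) : fresh s ∉ s := fun h => (lt_fresh h).false

/-- The renamed bound variable lies outside all terms substituted for the other free variables, so
updating it leaves the values of these terms alone. -/
theorem Str.sat_subst (S : Str M) (φ : Fml) : ∀ (s : ℕ → M) (σ : ℕ → Tm),
    S.Sat s (φ.subst σ) ↔ S.Sat (fun i => S.val s (σ i)) φ := by
  induction φ with
  | eq t u => intro s σ; simp [Fml.subst, S.val_subst]
  | rel a R ts => intro s σ; simp [Fml.subst, Str.sat_rel, S.val_subst]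
  | neg φ ih => intro s σ; simp [Fml.subst, ih]
  | and φ ψ ih1 ih2 => intro s σ; simp [Fml.subst, ih1, ih2]
  | all x φ ih =>
    intro s σ
    simp only [Fml.subst, Str.sat_all, ih]
    refine forall_congr' fun d => S.sat_congr φ fun n hn => ?_
    by_cases hx : n = x
    · subst hx; simp
    · simp only [Function.update_of_ne hx]
      refine S.val_congr _ fun m hm => Function.update_of_ne (fun e => ?_) _ _
      subst e
      refine fresh_notMem _ (Finset.mem_biUnion.2 ⟨n, ?_, hm⟩)
      simp [hn, hx]

theorem Str.sat_subst1 (S : Str M) (φ : Fml) (s : ℕ → M) (x : ℕ) (t : Tm) :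
    S.Sat s (φ.subst1 x t) ↔ S.Sat (Function.update s x (S.val s t)) φ := by
  rw [Fml.subst1, S.sat_subst]
  refine S.sat_congr φ fun n _ => ?_
  by_cases hx : n = x
  · subst hx; simp
  · simp [Function.update_of_ne hx]

/-- The assignment with values `l₀, l₁, …`, continued by `s`. -/
def lst (s : ℕ → M) (l : List M) : ℕ → M := fun i => l.getD i (s i)

@[simp] theorem lst_zero (s : ℕ → M) (a : M) (l : List M) : lst s (a :: l) 0 = a := rfl
@[simp] theorem lst_one (s : ℕ → M) (a b : M) (l : List M) : lst s (a :: b :: l) 1 = b := rfl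
@[simp] theorem lst_two (s : ℕ → M) (a b c : M) (l : List M) : lst s (a :: b :: c :: l) 2 = c := rfl
@[simp] theorem lst_three (s : ℕ → M) (a b c d : M) (l : List M) :
    lst s (a :: b :: c :: d :: l) 3 = d := rfl

theorem Str.sat_at (S : Str M) (φ : Fml) (s : ℕ → M) (ts : List Tm) :
    S.Sat s (φ.at ts) ↔ S.Sat (lst s (ts.map (S.val s))) φ := by
  rw [Fml.at, S.sat_subst]
  refine S.sat_congr φ fun n _ => ?_
  simp only [lst, List.getD_eq_getElem?_getD, List.getElem?_map]
  cases ts[n]? <;> simp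

/-! ### Languages -/

section inLang
variable {L : Lang}

@[simp] theorem inLangT_var (n : ℕ) : InLangT L (v n) := trivial
@[simp] theorem inLangT_fn {a f : ℕ} {ts : Fin a → Tm} :
    InLangT L (fn a f ts) ↔ (a, f) ∈ L.funs ∧ ∀ i, InLangT L (ts i) := Iff.rfl

@[simp] theorem Fml.in_eq {t u : Tm} : (Fml.eq t u).In L ↔ InLangT L t ∧ InLangT L u := Iff.rfl
@[simp] theorem Fml.in_rel {a R : ℕ} {ts : Fin a → Tm} :
    (Fml.rel a R ts).In L ↔ (a, R) ∈ L.rels ∧ ∀ i, InLangT L (ts i) := Iff.rfl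
@[simp] theorem Fml.in_neg {φ : Fml} : (Fml.neg φ).In L ↔ φ.In L := Iff.rfl
@[simp] theorem Fml.in_and {φ ψ : Fml} : (Fml.and φ ψ).In L ↔ φ.In L ∧ ψ.In L := Iff.rfl
@[simp] theorem Fml.in_all {x : ℕ} {φ : Fml} : (Fml.all x φ).In L ↔ φ.In L := Iff.rfl
@[simp] theorem Fml.in_imp {φ ψ : Fml} : (Fml.imp φ ψ).In L ↔ φ.In L ∧ ψ.In L := Iff.rfl
@[simp] theorem Fml.in_or {φ ψ : Fml} : (Fml.or φ ψ).In L ↔ φ.In L ∧ ψ.In L := Iff.rfl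
@[simp] theorem Fml.in_ex {x : ℕ} {φ : Fml} : (Fml.ex x φ).In L ↔ φ.In L := Iff.rfl
@[simp] theorem Fml.in_iff {φ ψ : Fml} : (Fml.iff φ ψ).In L ↔ φ.In L ∧ ψ.In L := by
  simp only [Fml.iff, Fml.in_and, Fml.in_imp]; tauto

theorem InLangT.mono {K : Lang} (h : K.Sub L) {t : Tm} : InLangT K t → InLangT L t := by
  induction t with
  | var n => intro _; trivial
  | func f ts ih => exact fun ht => ⟨h.1 _ ht.1, fun i => ih i (ht.2 i)⟩

theorem Fml.In.mono {K : Lang} (h : K.Sub L) {φ : Fml} : φ.In K → φ.In L := by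
  induction φ with
  | eq t u => exact fun hh => ⟨hh.1.mono h, hh.2.mono h⟩
  | rel a R ts => exact fun hh => ⟨h.2 _ hh.1, fun i => (hh.2 i).mono h⟩
  | neg φ ih => exact ih
  | and φ ψ ih1 ih2 => exact fun hh => ⟨ih1 hh.1, ih2 hh.2⟩
  | all x φ ih => exact ih

theorem InLangT.subst {t : Tm} {σ : ℕ → Tm} (hσ : ∀ n ∈ t.varFinset, InLangT L (σ n)) :
    InLangT L t → InLangT L (t.subst σ) := by
  induction t with
  | var n => exact fun _ => hσ n (by simp [Language.Term.varFinset])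
  | func f ts ih =>
    exact fun ht => ⟨ht.1, fun i => ih i (fun n hn => hσ n (by
      simp only [Language.Term.varFinset, Finset.mem_biUnion]
      exact ⟨i, Finset.mem_univ _, hn⟩)) (ht.2 i)⟩

theorem Fml.In.subst {φ : Fml} : ∀ {σ : ℕ → Tm}, (∀ n ∈ φ.fv, InLangT L (σ n)) →
    φ.In L → (φ.subst σ).In L := by
  induction φ with
  | eq t u =>
    intro σ hσ hh
    exact ⟨hh.1.subst fun n hn => hσ n (by simp [Fml.fv, hn]),
      hh.2.subst fun n hn => hσ n (by simp [Fml.fv, hn])⟩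
  | rel a R ts =>
    intro σ hσ hh
    exact ⟨hh.1, fun i => (hh.2 i).subst fun n hn => hσ n (by
      simp only [Fml.fv, Finset.mem_biUnion]; exact ⟨i, Finset.mem_univ _, hn⟩)⟩
  | neg φ ih => exact ih
  | and φ ψ ih1 ih2 =>
    intro σ hσ hh
    exact ⟨ih1 (fun n hn => hσ n (by simp [Fml.fv, hn])) hh.1,
      ih2 (fun n hn => hσ n (by simp [Fml.fv, hn])) hh.2⟩
  | all x φ ih =>
    intro σ hσ hh
    refine ih (fun n hn => ?_) hh
    by_cases hx : n = x
    · subst hx; simp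
    · rw [Function.update_of_ne hx]; exact hσ n (by simp [Fml.fv, hn, hx])

theorem Fml.In.at {φ : Fml} {ts : List Tm} (hφ : φ.In L) (hts : ∀ t ∈ ts, InLangT L t) :
    (φ.at ts).In L := by
  refine hφ.subst fun n _ => ?_
  rw [List.getD_eq_getElem?_getD]
  cases h : ts[n]? with
  | none => exact inLangT_var n
  | some t => exact hts t (List.mem_of_getElem? h)

end inLang

/-! ### Syntactic properties of substitution -/

theorem Tm.subst_congr {t : Tm} {σ τ : ℕ → Tm} (h : ∀ n ∈ t.varFinset, σ n = τ n) :
    t.subst σ = t.subst τ := by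
  induction t with
  | var n => exact h n (by simp [Language.Term.varFinset])
  | func f ts ih =>
    simp only [Language.Term.subst]
    congr 1
    funext i
    exact ih i fun n hn => h n (by
      simp only [Language.Term.varFinset, Finset.mem_biUnion]; exact ⟨i, Finset.mem_univ _, hn⟩)

theorem Tm.subst_subst (t : Tm) (σ τ : ℕ → Tm) :
    (t.subst σ).subst τ = t.subst fun n => (σ n).subst τ := by
  induction t with
  | var n => rfl
  | func f ts ih => simp only [Language.Term.subst, ih]

theorem Tm.subst_var (t : Tm) : t.subst v = t := by
  induction t with
  | var n => rfl
  | func f ts ih => simp only [Language.Term.subst, ih]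

theorem Tm.varFinset_subst (t : Tm) (σ : ℕ → Tm) :
    (t.subst σ).varFinset = t.varFinset.biUnion fun n => (σ n).varFinset := by
  induction t with
  | var n => simp [Language.Term.subst, Language.Term.varFinset]
  | func f ts ih => simp only [Language.Term.subst, Language.Term.varFinset, ih, Finset.biUnion_biUnion]

theorem Fml.subst_congr {φ : Fml} : ∀ {σ τ : ℕ → Tm}, (∀ n ∈ φ.fv, σ n = τ n) →
    φ.subst σ = φ.subst τ := by
  induction φ with
  | eq t u =>
    intro σ τ h
    simp only [Fml.subst]
    rw [Tm.subst_congr fun n hn => h n (by simp [Fml.fv, hn]),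
      Tm.subst_congr (t := u) fun n hn => h n (by simp [Fml.fv, hn])]
  | rel a R ts =>
    intro σ τ h
    simp only [Fml.subst]
    congr 1
    funext i
    exact Tm.subst_congr fun n hn => h n (by
      simp only [Fml.fv, Finset.mem_biUnion]; exact ⟨i, Finset.mem_univ _, hn⟩)
  | neg φ ih => intro σ τ h; simp only [Fml.subst]; rw [ih h]
  | and φ ψ ih1 ih2 =>
    intro σ τ h
    simp only [Fml.subst]
    rw [ih1 fun n hn => h n (by simp [Fml.fv, hn]), ih2 fun n hn => h n (by simp [Fml.fv, hn])]
  | all x φ ih =>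
    intro σ τ h
    have h1 : ((φ.fv.erase x).biUnion fun y => (σ y).varFinset) =
        (φ.fv.erase x).biUnion fun y => (τ y).varFinset :=
      Finset.biUnion_congr rfl fun n hn => by rw [h n hn]
    simp only [Fml.subst, h1]
    congr 1
    refine ih fun n hn => ?_
    by_cases hx : n = x
    · subst hx; simp
    · simp only [Function.update_of_ne hx]; exact h n (by simp [Fml.fv, hn, hx])

theorem Fml.fv_subst {φ : Fml} : ∀ (σ : ℕ → Tm),
    (φ.subst σ).fv = φ.fv.biUnion fun n => (σ n).varFinset := by
  induction φ with
  | eq t u =>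
    intro σ
    simp only [Fml.subst, Fml.fv, Tm.varFinset_subst, Finset.union_biUnion]
  | rel a R ts =>
    intro σ
    simp only [Fml.subst, Fml.fv, Tm.varFinset_subst, Finset.biUnion_biUnion]
  | neg φ ih => exact ih
  | and φ ψ ih1 ih2 => intro σ; simp only [Fml.subst, Fml.fv, ih1, ih2, Finset.union_biUnion]
  | all x φ ih =>
    intro σ
    simp only [Fml.subst, Fml.fv, ih]
    set z := fresh ((φ.fv.erase x).biUnion fun y => (σ y).varFinset) with hz
    ext m
    simp only [Finset.mem_erase, Finset.mem_biUnion]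
    constructor
    · rintro ⟨hm, n, hn, hmn⟩
      by_cases hx : n = x
      · subst hx
        simp [Language.Term.varFinset] at hmn
        exact absurd hmn hm
      · rw [Function.update_of_ne hx] at hmn
        exact ⟨n, ⟨hx, hn⟩, hmn⟩
    · rintro ⟨n, ⟨hx, hn⟩, hmn⟩
      refine ⟨?_, n, hn, by rwa [Function.update_of_ne hx]⟩
      rintro rfl
      exact fresh_notMem _ (Finset.mem_biUnion.2 ⟨n, Finset.mem_erase.2 ⟨hx, hn⟩, hmn⟩)

/-- The fresh bound variable depends only on the variables of the substituted terms, and both sides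
compute the same set of these. The equality is therefore literal and not merely up to renaming. -/
theorem Fml.subst_subst {φ : Fml} : ∀ (σ τ : ℕ → Tm),
    (φ.subst σ).subst τ = φ.subst fun n => (σ n).subst τ := by
  induction φ with
  | eq t u => intro σ τ; simp only [Fml.subst, Tm.subst_subst]
  | rel a R ts => intro σ τ; simp only [Fml.subst, Tm.subst_subst]
  | neg φ ih => intro σ τ; simp only [Fml.subst, ih]
  | and φ ψ ih1 ih2 => intro σ τ; simp only [Fml.subst, ih1, ih2]
  | all x φ ih =>
    intro σ τ
    have h1 : ((φ.subst (Function.update σ x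
          (v (fresh ((φ.fv.erase x).biUnion fun y => (σ y).varFinset))))).fv.erase
          (fresh ((φ.fv.erase x).biUnion fun y => (σ y).varFinset))) =
        (φ.fv.erase x).biUnion fun y => (σ y).varFinset := by
      have := Fml.fv_subst (φ := .all x φ) σ
      simpa only [Fml.subst, Fml.fv] using this
    simp only [Fml.subst]
    rw [h1, Finset.biUnion_biUnion, ih]
    simp only [Tm.varFinset_subst]
    congr 1
    refine Fml.subst_congr fun n hn => ?_
    by_cases hx : n = x
    · subst hx; simp [Language.Term.subst]
    · simp only [Function.update_of_ne hx]
      refine Tm.subst_congr fun m hm => Function.update_of_ne (fun e => ?_) _ _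
      subst e
      exact fresh_notMem _ (Finset.mem_biUnion.2 ⟨n, Finset.mem_erase.2 ⟨hx, hn⟩, hm⟩)

/-! ### Soundness -/

theorem Str.valid_logicalAx (S : Str M) {φ : Fml} (h : LogicalAx φ) : S.Valid φ := by
  intro s
  cases h with
  | taut _ h => exact h (S.Sat s) (fun _ => Iff.rfl) fun _ _ => Iff.rfl
  | inst φ x t => rw [Str.sat_imp, S.sat_subst1]; exact fun h => h _
  | inst_self φ x =>
    rw [Str.sat_imp]
    intro h
    simpa using h (s x)
  | dist φ ψ x hx =>
    simp only [Str.sat_imp, Str.sat_all]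
    refine fun h hφ d => h d ((S.sat_congr φ fun n hn => ?_).1 hφ)
    rw [Function.update_of_ne]
    rintro rfl
    exact hx hn
  | eq_refl t => rfl
  | eq_subst φ x t u =>
    simp only [Str.sat_imp, S.sat_subst1, Str.sat_eq]
    intro h
    rw [h]
    exact id

theorem Proves.sound {L : Lang} {T : Set Fml} {φ : Fml} (h : Proves L T φ) (S : Str M)
    (hS : ∀ ψ ∈ T, ψ.In L → S.Valid ψ) : S.Valid φ := by
  induction h with
  | ax φ h hL => exact hS φ h hL
  | logic φ h _ => exact S.valid_logicalAx h
  | mp φ ψ _ _ ih1 ih2 => exact fun s => (S.sat_imp s φ ψ).1 (ih2 s) (ih1 s)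
  | gen φ x _ ih => exact fun s d => ih _

theorem Proves.inLang {L : Lang} {T : Set Fml} {φ : Fml} (h : Proves L T φ) : φ.In L := by
  induction h with
  | ax φ h hL => exact hL
  | logic φ h hL => exact hL
  | mp φ ψ _ _ ih1 ih2 => exact (Fml.in_imp.1 ih2).2
  | gen φ x _ ih => exact ih

theorem Proves.trans {L : Lang} {T U : Set Fml} {φ : Fml} (h : Proves L T φ)
    (hT : ∀ ψ ∈ T, ψ.In L → Proves L U ψ) : Proves L U φ := by
  induction h with
  | ax φ h hL => exact hT φ h hL
  | logic φ h hL => exact .logic φ h hL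
  | mp φ ψ _ _ ih1 ih2 => exact .mp φ ψ ih1 ih2
  | gen φ x _ ih => exact .gen φ x ih

end Multiverse

namespace Multiverse

/-! ### Gödel codes are injective -/

/-- The number (a+b)² + a lies between (a+b)² and the next square, so the sum a+b is recovered
before a. -/
theorem pr_inj {a b c d : ℕ} (h : pr a b = pr c d) : a = c ∧ b = d := by
  unfold pr at h
  have h1 : a + b = c + d := by
    by_contra hne
    rcases Nat.lt_or_gt_of_ne hne with hlt | hlt <;> nlinarith
  rw [h1] at h
  omega

theorem listCode_inj : ∀ {l l' : List ℕ}, listCode l = listCode l' → l = l'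
  | [], [], _ => rfl
  | [], _ :: _, h => by simp [listCode] at h
  | _ :: _, [], h => by simp [listCode] at h
  | a :: l, b :: l', h => by
    simp only [listCode, Nat.add_right_cancel_iff] at h
    obtain ⟨h1, h2⟩ := pr_inj h
    rw [h1, listCode_inj h2]

theorem codeT_inj : ∀ {t u : Tm}, codeT t = codeT u → t = u := by
  intro t
  induction t with
  | var n =>
    intro u h
    cases u with
    | var m => rw [(pr_inj h).2]
    | func f ts => simp only [codeT] at h; exact absurd (pr_inj h).1 (by decide)
  | @func a f ts ih =>
    intro u h
    cases u with
    | var m => simp only [codeT] at h; exact absurd (pr_inj h).1 (by decide)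
    | @func b g us =>
      simp only [codeT] at h
      obtain ⟨h1, h2⟩ := pr_inj (pr_inj h).2
      obtain ⟨rfl, rfl⟩ := pr_inj h1
      have := List.ofFn_injective (listCode_inj h2)
      congr 1
      funext i
      exact ih i (congrFun this i)

theorem code_inj : ∀ {φ ψ : Fml}, code φ = code ψ → φ = ψ := by
  intro φ
  induction φ with
  | eq t u =>
    intro ψ h
    cases ψ <;> simp only [code] at h <;> have h1 := pr_inj h <;> try exact absurd h1.1 (by decide)
    obtain ⟨h2, h3⟩ := pr_inj h1.2
    rw [codeT_inj h2, codeT_inj h3]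
  | rel a R ts =>
    intro ψ h
    cases ψ <;> simp only [code] at h <;> have h1 := pr_inj h <;> try exact absurd h1.1 (by decide)
    obtain ⟨h2, h3⟩ := pr_inj h1.2
    obtain ⟨rfl, rfl⟩ := pr_inj h2
    have := List.ofFn_injective (listCode_inj h3)
    congr 1
    funext i
    exact codeT_inj (congrFun this i)
  | neg φ ih =>
    intro ψ h
    cases ψ <;> simp only [code] at h <;> have h1 := pr_inj h <;> try exact absurd h1.1 (by decide)
    rw [ih h1.2]
  | and φ φ' ih ih' =>
    intro ψ h
    cases ψ <;> simp only [code] at h <;> have h1 := pr_inj h <;> try exact absurd h1.1 (by decide)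
    obtain ⟨h2, h3⟩ := pr_inj h1.2
    rw [ih h2, ih' h3]
  | all x φ ih =>
    intro ψ h
    cases ψ <;> simp only [code] at h <;> have h1 := pr_inj h <;> try exact absurd h1.1 (by decide)
    obtain ⟨h2, h3⟩ := pr_inj h1.2
    rw [h2, ih h3]

/-- Countability supplies the enumeration of all formulas used in the Henkin construction. -/
instance : Countable Fml := Function.Injective.countable (f := code) fun _ _ => code_inj
instance : Nonempty Fml := ⟨topF⟩

/-! ### Completeness -/

section completeness
variable {L : Lang} {T : Set Fml}

theorem Proves.taut {φ : Fml} (h : IsTaut φ) (hL : φ.In L) : Proves L T φ :=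
  .logic φ (.taut φ h) hL

theorem proves_self {φ : Fml} (hL : φ.In L) : Proves L T (φ ⇛ φ) :=
  .taut (by intro e hn ha; simp only [Fml.imp, hn, ha]; tauto) ⟨hL, hL⟩

theorem Proves.taut₁ {φ ψ : Fml} (h : Proves L T φ) (ht : IsTaut (φ ⇛ ψ)) (hL : ψ.In L) :
    Proves L T ψ :=
  .mp φ ψ h (.taut ht ⟨h.inLang, hL⟩)

theorem Proves.taut₂ {φ χ ψ : Fml} (h : Proves L T φ) (h' : Proves L T χ)
    (ht : IsTaut (φ ⇛ χ ⇛ ψ)) (hL : ψ.In L) : Proves L T ψ :=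
  .mp χ ψ h' (h.taut₁ ht ⟨h'.inLang, hL⟩)

theorem Proves.imp_trans {φ χ ψ : Fml} (h : Proves L T (φ ⇛ χ)) (h' : Proves L T (χ ⇛ ψ)) :
    Proves L T (φ ⇛ ψ) :=
  h.taut₂ h' (by intro e hn ha; simp only [Fml.imp, hn, ha]; tauto) ⟨h.inLang.1, h'.inLang.2⟩

theorem Proves.imp_all {φ ψ : Fml} {x : ℕ} (h : Proves L T (φ ⇛ ψ)) (hx : x ∉ φ.fv) :
    Proves L T (φ ⇛ .all x ψ) :=
  .mp _ _ (.gen _ x h) (.logic _ (.dist φ ψ x hx) ⟨h.inLang, h.inLang⟩)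

theorem Fml.In.subst1 {φ : Fml} {x : ℕ} {t : Tm} (h : φ.In L) (ht : InLangT L t) :
    (φ.subst1 x t).In L := by
  refine h.subst fun n _ => ?_
  by_cases hx : n = x
  · subst hx; simpa using ht
  · rw [Function.update_of_ne hx]; trivial

theorem Proves.inst {φ : Fml} {x : ℕ} {t : Tm} (h : φ.In L) (ht : InLangT L t) :
    Proves L T (.imp (.all x φ) (φ.subst1 x t)) :=
  .logic _ (.inst φ x t) ⟨h, h.subst1 ht⟩

/-- Putting x back for y in φ[y/x] gives `φ.subst v`, because y is not free in φ elsewhere; the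
hypothesis `h` leads from this variant to φ. -/
theorem proves_all_of_rename {φ : Fml} {x y : ℕ} (hL : φ.In L) (hy : y ∉ φ.fv.erase x)
    (h : Proves L T (φ.subst v ⇛ φ)) :
    Proves L T (.all y (φ.subst1 x (v y)) ⇛ .all x φ) := by
  have h1 : (φ.subst1 x (v y)).subst1 y (v x) = φ.subst v := by
    simp only [Fml.subst1, Fml.subst_subst]
    refine Fml.subst_congr fun n hn => ?_
    by_cases hx : n = x
    · subst hx; simp [Language.Term.subst]
    · have : n ≠ y := by
        rintro rfl
        exact hy (Finset.mem_erase.2 ⟨hx, hn⟩)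
      simp [Language.Term.subst, Function.update_of_ne hx, Function.update_of_ne this]
  have h2 := Proves.inst (T := T) (x := y) (hL.subst1 (x := x) (t := v y) trivial)
    (inLangT_var (L := L) x)
  rw [h1] at h2
  refine (h2.imp_trans h).imp_all fun hx => ?_
  simp only [Fml.fv, Fml.subst1, Fml.fv_subst, Finset.mem_erase, Finset.mem_biUnion] at hx
  obtain ⟨hxy, n, hn, hx⟩ := hx
  by_cases hnx : n = x
  · subst hnx
    simp [Language.Term.varFinset] at hx
    exact hxy hx
  · simp [Function.update_of_ne hnx, Language.Term.varFinset] at hx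
    exact hnx hx.symm

/-- Substitution renames bound variables even when every variable is replaced by itself, so `φ.subst
v` is only an alphabetic variant of φ. The calculus itself has to prove the equivalence, since the
truth lemma speaks of substituted formulas. -/
theorem proves_rename {φ : Fml} (hL : φ.In L) :
    Proves L T (φ ⇛ φ.subst v) ∧ Proves L T (φ.subst v ⇛ φ) := by
  induction φ with
  | eq t u => simpa only [Fml.subst, Tm.subst_var, and_self] using proves_self hL
  | rel a R ts => simpa only [Fml.subst, Tm.subst_var, and_self] using proves_self hL
  | neg φ ih =>
    obtain ⟨h1, h2⟩ := ih hL
    exact ⟨h2.taut₁ (by intro e hn ha; simp only [Fml.subst, Fml.imp, hn, ha]; tauto)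
      ⟨hL, h1.inLang.2⟩, h1.taut₁ (by intro e hn ha; simp only [Fml.subst, Fml.imp, hn, ha]; tauto)
      ⟨h1.inLang.2, hL⟩⟩
  | and φ ψ ih1 ih2 =>
    obtain ⟨h1, h2⟩ := ih1 hL.1
    obtain ⟨h3, h4⟩ := ih2 hL.2
    exact ⟨h1.taut₂ h3 (by intro e hn ha; simp only [Fml.subst, Fml.imp, hn, ha]; tauto)
      ⟨hL, h1.inLang.2, h3.inLang.2⟩,
      h2.taut₂ h4 (by intro e hn ha; simp only [Fml.subst, Fml.imp, hn, ha]; tauto)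
      ⟨⟨h1.inLang.2, h3.inLang.2⟩, hL⟩⟩
  | all x φ ih =>
    obtain ⟨h1, h2⟩ := ih hL
    set z := fresh ((φ.fv.erase x).biUnion fun y => (v y : Tm).varFinset) with hz
    have hzf : z ∉ φ.fv.erase x := fun h =>
      fresh_notMem _ (Finset.mem_biUnion.2 ⟨z, h, Finset.mem_singleton_self z⟩)
    have hs : (Fml.all x φ).subst v = .all z (φ.subst1 x (v z)) := rfl
    rw [hs]
    exact ⟨(Proves.inst (φ := φ) hL (inLangT_var z)).imp_all hzf, proves_all_of_rename hL hzf h2⟩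

/-- A complete theory with witnesses for all quantified formulas. -/
structure IsHenkin (L : Lang) (T Δ : Set Fml) : Prop where
  inLang : ∀ φ ∈ Δ, φ.In L
  thm : ∀ φ, Proves L T φ → φ ∈ Δ
  mp : ∀ φ ψ, φ ∈ Δ → φ.imp ψ ∈ Δ → ψ ∈ Δ
  neg : ∀ φ : Fml, φ.In L → (φ.neg ∈ Δ ↔ φ ∉ Δ)
  wit : ∀ x φ, φ.In L → ∃ y, Fml.imp (φ.subst1 x (v y)) (.all x φ) ∈ Δ

/-- A single consistent formula is strengthened at a time. Variables play the role of Henkin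
constants: a variable fresh for the current formula and for ψ is an admissible witness, so the
language need not be extended. -/
theorem henkin_step (H : Fml) (hL : H.In L) (hc : ¬ Proves L T H.neg) (ψ : Fml) :
    ∃ H' : Fml, H'.In L ∧ ¬ Proves L T H'.neg ∧ Proves L T (H' ⇛ H) ∧
      (ψ.In L → Proves L T (H' ⇛ ψ) ∨ Proves L T (H' ⇛ ψ.neg)) ∧
      (∀ x χ, ψ = .all x χ → ψ.In L → ∃ y, Proves L T (H' ⇛ (χ.subst1 x (v y) ⇛ ψ))) := by
  by_cases hψ : ψ.In L
  swap
  · exact ⟨H, hL, hc, proves_self hL,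
      fun h => absurd h hψ, fun _ _ _ h => absurd h hψ⟩
  obtain ⟨G, hGL, hGc, hGH, hG⟩ : ∃ G : Fml, G.In L ∧ ¬ Proves L T G.neg ∧ Proves L T (G ⇛ H) ∧
      (Proves L T (G ⇛ ψ) ∨ Proves L T (G ⇛ ψ.neg)) := by
    by_cases h : Proves L T (H.and ψ).neg
    · refine ⟨H, hL, hc, proves_self hL,
        .inr (h.taut₁ (by intro e hn ha; simp only [Fml.imp, hn, ha]; tauto) ⟨hL, hψ⟩)⟩
    · exact ⟨H.and ψ, ⟨hL, hψ⟩, h,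
        .taut (by intro e hn ha; simp only [Fml.imp, hn, ha]; tauto) ⟨⟨hL, hψ⟩, hL⟩,
        .inl (.taut (by intro e hn ha; simp only [Fml.imp, hn, ha]; tauto) ⟨⟨hL, hψ⟩, hψ⟩)⟩
  by_cases hx : ∃ x χ, ψ = .all x χ
  swap
  · exact ⟨G, hGL, hGc, hGH, fun _ => hG, fun x χ h => absurd ⟨x, χ, h⟩ hx⟩
  obtain ⟨x, χ, rfl⟩ := hx
  set y := fresh (G.fv ∪ (Fml.all x χ).fv) with hy
  have hyG : y ∉ G.fv := fun h => fresh_notMem _ (Finset.mem_union_left _ h)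
  have hyχ : y ∉ χ.fv.erase x := fun h => fresh_notMem _ (Finset.mem_union_right _ h)
  have hA : (χ.subst1 x (v y)).In L := Fml.In.subst1 hψ trivial
  refine ⟨G.and (χ.subst1 x (v y) ⇛ .all x χ), ⟨hGL, hA, hψ⟩, fun h => hGc ?_, ?_, fun _ => ?_, ?_⟩
  -- If the witness implication were refutable from G, then G would imply both χ[y/x] and ¬∀xχ; as y
  -- is fresh, the former generalizes to ∀xχ, so G would be inconsistent.
  · have h1 : Proves L T (G ⇛ χ.subst1 x (v y)) :=
      h.taut₁ (by intro e hn ha; simp only [Fml.imp, hn, ha]; tauto) ⟨hGL, hA⟩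
    have h2 : Proves L T (G ⇛ (Fml.all x χ).neg) :=
      h.taut₁ (by intro e hn ha; simp only [Fml.imp, hn, ha]; tauto) ⟨hGL, hψ⟩
    have h3 := (h1.imp_all hyG).imp_trans
      (proves_all_of_rename hψ hyχ (proves_rename (φ := χ) hψ).2)
    exact h3.taut₂ h2 (by intro e hn ha; simp only [Fml.imp, hn, ha]; tauto) hGL
  · exact hGH.taut₁ (by intro e hn ha; simp only [Fml.imp, hn, ha]; tauto) ⟨⟨hGL, hA, hψ⟩, hL⟩
  · exact hG.imp
      (fun h => h.taut₁ (by intro e hn ha; simp only [Fml.imp, hn, ha]; tauto) ⟨⟨hGL, hA, hψ⟩, hψ⟩)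
      (fun h => h.taut₁ (by intro e hn ha; simp only [Fml.imp, hn, ha]; tauto) ⟨⟨hGL, hA, hψ⟩, hψ⟩)
  · rintro x' χ' h -
    injection h with h1 h2
    subst h1 h2
    exact ⟨y, .taut (by intro e hn ha; simp only [Fml.imp, hn, ha]; tauto)
      ⟨⟨hGL, hA, hψ⟩, hA, hψ⟩⟩

/-- The step is iterated along an enumeration of all formulas. Each formula of the chain implies the
earlier ones, so the consequences of its members form a complete consistent set. -/
theorem exists_henkin {H₀ : Fml} (hL : H₀.In L) (hc : ¬ Proves L T H₀.neg) :
    ∃ Δ, IsHenkin L T Δ ∧ H₀ ∈ Δ := by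
  classical
  obtain ⟨en, hen⟩ := exists_surjective_nat Fml
  let X := {H : Fml // H.In L ∧ ¬ Proves L T H.neg}
  choose next hn1 hn2 hn3 hn4 hn5 using fun (H : X) (n : ℕ) =>
    henkin_step (T := T) H.1 H.2.1 H.2.2 (en n)
  let seq : ℕ → X := fun n => Nat.rec ⟨H₀, hL, hc⟩ (fun n H => ⟨next H n, hn1 H n, hn2 H n⟩) n
  have hseq : ∀ n, (seq (n + 1)).1 = next (seq n) n := fun n => rfl
  have hmono : ∀ m k, Proves L T ((seq (m + k)).1 ⇛ (seq m).1) := by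
    intro m k
    induction k with
    | zero => exact proves_self (seq m).2.1
    | succ k ih =>
      have := hn3 (seq (m + k)) (m + k)
      exact this.imp_trans ih
  have hmono' : ∀ {m n ψ}, m ≤ n → Proves L T ((seq m).1 ⇛ ψ) → Proves L T ((seq n).1 ⇛ ψ) := by
    intro m n ψ h h'
    obtain ⟨k, rfl⟩ := Nat.exists_eq_add_of_le h
    exact (hmono m k).imp_trans h'
  have hcons : ∀ ψ m n, Proves L T ((seq m).1 ⇛ ψ) → ¬ Proves L T ((seq n).1 ⇛ ψ.neg) := by
    intro ψ m n h h'
    refine (seq (max m n)).2.2 ((hmono' (le_max_left m n) h).taut₂ (hmono' (le_max_right m n) h')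
      (by intro e hn ha; simp only [Fml.imp, hn, ha]; tauto) (seq (max m n)).2.1)
  refine ⟨{ψ | ∃ n, Proves L T ((seq n).1 ⇛ ψ)}, ⟨?_, ?_, ?_, ?_, ?_⟩, 0, hmono 0 0⟩
  · rintro φ ⟨n, h⟩
    exact h.inLang.2
  · intro φ h
    exact ⟨0, h.taut₁ (by intro e hn ha; simp only [Fml.imp, hn, ha]; tauto) ⟨hL, h.inLang⟩⟩
  · rintro φ ψ ⟨m, h⟩ ⟨n, h'⟩
    exact ⟨max m n, (hmono' (le_max_left m n) h).taut₂ (hmono' (le_max_right m n) h')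
      (by intro e hn ha; simp only [Fml.imp, hn, ha]; tauto) ⟨(seq (max m n)).2.1, h'.inLang.2.2⟩⟩
  · intro φ hφ
    constructor
    · rintro ⟨n, h⟩ ⟨m, h'⟩
      exact hcons φ m n h' h
    · intro h
      obtain ⟨n, rfl⟩ := hen φ
      rcases hn4 (seq n) n hφ with h' | h'
      · exact absurd ⟨n + 1, h'⟩ h
      · exact ⟨n + 1, h'⟩
  · intro x φ hφ
    obtain ⟨n, hn⟩ := hen (.all x φ)
    obtain ⟨y, hy⟩ := hn5 (seq n) n x φ hn (by rw [hn]; exact hφ)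
    rw [hn] at hy
    exact ⟨y, n + 1, hy⟩

/-! ### The term model of a Henkin set -/

section termModel
variable {Δ : Set Fml} (hΔ : IsHenkin L T Δ)
include hΔ

theorem IsHenkin.taut₁ {φ ψ : Fml} (h : φ ∈ Δ) (ht : IsTaut (φ ⇛ ψ)) (hL : ψ.In L) : ψ ∈ Δ :=
  hΔ.mp _ _ h (hΔ.thm _ (.taut ht ⟨hΔ.inLang _ h, hL⟩))

theorem IsHenkin.mem_and {φ ψ : Fml} (hφ : φ.In L) (hψ : ψ.In L) :
    φ.and ψ ∈ Δ ↔ φ ∈ Δ ∧ ψ ∈ Δ := by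
  constructor
  · exact fun h => ⟨hΔ.taut₁ h (by intro e hn ha; simp only [Fml.imp, hn, ha]; tauto) hφ,
      hΔ.taut₁ h (by intro e hn ha; simp only [Fml.imp, hn, ha]; tauto) hψ⟩
  · rintro ⟨h1, h2⟩
    exact hΔ.mp _ _ h2
      (hΔ.taut₁ h1 (by intro e hn ha; simp only [Fml.imp, hn, ha]; tauto) ⟨hψ, hφ, hψ⟩)

/-- Marking the place j by a variable fresh for the other substituted terms reduces replacement
inside a simultaneous substitution to the equality axiom for one variable. -/
theorem IsHenkin.replace {φ : Fml} {σ : ℕ → Tm} {j : ℕ} {t u : Tm} (hφ : φ.In L)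
    (hσ : ∀ i ∈ φ.fv, i ≠ j → InLangT L (σ i)) (ht : InLangT L t) (hu : InLangT L u)
    (h : Fml.eq t u ∈ Δ) (hm : φ.subst (Function.update σ j t) ∈ Δ) :
    φ.subst (Function.update σ j u) ∈ Δ := by
  set z := fresh ((φ.fv.erase j).biUnion fun i => (σ i).varFinset) with hz
  have key : ∀ w : Tm, (φ.subst (Function.update σ j (v z))).subst1 z w =
      φ.subst (Function.update σ j w) := by
    intro w
    simp only [Fml.subst1, Fml.subst_subst]
    refine Fml.subst_congr fun n hn => ?_
    by_cases hnj : n = j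
    · subst hnj; simp [Language.Term.subst]
    · simp only [Function.update_of_ne hnj]
      conv_rhs => rw [← Tm.subst_var (σ n)]
      refine Tm.subst_congr fun m hm => Function.update_of_ne (fun e => ?_) _ _
      subst e
      exact fresh_notMem _ (Finset.mem_biUnion.2 ⟨n, Finset.mem_erase.2 ⟨hnj, hn⟩, hm⟩)
  have hin : ∀ w : Tm, InLangT L w → (φ.subst (Function.update σ j w)).In L := by
    refine fun w hw => hφ.subst fun i hi => ?_
    by_cases hij : i = j
    · subst hij; simpa using hw
    · rw [Function.update_of_ne hij]; exact hσ i hi hij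
  have := hΔ.thm _ (.logic _ (.eq_subst (φ.subst (Function.update σ j (v z))) z t u) (by
    rw [key, key]
    exact ⟨⟨ht, hu⟩, hin t ht, hin u hu⟩))
  rw [key, key] at this
  exact hΔ.mp _ _ hm (hΔ.mp _ _ h this)

/-- One free variable is replaced at a time. Symmetry, transitivity and the congruence laws below
are instances for suitable template formulas. -/
theorem IsHenkin.replace_all {φ : Fml} {σ τ : ℕ → Tm} (hφ : φ.In L)
    (hσ : ∀ i, InLangT L (σ i)) (hτ : ∀ i, InLangT L (τ i))
    (h : ∀ i ∈ φ.fv, Fml.eq (σ i) (τ i) ∈ Δ) (hm : φ.subst σ ∈ Δ) : φ.subst τ ∈ Δ := by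
  classical
  have key : ∀ F : Finset ℕ, F ⊆ φ.fv → φ.subst (fun i => if i ∈ F then τ i else σ i) ∈ Δ := by
    intro F
    induction F using Finset.induction_on with
    | empty => intro _; simpa using hm
    | insert j F hj ih =>
      intro hF
      have h1 := ih fun i hi => hF (Finset.mem_insert_of_mem hi)
      have e1 : (fun i => if i ∈ F then τ i else σ i) =
          Function.update (fun i => if i ∈ F then τ i else σ i) j (σ j) := by
        funext i
        by_cases hij : i = j
        · subst hij; simp [hj]
        · simp [hij]
      have e2 : (fun i => if i ∈ insert j F then τ i else σ i) =
          Function.update (fun i => if i ∈ F then τ i else σ i) j (τ j) := by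
        funext i
        by_cases hij : i = j
        · subst hij; simp
        · simp [hij]
      rw [e1] at h1
      rw [e2]
      refine hΔ.replace hφ (fun i _ _ => ?_) (hσ j) (hτ j) (h j (hF (Finset.mem_insert_self _ _))) h1
      split_ifs
      exacts [hτ i, hσ i]
  have := key φ.fv subset_rfl
  rwa [Fml.subst_congr (τ := τ) fun n hn => by simp [hn] ] at this

theorem IsHenkin.eq_refl {t : Tm} (ht : InLangT L t) : Fml.eq t t ∈ Δ :=
  hΔ.thm _ (.logic _ (.eq_refl t) ⟨ht, ht⟩)

theorem IsHenkin.eq_symm {t u : Tm} (h : Fml.eq t u ∈ Δ) : Fml.eq u t ∈ Δ := by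
  obtain ⟨ht, hu⟩ := hΔ.inLang _ h
  have := hΔ.replace_all (φ := .eq (v 0) (v 1)) (σ := fun _ => t)
    (τ := fun i => if i = 0 then u else t) ⟨trivial, trivial⟩ (fun _ => ht)
    (fun i => by split_ifs; exacts [hu, ht]) (fun i _ => by
      split_ifs; exacts [h, hΔ.eq_refl ht]) (hΔ.eq_refl ht)
  exact this

theorem IsHenkin.eq_trans {t u w : Tm} (h : Fml.eq t u ∈ Δ) (h' : Fml.eq u w ∈ Δ) :
    Fml.eq t w ∈ Δ := by
  obtain ⟨ht, hu⟩ := hΔ.inLang _ h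
  obtain ⟨_, hw⟩ := hΔ.inLang _ h'
  have := hΔ.replace_all (φ := .eq (v 0) (v 1)) (σ := fun i => if i = 0 then t else u)
    (τ := fun i => if i = 0 then t else w) ⟨trivial, trivial⟩
    (fun i => by split_ifs; exacts [ht, hu])
    (fun i => by split_ifs; exacts [ht, hw]) (fun i _ => by
      split_ifs; exacts [hΔ.eq_refl ht, h']) h
  exact this

theorem IsHenkin.fn_congr {a f : ℕ} {ts us : Fin a → Tm} (hf : (a, f) ∈ L.funs)
    (h : ∀ i, Fml.eq (ts i) (us i) ∈ Δ) : Fml.eq (fn a f ts) (fn a f us) ∈ Δ := by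
  have hts := fun i => (hΔ.inLang _ (h i)).1
  have hus := fun i => (hΔ.inLang _ (h i)).2
  -- The template is f(x₀,…,x_{a-1}) = f(x_a,…,x_{2a-1}). The substitution σ puts `ts` into both
  -- halves, and τ changes the second half to `us`.
  have := hΔ.replace_all
    (φ := .eq (fn a f fun i => v i) (fn a f fun i => v (a + i)))
    (σ := fun i => if h : i < a then ts ⟨i, h⟩ else if h : i - a < a then ts ⟨i - a, h⟩ else v 0)
    (τ := fun i => if h : i < a then ts ⟨i, h⟩ else if h : i - a < a then us ⟨i - a, h⟩ else v 0)
    ⟨⟨hf, fun _ => trivial⟩, hf, fun _ => trivial⟩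
    (fun i => by split_ifs; exacts [hts _, hts _, trivial])
    (fun i => by split_ifs; exacts [hts _, hus _, trivial])
    (fun i _ => by
      split_ifs
      exacts [hΔ.eq_refl (hts _), h _, hΔ.eq_refl trivial])
  simp only [Fml.subst, Language.Term.subst, Fin.is_lt, dif_pos, Nat.add_sub_cancel_left,
    add_lt_iff_neg_left, not_lt_zero, dif_neg, not_false_eq_true] at this
  exact this (hΔ.eq_refl ⟨hf, hts⟩)

theorem IsHenkin.rel_congr {a R : ℕ} {ts us : Fin a → Tm} (hR : (a, R) ∈ L.rels)
    (h : ∀ i, Fml.eq (ts i) (us i) ∈ Δ) (hm : Fml.rel a R ts ∈ Δ) : Fml.rel a R us ∈ Δ := by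
  have hts := fun i => (hΔ.inLang _ (h i)).1
  have hus := fun i => (hΔ.inLang _ (h i)).2
  have := hΔ.replace_all
    (φ := .rel a R fun i => v i)
    (σ := fun i => if h : i < a then ts ⟨i, h⟩ else v 0)
    (τ := fun i => if h : i < a then us ⟨i, h⟩ else v 0)
    ⟨hR, fun _ => trivial⟩
    (fun i => by split_ifs; exacts [hts _, trivial])
    (fun i => by split_ifs; exacts [hus _, trivial])
    (fun i _ => by
      split_ifs
      exacts [h _, hΔ.eq_refl trivial])
  simp only [Fml.subst, Language.Term.subst, Fin.is_lt, dif_pos] at this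
  exact this hm

/-- Provable equality of terms. -/
def IsHenkin.setoid : Setoid {t : Tm // InLangT L t} where
  r t u := Fml.eq t.1 u.1 ∈ Δ
  iseqv := ⟨fun t => hΔ.eq_refl t.2, hΔ.eq_symm, hΔ.eq_trans⟩

/-- The domain of the term model. -/
abbrev IsHenkin.Dom : Type := Quotient hΔ.setoid

theorem IsHenkin.out_eq {t : Tm} (ht : InLangT L t) :
    Fml.eq (Quotient.out (⟦⟨t, ht⟩⟧ : hΔ.Dom)).1 t ∈ Δ :=
  Quotient.exact (s := hΔ.setoid) (Quotient.out_eq (⟦⟨t, ht⟩⟧ : hΔ.Dom))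

open Classical in
/-- The term model. -/
noncomputable def IsHenkin.str : Str hΔ.Dom where
  -- A function symbol outside L gets the class of x₀ as its value; no formula of L depends on this
  -- choice.
  fnI a f ts := if h : (a, f) ∈ L.funs then
    ⟦⟨fn a f fun i => (ts i).out.1, h, fun i => (ts i).out.2⟩⟧ else ⟦⟨v 0, trivial⟩⟧
  relI a R ts := Fml.rel a R (fun i => (ts i).out.1) ∈ Δ

theorem IsHenkin.val_str {σ : ℕ → Tm} (hσ : ∀ i, InLangT L (σ i)) {t : Tm} (ht : InLangT L t) :
    hΔ.str.val (fun i => ⟦⟨σ i, hσ i⟩⟧) t = ⟦⟨t.subst σ, ht.subst fun i _ => hσ i⟩⟧ := by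
  induction t with
  | var n => rfl
  | @func a f ts ih =>
    simp only [Str.val]
    have hf : (a, f) ∈ L.funs := ht.1
    have : (fun i => hΔ.str.val (fun i => ⟦⟨σ i, hσ i⟩⟧) (ts i)) =
      fun i => ⟦⟨(ts i).subst σ, (ht.2 i).subst fun i _ => hσ i⟩⟧ := funext fun i => ih i (ht.2 i)
    rw [this]
    simp only [IsHenkin.str, hf, dif_pos]
    exact Quotient.sound (s := hΔ.setoid) (hΔ.fn_congr hf fun i => hΔ.out_eq _)

/-- This is the truth lemma, generalized to all substitutions so that the induction passes through
quantifiers. Under ∀, one direction uses the witness implication and the other the instantiation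
axiom. -/
theorem IsHenkin.sat_str {φ : Fml} (hφ : φ.In L) : ∀ {σ : ℕ → Tm} (hσ : ∀ i, InLangT L (σ i)),
    hΔ.str.Sat (fun i => ⟦⟨σ i, hσ i⟩⟧) φ ↔ φ.subst σ ∈ Δ := by
  induction φ with
  | eq t u =>
    intro σ hσ
    rw [Str.sat_eq, hΔ.val_str hσ hφ.1, hΔ.val_str hσ hφ.2]
    exact Quotient.eq (r := hΔ.setoid)
  | rel a R ts =>
    intro σ hσ
    rw [Str.sat_rel]
    have : (fun i => hΔ.str.val (fun i => ⟦⟨σ i, hσ i⟩⟧) (ts i)) =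
      fun i => ⟦⟨(ts i).subst σ, (hφ.2 i).subst fun i _ => hσ i⟩⟧ :=
      funext fun i => hΔ.val_str hσ (hφ.2 i)
    rw [this]
    exact ⟨hΔ.rel_congr hφ.1 fun i => hΔ.out_eq _,
      hΔ.rel_congr hφ.1 fun i => hΔ.eq_symm (hΔ.out_eq _)⟩
  | neg φ ih =>
    intro σ hσ
    rw [Str.sat_neg, ih hφ hσ]
    exact (hΔ.neg _ (Fml.In.subst (φ := φ) (fun i _ => hσ i) hφ)).symm
  | and φ ψ ih1 ih2 =>
    intro σ hσ
    rw [Str.sat_and, ih1 hφ.1 hσ, ih2 hφ.2 hσ]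
    exact (hΔ.mem_and (Fml.In.subst (fun i _ => hσ i) hφ.1)
      (Fml.In.subst (fun i _ => hσ i) hφ.2)).symm
  | all x φ ih =>
    intro σ hσ
    set z := fresh ((φ.fv.erase x).biUnion fun y => (σ y).varFinset) with hz
    have hs : (Fml.all x φ).subst σ = .all z (φ.subst (Function.update σ x (v z))) := rfl
    have hup : ∀ t : Tm, InLangT L t → ∀ i, InLangT L (Function.update σ x t i) := by
      intro t ht i
      by_cases hi : i = x
      · subst hi; simpa using ht
      · rw [Function.update_of_ne hi]; exact hσ i
    have hA : (φ.subst (Function.update σ x (v z))).In L :=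
      Fml.In.subst (fun i _ => hup (v z) trivial i) hφ
    have key : ∀ w : Tm, (φ.subst (Function.update σ x (v z))).subst1 z w =
        φ.subst (Function.update σ x w) := by
      intro w
      simp only [Fml.subst1, Fml.subst_subst]
      refine Fml.subst_congr fun n hn => ?_
      by_cases hnj : n = x
      · subst hnj; simp [Language.Term.subst]
      · simp only [Function.update_of_ne hnj]
        conv_rhs => rw [← Tm.subst_var (σ n)]
        refine Tm.subst_congr fun m hm => Function.update_of_ne (fun e => ?_) _ _
        subst e
        exact fresh_notMem _ (Finset.mem_biUnion.2 ⟨n, Finset.mem_erase.2 ⟨hnj, hn⟩, hm⟩)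
    have key2 : ∀ (t : Tm) (ht : InLangT L t),
        hΔ.str.Sat (Function.update (fun i => (⟦⟨σ i, hσ i⟩⟧ : hΔ.Dom)) x ⟦⟨t, ht⟩⟧) φ ↔
          φ.subst (Function.update σ x t) ∈ Δ := by
      intro t ht
      rw [← ih hφ (hup t ht)]
      have : Function.update (fun i => (⟦⟨σ i, hσ i⟩⟧ : hΔ.Dom)) x ⟦⟨t, ht⟩⟧ =
          fun i => ⟦⟨Function.update σ x t i, hup t ht i⟩⟧ := by
        funext i
        by_cases hi : i = x
        · subst hi; simp
        · simp [Function.update_of_ne hi]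
      rw [this]
    rw [hs, Str.sat_all]
    constructor
    · intro h
      obtain ⟨y, hy⟩ := hΔ.wit z _ hA
      rw [key] at hy
      exact hΔ.mp _ _ ((key2 (v y) trivial).1 (h _)) hy
    · intro h d
      obtain ⟨⟨t, ht⟩, rfl⟩ := Quotient.exists_rep d
      rw [key2, ← key]
      exact hΔ.mp _ _ h (hΔ.thm _ (Proves.inst hA ht))

end termModel

/-! ### From the term model to completeness -/

theorem Fml.fv_foldr_all (φ : Fml) (l : List ℕ) :
    (l.foldr Fml.all φ).fv = φ.fv \ l.toFinset := by
  induction l with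
  | nil => simp
  | cons x l ih =>
    simp only [List.foldr, Fml.fv, ih, List.toFinset_cons]
    ext; simp; tauto

theorem Proves.foldr_all {φ : Fml} (h : Proves L T φ) (l : List ℕ) :
    Proves L T (l.foldr Fml.all φ) := by
  induction l with
  | nil => exact h
  | cons x l ih => exact .gen _ x ih

theorem Str.sat_of_foldr_all (S : Str M) {φ : Fml} {l : List ℕ} {s : ℕ → M}
    (h : S.Sat s (l.foldr Fml.all φ)) : S.Sat s φ := by
  induction l with
  | nil => exact h
  | cons x l ih =>
    have := (S.sat_all s x _).1 h (s x)
    rw [Function.update_eq_self] at this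
    exact ih this

/-- Generalization makes the universal closure a theorem as well, and a closed formula is unaffected
by the substitution that describes the assignment. -/
theorem IsHenkin.valid {Δ : Set Fml} (hΔ : IsHenkin L T Δ) {φ : Fml} (h : Proves L T φ) :
    hΔ.str.Valid φ := by
  intro s
  refine hΔ.str.sat_of_foldr_all (l := φ.fv.toList) ?_
  have h1 := h.foldr_all φ.fv.toList
  have hs : s = fun i => (⟦⟨(s i).out.1, (s i).out.2⟩⟧ : hΔ.Dom) := by
    funext i
    exact (Quotient.out_eq (s i)).symm
  rw [hs, hΔ.sat_str h1.inLang fun i => (s i).out.2]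
  have h2 := Proves.mp _ _ h1 (proves_rename h1.inLang).1
  rw [Fml.subst_congr (τ := v)]
  · exact hΔ.thm _ h2
  · intro n hn
    simp [Fml.fv_foldr_all] at hn

/-- The completeness theorem. -/
theorem proves_of_valid {φ : Fml} (hφ : φ.In L)
    (h : ∀ (M : Type) (S : Str M), Nonempty M → (∀ ψ ∈ T, ψ.In L → S.Valid ψ) → S.Valid φ) :
    Proves L T φ := by
  by_contra hn
  obtain ⟨Δ, hΔ, hmem⟩ := exists_henkin (T := T) (H₀ := φ.neg) hφ fun h' =>
    hn (h'.taut₁ (by intro e hn ha; simp only [Fml.imp, hn, ha]; tauto) hφ)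
  -- At the assignment sending each variable to its own class, truth of φ means that its variant
  -- `φ.subst v` belongs to Δ, which contradicts the choice of Δ.
  have h1 := h hΔ.Dom hΔ.str ⟨⟦⟨v 0, trivial⟩⟧⟩ (fun ψ hψ hL => hΔ.valid (.ax ψ hψ hL))
    (fun i => ⟦⟨v i, trivial⟩⟧)
  have h1 := (hΔ.sat_str hφ (σ := v) fun _ => trivial).1 h1
  exact (hΔ.neg φ hφ).1 hmem (hΔ.mp _ _ h1 (hΔ.thm _ (proves_rename hφ).2))

end completeness

/-! ### Compactness for increasing theories -/

/-- A derivation uses finitely many axioms and each theory proves the preceding one. The conclusion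
for all later k is what allows such bounds to be combined by maxima. -/
theorem Proves.exists_stage {L : Lang} {T : ℕ → Set Fml}
    (hin : ∀ n, ∀ φ ∈ T n, Proves L (T (n + 1)) φ) {φ : Fml}
    (h : Proves L (unionTheory T) φ) : ∃ A, ∀ k, A ≤ k → Proves L (T k) φ := by
  have mono : ∀ n k, ∀ φ, Proves L (T n) φ → Proves L (T (n + k)) φ := by
    intro n k
    induction k with
    | zero => exact fun _ h => h
    | succ k ih => exact fun φ h => (ih φ h).trans fun ψ hψ _ => hin _ ψ hψ
  induction h with
  | ax φ h hL =>
    obtain ⟨n, hn⟩ := h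
    refine ⟨n, fun k hk => ?_⟩
    obtain ⟨j, rfl⟩ := Nat.exists_eq_add_of_le hk
    exact mono n j φ (.ax φ hn hL)
  | logic φ h hL => exact ⟨0, fun k _ => .logic φ h hL⟩
  | mp φ ψ _ _ ih1 ih2 =>
    obtain ⟨A, hA⟩ := ih1
    obtain ⟨B, hB⟩ := ih2
    exact ⟨max A B, fun k hk => .mp φ ψ (hA k (le_of_max_le_left hk)) (hB k (le_of_max_le_right hk))⟩
  | gen φ x _ ih =>
    obtain ⟨A, hA⟩ := ih
    exact ⟨A, fun k hk => .gen φ x (hA k hk)⟩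

end Multiverse

namespace Multiverse

set_option linter.unusedSimpArgs false

variable {M : Type}

/-! ### The basic notions of set theory in a structure -/

namespace Str
variable (S : Str M)

def E (x y : M) : Prop := S.relI 2 0 ![x, y]
def zero : M := S.fnI 0 0 ![]
def suc (x : M) : M := S.fnI 1 0 ![x]
def add (x y : M) : M := S.fnI 2 0 ![x, y]
def mul (x y : M) : M := S.fnI 2 1 ![x, y]

def numI : ℕ → M
  | 0 => S.zero
  | n + 1 => S.suc (numI n)

def prI (a b : M) : M := S.add (S.mul (S.add a b) (S.add a b)) a

def listI : List M → M
  | [] => S.zero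
  | a :: l => S.suc (S.prI a (listI l))

def varI (n : M) : M := S.prI (S.numI 0) n
def appI (a f : ℕ) (l : List M) : M :=
  S.prI (S.numI 1) (S.prI (S.prI (S.numI a) (S.numI f)) (S.listI l))
def eqI (t u : M) : M := S.prI (S.numI 0) (S.prI t u)
def relI' (a R : ℕ) (l : List M) : M :=
  S.prI (S.numI 1) (S.prI (S.prI (S.numI a) (S.numI R)) (S.listI l))
def negI (t : M) : M := S.prI (S.numI 2) t
def andI (t u : M) : M := S.prI (S.numI 3) (S.prI t u)
def allI (x t : M) : M := S.prI (S.numI 4) (S.prI x t)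
def impI (t u : M) : M := S.negI (S.andI t (S.negI u))
def stageI (χ c : M) : M := S.allI (S.numI 0) (S.impI (S.eqI (S.varI (S.numI 0)) c) χ)

section values
variable (s : ℕ → M)

theorem vec1 (t : Tm) : (fun i => S.val s (![t] i)) = ![S.val s t] := by
  funext i; fin_cases i; rfl
theorem vec2 (t u : Tm) : (fun i => S.val s (![t, u] i)) = ![S.val s t, S.val s u] := by
  funext i; fin_cases i <;> rfl

@[simp] theorem val_zeroT : S.val s zeroT = S.zero := by
  rw [zeroT, val_fn, zero]; congr 1; funext i; exact i.elim0
@[simp] theorem val_succT (t : Tm) : S.val s (succT t) = S.suc (S.val s t) := by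
  rw [succT, val_fn, vec1, suc]
@[simp] theorem val_addT (t u : Tm) : S.val s (addT t u) = S.add (S.val s t) (S.val s u) := by
  rw [addT, val_fn, vec2, add]
@[simp] theorem val_mulT (t u : Tm) : S.val s (mulT t u) = S.mul (S.val s t) (S.val s u) := by
  rw [mulT, val_fn, vec2, mul]
@[simp] theorem sat_mem (t u : Tm) : S.Sat s (t ∊ u) ↔ S.E (S.val s t) (S.val s u) := by
  rw [mem, sat_rel, vec2, E]
@[simp] theorem val_num (n : ℕ) : S.val s (num n) = S.numI n := by
  induction n with
  | zero => simp [num, numI]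
  | succ n ih => simp [num, numI, ih]
@[simp] theorem val_prT (t u : Tm) : S.val s (prT t u) = S.prI (S.val s t) (S.val s u) := by
  simp [prT, prI]
@[simp] theorem val_listT (l : List Tm) : S.val s (listT l) = S.listI (l.map (S.val s)) := by
  induction l with
  | nil => simp [listT, listI]
  | cons t l ih => simp [listT, listI, ih]
@[simp] theorem val_varC (t : Tm) : S.val s (varC t) = S.varI (S.val s t) := by simp [varC, varI]
@[simp] theorem val_appC (a f : ℕ) (l : List Tm) :
    S.val s (appC a f l) = S.appI a f (l.map (S.val s)) := by simp [appC, appI]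
@[simp] theorem val_relC (a f : ℕ) (l : List Tm) :
    S.val s (relC a f l) = S.relI' a f (l.map (S.val s)) := by simp [relC, relI']
@[simp] theorem val_eqC (t u : Tm) : S.val s (eqC t u) = S.eqI (S.val s t) (S.val s u) := by
  simp [eqC, eqI]
@[simp] theorem val_negC (t : Tm) : S.val s (negC t) = S.negI (S.val s t) := by simp [negC, negI]
@[simp] theorem val_andC (t u : Tm) : S.val s (andC t u) = S.andI (S.val s t) (S.val s u) := by
  simp [andC, andI]
@[simp] theorem val_allC (t u : Tm) : S.val s (allC t u) = S.allI (S.val s t) (S.val s u) := by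
  simp [allC, allI]
@[simp] theorem val_impC (t u : Tm) : S.val s (impC t u) = S.impI (S.val s t) (S.val s u) := by
  simp [impC, impI]
@[simp] theorem val_stageC (χ : Fml) (c : Tm) :
    S.val s (stageC χ c) = S.stageI (S.numI (code χ)) (S.val s c) := by
  simp [stageC, stageI]

@[simp] theorem sat_topF : S.Sat s topF := by simp [topF]

@[simp] theorem sat_conjs (l : List Fml) : S.Sat s (conjs l) ↔ ∀ φ ∈ l, S.Sat s φ := by
  induction l with
  | nil => simp [conjs]
  | cons φ l ih => simpa [conjs] using fun _ => ih

@[simp] theorem sat_disjs (l : List Fml) : S.Sat s (disjs l) ↔ ∃ φ ∈ l, S.Sat s φ := by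
  induction l with
  | nil => simp [disjs]
  | cons φ l ih =>
    have : disjs (φ :: l) = .or φ (disjs l) := rfl
    simp [this, ih]

/-- The assignment `s`, changed to `w` at the variables `x_st, …, x_{st+n-1}`. -/
def _root_.Multiverse.ov (s : ℕ → M) (st : ℕ) {n : ℕ} (w : Fin n → M) : ℕ → M :=
  fun i => if h : st ≤ i ∧ i - st < n then w ⟨i - st, h.2⟩ else s i

@[simp] theorem _root_.Multiverse.ov_add (st : ℕ) {n : ℕ} (w : Fin n → M) (j : Fin n) :
    ov s st w (st + j) = w j := by
  have h : st ≤ st + (j : ℕ) ∧ st + (j : ℕ) - st < n := ⟨by omega, by omega⟩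
  rw [ov, dif_pos h]
  congr
  omega

@[simp] theorem _root_.Multiverse.ov_lt {st i : ℕ} {n : ℕ} (w : Fin n → M) (h : i < st) :
    ov s st w i = s i := by
  rw [ov, dif_neg (by omega)]

theorem _root_.Multiverse.ov_ge {st i : ℕ} {n : ℕ} (w : Fin n → M) (h : st + n ≤ i) :
    ov s st w i = s i := by
  rw [ov, dif_neg (by omega)]

theorem _root_.Multiverse.ov_succ (st : ℕ) {n : ℕ} (w : Fin (n + 1) → M) :
    ov s st w = Function.update (ov s st fun j : Fin n => w j.castSucc) (st + n) (w (Fin.last n)) := by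
  funext i
  by_cases hi : i = st + n
  · subst hi
    rw [Function.update_self]
    exact ov_add s st w (Fin.last n)
  · rw [Function.update_of_ne hi]
    by_cases h : st ≤ i ∧ i - st < n
    · rw [ov, ov, dif_pos h, dif_pos ⟨h.1, by omega⟩]
      rfl
    · rw [ov, ov, dif_neg h, dif_neg (by omega)]

@[simp] theorem _root_.Multiverse.ov_nil (st : ℕ) (w : Fin 0 → M) : ov s st w = s := by
  funext i; rw [ov, dif_neg (by omega)]

end values

theorem sat_alls (st n : ℕ) : ∀ (φ : Fml) (s : ℕ → M),
    S.Sat s (alls st n φ) ↔ ∀ w : Fin n → M, S.Sat (ov s st w) φ := by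
  induction n with
  | zero => intro φ s; simp [alls]
  | succ n ih =>
    intro φ s
    have : alls st (n + 1) φ = alls st n (.all (st + n) φ) := by
      simp [alls, List.range_succ]
    rw [this, ih]
    simp only [sat_all]
    constructor
    · intro h w
      rw [ov_succ]
      exact h _ _
    · intro h w d
      have := h (Fin.snoc w d)
      rw [ov_succ] at this
      simpa using this

theorem sat_exs (st n : ℕ) : ∀ (φ : Fml) (s : ℕ → M),
    S.Sat s (exs st n φ) ↔ ∃ w : Fin n → M, S.Sat (ov s st w) φ := by
  induction n with
  | zero => intro φ s; simp [exs]
  | succ n ih =>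
    intro φ s
    have : exs st (n + 1) φ = exs st n (.ex (st + n) φ) := by
      simp [exs, List.range_succ]
    rw [this, ih]
    simp only [sat_ex]
    constructor
    · rintro ⟨w, d, h⟩
      refine ⟨Fin.snoc w d, ?_⟩
      rw [ov_succ]
      simpa using h
    · rintro ⟨w, h⟩
      rw [ov_succ] at h
      exact ⟨_, _, h⟩

theorem map_vs (s : ℕ → M) (st a : ℕ) :
    (vs st a).map (S.val s) = List.ofFn fun j : Fin a => s (st + j) := by
  simp only [vs, List.map_map, List.ofFn_eq_map]
  rw [← List.map_coe_finRange_eq_range, List.map_map]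
  rfl

theorem forall_mem_vs (st a : ℕ) (P : Tm → Prop) :
    (∀ t ∈ vs st a, P t) ↔ ∀ j : Fin a, P (v (st + j)) := by
  simp only [vs, List.mem_map, List.mem_range]
  constructor
  · exact fun h j => h _ ⟨j, j.2, rfl⟩
  · rintro h _ ⟨j, hj, rfl⟩
    exact h ⟨j, hj⟩

theorem forall_mem_range (a : ℕ) (P : ℕ → Prop) :
    (∀ j ∈ List.range a, P j) ↔ ∀ j : Fin a, P j := by
  simp only [List.mem_range]
  exact ⟨fun h j => h j j.2, fun h j hj => h ⟨j, hj⟩⟩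

theorem exists_mem_list_map {α β : Type} (l : List α) (g : α → β) (P : β → Prop) :
    (∃ y ∈ l.map g, P y) ↔ ∃ x ∈ l, P (g x) := by
  simp

theorem _root_.Multiverse.lst_cons_ofFn (s : ℕ → M) (q : M) {a : ℕ} (w : Fin a → M) (j : Fin a) :
    lst s (q :: List.ofFn w) (1 + j) = w j := by
  simp [lst, Nat.add_comm 1, List.getD_eq_getElem?_getD]

/-! ### Semantic counterparts of the defined notions -/

def IsNat (x : M) : Prop := ∀ y, S.E S.zero y ∧ (∀ z, S.E z y → S.E (S.suc z) y) → S.E x y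

def IsPair (p a b : M) : Prop :=
  ∀ z, S.E z p ↔ ((∀ w, S.E w z ↔ w = a) ∨ ∀ w, S.E w z ↔ (w = a ∨ w = b))

def PairMem (a b r : M) : Prop := ∃ p, S.IsPair p a b ∧ S.E p r

def TripleMem (a b c r : M) : Prop := ∃ p, S.IsPair p a b ∧ S.PairMem p c r

def IsTuple : (a : ℕ) → M → (Fin a → M) → Prop
  | 0, p, _ => p = S.zero
  | a + 1, p, w => ∃ r, IsTuple a r (fun j => w j.succ) ∧ S.IsPair p (w 0) r

def IsVA (f D : M) : Prop :=
  (∀ p, S.E p f → ∃ n d, S.IsNat n ∧ S.E d D ∧ S.IsPair p n d) ∧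
  ∀ n, S.IsNat n → ∃ d, ∀ e, S.PairMem n e f ↔ e = d

def IsVAof (f U : M) : Prop := ∃ D I, S.IsPair U D I ∧ S.IsVA f D

def AgreeOff (f g x : M) : Prop :=
  ∀ n, S.IsNat n ∧ n ≠ x → ∀ d, S.PairMem n d f ↔ S.PairMem n d g

def ClosedTerms (K : Lang) (X : M) : Prop :=
  (∀ n, S.IsNat n → S.E (S.varI n) X) ∧ ∀ s ∈ K.funs, ∀ w : Fin s.1 → M,
    (∀ i, S.E (w i) X) → S.E (S.appI s.1 s.2 (List.ofFn w)) X

def IsTerm (K : Lang) (t : M) : Prop := ∀ X, S.ClosedTerms K X → S.E t X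

def ClosedForms (K : Lang) (X : M) : Prop :=
  (∀ t u, S.IsTerm K t ∧ S.IsTerm K u → S.E (S.eqI t u) X) ∧
  (∀ s ∈ K.rels, ∀ w : Fin s.1 → M,
    (∀ i, S.IsTerm K (w i)) → S.E (S.relI' s.1 s.2 (List.ofFn w)) X) ∧
  (∀ φ, S.E φ X → S.E (S.negI φ) X) ∧
  (∀ φ ψ, S.E φ X ∧ S.E ψ X → S.E (S.andI φ ψ) X) ∧
  ∀ x φ, S.IsNat x ∧ S.E φ X → S.E (S.allI x φ) X

def IsForm (K : Lang) (φ : M) : Prop := ∀ X, S.ClosedForms K X → S.E φ X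

def IsOp (a : ℕ) (r D : M) : Prop :=
  (∀ p, S.E p r → ∃ q d, ∃ w : Fin a → M, (∀ i, S.E (w i) D) ∧ S.E d D ∧ S.IsTuple a q w ∧
    S.IsPair p q d) ∧
  ∀ (w : Fin a → M) (q : M), (∀ i, S.E (w i) D) ∧ S.IsTuple a q w →
    ∃ d, ∀ e, S.PairMem q e r ↔ e = d

def IsRel (a : ℕ) (r D : M) : Prop :=
  ∀ q, S.E q r → ∃ w : Fin a → M, (∀ i, S.E (w i) D) ∧ S.IsTuple a q w

/-- The codes of the symbols of a language. -/
def _root_.Multiverse.symCodes (K : Lang) : List ℕ := K.funs.map funSymCode ++ K.rels.map relSymCode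

/-- The structure with the domain `D` and the interpretation function `I`. -/
def IsStructOn (K : Lang) (D I : M) : Prop :=
  (∃ d, S.E d D) ∧
  (∀ p, S.E p I → ∃ n ∈ symCodes K, ∃ r, S.IsPair p (S.numI n) r) ∧
  (∀ s ∈ K.funs, ∃ r, (∀ y, S.PairMem (S.numI (funSymCode s)) y I ↔ y = r) ∧ S.IsOp s.1 r D) ∧
  ∀ s ∈ K.rels, ∃ r, (∀ y, S.PairMem (S.numI (relSymCode s)) y I ↔ y = r) ∧ S.IsRel s.1 r D

def IsStruct (K : Lang) (U : M) : Prop := ∃ D I, S.IsPair U D I ∧ S.IsStructOn K D I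

def EvalClauses (K : Lang) (D I ev : M) : Prop := ∀ f, S.IsVA f D →
  (∀ n d, S.IsNat n → (S.TripleMem (S.varI n) f d ev ↔ S.PairMem n d f)) ∧
  ∀ s ∈ K.funs, ∀ w : Fin s.1 → M, (∀ i, S.IsTerm K (w i)) → ∀ d,
    (S.TripleMem (S.appI s.1 s.2 (List.ofFn w)) f d ev ↔
      ∃ z : Fin s.1 → M, (∀ j, S.TripleMem (w j) f (z j) ev) ∧ ∃ q y, S.IsTuple s.1 q z ∧
        S.PairMem (S.numI (funSymCode s)) y I ∧ S.PairMem q d y)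

def SatClauses (K : Lang) (D I ev sa : M) : Prop := ∀ f, S.IsVA f D →
  (∀ t u, S.IsTerm K t ∧ S.IsTerm K u → (S.PairMem (S.eqI t u) f sa ↔
    ∃ d, S.TripleMem t f d ev ∧ S.TripleMem u f d ev)) ∧
  (∀ s ∈ K.rels, ∀ w : Fin s.1 → M, (∀ i, S.IsTerm K (w i)) →
    (S.PairMem (S.relI' s.1 s.2 (List.ofFn w)) f sa ↔
      ∃ z : Fin s.1 → M, (∀ j, S.TripleMem (w j) f (z j) ev) ∧ ∃ q y, S.IsTuple s.1 q z ∧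
        S.PairMem (S.numI (relSymCode s)) y I ∧ S.E q y)) ∧
  (∀ φ, S.IsForm K φ → (S.PairMem (S.negI φ) f sa ↔ ¬ S.PairMem φ f sa)) ∧
  (∀ φ ψ, S.IsForm K φ ∧ S.IsForm K ψ →
    (S.PairMem (S.andI φ ψ) f sa ↔ S.PairMem φ f sa ∧ S.PairMem ψ f sa)) ∧
  ∀ φ x, S.IsForm K φ ∧ S.IsNat x → (S.PairMem (S.allI x φ) f sa ↔
    ∀ g, S.IsVA g D ∧ S.AgreeOff g f x → S.PairMem φ g sa)

def SatI (K : Lang) (U φ f : M) : Prop := ∃ D I ev sa, S.IsPair U D I ∧ S.IsForm K φ ∧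
  S.IsVA f D ∧ S.EvalClauses K D I ev ∧ S.SatClauses K D I ev sa ∧ S.PairMem φ f sa

def IsNumCode (n c : M) : Prop := ∃ h,
  (∀ i x y, S.PairMem i x h ∧ S.PairMem i y h → x = y) ∧
  S.PairMem S.zero (S.appI 0 0 []) h ∧
  (∀ i x, S.E i n ∧ S.PairMem i x h → S.PairMem (S.suc i) (S.appI 1 0 [x]) h) ∧
  S.PairMem n c h

/-- The structure with the domain `D` and the interpretation function `J` is the expansion of the
reduct to `LR` of the `LT`-structure `U` with the domain `D` and the interpretation function `I` by
the extensions of the formulas with the codes `u`, `m` at the stage with the numeral code `c`. -/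
def IsExpansionOn (LT LR : Lang) (u m c U D I J : M) : Prop :=
  (∀ n ∈ symCodes LR, ∀ r, S.PairMem (S.numI n) r I ↔ S.PairMem (S.numI n) r J) ∧
  (∀ r, S.PairMem (S.numI (relSymCode uniSym)) r J → ∀ a q, S.E a D ∧ S.IsTuple 1 q ![a] →
    (S.E q r ↔ ∃ f, S.IsVA f D ∧ S.PairMem (S.numI 1) a f ∧ S.SatI LT U (S.stageI u c) f)) ∧
  ∀ r, S.PairMem (S.numI (relSymCode modSym)) r J → ∀ (w : Fin 3 → M) (q : M),
    (∀ i, S.E (w i) D) ∧ S.IsTuple 3 q w →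
    (S.E q r ↔ ∃ f, S.IsVA f D ∧ S.PairMem (S.numI 1) (w 0) f ∧ S.PairMem (S.numI 2) (w 1) f ∧
      S.PairMem (S.numI 3) (w 2) f ∧ S.SatI LT U (S.stageI m c) f)

def IsExpansion (LT LR : Lang) (u m U n V : M) : Prop := ∃ D I J c,
  S.IsPair U D I ∧ S.IsPair V D J ∧ S.IsNumCode n c ∧ S.IsStruct LR.um V ∧
  S.IsExpansionOn LT LR u m c U D I J

/-! ### The object-level formulas define these counterparts -/

variable (s : ℕ → M)

@[simp] theorem sat_isNat : S.Sat s isNat ↔ S.IsNat (s 0) := by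
  simp [isNat, IsNat]

@[simp] theorem sat_isPair : S.Sat s isPair ↔ S.IsPair (s 0) (s 1) (s 2) := by
  simp [isPair, IsPair]

@[simp] theorem sat_pairMem : S.Sat s pairMem ↔ S.PairMem (s 0) (s 1) (s 2) := by
  simp [pairMem, PairMem, sat_at]

@[simp] theorem sat_tripleMem : S.Sat s tripleMem ↔ S.TripleMem (s 0) (s 1) (s 2) (s 3) := by
  simp [tripleMem, TripleMem, sat_at]

@[simp] theorem sat_isTuple (a : ℕ) : ∀ s : ℕ → M,
    S.Sat s (isTuple a) ↔ S.IsTuple a (s 0) fun j => s (1 + j) := by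
  induction a with
  | zero => intro s; simp [isTuple, IsTuple]
  | succ a ih =>
    intro s
    simp only [isTuple, IsTuple, sat_ex, sat_and, sat_at, ih, List.map_cons, map_vs, lst_cons_ofFn]
    refine exists_congr fun r => ?_
    have : (fun j : Fin a => Function.update s (a + 2) r (2 + ↑j)) =
        fun j : Fin a => s (1 + (j.succ : ℕ)) := by
      funext j
      rw [Function.update_of_ne (by omega)]
      congr 1
      simp; omega
    rw [this]
    simp

theorem sat_isTuple_at (a st : ℕ) (q : Tm) :
    S.Sat s ((isTuple a).at (q :: vs st a)) ↔ S.IsTuple a (S.val s q) fun j => s (st + j) := by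
  simp only [sat_at, sat_isTuple, List.map_cons, map_vs, lst_cons_ofFn, lst_zero]

@[simp] theorem sat_isVA : S.Sat s isVA ↔ S.IsVA (s 0) (s 1) := by
  simp [isVA, IsVA, sat_at]

@[simp] theorem sat_isVAof : S.Sat s isVAof ↔ S.IsVAof (s 0) (s 1) := by
  simp [isVAof, IsVAof, sat_at]

@[simp] theorem sat_agreeOff : S.Sat s agreeOff ↔ S.AgreeOff (s 0) (s 1) (s 2) := by
  simp [agreeOff, AgreeOff, sat_at]

@[simp] theorem sat_closedTerms (K : Lang) : S.Sat s (closedTerms K) ↔ S.ClosedTerms K (s 0) := by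
  simp only [closedTerms, ClosedTerms, sat_and, sat_conjs, sat_alls, sat_imp,
    List.forall_mem_map, forall_mem_vs, sat_mem, val_appC, map_vs]
  simp [sat_at]

@[simp] theorem sat_isTerm (K : Lang) : S.Sat s (isTerm K) ↔ S.IsTerm K (s 0) := by
  simp [isTerm, IsTerm, sat_at]

@[simp] theorem sat_closedForms (K : Lang) : S.Sat s (closedForms K) ↔ S.ClosedForms K (s 0) := by
  simp only [closedForms, ClosedForms, sat_and, sat_conjs, sat_alls, sat_imp,
    List.forall_mem_map, forall_mem_vs, sat_mem, val_relC, map_vs]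
  simp [sat_at]

@[simp] theorem sat_isForm (K : Lang) : S.Sat s (isForm K) ↔ S.IsForm K (s 0) := by
  simp [isForm, IsForm, sat_at]

@[simp] theorem sat_isOp (a : ℕ) : S.Sat s (isOp a) ↔ S.IsOp a (s 0) (s 1) := by
  simp only [isOp, IsOp, sat_and, sat_conjs, sat_alls, sat_exs, sat_imp, sat_all, sat_ex, sat_isTuple_at,
    List.forall_mem_map, forall_mem_vs, sat_mem]
  simp (disch := omega) [sat_at]

@[simp] theorem sat_isRel (a : ℕ) : S.Sat s (isRel a) ↔ S.IsRel a (s 0) (s 1) := by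
  simp only [isRel, IsRel, sat_and, sat_conjs, sat_alls, sat_exs, sat_imp, sat_all, sat_ex, sat_isTuple_at,
    List.forall_mem_map, forall_mem_vs, sat_mem]
  simp (disch := omega) [sat_at]

@[simp] theorem sat_isStruct (K : Lang) : S.Sat s (isStruct K) ↔ S.IsStruct K (s 0) := by
  simp only [isStruct, IsStruct, IsStructOn, sat_and, sat_conjs, sat_disjs, List.forall_mem_map,
    exists_mem_list_map, sat_imp, sat_all, sat_ex, sat_mem, symCodes]
  -- The formula quantifies over a code and then requires it to be one of finitely many numerals,
  -- whereas the counterpart quantifies over the list itself.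
  have h : ∀ (p : M) (l : List ℕ), (∃ c r, S.IsPair p c r ∧ ∃ n ∈ l, c = S.numI n) ↔
      ∃ n ∈ l, ∃ r, S.IsPair p (S.numI n) r := by
    intro p l
    constructor
    · rintro ⟨c, r, h, n, hn, rfl⟩
      exact ⟨n, hn, r, h⟩
    · rintro ⟨n, hn, r, h⟩
      exact ⟨_, r, h, n, hn, rfl⟩
  simp only [← h]
  simp (disch := omega) only [sat_at, List.map, lst_zero, lst_one, lst_two, sat_isPair, sat_pairMem, sat_isOp,
    sat_isRel, val_var, val_num, Function.update_self, Function.update_of_ne, sat_eq, sat_iff]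

@[simp] theorem sat_evalClauses (K : Lang) :
    S.Sat s (evalClauses K) ↔ S.EvalClauses K (s 0) (s 1) (s 2) := by
  simp only [evalClauses, EvalClauses, sat_and, sat_conjs, sat_alls, sat_exs, sat_imp, sat_iff, sat_all, sat_ex,
    sat_isTuple_at, forall_mem_vs, forall_mem_range, List.forall_mem_map, sat_mem]
  simp (disch := omega) [sat_at, map_vs, ov_ge]

@[simp] theorem sat_satClauses (K : Lang) :
    S.Sat s (satClauses K) ↔ S.SatClauses K (s 0) (s 1) (s 2) (s 3) := by
  simp only [satClauses, SatClauses, sat_and, sat_conjs, sat_alls, sat_exs, sat_imp, sat_iff, sat_all, sat_ex,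
    sat_isTuple_at, forall_mem_vs, forall_mem_range, List.forall_mem_map, sat_mem]
  simp (disch := omega) [sat_at, map_vs, ov_ge]

@[simp] theorem sat_sat (K : Lang) : S.Sat s (sat K) ↔ S.SatI K (s 0) (s 1) (s 2) := by
  simp [sat, SatI, sat_at]

@[simp] theorem sat_models (K : Lang) :
    S.Sat s (models K) ↔ ∀ f, S.IsVAof f (s 0) → S.SatI K (s 0) (s 1) f := by
  simp [models, sat_at]

@[simp] theorem sat_isNumCode : S.Sat s isNumCode ↔ S.IsNumCode (s 0) (s 1) := by
  simp [isNumCode, IsNumCode, sat_at]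

end Str

/-- The formula `isExpansion` with a term `t` in place of the code of the formula `Mod`. -/
def isExpansionT (LT LR : Lang) (Uni : Fml) (t : Tm) : Fml :=
  .ex 3 (.ex 4 (.ex 5 (.ex 6 (isPair.at [v 0, v 3, v 4] ⋏ isPair.at [v 2, v 3, v 5] ⋏
    isNumCode.at [v 1, v 6] ⋏ (isStruct LR.um).at [v 2] ⋏
    conjs ((LR.funs.map funSymCode ++ LR.rels.map relSymCode).map fun c =>
      .all 7 (pairMem.at [num c, v 7, v 4] ⟚ pairMem.at [num c, v 7, v 5])) ⋏
    .all 7 (pairMem.at [num (relSymCode uniSym), v 7, v 5] ⇛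
      .all 8 (.all 9 (v 8 ∊ v 3 ⋏ (isTuple 1).at [v 9, v 8] ⇛
        (v 9 ∊ v 7 ⟚ .ex 10 (isVA.at [v 10, v 3] ⋏ pairMem.at [num 1, v 8, v 10] ⋏
          (sat LT).at [v 0, stageC Uni (v 6), v 10]))))) ⋏
    .all 7 (pairMem.at [num (relSymCode modSym), v 7, v 5] ⇛
      alls 8 3 (.all 11 (conjs ((vs 8 3).map fun t => t ∊ v 3) ⋏ (isTuple 3).at (v 11 :: vs 8 3) ⇛
        (v 11 ∊ v 7 ⟚ .ex 12 (isVA.at [v 12, v 3] ⋏ pairMem.at [num 1, v 8, v 12] ⋏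
          pairMem.at [num 2, v 9, v 12] ⋏ pairMem.at [num 3, v 10, v 12] ⋏
          (sat LT).at [v 0, allC (num 0) (impC (eqC (varC (num 0)) (v 6)) t), v 12])))))))))

theorem isExpansion_eq (LT LR : Lang) (Uni Mod : Fml) :
    isExpansion LT LR Uni Mod = isExpansionT LT LR Uni (num (code Mod)) := rfl

namespace Str
variable (S : Str M) (s : ℕ → M)

/-- The quantifiers above the term bind only variables below x₁₃, so a term whose value depends only
on x₁₃ and later variables keeps its value there. This leaves x₁₃ available for the self-reference.
-/
theorem sat_isExpansionT (LT LR : Lang) (Uni : Fml) (t : Tm)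
    (ht : ∀ s' : ℕ → M, (∀ i, 13 ≤ i → s' i = s i) → S.val s' t = S.val s t) :
    S.Sat s (isExpansionT LT LR Uni t) ↔
      S.IsExpansion LT LR (S.numI (code Uni)) (S.val s t) (s 0) (s 1) (s 2) := by
  simp only [isExpansionT, sat_ex, sat_and, sat_conjs, sat_all, sat_imp, sat_iff, sat_alls,
    sat_isTuple_at, List.forall_mem_map, forall_mem_vs]
  simp only [sat_at, List.map, val_allC, val_impC, val_eqC, val_varC, val_stageC]
  have key : ∀ (a b c d e f k: M) (w : Fin 3 → M), S.val (Function.update (Function.update (ov (Function.update (Function.update (Function.update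
     (Function.update (Function.update s 3 a) 4 b) 5 c) 6 d) 7 e) 8 w) 11 f) 12 k) t = S.val s t := by
    intro a b c d e f k w
    refine ht _ fun i hi => ?_
    rw [Function.update_of_ne (by omega), Function.update_of_ne (by omega), ov_ge _ _ (by omega)]
    repeat rw [Function.update_of_ne (by omega)]
  simp only [key]
  have h8 : ∀ (s : ℕ → M) (w : Fin 3 → M), ov s 8 w 8 = w 0 := fun s w => ov_add s 8 w 0
  have h9 : ∀ (s : ℕ → M) (w : Fin 3 → M), ov s 8 w 9 = w 1 := fun s w => ov_add s 8 w 1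
  have h10 : ∀ (s : ℕ → M) (w : Fin 3 → M), ov s 8 w 10 = w 2 := fun s w => ov_add s 8 w 2
  have h1' : ∀ (s : ℕ → M) (a b : M), (fun j : Fin 1 => lst s [a, b] (1 + (j : ℕ))) = ![b] := by
    intro s a b; funext j; fin_cases j; rfl
  simp (disch := omega) only [sat_isTuple, h1', sat_isPair, sat_isNumCode, sat_isStruct, sat_pairMem, sat_isVA, sat_sat, lst_zero, lst_one,
    lst_two, lst_three, val_var, Function.update_self, Function.update_of_ne, ne_eq, val_num, sat_mem, not_false_eq_true, ov_add, ov_lt, ov_ge, h8, h9, h10]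
  simp only [IsExpansion, IsExpansionOn, symCodes, stageI]

theorem sat_revisionEquiv (LT LR : Lang) (Uni Mod₀ Mod : Fml) :
    S.Sat s (revisionEquiv LT LR Uni Mod₀ Mod) ↔ (S.Sat s Mod ↔
      S.IsNat (s 0) ∧ S.Sat s Uni ∧ S.IsForm LR.um (s 2) ∧ S.IsVAof (s 3) (s 1) ∧
      (s 0 = S.zero → S.Sat s Mod₀) ∧ ∀ m, S.IsNat m ∧ s 0 = S.suc m → ∃ V,
        S.IsExpansion LT LR (S.numI (code Uni)) (S.numI (code Mod)) (s 1) m V ∧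
        S.SatI LR.um V (s 2) (s 3)) := by
  have h : ∀ s : ℕ → M, S.Sat s (isExpansion LT LR Uni Mod) ↔
      S.IsExpansion LT LR (S.numI (code Uni)) (S.numI (code Mod)) (s 0) (s 1) (s 2) := by
    intro s
    rw [isExpansion_eq, S.sat_isExpansionT _ _ _ _ _ fun s' _ => by simp, val_num]
  simp [revisionEquiv, sat_at, h]

end Str
end Multiverse

/-! ### The defined formulas belong to the language of set theory -/

namespace Multiverse

attribute [simp] Fml.In.at

section
variable {L : Lang}

@[simp] theorem inLangT_zeroT : InLangT baseLang zeroT := ⟨by simp [baseLang], fun i => i.elim0⟩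
@[simp] theorem inLangT_succT {t : Tm} : InLangT baseLang (succT t) ↔ InLangT baseLang t := by
  simp [succT, baseLang]
@[simp] theorem inLangT_addT {t u : Tm} :
    InLangT baseLang (addT t u) ↔ InLangT baseLang t ∧ InLangT baseLang u := by
  simp [addT, baseLang, Fin.forall_fin_two]
@[simp] theorem inLangT_mulT {t u : Tm} :
    InLangT baseLang (mulT t u) ↔ InLangT baseLang t ∧ InLangT baseLang u := by
  simp [mulT, baseLang, Fin.forall_fin_two]
@[simp] theorem in_mem {t u : Tm} :
    (t ∊ u).In baseLang ↔ InLangT baseLang t ∧ InLangT baseLang u := by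
  simp [mem, baseLang, Fin.forall_fin_two]
@[simp] theorem inLangT_num (n : ℕ) : InLangT baseLang (num n) := by
  induction n with
  | zero => exact inLangT_zeroT
  | succ n ih => exact inLangT_succT.2 ih
@[simp] theorem inLangT_prT {t u : Tm} :
    InLangT baseLang (prT t u) ↔ InLangT baseLang t ∧ InLangT baseLang u := by
  simp [prT]; tauto
@[simp] theorem inLangT_listT {l : List Tm} :
    InLangT baseLang (listT l) ↔ ∀ t ∈ l, InLangT baseLang t := by
  induction l with
  | nil => simp [listT]
  | cons t l ih => simp [listT, ih]
@[simp] theorem inLangT_varC {t : Tm} : InLangT baseLang (varC t) ↔ InLangT baseLang t := by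
  simp [varC]
@[simp] theorem inLangT_appC {a f : ℕ} {l : List Tm} :
    InLangT baseLang (appC a f l) ↔ ∀ t ∈ l, InLangT baseLang t := by simp [appC]
@[simp] theorem inLangT_relC {a f : ℕ} {l : List Tm} :
    InLangT baseLang (relC a f l) ↔ ∀ t ∈ l, InLangT baseLang t := by simp [relC]
@[simp] theorem inLangT_eqC {t u : Tm} :
    InLangT baseLang (eqC t u) ↔ InLangT baseLang t ∧ InLangT baseLang u := by simp [eqC]
@[simp] theorem inLangT_negC {t : Tm} : InLangT baseLang (negC t) ↔ InLangT baseLang t := by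
  simp [negC]
@[simp] theorem inLangT_andC {t u : Tm} :
    InLangT baseLang (andC t u) ↔ InLangT baseLang t ∧ InLangT baseLang u := by simp [andC]
@[simp] theorem inLangT_allC {t u : Tm} :
    InLangT baseLang (allC t u) ↔ InLangT baseLang t ∧ InLangT baseLang u := by simp [allC]
@[simp] theorem inLangT_impC {t u : Tm} :
    InLangT baseLang (impC t u) ↔ InLangT baseLang t ∧ InLangT baseLang u := by simp [impC]
@[simp] theorem inLangT_stageC {χ : Fml} {c : Tm} :
    InLangT baseLang (stageC χ c) ↔ InLangT baseLang c := by simp [stageC]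

@[simp] theorem in_conjs {l : List Fml} : (conjs l).In baseLang ↔ ∀ φ ∈ l, φ.In baseLang := by
  induction l with
  | nil => simp [conjs, topF]
  | cons φ l ih => simpa [conjs] using fun _ => ih
@[simp] theorem in_disjs {l : List Fml} : (disjs l).In baseLang ↔ ∀ φ ∈ l, φ.In baseLang := by
  induction l with
  | nil => simp [disjs, topF]
  | cons φ l ih => simpa [disjs] using fun _ => ih
@[simp] theorem in_alls {st n : ℕ} : ∀ {φ : Fml}, (alls st n φ).In L ↔ φ.In L := by
  intro φ
  simp only [alls]
  induction List.range n with
  | nil => rfl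
  | cons j l ih => simpa using ih
@[simp] theorem in_exs {st n : ℕ} : ∀ {φ : Fml}, (exs st n φ).In L ↔ φ.In L := by
  intro φ
  simp only [exs]
  induction List.range n with
  | nil => rfl
  | cons j l ih => simpa using ih
@[simp] theorem inLangT_vs {st n : ℕ} : (∀ t ∈ vs st n, InLangT L t) ↔ True := by
  simp [vs]
@[simp high] theorem in_conjs_map {α : Type} {l : List α} {g : α → Fml} :
    (conjs (l.map g)).In baseLang ↔ ∀ x ∈ l, (g x).In baseLang := by
  simp

end

@[simp] theorem in_isNat : isNat.In baseLang := by simp [isNat]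
@[simp] theorem in_isPair : isPair.In baseLang := by simp [isPair]
@[simp] theorem in_pairMem : pairMem.In baseLang := by simp [pairMem]
@[simp] theorem in_tripleMem : tripleMem.In baseLang := by simp [tripleMem]
@[simp] theorem in_isTuple (a : ℕ) : (isTuple a).In baseLang := by
  induction a with
  | zero => simp [isTuple]
  | succ a ih => simp [isTuple, ih]
@[simp] theorem in_isVA : isVA.In baseLang := by simp [isVA]
@[simp] theorem in_isVAof : isVAof.In baseLang := by simp [isVAof]
@[simp] theorem in_agreeOff : agreeOff.In baseLang := by simp [agreeOff]
@[simp] theorem in_closedTerms (K : Lang) : (closedTerms K).In baseLang := by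
  simp [closedTerms]
@[simp] theorem in_isTerm (K : Lang) : (isTerm K).In baseLang := by simp [isTerm]
@[simp] theorem in_closedForms (K : Lang) : (closedForms K).In baseLang := by
  simp [closedForms, Str.forall_mem_vs]
@[simp] theorem in_isForm (K : Lang) : (isForm K).In baseLang := by simp [isForm]
@[simp] theorem in_isOp (a : ℕ) : (isOp a).In baseLang := by simp [isOp]
@[simp] theorem in_isRel (a : ℕ) : (isRel a).In baseLang := by simp [isRel]
@[simp] theorem in_isStruct (K : Lang) : (isStruct K).In baseLang := by
  simp only [isStruct, Fml.in_ex, Fml.in_and, Fml.in_all, Fml.in_imp, in_conjs, in_disjs,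
    List.forall_mem_map]
  simp
@[simp] theorem in_evalClauses (K : Lang) : (evalClauses K).In baseLang := by
  simp [evalClauses, Str.forall_mem_vs]
@[simp] theorem in_satClauses (K : Lang) : (satClauses K).In baseLang := by
  simp [satClauses, Str.forall_mem_vs]
@[simp] theorem in_sat (K : Lang) : (sat K).In baseLang := by simp [sat]
@[simp] theorem in_models (K : Lang) : (models K).In baseLang := by simp [models]
@[simp] theorem in_isNumCode : isNumCode.In baseLang := by simp [isNumCode]
theorem in_isExpansionT (LT LR : Lang) (Uni : Fml) {t : Tm} (ht : InLangT baseLang t) :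
    (isExpansionT LT LR Uni t).In baseLang := by
  simp only [isExpansionT, Fml.in_ex, Fml.in_and, Fml.in_all, Fml.in_imp, in_conjs,
    List.forall_mem_map, in_alls, Fml.in_iff]
  simp [ht]
@[simp] theorem in_isExpansion (LT LR : Lang) (Uni Mod : Fml) :
    (isExpansion LT LR Uni Mod).In baseLang := by
  rw [isExpansion_eq]; exact in_isExpansionT _ _ _ (inLangT_num _)
theorem in_stage {k : ℕ} {χ : Fml} (h : χ.In baseLang) : (stage k χ).In baseLang := by
  simp [stage, h]
theorem in_allModel {LT : Lang} {Uni : Fml} (h : Uni.In baseLang) (k : ℕ) (φ : Fml) :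
    (allModel LT Uni k φ).In baseLang := by
  simp [allModel, in_stage h]
theorem in_revisionEquiv {LT LR : Lang} {Uni Mod₀ Mod : Fml} (h : Uni.In baseLang)
    (h₀ : Mod₀.In baseLang) (h' : Mod.In baseLang) :
    (revisionEquiv LT LR Uni Mod₀ Mod).In baseLang := by
  simp [revisionEquiv, h, h₀, h']

end Multiverse

namespace Multiverse

variable {M : Type}

/-! ### Definable predicates

`DP S P` says that the predicate `P` on a context `X`, an iterated product of copies of the domain of
`S` and of its finite powers, is definable with parameters by a formula of the language of set
theory. -/

/-- A block is what one quantifier step adds to a context: a single element or a tuple of fixed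
finite length. Tuples occur in the clauses for function and relation symbols. -/
class Blk (M Y : Type) where
  bproj : Set (Y → M)

instance : Blk M M := ⟨{id}⟩
instance {a : ℕ} : Blk M (Fin a → M) := ⟨Set.range fun j w => w j⟩

class Ctx (M X : Type) where
  proj : Set (X → M)

instance : Ctx M Unit := ⟨∅⟩
instance {X Y : Type} [Ctx M X] [Blk M Y] : Ctx M (X × Y) :=
  ⟨{t | (∃ f ∈ Ctx.proj (M := M) (X := X), t = fun p => f p.1) ∨
    ∃ g ∈ Blk.bproj (M := M) (Y := Y), t = fun p => g p.2}⟩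

/-- A parameter or a coordinate. -/
def IsCoord {X : Type} [Ctx M X] (t : X → M) : Prop := (∃ a, t = fun _ => a) ∨ t ∈ Ctx.proj

class DT (S : Str M) {X : Type} [Ctx M X] (t : X → M) : Prop where
  out : ∃ (τ : Tm) (e : ℕ → X → M), InLangT baseLang τ ∧ (∀ i, IsCoord (e i)) ∧
    ∀ x, t x = S.val (fun i => e i x) τ

/-- Separation in a model applies only to definable predicates. As a class, definability can be
inferred from the shape of the predicate, so that no defining formula has to be written by hand. -/
class DP (S : Str M) {X : Type} [Ctx M X] (P : X → Prop) : Prop where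
  out : ∃ (φ : Fml) (e : ℕ → X → M), φ.In baseLang ∧ (∀ i, IsCoord (e i)) ∧
    ∀ x, P x ↔ S.Sat (fun i => e i x) φ

section
variable {S : Str M} {X Y : Type} [Ctx M X] [Blk M Y]

theorem IsCoord.dt {t : X → M} (h : IsCoord t) : DT S t :=
  ⟨v 0, fun _ => t, trivial, fun _ => h, fun _ => rfl⟩

/-- The terms substituted for different variables bring their own variables; indexing these by pairs
keeps them apart. -/
theorem DP.ofSat {φ : Fml} (hφ : φ.In baseLang) (ts : ℕ → X → M) (h : ∀ i, DT S (ts i)) :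
    DP S fun x => S.Sat (fun i => ts i x) φ := by
  choose τ e h1 h2 h3 using fun i => (h i).out
  refine ⟨φ.subst fun i => (τ i).subst fun j => v (Nat.pair i j),
    fun n => e n.unpair.1 n.unpair.2, hφ.subst fun n _ => (h1 n).subst fun _ _ => trivial,
    fun i => h2 _ _, fun x => ?_⟩
  simp only [S.sat_subst, S.val_subst, Str.val_var, Nat.unpair_pair, h3]

theorem DT.ofVal {t : Tm} (ht : InLangT baseLang t) (ts : ℕ → X → M) (h : ∀ i, DT S (ts i)) :
    DT S fun x => S.val (fun i => ts i x) t := by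
  choose τ e h1 h2 h3 using fun i => (h i).out
  refine ⟨t.subst fun i => (τ i).subst fun j => v (Nat.pair i j),
    fun n => e n.unpair.1 n.unpair.2, ht.subst fun n _ => (h1 n).subst fun _ _ => trivial,
    fun i => h2 _ _, fun x => ?_⟩
  simp only [S.val_subst, Str.val_var, Nat.unpair_pair, h3]

theorem DP.congr {P Q : X → Prop} (h : ∀ x, P x ↔ Q x) (hP : DP S P) : DP S Q := by
  rwa [← funext fun x => propext (h x)]

instance DT.const (a : M) : DT S fun _ : X => a := IsCoord.dt (.inl ⟨a, rfl⟩)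

instance DP.const (p : Prop) : DP S fun _ : X => p := by
  by_cases hp : p
  · exact ⟨topF, fun _ _ => S.zero, by simp [topF], fun _ => .inl ⟨_, rfl⟩, by simp [hp]⟩
  · exact ⟨.neg topF, fun _ _ => S.zero, by simp [topF], fun _ => .inl ⟨_, rfl⟩, by simp [hp]⟩

instance DP.not (P : X → Prop) [h : DP S P] : DP S fun x => ¬ P x := by
  obtain ⟨φ, e, h1, h2, h3⟩ := h.out
  exact ⟨φ.neg, e, h1, h2, fun x => by simp [h3]⟩

instance DP.and (P Q : X → Prop) [hP : DP S P] [hQ : DP S Q] : DP S fun x => P x ∧ Q x := by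
  obtain ⟨φ, e, h1, h2, h3⟩ := hP.out
  obtain ⟨ψ, e', h1', h2', h3'⟩ := hQ.out
  -- Even variables serve the first formula and odd ones the second, so the two lists of coordinates
  -- can be interleaved.
  refine ⟨.and (φ.subst fun i => v (2 * i)) (ψ.subst fun i => v (2 * i + 1)),
    fun n => if n % 2 = 0 then e (n / 2) else e' (n / 2),
    ⟨h1.subst fun _ _ => trivial, h1'.subst fun _ _ => trivial⟩, fun i => ?_, fun x => ?_⟩
  · dsimp only
    split_ifs
    exacts [h2 _, h2' _]
  · rw [h3, h3', Str.sat_and, S.sat_subst, S.sat_subst]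
    have e1 : ∀ i, (2 * i + 1) % 2 = 1 := fun i => by omega
    have e2 : ∀ i, (2 * i + 1) / 2 = i := fun i => by omega
    simp [e1, e2]

instance DP.imp (P Q : X → Prop) [DP S P] [DP S Q] : DP S fun x => P x → Q x :=
  DP.congr (P := fun x => ¬ (P x ∧ ¬ Q x)) (fun x => by tauto) inferInstance
instance DP.or (P Q : X → Prop) [DP S P] [DP S Q] : DP S fun x => P x ∨ Q x :=
  DP.congr (P := fun x => ¬ (¬ P x ∧ ¬ Q x)) (fun x => by tauto) inferInstance
instance DP.iff (P Q : X → Prop) [DP S P] [DP S Q] : DP S fun x => P x ↔ Q x :=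
  DP.congr (P := fun x => (P x → Q x) ∧ (Q x → P x)) (fun x => by tauto) inferInstance

open Classical in
instance DP.all (P : X → M → Prop) [h : DP S fun p : X × M => P p.1 p.2] :
    DP S fun x => ∀ m, P x m := by
  obtain ⟨φ, e, h1, h2, h3⟩ := h.out
  have key : ∀ i, ∃ f : X → M, IsCoord f ∧ (e i ≠ Prod.snd → ∀ p, e i p = f p.1) := by
    intro i
    rcases h2 i with ⟨a, ha⟩ | ⟨f, hf, hi⟩ | ⟨g, hg, hi⟩
    · exact ⟨fun _ => a, .inl ⟨a, rfl⟩, fun _ p => by rw [ha]⟩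
    · exact ⟨f, .inr hf, fun _ p => by rw [hi]⟩
    · obtain rfl : g = id := hg
      exact ⟨fun _ => S.zero, .inl ⟨_, rfl⟩, fun h => absurd hi h⟩
  choose f hf hf' using key
  -- All variables that read the last coordinate are identified with the bound x₀; the others are
  -- shifted by one and read off the remaining context.
  refine ⟨.all 0 (φ.subst fun i => if e i = Prod.snd then v 0 else v (i + 1)), fun i => f (i - 1),
    Fml.In.subst (φ := φ) (fun i _ => by split_ifs <;> trivial) h1, fun i => hf _, fun x => ?_⟩
  rw [Str.sat_all]
  refine forall_congr' fun m => ?_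
  rw [h3 (x, m), S.sat_subst]
  refine S.sat_congr φ fun n _ => ?_
  split_ifs with hn
  · simp [hn]
  · simp [hf' n hn]

open Classical in
instance DP.allFin {a : ℕ} (P : X → (Fin a → M) → Prop)
    [h : DP S fun p : X × (Fin a → M) => P p.1 p.2] : DP S fun x => ∀ w, P x w := by
  obtain ⟨φ, e, h1, h2, h3⟩ := h.out
  have key : ∀ i, ∃ f : X → M, IsCoord f ∧
      ((¬ ∃ j : Fin a, e i = fun p => p.2 j) → ∀ p, e i p = f p.1) := by
    intro i
    rcases h2 i with ⟨a, ha⟩ | ⟨f, hf, hi⟩ | ⟨g, hg, hi⟩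
    · exact ⟨fun _ => a, .inl ⟨a, rfl⟩, fun _ p => by rw [ha]⟩
    · exact ⟨f, .inr hf, fun _ p => by rw [hi]⟩
    · obtain ⟨j, rfl⟩ := hg
      exact ⟨fun _ => S.zero, .inl ⟨_, rfl⟩, fun h => absurd ⟨j, hi⟩ h⟩
  choose f hf hf' using key
  refine ⟨alls 0 a (φ.subst fun i => if h : ∃ j : Fin a, e i = fun p => p.2 j then v h.choose
      else v (a + i)), fun i => f (i - a),
    in_alls.2 (Fml.In.subst (φ := φ) (fun i _ => by split_ifs <;> trivial) h1), fun i => hf _,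
    fun x => ?_⟩
  rw [S.sat_alls]
  refine forall_congr' fun w => ?_
  rw [h3 (x, w), S.sat_subst]
  refine S.sat_congr φ fun n _ => ?_
  split_ifs with hn
  · have h4 := ov_add (fun i => f (i - a) x) 0 w hn.choose
    rw [Nat.zero_add] at h4
    rw [Str.val_var, h4]
    conv_lhs => rw [hn.choose_spec]
  · rw [Str.val_var, ov_ge _ _ (by omega)]
    simp [hf' n hn]

instance DP.ex (P : X → M → Prop) [DP S fun p : X × M => P p.1 p.2] :
    DP S fun x => ∃ m, P x m :=
  DP.congr (P := fun x => ¬ ∀ m, ¬ P x m) (fun x => by simp) inferInstance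
instance DP.exFin {a : ℕ} (P : X → (Fin a → M) → Prop)
    [DP S fun p : X × (Fin a → M) => P p.1 p.2] : DP S fun x => ∃ w, P x w :=
  DP.congr (P := fun x => ¬ ∀ w, ¬ P x w) (fun x => by simp) inferInstance

instance DP.forallFin {a : ℕ} (P : Fin a → X → Prop) [h : ∀ j, DP S (P j)] :
    DP S fun x => ∀ j, P j x := by
  induction a with
  | zero => exact DP.congr (P := fun _ => True) (fun x => by simp) inferInstance
  | succ a ih =>
    have := ih fun j => P j.succ
    exact DP.congr (P := fun x => P 0 x ∧ ∀ j : Fin a, P j.succ x)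
      (fun x => (Fin.forall_fin_succ (P := fun j => P j x)).symm) inferInstance

instance DP.existsMem {α : Type} (l : List α) (P : α → X → Prop) [h : ∀ a, DP S (P a)] :
    DP S fun x => ∃ a ∈ l, P a x := by
  induction l with
  | nil => exact DP.congr (P := fun _ => False) (fun x => by simp) inferInstance
  | cons a l ih => exact DP.congr (P := fun x => P a x ∨ ∃ a ∈ l, P a x) (fun x => by simp) inferInstance

theorem DT.fst {t : X → M} (h : DT S t) : DT S fun p : X × Y => t p.1 := by
  obtain ⟨τ, e, h1, h2, h3⟩ := h.out
  refine ⟨τ, fun i p => e i p.1, h1, fun i => ?_, fun p => h3 _⟩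
  rcases h2 i with ⟨a, ha⟩ | h
  · exact .inl ⟨a, funext fun p => congrFun ha p.1⟩
  · exact .inr (.inl ⟨e i, h, rfl⟩)

instance DT.p2 : DT S fun p : X × M => p.2 := IsCoord.dt (.inr (.inr ⟨id, rfl, rfl⟩))
instance DT.w2 {a : ℕ} (j : Fin a) : DT S fun p : X × (Fin a → M) => p.2 j :=
  IsCoord.dt (.inr (.inr ⟨fun w => w j, ⟨j, rfl⟩, rfl⟩))

section
variable {Y₁ Y₂ Y₃ Y₄ Y₅ Y₆ Y₇ Y₈ : Type} [Blk M Y₁] [Blk M Y₂] [Blk M Y₃] [Blk M Y₄]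
  [Blk M Y₅] [Blk M Y₆] [Blk M Y₇] [Blk M Y₈]
instance DT.p12 : DT S fun p : (X × M) × Y₁ => p.1.2 := DT.p2.fst
instance DT.p112 : DT S fun p : ((X × M) × Y₁) × Y₂ => p.1.1.2 := DT.p12.fst
instance DT.p1112 : DT S fun p : (((X × M) × Y₁) × Y₂) × Y₃ => p.1.1.1.2 := DT.p112.fst
instance DT.p11112 : DT S fun p : ((((X × M) × Y₁) × Y₂) × Y₃) × Y₄ => p.1.1.1.1.2 :=
  DT.p1112.fst
instance DT.p111112 :
    DT S fun p : (((((X × M) × Y₁) × Y₂) × Y₃) × Y₄) × Y₅ => p.1.1.1.1.1.2 := DT.p11112.fst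
instance DT.p1111112 :
    DT S fun p : ((((((X × M) × Y₁) × Y₂) × Y₃) × Y₄) × Y₅) × Y₆ => p.1.1.1.1.1.1.2 :=
  DT.p111112.fst
instance DT.w12 {a : ℕ} (j : Fin a) : DT S fun p : (X × (Fin a → M)) × Y₁ => p.1.2 j :=
  (DT.w2 j).fst
instance DT.w112 {a : ℕ} (j : Fin a) :
    DT S fun p : ((X × (Fin a → M)) × Y₁) × Y₂ => p.1.1.2 j := (DT.w12 j).fst
end

theorem DP.ofList {φ : Fml} (hφ : φ.In baseLang) (l : List (X → M)) (h : ∀ t ∈ l, DT S t) :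
    DP S fun x => S.Sat (lst (fun _ => S.zero) (l.map fun t => t x)) φ := by
  refine DP.congr (P := fun x => S.Sat (fun i => l.getD i (fun _ => S.zero) x) φ) (fun x => ?_)
    (DP.ofSat hφ _ fun i => ?_)
  · refine S.sat_congr φ fun n _ => ?_
    simp only [lst, List.getD_eq_getElem?_getD, List.getElem?_map]
    cases l[n]? <;> simp
  · rw [List.getD_eq_getElem?_getD]
    cases hi : l[i]? with
    | none => exact DT.const _
    | some t => exact h t (List.mem_of_getElem? hi)

theorem DT.ofList {u : Tm} (hu : InLangT baseLang u) (l : List (X → M)) (h : ∀ t ∈ l, DT S t) :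
    DT S fun x => S.val (lst (fun _ => S.zero) (l.map fun t => t x)) u := by
  have : (fun x => S.val (lst (fun _ => S.zero) (l.map fun t => t x)) u) =
      fun x => S.val (fun i => l.getD i (fun _ => S.zero) x) u := by
    funext x
    refine S.val_congr u fun n _ => ?_
    simp only [lst, List.getD_eq_getElem?_getD, List.getElem?_map]
    cases l[n]? <;> simp
  rw [this]
  refine DT.ofVal hu _ fun i => ?_
  rw [List.getD_eq_getElem?_getD]
  cases hi : l[i]? with
  | none => exact DT.const _
  | some t => exact h t (List.mem_of_getElem? hi)

section terms
variable (a b c d : X → M) [ha : DT S a] [hb : DT S b]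

instance DT.suc : DT S fun x => S.suc (a x) := by
  simpa using DT.ofList (S := S) (u := succT (v 0)) (by simp) [a] (by simp [ha])
instance DT.add : DT S fun x => S.add (a x) (b x) := by
  simpa using DT.ofList (S := S) (u := addT (v 0) (v 1)) (by simp) [a, b] (by simp [ha, hb])
instance DT.mul : DT S fun x => S.mul (a x) (b x) := by
  simpa using DT.ofList (S := S) (u := mulT (v 0) (v 1)) (by simp) [a, b] (by simp [ha, hb])
instance DT.prI : DT S fun x => S.prI (a x) (b x) := by unfold Str.prI; infer_instance
instance DT.varI : DT S fun x => S.varI (a x) := by unfold Str.varI; infer_instance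
instance DT.eqI : DT S fun x => S.eqI (a x) (b x) := by unfold Str.eqI; infer_instance
instance DT.negI : DT S fun x => S.negI (a x) := by unfold Str.negI; infer_instance
instance DT.andI : DT S fun x => S.andI (a x) (b x) := by unfold Str.andI; infer_instance
instance DT.allI : DT S fun x => S.allI (a x) (b x) := by unfold Str.allI; infer_instance
instance DT.listI {n : ℕ} (w : X → Fin n → M) [h : ∀ j, DT S fun x => w x j] :
    DT S fun x => S.listI (List.ofFn (w x)) := by
  induction n with
  | zero => simp only [List.ofFn_zero]; infer_instance
  | succ n ih =>
    simp only [List.ofFn_succ, Str.listI]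
    have := ih fun x j => w x j.succ
    infer_instance
instance DT.appI {m n f : ℕ} (w : X → Fin n → M) [h : ∀ j, DT S fun x => w x j] :
    DT S fun x => S.appI m f (List.ofFn (w x)) := by unfold Str.appI; infer_instance
instance DT.relI {m n f : ℕ} (w : X → Fin n → M) [h : ∀ j, DT S fun x => w x j] :
    DT S fun x => S.relI' m f (List.ofFn (w x)) := by unfold Str.relI'; infer_instance
instance DT.appI1 {m f : ℕ} : DT S fun x => S.appI m f [a x] := by
  unfold Str.appI; simp only [Str.listI]; infer_instance

instance DP.eq : DP S fun x => a x = b x := by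
  simpa using DP.ofList (S := S) (φ := v 0 ≐ v 1) (by simp) [a, b] (by simp [ha, hb])
instance DP.E : DP S fun x => S.E (a x) (b x) := by
  simpa using DP.ofList (S := S) (φ := v 0 ∊ v 1) (by simp) [a, b] (by simp [ha, hb])
instance DP.isNat : DP S fun x => S.IsNat (a x) := by
  simpa using DP.ofList (S := S) in_isNat [a] (by simp [ha])
instance DP.isTerm (K : Lang) : DP S fun x => S.IsTerm K (a x) := by
  simpa using DP.ofList (S := S) (in_isTerm K) [a] (by simp [ha])
instance DP.isForm (K : Lang) : DP S fun x => S.IsForm K (a x) := by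
  simpa using DP.ofList (S := S) (in_isForm K) [a] (by simp [ha])
instance DP.isVA : DP S fun x => S.IsVA (a x) (b x) := by
  simpa using DP.ofList (S := S) in_isVA [a, b] (by simp [ha, hb])
variable [hc : DT S c] [hd : DT S d]
instance DP.isPair : DP S fun x => S.IsPair (a x) (b x) (c x) := by
  simpa using DP.ofList (S := S) in_isPair [a, b, c] (by simp [ha, hb, hc])
instance DP.pairMem : DP S fun x => S.PairMem (a x) (b x) (c x) := by
  simpa using DP.ofList (S := S) in_pairMem [a, b, c] (by simp [ha, hb, hc])
instance DP.agreeOff : DP S fun x => S.AgreeOff (a x) (b x) (c x) := by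
  simpa using DP.ofList (S := S) in_agreeOff [a, b, c] (by simp [ha, hb, hc])
instance DP.satI (K : Lang) : DP S fun x => S.SatI K (a x) (b x) (c x) := by
  simpa using DP.ofList (S := S) (in_sat K) [a, b, c] (by simp [ha, hb, hc])
instance DP.tripleMem : DP S fun x => S.TripleMem (a x) (b x) (c x) (d x) := by
  simpa using DP.ofList (S := S) in_tripleMem [a, b, c, d] (by simp [ha, hb, hc, hd])
end terms

instance DP.isTuple {n : ℕ} (q : X → M) (w : X → Fin n → M) [hq : DT S q]
    [h : ∀ j, DT S fun x => w x j] : DP S fun x => S.IsTuple n (q x) (w x) := by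
  have := DP.ofList (S := S) (in_isTuple n) (q :: List.ofFn fun j x => w x j)
    (by simp only [List.mem_cons, List.mem_ofFn]; rintro t (rfl | ⟨j, rfl⟩); exacts [hq, h j])
  simpa [List.map_ofFn, Function.comp_def, lst_cons_ofFn] using this

/-- In recursions the predicate C is arbitrary and offers no shape to follow; its definability is
assumed once and transferred to composites by substituting terms for the three coordinates. -/
theorem DP.comp₃ {C : M → M → M → Prop}
    (hC : DP S fun p : ((Unit × M) × M) × M => C p.1.1.2 p.1.2 p.2)
    (a b c : X → M) [ha : DT S a] [hb : DT S b] [hc : DT S c] : DP S fun x => C (a x) (b x) (c x) := by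
  obtain ⟨φ, e, h1, h2, h3⟩ := hC.out
  refine DP.congr (P := fun x => S.Sat (fun i => e i ((((), a x), b x), c x)) φ)
    (fun x => (h3 ((((), a x), b x), c x)).symm) (DP.ofSat h1 _ fun i => ?_)
  rcases h2 i with ⟨m, hm⟩ | ⟨f, ⟨f, ⟨f, hf, rfl⟩ | ⟨g, rfl, rfl⟩, rfl⟩ | ⟨g, rfl, rfl⟩, hi⟩ | ⟨g, rfl, hi⟩
  · simp only [hm]; infer_instance
  · exact absurd hf (Set.notMem_empty _)
  · simpa [hi] using ha
  · simpa [hi] using hb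
  · simpa [hi] using hc

end

/-! ### Models of ZF -/

/-- A model of ZF. -/
class Str.IsZF (S : Str M) : Prop where
  valid : ∀ φ ∈ ZF, S.Valid φ

/-- Finitely many axioms of ZF that suffice for the manipulation of pairs, tuples and numerals. -/
def basicAx : List Fml := extAx :: pairAx :: foundAx :: arithAx

theorem basicAx_subset : ∀ φ ∈ basicAx, φ ∈ ZF := by
  intro φ h
  simp only [basicAx, List.mem_cons] at h
  refine .inl (.inl ?_)
  rcases h with rfl | rfl | rfl | h
  · exact .inl (by simp)
  · exact .inl (by simp)
  · exact .inl (by simp)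
  · exact .inr h

/-- A model of `basicAx`. -/
class Str.IsBasic (S : Str M) : Prop where
  valid : ∀ φ ∈ basicAx, S.Valid φ

instance (S : Str M) [hS : S.IsZF] : S.IsBasic := ⟨fun φ h => hS.valid φ (basicAx_subset φ h)⟩

namespace Str
variable (S : Str M)

/-! ### Consequences of the finitely many basic axioms -/

section basic
variable [hS : S.IsBasic]

theorem ext {x y : M} (h : ∀ z, S.E z x ↔ S.E z y) : x = y := by
  have := hS.valid extAx (by simp [basicAx, arithAx]) fun _ => x
  simp [extAx] at this
  exact this x y h

theorem exists_pairSet (a b : M) : ∃ c, ∀ z, S.E z c ↔ (z = a ∨ z = b) := by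
  have := hS.valid pairAx (by simp [basicAx, arithAx]) fun _ => a
  simp [pairAx] at this
  exact this a b

theorem foundation {a b : M} (h : S.E b a) : ∃ m, S.E m a ∧ ∀ z, S.E z m → ¬ S.E z a := by
  have := hS.valid foundAx (by simp [basicAx, arithAx]) fun _ => a
  simp [foundAx] at this
  exact this a b h

theorem not_mem_zero (x : M) : ¬ S.E x S.zero := by
  have := hS.valid arithAx[0] (by simp [basicAx, arithAx]) fun _ => x
  simp [arithAx] at this
  exact this x

theorem mem_suc {x y : M} : S.E y (S.suc x) ↔ S.E y x ∨ y = x := by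
  have := hS.valid arithAx[1] (by simp [basicAx, arithAx]) fun _ => x
  simp [arithAx] at this
  exact this x y

theorem add_zeroI {x : M} (hx : S.IsNat x) : S.add x S.zero = x := by
  have := hS.valid arithAx[2] (by simp [basicAx, arithAx]) fun _ => x
  simp [arithAx] at this
  exact this x hx

theorem add_sucI {x y : M} (hx : S.IsNat x) (hy : S.IsNat y) :
    S.add x (S.suc y) = S.suc (S.add x y) := by
  have := hS.valid arithAx[3] (by simp [basicAx, arithAx]) fun _ => x
  simp [arithAx, sat_at] at this
  exact this x y hx hy

theorem mul_zeroI {x : M} (hx : S.IsNat x) : S.mul x S.zero = S.zero := by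
  have := hS.valid arithAx[4] (by simp [basicAx, arithAx]) fun _ => x
  simp [arithAx] at this
  exact this x hx

theorem mul_sucI {x y : M} (hx : S.IsNat x) (hy : S.IsNat y) :
    S.mul x (S.suc y) = S.add (S.mul x y) x := by
  have := hS.valid arithAx[5] (by simp [basicAx, arithAx]) fun _ => x
  simp [arithAx, sat_at] at this
  exact this x y hx hy

end basic

/-! ### Set existence in models of ZF -/

variable [hS : S.IsZF]

/-- In the defining formula the element is moved to x₂ and the parameters to x₃ and beyond, which
leaves x₀ and x₁ for the two sets of the Separation axiom. -/
theorem sep (P : M → Prop) [h : DP S fun p : Unit × M => P p.2] (A : M) :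
    ∃ B, ∀ z, S.E z B ↔ S.E z A ∧ P z := by
  obtain ⟨φ, e, h1, h2, h3⟩ := h.out
  have key : ∀ i, ∃ c, e i ≠ Prod.snd → ∀ p, e i p = c := by
    intro i
    rcases h2 i with ⟨a, ha⟩ | ⟨f, hf, hi⟩ | ⟨g, hg, hi⟩
    · exact ⟨a, fun _ p => by rw [ha]⟩
    · exact absurd hf (Set.notMem_empty _)
    · obtain rfl : g = id := hg
      exact ⟨S.zero, fun h => absurd hi h⟩
  choose c hc using key
  classical
  set φ' := φ.subst fun i => if e i = Prod.snd then v 2 else v (i + 3) with hφ'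
  have hfv : ∀ n ∈ φ'.fv, 2 ≤ n := by
    intro n hn
    rw [hφ', Fml.fv_subst, Finset.mem_biUnion] at hn
    obtain ⟨i, -, hi⟩ := hn
    split_ifs at hi <;> simp [Language.Term.varFinset] at hi <;> omega
  have := hS.valid (sepAx φ' 2 0 1) (.inl (.inr ⟨φ', 2, 0, 1,
    Fml.In.subst (fun i _ => by split_ifs <;> trivial) h1, by simp,
    fun h => by have := hfv 0 h; omega, fun h => by have := hfv 1 h; omega, rfl⟩))
    fun i => c (i - 3)
  simp only [sepAx, sat_all, sat_ex, sat_iff, sat_and, sat_mem] at this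
  obtain ⟨B, hB⟩ := this A
  refine ⟨B, fun z => ?_⟩
  have h4 := hB z
  simp only [val_var, Function.update_self, hφ', S.sat_subst] at h4
  rw [h3 ((), z)]
  simp at h4
  rw [h4]
  refine and_congr_right fun _ => S.sat_congr φ fun n _ => ?_
  split_ifs with hn
  · simp [hn]
  · rw [hc n hn, val_var, Function.update_of_ne (by omega), Function.update_of_ne (by omega),
      Function.update_of_ne (by omega)]
    rfl

theorem exists_union (a : M) : ∃ c, ∀ z, S.E z c ↔ ∃ y, S.E y a ∧ S.E z y := by
  have := hS.valid unionAx (.inl (.inl (.inl (by simp)))) fun _ => a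
  simp [unionAx] at this
  exact this a

theorem exists_power (a : M) : ∃ c, ∀ z, S.E z c ↔ ∀ y, S.E y z → S.E y a := by
  have := hS.valid powerAx (.inl (.inl (.inl (by simp)))) fun _ => a
  simp [powerAx] at this
  exact this a

theorem exists_inductive : ∃ c, S.E S.zero c ∧ ∀ z, S.E z c → S.E (S.suc z) c := by
  have := hS.valid infAx (.inl (.inl (.inl (by simp)))) fun _ => S.zero
  simpa [infAx] using this

end Str
end Multiverse

namespace Multiverse

variable {M : Type}

/-! ### Set theory in models of ZF -/

namespace Str
variable (S : Str M)

theorem isNat_zero : S.IsNat S.zero := fun _ h => h.1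
variable {S} in
theorem IsNat.suc {x : M} (h : S.IsNat x) : S.IsNat (S.suc x) := fun y hy => hy.2 _ (h y hy)
theorem isNat_numI (n : ℕ) : S.IsNat (S.numI n) := by
  induction n with
  | zero => exact S.isNat_zero
  | succ n ih => exact ih.suc

section basic
variable [hS : S.IsBasic]

theorem not_mem_mem {x y : M} (h : S.E x y) (h' : S.E y x) : False := by
  obtain ⟨c, hc⟩ := S.exists_pairSet x y
  obtain ⟨m, hm, hm'⟩ := S.foundation ((hc x).2 (.inl rfl))
  rcases (hc m).1 hm with rfl | rfl
  · exact hm' y h' ((hc y).2 (.inr rfl))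
  · exact hm' x h ((hc x).2 (.inl rfl))

theorem not_mem_self (x : M) : ¬ S.E x x := fun h => S.not_mem_mem h h

theorem suc_ne_zero (x : M) : S.suc x ≠ S.zero := fun h =>
  S.not_mem_zero x (h ▸ S.mem_suc.2 (.inr rfl))

/-- Otherwise x ∈ y and y ∈ x, against Foundation. -/
theorem suc_inj {x y : M} (h : S.suc x = S.suc y) : x = y := by
  have h1 : S.E x (S.suc y) := h ▸ S.mem_suc.2 (.inr rfl)
  have h2 : S.E y (S.suc x) := h ▸ S.mem_suc.2 (.inr rfl)
  rcases S.mem_suc.1 h1 with h1 | h1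
  · rcases S.mem_suc.1 h2 with h2 | h2
    · exact (S.not_mem_mem h1 h2).elim
    · exact h2.symm
  · exact h1

theorem numI_inj {m n : ℕ} (h : S.numI m = S.numI n) : m = n := by
  induction m generalizing n with
  | zero =>
    cases n with
    | zero => rfl
    | succ n => exact (S.suc_ne_zero _ h.symm).elim
  | succ m ih =>
    cases n with
    | zero => exact (S.suc_ne_zero _ h).elim
    | succ n => rw [ih (S.suc_inj h)]

theorem exists_pair (a b : M) : ∃ p, S.IsPair p a b := by
  obtain ⟨s, hs⟩ := S.exists_pairSet a a
  obtain ⟨t, ht⟩ := S.exists_pairSet a b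
  obtain ⟨p, hp⟩ := S.exists_pairSet s t
  refine ⟨p, fun z => (hp z).trans (or_congr ?_ ?_)⟩
  · constructor
    · rintro rfl w; simpa using hs w
    · exact fun h => S.ext fun w => by rw [h, hs, or_self]
  · constructor
    · rintro rfl w; exact ht w
    · exact fun h => S.ext fun w => by rw [h, ht]

/-- The ordered pair. -/
noncomputable def op (a b : M) : M := (S.exists_pair a b).choose

theorem isPair_iff {p a b : M} : S.IsPair p a b ↔ p = S.op a b := by
  have h := (S.exists_pair a b).choose_spec
  constructor
  · exact fun h' => S.ext fun z => by rw [h' z]; exact (h z).symm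
  · rintro rfl; exact h

theorem op_inj {a b c d : M} : S.op a b = S.op c d ↔ a = c ∧ b = d := by
  refine ⟨fun h => ?_, fun h => by rw [h.1, h.2]⟩
  have h1 : S.IsPair (S.op a b) a b := S.isPair_iff.2 rfl
  have h2 : S.IsPair (S.op a b) c d := S.isPair_iff.2 h
  obtain ⟨s, hs⟩ := S.exists_pairSet a a
  obtain ⟨t, ht⟩ := S.exists_pairSet a b
  obtain ⟨t', ht'⟩ := S.exists_pairSet c d
  simp only [or_self] at hs
  have hac : a = c := by
    rcases (h2 s).1 ((h1 s).2 (.inl hs)) with h | h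
    · exact (h a).1 ((hs a).2 rfl)
    · exact ((hs c).1 ((h c).2 (.inl rfl))).symm
  subst hac
  refine ⟨rfl, ?_⟩
  have h3 : b = a ∨ b = d := by
    rcases (h2 t).1 ((h1 t).2 (.inr ht)) with h | h
    · exact .inl ((h b).1 ((ht b).2 (.inr rfl)))
    · exact (h b).1 ((ht b).2 (.inr rfl))
  have h4 : d = a ∨ d = b := by
    rcases (h1 t').1 ((h2 t').2 (.inr ht')) with h | h
    · exact .inl ((h d).1 ((ht' d).2 (.inr rfl)))
    · exact (h d).1 ((ht' d).2 (.inr rfl))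
  rcases h3 with h3 | h3
  · rcases h4 with h4 | h4
    · rw [h3, h4]
    · exact h4.symm
  · exact h3

theorem pairMem_iff {a b r : M} : S.PairMem a b r ↔ S.E (S.op a b) r := by
  simp [PairMem, isPair_iff]

theorem tripleMem_iff {a b c r : M} : S.TripleMem a b c r ↔ S.E (S.op (S.op a b) c) r := by
  simp [TripleMem, isPair_iff, pairMem_iff]

theorem isTuple_exists {a : ℕ} (w : Fin a → M) : ∃ q, S.IsTuple a q w := by
  induction a with
  | zero => exact ⟨S.zero, rfl⟩
  | succ a ih =>
    obtain ⟨r, hr⟩ := ih fun j => w j.succ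
    exact ⟨S.op (w 0) r, r, hr, S.isPair_iff.2 rfl⟩

theorem isTuple_unique {a : ℕ} {w : Fin a → M} {q q' : M} (h : S.IsTuple a q w)
    (h' : S.IsTuple a q' w) : q = q' := by
  induction a generalizing q q' with
  | zero => exact h.trans h'.symm
  | succ a ih =>
    obtain ⟨r, hr, h⟩ := h
    obtain ⟨r', hr', h'⟩ := h'
    rw [S.isPair_iff.1 h, S.isPair_iff.1 h', ih hr hr']

theorem isTuple_inj {a : ℕ} {w w' : Fin a → M} {q : M} (h : S.IsTuple a q w)
    (h' : S.IsTuple a q w') : w = w' := by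
  induction a generalizing q with
  | zero => funext i; exact i.elim0
  | succ a ih =>
    obtain ⟨r, hr, h⟩ := h
    obtain ⟨r', hr', h'⟩ := h'
    have := S.op_inj.1 ((S.isPair_iff.1 h).symm.trans (S.isPair_iff.1 h'))
    obtain ⟨h0, rfl⟩ := this
    have := ih hr hr'
    funext i
    refine Fin.cases h0 (fun j => congrFun this j) i

/-- Variable assignments, in terms of ordered pairs. -/
theorem isVA_iff {f D : M} : S.IsVA f D ↔
    (∀ p, S.E p f → ∃ n d, S.IsNat n ∧ S.E d D ∧ p = S.op n d) ∧
    ∀ n, S.IsNat n → ∃ d, ∀ e, S.E (S.op n e) f ↔ e = d := by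
  simp only [IsVA, isPair_iff, pairMem_iff]

theorem VA_range {f D n d : M} (hf : S.IsVA f D) (h : S.PairMem n d f) : S.E d D := by
  obtain ⟨n', d', -, hd, hp⟩ := hf.1 _ (S.pairMem_iff.1 h)
  obtain ⟨-, rfl⟩ := S.op_inj.1 (S.isPair_iff.1 hp)
  exact hd

theorem op_range {a : ℕ} {r D q d : M} (hr : S.IsOp a r D) (h : S.PairMem q d r) : S.E d D := by
  obtain ⟨q', d', -, -, hd, -, hp⟩ := hr.1 _ (S.pairMem_iff.1 h)
  obtain ⟨-, rfl⟩ := S.op_inj.1 (S.isPair_iff.1 hp)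
  exact hd

end basic

variable [hS : S.IsZF]

theorem exists_omega : ∃ W, ∀ x, S.E x W ↔ S.IsNat x := by
  obtain ⟨c, hc⟩ := S.exists_inductive
  obtain ⟨W, hW⟩ := S.sep (fun x => S.IsNat x) c
  exact ⟨W, fun x => (hW x).trans ⟨And.right, fun h => ⟨h c hc, h⟩⟩⟩

/-- Separation cuts out of ω the set of numbers with the property; this set is inductive. The
argument also covers nonstandard numbers, which is why definability is required. -/
theorem nat_induction (P : M → Prop) [DP S fun p : Unit × M => P p.2] (h0 : P S.zero)
    (hs : ∀ n, S.IsNat n → P n → P (S.suc n)) {n : M} (hn : S.IsNat n) : P n := by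
  obtain ⟨W, hW⟩ := S.exists_omega
  obtain ⟨B, hB⟩ := S.sep P W
  refine ((hB n).1 (hn B ⟨(hB _).2 ⟨(hW _).2 S.isNat_zero, h0⟩, fun z hz => ?_⟩)).2
  obtain ⟨h1, h2⟩ := (hB z).1 hz
  have := (hW z).1 h1
  exact (hB _).2 ⟨(hW _).2 this.suc, hs z this h2⟩

theorem isNat_of_mem {n m : M} (hn : S.IsNat n) : S.E m n → S.IsNat m := by
  refine S.nat_induction (fun n => ∀ m, S.E m n → S.IsNat m) ?_ ?_ hn m
  · exact fun m hm => (S.not_mem_zero m hm).elim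
  · intro n hn ih m hm
    rcases S.mem_suc.1 hm with h | rfl
    exacts [ih m h, hn]

theorem nat_trans {n m k : M} (hn : S.IsNat n) (hm : S.E m n) (hk : S.E k m) : S.E k n := by
  revert hk hm
  refine S.nat_induction (fun n => ∀ m k, S.E m n → S.E k m → S.E k n) ?_ ?_ hn m k
  · exact fun m k hm => (S.not_mem_zero m hm).elim
  · intro n hn ih m k hm hk
    rcases S.mem_suc.1 hm with h | rfl
    · exact S.mem_suc.2 (.inl (ih m k h hk))
    · exact S.mem_suc.2 (.inl hk)

theorem nat_cases {n : M} (hn : S.IsNat n) : n = S.zero ∨ ∃ m, S.IsNat m ∧ n = S.suc m := by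
  refine S.nat_induction (fun n => n = S.zero ∨ ∃ m, S.IsNat m ∧ n = S.suc m) (.inl rfl) ?_ hn
  exact fun n hn _ => .inr ⟨n, hn, rfl⟩

variable {S} in
theorem IsNat.add {m n : M} (hm : S.IsNat m) (hn : S.IsNat n) : S.IsNat (S.add m n) := by
  refine S.nat_induction (fun n => S.IsNat (S.add m n)) ?_ ?_ hn
  · rwa [S.add_zeroI hm]
  · intro n hn ih
    rw [S.add_sucI hm hn]
    exact ih.suc

variable {S} in
theorem IsNat.mul {m n : M} (hm : S.IsNat m) (hn : S.IsNat n) : S.IsNat (S.mul m n) := by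
  refine S.nat_induction (fun n => S.IsNat (S.mul m n)) ?_ ?_ hn
  · rw [S.mul_zeroI hm]; exact S.isNat_zero
  · intro n hn ih
    rw [S.mul_sucI hm hn]
    exact ih.add hm

variable {S} in
theorem IsNat.prI {m n : M} (hm : S.IsNat m) (hn : S.IsNat n) : S.IsNat (S.prI m n) :=
  ((hm.add hn).mul (hm.add hn)).add hm

theorem zero_addI {n : M} (hn : S.IsNat n) : S.add S.zero n = n := by
  refine S.nat_induction (fun n => S.add S.zero n = n) (S.add_zeroI S.isNat_zero) ?_ hn
  intro n hn ih
  rw [S.add_sucI S.isNat_zero hn, ih]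

theorem suc_addI {m n : M} (hm : S.IsNat m) (hn : S.IsNat n) :
    S.add (S.suc m) n = S.suc (S.add m n) := by
  refine S.nat_induction (fun n => S.add (S.suc m) n = S.suc (S.add m n)) ?_ ?_ hn
  · rw [S.add_zeroI hm, S.add_zeroI hm.suc]
  · intro n hn ih
    rw [S.add_sucI hm hn, S.add_sucI hm.suc hn, ih]

theorem add_commI {m n : M} (hm : S.IsNat m) (hn : S.IsNat n) : S.add m n = S.add n m := by
  refine S.nat_induction (fun n => S.add m n = S.add n m) ?_ ?_ hn
  · rw [S.add_zeroI hm, S.zero_addI hm]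
  · intro n hn ih
    rw [S.add_sucI hm hn, S.suc_addI hn hm, ih]

theorem add_assocI {m n k : M} (hm : S.IsNat m) (hn : S.IsNat n) (hk : S.IsNat k) :
    S.add (S.add m n) k = S.add m (S.add n k) := by
  refine S.nat_induction (fun k => S.add (S.add m n) k = S.add m (S.add n k)) ?_ ?_ hk
  · rw [S.add_zeroI hn, S.add_zeroI (hm.add hn)]
  · intro k hk ih
    rw [S.add_sucI (hm.add hn) hk, S.add_sucI hn hk, S.add_sucI hm (hn.add hk), ih]

theorem mul_addI {m n k : M} (hm : S.IsNat m) (hn : S.IsNat n) (hk : S.IsNat k) :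
    S.mul m (S.add n k) = S.add (S.mul m n) (S.mul m k) := by
  refine S.nat_induction (fun k => S.mul m (S.add n k) = S.add (S.mul m n) (S.mul m k)) ?_ ?_ hk
  · rw [S.add_zeroI hn, S.mul_zeroI hm, S.add_zeroI (hm.mul hn)]
  · intro k hk ih
    rw [S.add_sucI hn hk, S.mul_sucI hm (hn.add hk), ih, S.mul_sucI hm hk,
      S.add_assocI (hm.mul hn) (hm.mul hk) hm]

theorem zero_mulI {n : M} (hn : S.IsNat n) : S.mul S.zero n = S.zero := by
  refine S.nat_induction (fun n => S.mul S.zero n = S.zero) (S.mul_zeroI S.isNat_zero) ?_ hn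
  intro n hn ih
  rw [S.mul_sucI S.isNat_zero hn, ih, S.add_zeroI S.isNat_zero]

theorem suc_mulI {m n : M} (hm : S.IsNat m) (hn : S.IsNat n) :
    S.mul (S.suc m) n = S.add (S.mul m n) n := by
  refine S.nat_induction (fun n => S.mul (S.suc m) n = S.add (S.mul m n) n) ?_ ?_ hn
  · rw [S.mul_zeroI hm, S.mul_zeroI hm.suc, S.add_zeroI S.isNat_zero]
  · intro n hn ih
    rw [S.mul_sucI hm hn, S.mul_sucI hm.suc hn, ih, S.add_sucI ((hm.mul hn).add hn) hm,
      S.add_sucI ((hm.mul hn).add hm) hn, S.add_assocI (hm.mul hn) hn hm,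
      S.add_assocI (hm.mul hn) hm hn, S.add_commI hm hn]

theorem mul_commI {m n : M} (hm : S.IsNat m) (hn : S.IsNat n) : S.mul m n = S.mul n m := by
  refine S.nat_induction (fun n => S.mul m n = S.mul n m) ?_ ?_ hn
  · rw [S.mul_zeroI hm, S.zero_mulI hm]
  · intro n hn ih
    rw [S.mul_sucI hm hn, S.suc_mulI hn hm, ih]

theorem mul_assocI {m n k : M} (hm : S.IsNat m) (hn : S.IsNat n) (hk : S.IsNat k) :
    S.mul (S.mul m n) k = S.mul m (S.mul n k) := by
  refine S.nat_induction (fun k => S.mul (S.mul m n) k = S.mul m (S.mul n k)) ?_ ?_ hk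
  · rw [S.mul_zeroI hn, S.mul_zeroI (hm.mul hn), S.mul_zeroI hm]
  · intro k hk ih
    rw [S.mul_sucI (hm.mul hn) hk, S.mul_sucI hn hk, S.mul_addI hm (hn.mul hk) hn, ih]

/-- The natural numbers of a model of ZF. -/
@[ext]
structure N where
  val : M
  isNat : S.IsNat val

instance : Add S.N := ⟨fun a b => ⟨S.add a.1 b.1, a.2.add b.2⟩⟩
instance : Zero S.N := ⟨⟨S.zero, S.isNat_zero⟩⟩

/-- With this structure `ring` checks the polynomial identities behind the injectivity of pairing
and the comparison of codes inside the model. -/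
instance : CommSemiring S.N where
  mul a b := ⟨S.mul a.1 b.1, a.2.mul b.2⟩
  one := ⟨S.suc S.zero, S.isNat_zero.suc⟩
  add_assoc a b c := N.ext (S.add_assocI a.2 b.2 c.2)
  add_comm a b := N.ext (S.add_commI a.2 b.2)
  zero_add a := N.ext (S.zero_addI a.2)
  add_zero a := N.ext (S.add_zeroI a.2)
  left_distrib a b c := N.ext (S.mul_addI a.2 b.2 c.2)
  right_distrib a b c := N.ext (by
    change S.mul (S.add a.1 b.1) c.1 = S.add (S.mul a.1 c.1) (S.mul b.1 c.1)
    rw [S.mul_commI (a.2.add b.2) c.2, S.mul_addI c.2 a.2 b.2, S.mul_commI c.2 a.2,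
      S.mul_commI c.2 b.2])
  zero_mul a := N.ext (S.zero_mulI a.2)
  mul_zero a := N.ext (S.mul_zeroI a.2)
  mul_assoc a b c := N.ext (S.mul_assocI a.2 b.2 c.2)
  one_mul a := N.ext (by
    change S.mul (S.suc S.zero) a.1 = a.1
    rw [S.suc_mulI S.isNat_zero a.2, S.zero_mulI a.2, S.zero_addI a.2])
  mul_one a := N.ext (by
    change S.mul a.1 (S.suc S.zero) = a.1
    rw [S.mul_sucI a.2 S.isNat_zero, S.mul_zeroI a.2, S.zero_addI a.2])
  mul_comm a b := N.ext (S.mul_commI a.2 b.2)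
  nsmul := nsmulRec

theorem N.add_one_val (a : S.N) : (a + 1).1 = S.suc a.1 := by
  change S.add a.1 (S.suc S.zero) = _
  rw [S.add_sucI a.2 S.isNat_zero, S.add_zeroI a.2]

theorem N.add_right_cancel {a b c : S.N} (h : a + c = b + c) : a = b := by
  have : S.add a.1 c.1 = S.add b.1 c.1 → a.1 = b.1 := by
    refine S.nat_induction (fun c => S.add a.1 c = S.add b.1 c → a.1 = b.1) ?_ ?_ c.2
    · rw [S.add_zeroI a.2, S.add_zeroI b.2]; exact id
    · intro n hn ih h
      rw [S.add_sucI a.2 hn, S.add_sucI b.2 hn] at h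
      exact ih (S.suc_inj h)
  exact N.ext (this (congrArg N.val h))

theorem N.add_one_ne_zero (a : S.N) : a + 1 ≠ 0 := fun h =>
  S.suc_ne_zero a.1 (by rw [← N.add_one_val, h]; rfl)

theorem N.cases (a : S.N) : a = 0 ∨ ∃ b, a = b + 1 := by
  rcases S.nat_cases a.2 with h | ⟨m, hm, h⟩
  · exact .inl (N.ext h)
  · exact .inr ⟨⟨m, hm⟩, N.ext (by rw [h, N.add_one_val])⟩

theorem N.total (a b : S.N) : (∃ c, b = a + c) ∨ ∃ c, a = b + c := by
  have : (∃ c, S.IsNat c ∧ b.1 = S.add a.1 c) ∨ ∃ c, S.IsNat c ∧ a.1 = S.add b.1 c := by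
    refine S.nat_induction (fun b => (∃ c, S.IsNat c ∧ b = S.add a.1 c) ∨
      ∃ c, S.IsNat c ∧ a.1 = S.add b c) ?_ ?_ b.2
    · exact .inr ⟨a.1, a.2, (S.zero_addI a.2).symm⟩
    · rintro n hn (⟨c, hc, h⟩ | ⟨c, hc, h⟩)
      · exact .inl ⟨S.suc c, hc.suc, by rw [h, S.add_sucI a.2 hc]⟩
      · rcases S.nat_cases hc with rfl | ⟨d, hd, rfl⟩
        · exact .inl ⟨S.suc S.zero, S.isNat_zero.suc, by
            rw [h, S.add_zeroI hn, S.add_sucI hn S.isNat_zero, S.add_zeroI hn]⟩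
        · exact .inr ⟨d, hd, by rw [h, S.add_sucI hn hd, S.suc_addI hn hd]⟩
  rcases this with ⟨c, hc, h⟩ | ⟨c, hc, h⟩
  · exact .inl ⟨⟨c, hc⟩, N.ext h⟩
  · exact .inr ⟨⟨c, hc⟩, N.ext h⟩

/-- The order of the internal numbers is membership. It is obtained from an explicit positive
difference, as semirings have no subtraction. -/
theorem N.mem_of_eq {a b c : S.N} (h : b = a + c + 1) : S.E a.1 b.1 := by
  have : ∀ c, S.IsNat c → S.E a.1 (S.suc (S.add a.1 c)) := by
    intro c hc
    refine S.nat_induction (fun c => S.E a.1 (S.suc (S.add a.1 c))) ?_ ?_ hc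
    · rw [S.add_zeroI a.2]; exact S.mem_suc.2 (.inr rfl)
    · intro n hn ih
      rw [S.add_sucI a.2 hn]
      exact S.mem_suc.2 (.inl ih)
  rw [h, N.add_one_val]
  exact this c.1 c.2

/-- The larger sum gives the larger code, because (a+b+e+1)² exceeds (a+b)² + a. After cancelling a
common summand the equation of the codes says that a successor is 0. -/
theorem N.pr_aux {a b c d e : S.N} (h : c + d = a + b + e + 1)
    (h' : (a + b) * (a + b) + a = (c + d) * (c + d) + c) : False := by
  rw [h] at h'
  have h2 : (((a + b) * e + b + (a + b) * e + (a + b) + e * e + e + e + c) + 1) +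
      (a + (a + b) * (a + b)) = 0 + (a + (a + b) * (a + b)) := by
    rw [zero_add]
    have h3 : a + (a + b) * (a + b) = (a + b + e + 1) * (a + b + e + 1) + c := by
      rw [← h']; ring
    conv_rhs => rw [h3]
    ring
  exact N.add_one_ne_zero S _ (N.add_right_cancel S h2)

theorem N.pr_inj {a b c d : S.N} (h : (a + b) * (a + b) + a = (c + d) * (c + d) + c) :
    a = c ∧ b = d := by
  have h1 : a + b = c + d := by
    rcases N.total S (a + b) (c + d) with ⟨e, he⟩ | ⟨e, he⟩ <;>
      rcases N.cases S e with rfl | ⟨e, rfl⟩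
    · rw [he, add_zero]
    · exact (N.pr_aux S (e := e) (by rw [he, ← add_assoc]) h).elim
    · rw [he, add_zero]
    · exact (N.pr_aux S (e := e) (by rw [he, ← add_assoc]) h.symm).elim
  have h2 : a = c := by
    rw [h1, add_comm _ a, add_comm _ c] at h
    exact N.add_right_cancel S h
  subst h2
  rw [add_comm a b, add_comm a d] at h1
  exact ⟨rfl, N.add_right_cancel S h1⟩

theorem prI_inj {a b c d : M} (ha : S.IsNat a) (hb : S.IsNat b) (hc : S.IsNat c) (hd : S.IsNat d)
    (h : S.prI a b = S.prI c d) : a = c ∧ b = d := by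
  have := N.pr_inj S (a := ⟨a, ha⟩) (b := ⟨b, hb⟩) (c := ⟨c, hc⟩) (d := ⟨d, hd⟩) (N.ext h)
  exact ⟨congrArg N.val this.1, congrArg N.val this.2⟩

/-- `b ≤ ⟨a, b⟩` -/
theorem mem_suc_prI_right {a b : M} (ha : S.IsNat a) (hb : S.IsNat b) :
    S.E b (S.suc (S.prI a b)) := by
  rcases S.nat_cases hb with rfl | ⟨b, hb', rfl⟩
  · have := N.mem_of_eq S (a := 0) (b := ⟨S.prI a S.zero, ha.prI hb⟩ + 1)
      (c := ⟨S.prI a S.zero, ha.prI hb⟩) (by rw [zero_add])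
    rwa [N.add_one_val] at this
  · let A : S.N := ⟨a, ha⟩
    let B : S.N := ⟨b, hb'⟩
    let B' : S.N := ⟨S.suc b, hb⟩
    have hB' : B' = B + 1 := N.ext (N.add_one_val S B).symm
    -- Writing B' = B + 1 makes the difference (A+B')² + A − B' a polynomial with nonnegative
    -- coefficients.
    have := N.mem_of_eq S (a := B') (b := (A + B') * (A + B') + A + 1)
      (c := A * A + B * B + (A + A) * B + A + A + A + B) (by rw [hB']; ring)
    rw [N.add_one_val] at this
    exact this

theorem mem_suc_prI_left {a b : M} (ha : S.IsNat a) (hb : S.IsNat b) :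
    S.E a (S.suc (S.prI a b)) := by
  let A : S.N := ⟨a, ha⟩
  let B : S.N := ⟨b, hb⟩
  have := N.mem_of_eq S (a := A) (b := (A + B) * (A + B) + A + 1)
    (c := (A + B) * (A + B)) (by ring)
  rw [N.add_one_val] at this
  exact this

/-- `b < ⟨a, b⟩` for `a > 0` -/
theorem mem_prI_right {a b : M} (ha : S.IsNat a) (hb : S.IsNat b) :
    S.E b (S.prI (S.suc a) b) := by
  let A : S.N := ⟨a, ha⟩
  let B : S.N := ⟨b, hb⟩
  have := N.mem_of_eq S (a := B) (b := (A + 1 + B) * (A + 1 + B) + (A + 1))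
    (c := A * A + A * B + A * B + B + B * B + A + A + A + 1) (by ring)
  have h2 : ((A + 1 + B) * (A + 1 + B) + (A + 1)).1 = S.prI (A + 1).1 B.1 := rfl
  rwa [h2, N.add_one_val] at this

theorem mem_of_mem_suc {a b c : M} (hc : S.IsNat c) (h : S.E a (S.suc b)) (h' : S.E b c) :
    S.E a c := by
  rcases S.mem_suc.1 h with h | rfl
  exacts [S.nat_trans hc h' h, h']

/-! ### Products, tuples and variable assignments as sets -/

theorem exists_union₂ (a b : M) : ∃ c, ∀ z, S.E z c ↔ S.E z a ∨ S.E z b := by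
  obtain ⟨p, hp⟩ := S.exists_pairSet a b
  obtain ⟨c, hc⟩ := S.exists_union p
  refine ⟨c, fun z => ?_⟩
  simp [hc, hp]

theorem exists_prod (A B : M) :
    ∃ C, ∀ z, S.E z C ↔ ∃ a b, S.E a A ∧ S.E b B ∧ z = S.op a b := by
  obtain ⟨u, hu⟩ := S.exists_union₂ A B
  obtain ⟨P, hP⟩ := S.exists_power u
  obtain ⟨Q, hQ⟩ := S.exists_power P
  obtain ⟨C, hC⟩ := S.sep (fun z => ∃ a b, S.E a A ∧ S.E b B ∧ S.IsPair z a b) Q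
  refine ⟨C, fun z => ?_⟩
  rw [hC]
  simp only [isPair_iff]
  refine ⟨And.right, fun h => ⟨?_, h⟩⟩
  obtain ⟨a, b, ha, hb, rfl⟩ := h
  rw [hQ]
  intro y hy
  rw [hP]
  intro x hx
  rw [hu]
  rcases ((S.isPair_iff (p := S.op a b)).2 rfl y).1 hy with h | h
  · rw [(h x).1 hx]; exact .inl ha
  · rcases (h x).1 hx with rfl | rfl
    exacts [.inl ha, .inr hb]

theorem exists_tuples (a : ℕ) (D : M) :
    ∃ C, ∀ q, S.E q C ↔ ∃ w : Fin a → M, (∀ i, S.E (w i) D) ∧ S.IsTuple a q w := by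
  induction a with
  | zero =>
    refine ⟨S.suc S.zero, fun q => ?_⟩
    rw [S.mem_suc]
    constructor
    · rintro (h | rfl)
      · exact (S.not_mem_zero _ h).elim
      · exact ⟨fun i => i.elim0, fun i => i.elim0, rfl⟩
    · rintro ⟨w, -, h⟩
      exact .inr h
  | succ a ih =>
    obtain ⟨C, hC⟩ := ih
    obtain ⟨B, hB⟩ := S.exists_prod D C
    refine ⟨B, fun q => ?_⟩
    rw [hB]
    constructor
    · rintro ⟨d, r, hd, hr, rfl⟩
      obtain ⟨w, hw, hr⟩ := (hC r).1 hr
      exact ⟨Fin.cons d w, fun i => Fin.cases hd hw i, r, by simpa using hr, by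
        simpa using S.isPair_iff.2 rfl⟩
    · rintro ⟨w, hw, r, hr, h⟩
      exact ⟨w 0, r, hw 0, (hC r).2 ⟨_, fun i => hw _, hr⟩, S.isPair_iff.1 h⟩

theorem exists_VA (D : M) : ∃ V, ∀ f, S.E f V ↔ S.IsVA f D := by
  obtain ⟨W, hW⟩ := S.exists_omega
  obtain ⟨P, hP⟩ := S.exists_prod W D
  obtain ⟨Q, hQ⟩ := S.exists_power P
  obtain ⟨V, hV⟩ := S.sep (fun f => S.IsVA f D) Q
  refine ⟨V, fun f => (hV f).trans ⟨And.right, fun h => ⟨(hQ f).2 fun p hp => ?_, h⟩⟩⟩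
  obtain ⟨n, d, hn, hd, hp⟩ := h.1 p hp
  exact (hP p).2 ⟨n, d, (hW n).2 hn, hd, S.isPair_iff.1 hp⟩

/-- A definable function from the natural numbers to `D` is a variable assignment. -/
theorem exists_VA_of (D : M) (R : M → M → Prop) [DP S fun p : (Unit × M) × M => R p.1.2 p.2]
    (hR : ∀ n, S.IsNat n → ∃ d, S.E d D ∧ ∀ e, R n e ↔ e = d) :
    ∃ f, S.IsVA f D ∧ ∀ n e, S.IsNat n → (S.PairMem n e f ↔ R n e) := by
  obtain ⟨W, hW⟩ := S.exists_omega
  obtain ⟨P, hP⟩ := S.exists_prod W D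
  -- R is arbitrary, so its definability in the contexts met below has to be derived from the given
  -- one by substitution.
  have inst : ∀ {X : Type} [Ctx M X] (a b : X → M) [DT S a] [DT S b],
      DP S fun x => R (a x) (b x) := by
    intro X _ a b _ _
    have hC : DP S fun p : ((Unit × M) × M) × M => (fun _ b c => R b c) p.1.1.2 p.1.2 p.2 := by
      obtain ⟨φ, e, h1, h2, h3⟩ := (inferInstance : DP S fun p : (Unit × M) × M => R p.1.2 p.2).out
      refine DP.congr (P := fun p => S.Sat (fun i => e i (((), p.1.2), p.2)) φ)
        (fun x => (h3 (((), x.1.2), x.2)).symm) (DP.ofSat h1 _ fun i => ?_)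
      rcases h2 i with ⟨m, hm⟩ | ⟨f, ⟨f, hf, rfl⟩ | ⟨g, rfl, rfl⟩, hi⟩ | ⟨g, rfl, hi⟩
      · simp only [hm]; infer_instance
      · exact absurd hf (Set.notMem_empty _)
      · simp only [hi]; exact DT.p12
      · simp only [hi]; exact DT.p2
    exact DP.comp₃ (C := fun _ b c => R b c) hC b a b
  obtain ⟨f, hf⟩ := S.sep (fun p => ∃ n d, S.IsPair p n d ∧ R n d) P
  have key : ∀ n e, S.IsNat n → (S.E (S.op n e) f ↔ R n e) := by
    intro n e hn
    rw [hf, hP]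
    simp only [isPair_iff, op_inj]
    constructor
    · rintro ⟨-, n', e', ⟨rfl, rfl⟩, h⟩
      exact h
    · intro h
      obtain ⟨d, hd, h'⟩ := hR n hn
      obtain rfl := (h' e).1 h
      exact ⟨⟨n, e, (hW n).2 hn, hd, rfl, rfl⟩, n, e, ⟨rfl, rfl⟩, h⟩
  refine ⟨f, S.isVA_iff.2 ⟨fun p hp => ?_, fun n hn => ?_⟩, fun n e hn => by
    rw [pairMem_iff, key n e hn]⟩
  · obtain ⟨n, d, hn, hd, rfl⟩ := (hP p).1 ((hf p).1 hp).1
    exact ⟨n, d, (hW n).1 hn, hd, rfl⟩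
  · obtain ⟨d, -, h⟩ := hR n hn
    exact ⟨d, fun e => (key n e hn).trans (h e)⟩

theorem exists_VA_const {D d : M} (hd : S.E d D) : ∃ f, S.IsVA f D := by
  obtain ⟨f, hf, -⟩ := S.exists_VA_of D (fun _ e => e = d) fun n _ => ⟨d, hd, fun e => Iff.rfl⟩
  exact ⟨f, hf⟩

theorem exists_VA_update {D f x d : M} (hf : S.IsVA f D) (hx : S.IsNat x) (hd : S.E d D) :
    ∃ g, S.IsVA g D ∧ S.AgreeOff g f x ∧ S.PairMem x d g := by
  obtain ⟨g, hg, h⟩ := S.exists_VA_of D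
    (fun n e => (n = x ∧ e = d) ∨ (¬ n = x ∧ S.PairMem n e f)) fun n hn => by
      by_cases hnx : n = x
      · exact ⟨d, hd, fun e => by simp [hnx]⟩
      · obtain ⟨e, he⟩ := hf.2 n hn
        obtain ⟨n', e', -, he', hp⟩ := hf.1 _ (S.pairMem_iff.1 ((he e).2 rfl))
        obtain ⟨rfl, rfl⟩ := S.op_inj.1 (S.isPair_iff.1 hp)
        exact ⟨e, he', fun e' => by simp [hnx, he]⟩
  refine ⟨g, hg, fun n hn e => ?_, (h x d hx).2 (.inl ⟨rfl, rfl⟩)⟩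
  rw [h n e hn.1]
  simp [hn.2]

/-! ### Recursion on the natural numbers -/

/-- Course-of-values recursion for relations. -/
theorem exists_rec (Y : M) (C : M → M → M → Prop)
    (hC : DP S fun p : ((Unit × M) × M) × M => C p.1.1.2 p.1.2 p.2)
    (hloc : ∀ n, S.IsNat n → ∀ R R',
      (∀ k, S.E k n → ∀ y, S.E y Y → (S.PairMem k y R ↔ S.PairMem k y R')) →
      ∀ y, S.E y Y → (C n R y ↔ C n R' y)) :
    ∃ R, (∀ p, S.E p R → ∃ n y, S.IsNat n ∧ S.E y Y ∧ p = S.op n y) ∧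
      ∀ n y, S.IsNat n → S.E y Y → (S.PairMem n y R ↔ C n R y) := by
  have inst : ∀ {X : Type} [Ctx M X] (a b c : X → M) [DT S a] [DT S b] [DT S c],
      DP S fun x => C (a x) (b x) (c x) := fun a b c _ _ _ => DP.comp₃ hC a b c
  obtain ⟨W, hW⟩ := S.exists_omega
  obtain ⟨P, hP⟩ := S.exists_prod W Y
  -- `A n R` says that R obeys the recursion below n. Such approximations agree below n, they exist
  -- for every n by induction, and they are glued together at the end.
  let A : M → M → Prop := fun n R => ∀ m, S.E m n → ∀ y, S.E y Y → (S.PairMem m y R ↔ C m R y)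
  have uniq : ∀ n R R', S.IsNat n → A n R → A n R' → ∀ m, S.E m n → ∀ y, S.E y Y →
      (S.PairMem m y R ↔ S.PairMem m y R') := by
    intro n R R' hn hR hR'
    have : ∀ m, S.IsNat m → ∀ k, S.E k m → S.E k n → ∀ y, S.E y Y →
        (S.PairMem k y R ↔ S.PairMem k y R') := by
      intro m hm
      refine S.nat_induction (fun m => ∀ k, S.E k m → S.E k n → ∀ y, S.E y Y →
        (S.PairMem k y R ↔ S.PairMem k y R')) ?_ ?_ hm
      · exact fun k hk => (S.not_mem_zero k hk).elim
      · intro m hm ih k hk hkn y hy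
        rcases S.mem_suc.1 hk with hk | rfl
        · exact ih k hk hkn y hy
        · rw [hR k hkn y hy, hR' k hkn y hy]
          exact hloc k hm R R' (fun j hj y hy => ih j hj (S.nat_trans hn hkn hj) y hy) y hy
    exact fun m hm => this n hn m hm hm
  have ex : ∀ n, S.IsNat n → ∃ R, A n R := by
    intro n hn
    refine S.nat_induction (fun n => ∃ R, ∀ m, S.E m n → ∀ y, S.E y Y →
      (S.PairMem m y R ↔ C m R y)) ?_ ?_ hn
    · exact ⟨S.zero, fun m hm => (S.not_mem_zero m hm).elim⟩
    · rintro n hn ⟨R, hR⟩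
      obtain ⟨R', hR'⟩ := S.sep (fun z => ∃ m y, S.IsPair z m y ∧
        ((S.E m n ∧ S.PairMem m y R) ∨ (m = n ∧ C n R y))) P
      have key : ∀ m y, S.IsNat m → S.E y Y → (S.PairMem m y R' ↔
          (S.E m n ∧ S.PairMem m y R) ∨ (m = n ∧ C n R y)) := by
        intro m y hm hy
        rw [pairMem_iff, hR', hP]
        simp only [isPair_iff, op_inj]
        constructor
        · rintro ⟨-, m', y', ⟨rfl, rfl⟩, h⟩
          exact h
        · exact fun h => ⟨⟨m, y, (hW m).2 hm, hy, rfl, rfl⟩, m, y, ⟨rfl, rfl⟩, h⟩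
      have agree : ∀ m y, S.E m n → S.E y Y → (S.PairMem m y R' ↔ S.PairMem m y R) := by
        intro m y hm hy
        rw [key m y (S.isNat_of_mem hn hm) hy]
        constructor
        · rintro (h | ⟨rfl, -⟩)
          exacts [h.2, (S.not_mem_self _ hm).elim]
        · exact fun h => .inl ⟨hm, h⟩
      refine ⟨R', fun m hm y hy => ?_⟩
      rcases S.mem_suc.1 hm with hm | rfl
      · rw [agree m y hm hy, hR m hm y hy]
        exact hloc m (S.isNat_of_mem hn hm) R R' (fun k hk y hy =>
          (agree k y (S.nat_trans hn hm hk) hy).symm) y hy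
      · rw [key m y hn hy]
        rw [← hloc m hn R R' (fun k hk y hy => (agree k y hk hy).symm) y hy]
        constructor
        · rintro (h | h)
          exacts [(S.not_mem_self _ h.1).elim, h.2]
        · exact fun h => .inr ⟨rfl, h⟩
  -- Row m of the final relation is taken from any approximation that is correct up to and including
  -- m.
  obtain ⟨R, hR⟩ := S.sep (fun z => ∃ m y, S.IsPair z m y ∧ ∃ R', (∀ k, S.E k (S.suc m) → ∀ y,
    S.E y Y → (S.PairMem k y R' ↔ C k R' y)) ∧ S.PairMem m y R') P
  have key : ∀ m y, S.IsNat m → S.E y Y → ∀ R', A (S.suc m) R' →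
      (S.PairMem m y R ↔ S.PairMem m y R') := by
    intro m y hm hy R' hR'
    rw [pairMem_iff, hR, hP]
    simp only [isPair_iff, op_inj]
    constructor
    · rintro ⟨-, m', y', ⟨rfl, rfl⟩, R'', hR'', h⟩
      exact (uniq _ R' R'' hm.suc hR' hR'' m (S.mem_suc.2 (.inr rfl)) y hy).2 h
    · exact fun h => ⟨⟨m, y, (hW m).2 hm, hy, rfl, rfl⟩, m, y, ⟨rfl, rfl⟩, R', hR', h⟩
  refine ⟨R, fun p hp => ?_, fun n y hn hy => ?_⟩
  · obtain ⟨n, y, hn, hy, rfl⟩ := (hP p).1 ((hR p).1 hp).1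
    exact ⟨n, y, (hW n).1 hn, hy, rfl⟩
  · obtain ⟨R', hR'⟩ := ex _ hn.suc
    rw [key n y hn hy R' hR', hR' n (S.mem_suc.2 (.inr rfl)) y hy]
    refine hloc n hn R' R (fun k hk y hy => (key k y (S.isNat_of_mem hn hk) hy R' ?_).symm) y hy
    intro j hj
    refine hR' j ?_
    rcases S.mem_suc.1 hj with hj | rfl
    · exact S.mem_suc.2 (.inl (S.nat_trans hn hk hj))
    · exact S.mem_suc.2 (.inl hk)

end Str
end Multiverse

namespace Multiverse

variable {M : Type}

/-! ### Terms and formulas inside a structure -/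

namespace Str
variable (S : Str M) {K : Lang}

section closure
variable {S}

theorem IsTerm.var {n : M} (hn : S.IsNat n) : S.IsTerm K (S.varI n) := fun _ hX => hX.1 n hn
theorem IsTerm.app {s : ℕ × ℕ} (hs : s ∈ K.funs) {w : Fin s.1 → M} (hw : ∀ i, S.IsTerm K (w i)) :
    S.IsTerm K (S.appI s.1 s.2 (List.ofFn w)) := fun X hX => hX.2 s hs w fun i => hw i X hX
theorem IsForm.eq {t u : M} (ht : S.IsTerm K t) (hu : S.IsTerm K u) : S.IsForm K (S.eqI t u) :=
  fun _ hX => hX.1 t u ⟨ht, hu⟩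
theorem IsForm.rel {s : ℕ × ℕ} (hs : s ∈ K.rels) {w : Fin s.1 → M} (hw : ∀ i, S.IsTerm K (w i)) :
    S.IsForm K (S.relI' s.1 s.2 (List.ofFn w)) := fun _ hX => hX.2.1 s hs w hw
theorem IsForm.neg {φ : M} (h : S.IsForm K φ) : S.IsForm K (S.negI φ) :=
  fun X hX => hX.2.2.1 φ (h X hX)
theorem IsForm.and {φ ψ : M} (h : S.IsForm K φ) (h' : S.IsForm K ψ) : S.IsForm K (S.andI φ ψ) :=
  fun X hX => hX.2.2.2.1 φ ψ ⟨h X hX, h' X hX⟩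
theorem IsForm.all {x φ : M} (hx : S.IsNat x) (h : S.IsForm K φ) : S.IsForm K (S.allI x φ) :=
  fun X hX => hX.2.2.2.2 x φ ⟨hx, h X hX⟩

theorem IsTerm.mono {K' : Lang} (h : K.Sub K') {t : M} (ht : S.IsTerm K t) : S.IsTerm K' t :=
  fun X hX => ht X ⟨hX.1, fun s hs => hX.2 s (h.1 s hs)⟩
theorem IsForm.mono {K' : Lang} (h : K.Sub K') {φ : M} (hφ : S.IsForm K φ) : S.IsForm K' φ :=
  fun X hX => hφ X ⟨fun t u ht => hX.1 t u ⟨ht.1.mono h, ht.2.mono h⟩,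
    fun s hs w hw => hX.2.1 s (h.2 s hs) w fun i => (hw i).mono h, hX.2.2⟩

end closure

/-! ### Unique readability of codes and induction on terms and formulas -/

variable [hS : S.IsZF]

theorem listI_nat {n : ℕ} {w : Fin n → M} (hw : ∀ i, S.IsNat (w i)) :
    S.IsNat (S.listI (List.ofFn w)) := by
  induction n with
  | zero => simpa [listI] using S.isNat_zero
  | succ n ih =>
    rw [List.ofFn_succ]
    exact ((hw 0).prI (ih fun i => hw i.succ)).suc

theorem mem_listI {n : ℕ} {w : Fin n → M} (hw : ∀ i, S.IsNat (w i)) (j : Fin n) :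
    S.E (w j) (S.listI (List.ofFn w)) := by
  induction n with
  | zero => exact j.elim0
  | succ n ih =>
    have h1 := S.listI_nat fun i : Fin n => hw i.succ
    rw [List.ofFn_succ]
    refine Fin.cases (S.mem_suc_prI_left (hw 0) h1) (fun j => ?_) j
    exact S.nat_trans ((hw 0).prI h1).suc (S.mem_suc_prI_right (hw 0) h1) (ih (fun i => hw i.succ) j)

theorem listI_inj {n : ℕ} {w w' : Fin n → M} (hw : ∀ i, S.IsNat (w i)) (hw' : ∀ i, S.IsNat (w' i))
    (h : S.listI (List.ofFn w) = S.listI (List.ofFn w')) : w = w' := by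
  induction n with
  | zero => funext i; exact i.elim0
  | succ n ih =>
    rw [List.ofFn_succ, List.ofFn_succ] at h
    obtain ⟨h1, h2⟩ := S.prI_inj (hw 0) (S.listI_nat fun i : Fin n => hw i.succ) (hw' 0)
      (S.listI_nat fun i : Fin n => hw' i.succ) (S.suc_inj h)
    have := ih (fun i => hw i.succ) (fun i => hw' i.succ) h2
    funext i
    exact Fin.cases h1 (fun j => congrFun this j) i

theorem tag_inj {i j : ℕ} {x y : M} (hx : S.IsNat x) (hy : S.IsNat y)
    (h : S.prI (S.numI i) x = S.prI (S.numI j) y) : i = j ∧ x = y := by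
  obtain ⟨h1, h2⟩ := S.prI_inj (S.isNat_numI i) hx (S.isNat_numI j) hy h
  exact ⟨S.numI_inj h1, h2⟩

theorem app_nat {a f n : ℕ} {w : Fin n → M} (hw : ∀ i, S.IsNat (w i)) :
    S.IsNat (S.prI (S.prI (S.numI a) (S.numI f)) (S.listI (List.ofFn w))) :=
  ((S.isNat_numI a).prI (S.isNat_numI f)).prI (S.listI_nat hw)

theorem app_inj {s s' : ℕ × ℕ} {w : Fin s.1 → M} {w' : Fin s'.1 → M}
    (hw : ∀ i, S.IsNat (w i)) (hw' : ∀ i, S.IsNat (w' i))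
    (h : S.appI s.1 s.2 (List.ofFn w) = S.appI s'.1 s'.2 (List.ofFn w')) :
    ∃ h : s = s', h ▸ w = w' := by
  obtain ⟨-, h⟩ := S.tag_inj (S.app_nat hw) (S.app_nat hw') h
  obtain ⟨h1, h2⟩ := S.prI_inj ((S.isNat_numI _).prI (S.isNat_numI _)) (S.listI_nat hw)
    ((S.isNat_numI _).prI (S.isNat_numI _)) (S.listI_nat hw') h
  obtain ⟨h3, h4⟩ := S.prI_inj (S.isNat_numI _) (S.isNat_numI _) (S.isNat_numI _) (S.isNat_numI _) h1
  obtain rfl : s = s' := Prod.ext (S.numI_inj h3) (S.numI_inj h4)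
  exact ⟨rfl, S.listI_inj hw hw' h2⟩

/-- Immediate subterms have smaller codes; this makes evaluation a course-of-values recursion on the
natural numbers. -/
theorem mem_app {a f n : ℕ} {w : Fin n → M} (hw : ∀ i, S.IsNat (w i)) (j : Fin n) :
    S.E (w j) (S.appI a f (List.ofFn w)) := by
  have h1 := S.listI_nat hw
  have h2 := (S.isNat_numI a).prI (S.isNat_numI f)
  have h3 := h2.prI h1
  have h4 : S.IsNat (S.appI a f (List.ofFn w)) := (S.isNat_numI 1).prI h3
  refine S.nat_trans h4 ?_ (S.mem_listI hw j)
  exact S.mem_of_mem_suc h4 (S.mem_suc_prI_right h2 h1) (S.mem_prI_right S.isNat_zero h3)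

variable {S} in
theorem IsTerm.nat {t : M} (ht : S.IsTerm K t) : S.IsNat t := by
  obtain ⟨W, hW⟩ := S.exists_omega
  refine (hW t).1 (ht W ⟨fun n hn => (hW _).2 ((S.isNat_numI 0).prI hn), fun s _ w hw => (hW _).2 ?_⟩)
  exact (S.isNat_numI 1).prI (S.app_nat fun i => (hW _).1 (hw i))

variable {S} in
theorem IsForm.nat {φ : M} (h : S.IsForm K φ) : S.IsNat φ := by
  obtain ⟨W, hW⟩ := S.exists_omega
  refine (hW φ).1 (h W ⟨fun t u ht => (hW _).2 ?_, fun s _ w hw => (hW _).2 ?_, fun φ h => (hW _).2 ?_,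
    fun φ ψ h => (hW _).2 ?_, fun x φ h => (hW _).2 ?_⟩)
  · exact (S.isNat_numI 0).prI (ht.1.nat.prI ht.2.nat)
  · exact (S.isNat_numI 1).prI (S.app_nat fun i => (hw i).nat)
  · exact (S.isNat_numI 2).prI ((hW _).1 h)
  · exact (S.isNat_numI 3).prI (((hW _).1 h.1).prI ((hW _).1 h.2))
  · exact (S.isNat_numI 4).prI (h.1.prI ((hW _).1 h.2))

/-- The terms with the property form a set, since codes are natural numbers, and this set is closed
under term formation; a term lies in every closed set. -/
theorem term_induction (P : M → Prop) [DP S fun p : Unit × M => P p.2]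
    (hv : ∀ n, S.IsNat n → P (S.varI n))
    (ha : ∀ s ∈ K.funs, ∀ w : Fin s.1 → M, (∀ i, S.IsTerm K (w i)) → (∀ i, P (w i)) →
      P (S.appI s.1 s.2 (List.ofFn w))) {t : M} (ht : S.IsTerm K t) : P t := by
  obtain ⟨W, hW⟩ := S.exists_omega
  obtain ⟨B, hB⟩ := S.sep (fun t => S.IsTerm K t ∧ P t) W
  refine ((hB t).1 (ht B ⟨fun n hn => ?_, fun s hs w hw => ?_⟩)).2.2
  · exact (hB _).2 ⟨(hW _).2 (IsTerm.var (K := K) hn).nat, .var hn, hv n hn⟩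
  · have h1 := IsTerm.app hs fun i => ((hB _).1 (hw i)).2.1
    exact (hB _).2 ⟨(hW _).2 h1.nat, h1, ha s hs w (fun i => ((hB _).1 (hw i)).2.1)
      fun i => ((hB _).1 (hw i)).2.2⟩

theorem form_induction (P : M → Prop) [DP S fun p : Unit × M => P p.2]
    (he : ∀ t u, S.IsTerm K t → S.IsTerm K u → P (S.eqI t u))
    (hr : ∀ s ∈ K.rels, ∀ w : Fin s.1 → M, (∀ i, S.IsTerm K (w i)) →
      P (S.relI' s.1 s.2 (List.ofFn w)))
    (hn : ∀ φ, S.IsForm K φ → P φ → P (S.negI φ))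
    (ha : ∀ φ ψ, S.IsForm K φ → S.IsForm K ψ → P φ → P ψ → P (S.andI φ ψ))
    (hq : ∀ x φ, S.IsNat x → S.IsForm K φ → P φ → P (S.allI x φ)) {φ : M} (h : S.IsForm K φ) :
    P φ := by
  obtain ⟨W, hW⟩ := S.exists_omega
  obtain ⟨B, hB⟩ := S.sep (fun t => S.IsForm K t ∧ P t) W
  have key : ∀ φ, S.IsForm K φ → P φ → S.E φ B := fun φ h h' => (hB _).2 ⟨(hW _).2 h.nat, h, h'⟩
  have key' : ∀ φ, S.E φ B → S.IsForm K φ ∧ P φ := fun φ h => ((hB _).1 h).2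
  refine (key' φ (h B ⟨fun t u ht => ?_, fun s hs w hw => ?_, fun φ h => ?_, fun φ ψ h => ?_,
    fun x φ h => ?_⟩)).2
  · exact key _ (.eq ht.1 ht.2) (he t u ht.1 ht.2)
  · exact key _ (.rel hs hw) (hr s hs w hw)
  · exact key _ (key' _ h).1.neg (hn _ (key' _ h).1 (key' _ h).2)
  · exact key _ ((key' _ h.1).1.and (key' _ h.2).1)
      (ha _ _ (key' _ h.1).1 (key' _ h.2).1 (key' _ h.1).2 (key' _ h.2).2)
  · exact key _ (.all h.1 (key' _ h.2).1) (hq _ _ h.1 (key' _ h.2).1 (key' _ h.2).2)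

/-! ### Evaluation of terms and satisfaction -/

/-- One step of the evaluation of terms. -/
def EvalStep (K : Lang) (D I : M) (R : M → M → Prop) (n f d : M) : Prop :=
  (∃ m, S.IsNat m ∧ n = S.varI m ∧ S.PairMem m d f) ∨
  ∃ s ∈ K.funs, ∃ w : Fin s.1 → M, (∀ i, S.IsTerm K (w i)) ∧ n = S.appI s.1 s.2 (List.ofFn w) ∧
    ∃ z : Fin s.1 → M, (∀ j, S.E (z j) D ∧ R (w j) (z j)) ∧ ∃ q r, S.IsTuple s.1 q z ∧
      S.PairMem (S.numI (funSymCode s)) r I ∧ S.PairMem q d r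

/-- The recursion runs on the code of the term and treats all pairs of an assignment and a value at
once. Unique readability then leaves only the clause belonging to the given term. -/
theorem exists_eval {D I : M} (hU : S.IsStructOn K D I) : ∃ ev, S.EvalClauses K D I ev := by
  obtain ⟨V, hV⟩ := S.exists_VA D
  obtain ⟨Y, hY⟩ := S.exists_prod V D
  obtain ⟨W, hW⟩ := S.exists_omega
  have hY' : ∀ {f d}, S.E (S.op f d) Y ↔ S.IsVA f D ∧ S.E d D := by
    intro f d
    rw [hY]
    constructor
    · rintro ⟨a, b, ha, hb, h⟩
      obtain ⟨rfl, rfl⟩ := S.op_inj.1 h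
      exact ⟨(hV _).1 ha, hb⟩
    · exact fun h => ⟨f, d, (hV _).2 h.1, h.2, rfl⟩
  obtain ⟨R, -, hR2⟩ := S.exists_rec Y (fun n R y => ∃ f d, S.IsPair y f d ∧
      ((∃ m, S.IsNat m ∧ n = S.varI m ∧ S.PairMem m d f) ∨
      ∃ s ∈ K.funs, ∃ w : Fin s.1 → M, (∀ i, S.IsTerm K (w i)) ∧
        n = S.appI s.1 s.2 (List.ofFn w) ∧
        ∃ z : Fin s.1 → M, (∀ j, S.E (z j) D ∧ ∃ y', S.IsPair y' f (z j) ∧ S.PairMem (w j) y' R) ∧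
          ∃ q r, S.IsTuple s.1 q z ∧ S.PairMem (S.numI (funSymCode s)) r I ∧ S.PairMem q d r))
    inferInstance (by
      intro n hn R R' hRR' y hy
      refine exists_congr fun f => exists_congr fun d => and_congr_right fun hp => or_congr_right ?_
      refine exists_congr fun s => and_congr_right fun _ => exists_congr fun w =>
        and_congr_right fun hw => and_congr_right fun hnw => exists_congr fun z =>
        and_congr_left fun _ => forall_congr' fun j => and_congr_right fun hz =>
        exists_congr fun y' => and_congr_right fun hy' => hRR' _ ?_ _ ?_
      · rw [hnw]; exact S.mem_app (fun i => (hw i).nat) j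
      · rw [S.isPair_iff.1 hp] at hy
        rw [S.isPair_iff.1 hy']
        exact hY'.2 ⟨(hY'.1 hy).1, hz⟩)
  obtain ⟨WV, hWV⟩ := S.exists_prod W V
  obtain ⟨WVD, hWVD⟩ := S.exists_prod WV D
  -- The recursion relates n to ⟨f, d⟩; the evaluation set regroups this as ⟨⟨n, f⟩, d⟩.
  obtain ⟨ev, hev⟩ := S.sep (fun p => ∃ n f d q y, S.IsPair q n f ∧ S.IsPair p q d ∧ S.IsPair y f d ∧
    S.PairMem n y R) WVD
  have hT : ∀ {n f d}, S.IsNat n → S.IsVA f D → (S.TripleMem n f d ev ↔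
      S.E d D ∧ S.PairMem n (S.op f d) R) := by
    intro n f d hn hf
    rw [tripleMem_iff, hev, hWVD]
    simp only [isPair_iff]
    constructor
    · rintro ⟨⟨a, b, -, hb, h⟩, n', f', d', q, y, hq, hp, hy, hR⟩
      subst hq hy
      obtain ⟨e1, e2⟩ := S.op_inj.1 hp
      obtain ⟨e3, e4⟩ := S.op_inj.1 e1
      obtain ⟨-, e5⟩ := S.op_inj.1 h
      rw [e2, e3, e4]
      exact ⟨e2 ▸ e5 ▸ hb, hR⟩
    · rintro ⟨hd, h⟩
      exact ⟨⟨_, d, (hWV _).2 ⟨n, f, (hW _).2 hn, (hV _).2 hf, rfl⟩, hd, rfl⟩, n, f, d, _, _, rfl,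
        rfl, rfl, h⟩
  have key : ∀ n f d, S.IsNat n → S.IsVA f D → (S.TripleMem n f d ev ↔
      S.E d D ∧ S.EvalStep K D I (fun w z => S.PairMem w (S.op f z) R) n f d) := by
    intro n f d hn hf
    rw [hT hn hf]
    refine and_congr_right fun hd => ?_
    rw [hR2 n _ hn (hY'.2 ⟨hf, hd⟩)]
    simp only [isPair_iff, EvalStep]
    constructor
    · rintro ⟨f', d', h, h'⟩
      obtain ⟨rfl, rfl⟩ := S.op_inj.1 h
      simpa using h'
    · exact fun h => ⟨f, d, rfl, by simpa using h⟩
  refine ⟨ev, fun f hf => ⟨fun n d hn => ?_, fun s hs w hw d => ?_⟩⟩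
  · rw [key _ f d (IsTerm.var (K := K) hn).nat hf]
    constructor
    · rintro ⟨hd, ⟨m, hm, h, h'⟩ | ⟨s, -, w, hw, h, -⟩⟩
      · rwa [(S.tag_inj hn hm h).2]
      · exact absurd (S.tag_inj hn (S.app_nat fun i => (hw i).nat) h).1 (by decide)
    · exact fun h => ⟨S.VA_range hf h, .inl ⟨n, hn, rfl, h⟩⟩
  · rw [key _ f d (IsTerm.app hs hw).nat hf]
    simp only [fun j => hT (hw j).nat hf]
    constructor
    · rintro ⟨hd, ⟨m, hm, h, h'⟩ | ⟨s', -, w', hw', h, h'⟩⟩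
      · exact absurd (S.tag_inj (S.app_nat fun i => (hw i).nat) hm h).1 (by decide)
      · obtain ⟨rfl, rfl⟩ := S.app_inj (fun i => (hw i).nat) (fun i => (hw' i).nat) h
        exact h'
    · intro h
      refine ⟨?_, .inr ⟨s, hs, w, hw, rfl, h⟩⟩
      obtain ⟨z, -, q, r, -, hr, h⟩ := h
      -- The recursion yields only values in D, and the clause does not mention D. The gap closes
      -- because the symbol is interpreted by an operation on D.
      obtain ⟨r', hr', hop⟩ := hU.2.2.1 s hs
      rw [hr'] at hr
      subst hr
      exact S.op_range hop h

-- The recursion runs on the code of the formula with all assignments in the second coordinate,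
-- because the quantifier clause consults the subformula under other assignments. Proper subformulas
-- have smaller codes, and unique readability selects the relevant clause.
set_option synthInstance.maxHeartbeats 400000 in
set_option synthInstance.maxSize 4000 in
theorem exists_satisfaction (D I ev : M) : ∃ sa, S.SatClauses K D I ev sa := by
  obtain ⟨V, hV⟩ := S.exists_VA D
  obtain ⟨R, -, hR⟩ := S.exists_rec V (fun n R f =>
      (∃ t u, S.IsTerm K t ∧ S.IsTerm K u ∧ n = S.eqI t u ∧
        ∃ d, S.TripleMem t f d ev ∧ S.TripleMem u f d ev) ∨
      (∃ s ∈ K.rels, ∃ w : Fin s.1 → M, (∀ i, S.IsTerm K (w i)) ∧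
        n = S.relI' s.1 s.2 (List.ofFn w) ∧
        ∃ z : Fin s.1 → M, (∀ j, S.TripleMem (w j) f (z j) ev) ∧ ∃ q y, S.IsTuple s.1 q z ∧
        S.PairMem (S.numI (relSymCode s)) y I ∧ S.E q y) ∨
      (∃ φ, S.IsForm K φ ∧ n = S.negI φ ∧ ¬ S.PairMem φ f R) ∨
      (∃ φ ψ, S.IsForm K φ ∧ S.IsForm K ψ ∧ n = S.andI φ ψ ∧ S.PairMem φ f R ∧ S.PairMem ψ f R) ∨
      ∃ φ x, S.IsForm K φ ∧ S.IsNat x ∧ n = S.allI x φ ∧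
        ∀ g, S.IsVA g D ∧ S.AgreeOff g f x → S.PairMem φ g R) inferInstance (by
    intro n hn R R' hRR' f hf
    refine or_congr_right (or_congr_right (or_congr ?_ (or_congr ?_ ?_)))
    · refine exists_congr fun φ => and_congr_right fun hφ => and_congr_right fun h => not_congr ?_
      refine hRR' φ ?_ f hf
      rw [h]
      exact S.mem_prI_right (S.isNat_numI 1) hφ.nat
    · refine exists_congr fun φ => exists_congr fun ψ => and_congr_right fun hφ =>
        and_congr_right fun hψ => and_congr_right fun h => and_congr (hRR' φ ?_ f hf) (hRR' ψ ?_ f hf)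
      all_goals
        rw [h]
        refine S.mem_of_mem_suc ((S.isNat_numI 3).prI (hφ.nat.prI hψ.nat)) ?_
          (S.mem_prI_right (S.isNat_numI 2) (hφ.nat.prI hψ.nat))
      · exact S.mem_suc_prI_left hφ.nat hψ.nat
      · exact S.mem_suc_prI_right hφ.nat hψ.nat
    · refine exists_congr fun φ => exists_congr fun x => and_congr_right fun hφ =>
        and_congr_right fun hx => and_congr_right fun h => forall_congr' fun g =>
        imp_congr_right fun hg => hRR' φ ?_ g ((hV g).2 hg.1)
      rw [h]
      exact S.mem_of_mem_suc ((S.isNat_numI 4).prI (hx.prI hφ.nat))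
        (S.mem_suc_prI_right hx hφ.nat) (S.mem_prI_right (S.isNat_numI 3) (hx.prI hφ.nat)))
  refine ⟨R, fun f hf => ⟨fun t u h => ?_, fun s hs w hw => ?_, fun φ hφ => ?_, fun φ ψ h => ?_,
    fun φ x h => ?_⟩⟩
  · have n1 := h.1.nat.prI h.2.nat
    rw [hR _ f (IsForm.eq h.1 h.2).nat ((hV f).2 hf)]
    constructor
    · rintro (⟨t', u', ht, hu, h1, h2⟩ | ⟨s, hs, w, hw, h1, -⟩ | ⟨φ, hφ, h1, -⟩ |
        ⟨φ, ψ, hφ, hψ, h1, -⟩ | ⟨φ, x, hφ, hx, h1, -⟩)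
      · obtain ⟨rfl, rfl⟩ := S.prI_inj h.1.nat h.2.nat ht.nat hu.nat
          (S.tag_inj n1 (ht.nat.prI hu.nat) h1).2
        exact h2
      · exact absurd (S.tag_inj n1 (S.app_nat fun i => (hw i).nat) h1).1 (by decide)
      · exact absurd (S.tag_inj n1 hφ.nat h1).1 (by decide)
      · exact absurd (S.tag_inj n1 (hφ.nat.prI hψ.nat) h1).1 (by decide)
      · exact absurd (S.tag_inj n1 (hx.prI hφ.nat) h1).1 (by decide)
    · exact fun h' => .inl ⟨t, u, h.1, h.2, rfl, h'⟩
  · have n1 := S.app_nat (a := s.1) (f := s.2) fun i => (hw i).nat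
    rw [hR _ f (IsForm.rel hs hw).nat ((hV f).2 hf)]
    constructor
    · rintro (⟨t', u', ht, hu, h1, h2⟩ | ⟨s', hs', w', hw', h1, h2⟩ | ⟨φ, hφ, h1, -⟩ |
        ⟨φ, ψ, hφ, hψ, h1, -⟩ | ⟨φ, x, hφ, hx, h1, -⟩)
      · exact absurd (S.tag_inj n1 (ht.nat.prI hu.nat) h1).1 (by decide)
      · obtain ⟨rfl, rfl⟩ := S.app_inj (fun i => (hw i).nat) (fun i => (hw' i).nat) h1
        exact h2
      · exact absurd (S.tag_inj n1 hφ.nat h1).1 (by decide)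
      · exact absurd (S.tag_inj n1 (hφ.nat.prI hψ.nat) h1).1 (by decide)
      · exact absurd (S.tag_inj n1 (hx.prI hφ.nat) h1).1 (by decide)
    · exact fun h' => .inr (.inl ⟨s, hs, w, hw, rfl, h'⟩)
  · have n1 := hφ.nat
    rw [hR _ f hφ.neg.nat ((hV f).2 hf)]
    constructor
    · rintro (⟨t', u', ht, hu, h1, h2⟩ | ⟨s, hs, w, hw, h1, -⟩ | ⟨φ', hφ', h1, h2⟩ |
        ⟨φ', ψ, hφ', hψ, h1, -⟩ | ⟨φ', x, hφ', hx, h1, -⟩)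
      · exact absurd (S.tag_inj n1 (ht.nat.prI hu.nat) h1).1 (by decide)
      · exact absurd (S.tag_inj n1 (S.app_nat fun i => (hw i).nat) h1).1 (by decide)
      · rwa [(S.tag_inj n1 hφ'.nat h1).2]
      · exact absurd (S.tag_inj n1 (hφ'.nat.prI hψ.nat) h1).1 (by decide)
      · exact absurd (S.tag_inj n1 (hx.prI hφ'.nat) h1).1 (by decide)
    · exact fun h' => .inr (.inr (.inl ⟨φ, hφ, rfl, h'⟩))
  · have n1 := h.1.nat.prI h.2.nat
    rw [hR _ f (h.1.and h.2).nat ((hV f).2 hf)]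
    constructor
    · rintro (⟨t', u', ht, hu, h1, h2⟩ | ⟨s, hs, w, hw, h1, -⟩ | ⟨φ', hφ', h1, h2⟩ |
        ⟨φ', ψ', hφ', hψ', h1, h2⟩ | ⟨φ', x, hφ', hx, h1, -⟩)
      · exact absurd (S.tag_inj n1 (ht.nat.prI hu.nat) h1).1 (by decide)
      · exact absurd (S.tag_inj n1 (S.app_nat fun i => (hw i).nat) h1).1 (by decide)
      · exact absurd (S.tag_inj n1 hφ'.nat h1).1 (by decide)
      · obtain ⟨rfl, rfl⟩ := S.prI_inj h.1.nat h.2.nat hφ'.nat hψ'.nat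
          (S.tag_inj n1 (hφ'.nat.prI hψ'.nat) h1).2
        exact h2
      · exact absurd (S.tag_inj n1 (hx.prI hφ'.nat) h1).1 (by decide)
    · exact fun h' => .inr (.inr (.inr (.inl ⟨φ, ψ, h.1, h.2, rfl, h'⟩)))
  · have n1 := h.2.prI h.1.nat
    rw [hR _ f (h.1.all h.2).nat ((hV f).2 hf)]
    constructor
    · rintro (⟨t', u', ht, hu, h1, h2⟩ | ⟨s, hs, w, hw, h1, -⟩ | ⟨φ', hφ', h1, h2⟩ |
        ⟨φ', ψ', hφ', hψ', h1, h2⟩ | ⟨φ', x', hφ', hx', h1, h2⟩)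
      · exact absurd (S.tag_inj n1 (ht.nat.prI hu.nat) h1).1 (by decide)
      · exact absurd (S.tag_inj n1 (S.app_nat fun i => (hw i).nat) h1).1 (by decide)
      · exact absurd (S.tag_inj n1 hφ'.nat h1).1 (by decide)
      · exact absurd (S.tag_inj n1 (hφ'.nat.prI hψ'.nat) h1).1 (by decide)
      · obtain ⟨rfl, rfl⟩ := S.prI_inj h.2 h.1.nat hx' hφ'.nat
          (S.tag_inj n1 (hx'.prI hφ'.nat) h1).2
        exact h2
    · exact fun h' => .inr (.inr (.inr (.inr ⟨φ, x, h.1, h.2, rfl, h'⟩)))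

/-! ### Uniqueness of evaluation and satisfaction -/

theorem eval_unique {D I ev ev' : M} (h : S.EvalClauses K D I ev) (h' : S.EvalClauses K D I ev')
    {t f : M} (ht : S.IsTerm K t) (hf : S.IsVA f D) (d : M) :
    S.TripleMem t f d ev ↔ S.TripleMem t f d ev' := by
  refine S.term_induction (K := K)
    (fun t => ∀ d, S.TripleMem t f d ev ↔ S.TripleMem t f d ev') ?_ ?_ ht d
  · intro n hn d
    rw [(h f hf).1 n d hn, (h' f hf).1 n d hn]
  · intro s hs w hw ih d
    rw [(h f hf).2 s hs w hw d, (h' f hf).2 s hs w hw d]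
    simp only [ih]

theorem sat_unique {D I ev ev' sa sa' : M} (h : S.EvalClauses K D I ev)
    (h' : S.EvalClauses K D I ev') (hs : S.SatClauses K D I ev sa)
    (hs' : S.SatClauses K D I ev' sa') {φ f : M} (hφ : S.IsForm K φ) (hf : S.IsVA f D) :
    S.PairMem φ f sa ↔ S.PairMem φ f sa' := by
  refine S.form_induction (K := K)
    (fun φ => ∀ f, S.IsVA f D → (S.PairMem φ f sa ↔ S.PairMem φ f sa')) ?_ ?_ ?_ ?_ ?_ hφ f hf
  · intro t u ht hu f hf
    rw [(hs f hf).1 t u ⟨ht, hu⟩, (hs' f hf).1 t u ⟨ht, hu⟩]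
    simp only [S.eval_unique h h' ht hf, S.eval_unique h h' hu hf]
  · intro s hs1 w hw f hf
    rw [(hs f hf).2.1 s hs1 w hw, (hs' f hf).2.1 s hs1 w hw]
    simp only [fun j => S.eval_unique h h' (hw j) hf]
  · intro φ hφ ih f hf
    rw [(hs f hf).2.2.1 φ hφ, (hs' f hf).2.2.1 φ hφ, ih f hf]
  · intro φ ψ hφ hψ ih1 ih2 f hf
    rw [(hs f hf).2.2.2.1 φ ψ ⟨hφ, hψ⟩, (hs' f hf).2.2.2.1 φ ψ ⟨hφ, hψ⟩, ih1 f hf, ih2 f hf]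
  · intro x φ hx hφ ih f hf
    rw [(hs f hf).2.2.2.2 φ x ⟨hφ, hx⟩, (hs' f hf).2.2.2.2 φ x ⟨hφ, hx⟩]
    exact forall_congr' fun g => imp_congr_right fun hg => ih g hg.1

/-- Satisfaction is defined by the existence of some suitable pair of relations; uniqueness allows
one fixed pair to be used for all formulas and assignments, so that Tarski's clauses hold for it. -/
theorem exists_sat {U D I : M} (hp : S.IsPair U D I) (hU : S.IsStructOn K D I) :
    ∃ ev sa, S.EvalClauses K D I ev ∧ S.SatClauses K D I ev sa ∧
      ∀ φ f, S.SatI K U φ f ↔ S.IsForm K φ ∧ S.IsVA f D ∧ S.PairMem φ f sa := by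
  obtain ⟨ev, hev⟩ := S.exists_eval hU
  obtain ⟨sa, hsa⟩ := S.exists_satisfaction (K := K) D I ev
  refine ⟨ev, sa, hev, hsa, fun φ f => ⟨?_, fun h => ⟨D, I, ev, sa, hp, h.1, h.2.1, hev, hsa, h.2.2⟩⟩⟩
  rintro ⟨D', I', ev', sa', hp', hφ, hf, hev', hsa', h⟩
  obtain ⟨rfl, rfl⟩ := S.op_inj.1 ((S.isPair_iff.1 hp).symm.trans (S.isPair_iff.1 hp'))
  exact ⟨hφ, hf, (S.sat_unique hev hev' hsa hsa' hφ hf).2 h⟩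

end Str
end Multiverse

namespace Multiverse

variable {M : Type}

namespace Str
variable (S : Str M)

/-! ### Codes of numerals and expansions -/

section
variable [hS : S.IsZF]

theorem appI_zero_nat : S.IsNat (S.appI 0 0 []) :=
  (S.isNat_numI 1).prI (S.app_nat (n := 0) (w := Fin.elim0) fun i => i.elim0)

theorem appI_suc_nat {c : M} (hc : S.IsNat c) : S.IsNat (S.appI 1 0 [c]) :=
  (S.isNat_numI 1).prI (S.app_nat (n := 1) (w := ![c]) fun i => by fin_cases i; exact hc)

/-- The witness is the recursively defined function on all natural numbers: the definition of
numeral codes puts no upper bound on the domain of the function. -/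
theorem exists_isNumCode {n : M} (hn : S.IsNat n) : ∃ c, S.IsNumCode n c := by
  obtain ⟨W, hW⟩ := S.exists_omega
  obtain ⟨R, hR1, hR2⟩ := S.exists_rec W (fun n R y => (n = S.zero ∧ y = S.appI 0 0 []) ∨
    ∃ m, S.IsNat m ∧ n = S.suc m ∧ ∃ c, S.IsNat c ∧ S.PairMem m c R ∧ y = S.appI 1 0 [c])
    inferInstance (by
      intro n hn R R' h y hy
      refine or_congr_right (exists_congr fun m => and_congr_right fun hm => and_congr_right fun h1 =>
        exists_congr fun c => and_congr_right fun hc => and_congr_left fun _ => h m ?_ c ((hW c).2 hc))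
      rw [h1]
      exact S.mem_suc.2 (.inr rfl))
  have key : ∀ {n}, S.IsNat n → ∃ c, S.IsNat c ∧ ∀ y, S.PairMem n y R ↔ y = c := by
    intro n hn
    refine S.nat_induction (fun n => ∃ c, S.IsNat c ∧ ∀ y, S.PairMem n y R ↔ y = c) ?_ ?_ hn
    · refine ⟨_, S.appI_zero_nat, fun y => ⟨fun h => ?_, fun h => ?_⟩⟩
      · have hy : S.E y W := by
          obtain ⟨n', y', -, h2, h3⟩ := hR1 _ (S.pairMem_iff.1 h)
          obtain ⟨-, rfl⟩ := S.op_inj.1 h3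
          exact h2
        rcases (hR2 _ y S.isNat_zero hy).1 h with h | ⟨m, -, h, -⟩
        · exact h.2
        · exact (S.suc_ne_zero _ h.symm).elim
      · subst h
        exact (hR2 _ _ S.isNat_zero ((hW _).2 S.appI_zero_nat)).2 (.inl ⟨rfl, rfl⟩)
    · rintro n hn ⟨c, hc, h⟩
      refine ⟨_, S.appI_suc_nat hc, fun y => ⟨fun h' => ?_, fun h' => ?_⟩⟩
      · have hy : S.E y W := by
          obtain ⟨n', y', -, h2, h3⟩ := hR1 _ (S.pairMem_iff.1 h')
          obtain ⟨-, rfl⟩ := S.op_inj.1 h3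
          exact h2
        rcases (hR2 _ y hn.suc hy).1 h' with h' | ⟨m, -, h', c', -, h3, h4⟩
        · exact (S.suc_ne_zero _ h'.1).elim
        · rw [← S.suc_inj h', h] at h3
          rw [h4, h3]
      · subst h'
        exact (hR2 _ _ hn.suc ((hW _).2 (S.appI_suc_nat hc))).2 (.inr ⟨n, hn, rfl, c, hc, (h c).2 rfl, rfl⟩)
  have dom : ∀ {i x}, S.PairMem i x R → S.IsNat i := by
    intro i x h
    obtain ⟨n', y', h1, -, h3⟩ := hR1 _ (S.pairMem_iff.1 h)
    obtain ⟨rfl, -⟩ := S.op_inj.1 h3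
    exact h1
  obtain ⟨c, -, hc⟩ := key hn
  refine ⟨c, R, fun i x y h => ?_, ?_, fun i x h => ?_, (hc c).2 rfl⟩
  · obtain ⟨d, -, hd⟩ := key (dom h.1)
    rw [(hd x).1 h.1, (hd y).1 h.2]
  · exact (hR2 _ _ S.isNat_zero ((hW _).2 S.appI_zero_nat)).2 (.inl ⟨rfl, rfl⟩)
  · have hi := dom h.2
    obtain ⟨d, hd1, hd⟩ := key hi
    obtain rfl := (hd x).1 h.2
    exact (hR2 _ _ hi.suc ((hW _).2 (S.appI_suc_nat hd1))).2 (.inr ⟨i, hi, rfl, x, hd1, h.2, rfl⟩)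

theorem _root_.Multiverse.relSymCode_inj {s s' : ℕ × ℕ} (h : relSymCode s = relSymCode s') :
    s = s' := by
  obtain ⟨h1, h2⟩ := pr_inj (pr_inj h).2
  exact Prod.ext h1 h2

theorem _root_.Multiverse.relSymCode_notMem {K : Lang} {s : ℕ × ℕ} (h : s ∉ K.rels) :
    relSymCode s ∉ symCodes K := by
  simp only [symCodes, List.mem_append, List.mem_map, not_or]
  refine ⟨?_, ?_⟩
  · rintro ⟨s', -, h'⟩
    exact absurd (pr_inj h').1 (by decide)
  · rintro ⟨s', hs', h'⟩
    exact h (relSymCode_inj h' ▸ hs')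

/-- The new interpretation function consists of the part of the old one that concerns LR and of two
further pairs. No clash arises because `Uni` and `Mod` are not symbols of LT. The two extensions are
sets by Separation from the tuples over the domain. -/
theorem exists_isExpansion {LT LR : Lang} (h : LR.Sub LT) (hu : uniSym ∉ LT.rels)
    (hm : modSym ∉ LT.rels) {U n : M} (hU : S.IsStruct LT U) (hn : S.IsNat n) (u m : M) :
    ∃ V, S.IsExpansion LT LR u m U n V := by
  obtain ⟨D, I, hp, hne, hI, hf, hr⟩ := hU
  obtain ⟨c, hc⟩ := S.exists_isNumCode hn
  obtain ⟨T1, hT1⟩ := S.exists_tuples 1 D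
  obtain ⟨T3, hT3⟩ := S.exists_tuples 3 D
  obtain ⟨ru, hru⟩ := S.sep (fun q => ∃ w : Fin 1 → M, S.IsTuple 1 q w ∧ ∃ f, S.IsVA f D ∧
    S.PairMem (S.numI 1) (w 0) f ∧ S.SatI LT U (S.stageI u c) f) T1
  obtain ⟨rm, hrm⟩ := S.sep (fun q => ∃ w : Fin 3 → M, S.IsTuple 3 q w ∧ ∃ f, S.IsVA f D ∧
    S.PairMem (S.numI 1) (w 0) f ∧ S.PairMem (S.numI 2) (w 1) f ∧ S.PairMem (S.numI 3) (w 2) f ∧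
    S.SatI LT U (S.stageI m c) f) T3
  obtain ⟨I', hI'⟩ := S.sep (fun p => ∃ k ∈ symCodes LR, ∃ r, S.IsPair p (S.numI k) r) I
  obtain ⟨P, hP⟩ := S.exists_pairSet (S.op (S.numI (relSymCode uniSym)) ru)
    (S.op (S.numI (relSymCode modSym)) rm)
  obtain ⟨J, hJ⟩ := S.exists_union₂ I' P
  have hcu : relSymCode uniSym ∉ symCodes LR := relSymCode_notMem fun h' => hu (h.2 _ h')
  have hcm : relSymCode modSym ∉ symCodes LR := relSymCode_notMem fun h' => hm (h.2 _ h')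
  have hcum : relSymCode uniSym ≠ relSymCode modSym := fun h => by
    have := relSymCode_inj h
    simp [uniSym, modSym] at this
  have hJ0 : ∀ k ∈ symCodes LR, ∀ r, S.PairMem (S.numI k) r I ↔ S.PairMem (S.numI k) r J := by
    intro k hk r
    simp only [pairMem_iff, hJ, hI', hP, isPair_iff, op_inj]
    constructor
    · exact fun h => .inl ⟨h, k, hk, r, rfl, rfl⟩
    · rintro (h | h | h)
      · exact h.1
      · exact absurd (S.numI_inj h.1 ▸ hk) hcu
      · exact absurd (S.numI_inj h.1 ▸ hk) hcm
  have hJu : ∀ r, S.PairMem (S.numI (relSymCode uniSym)) r J ↔ r = ru := by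
    intro r
    simp only [pairMem_iff, hJ, hI', hP, isPair_iff, op_inj]
    constructor
    · rintro (⟨-, k, hk, r, h, -⟩ | h | h)
      · exact absurd (S.numI_inj h ▸ hk) hcu
      · exact h.2
      · exact absurd (S.numI_inj h.1) hcum
    · exact fun h => .inr (.inl ⟨trivial, h⟩)
  have hJm : ∀ r, S.PairMem (S.numI (relSymCode modSym)) r J ↔ r = rm := by
    intro r
    simp only [pairMem_iff, hJ, hI', hP, isPair_iff, op_inj]
    constructor
    · rintro (⟨-, k, hk, r, h, -⟩ | h | h)
      · exact absurd (S.numI_inj h ▸ hk) hcm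
      · exact absurd (S.numI_inj h.1) hcum.symm
      · exact h.2
    · exact fun h => .inr (.inr ⟨trivial, h⟩)
  have sym : symCodes LR.um = LR.funs.map funSymCode ++
      (relSymCode uniSym :: relSymCode modSym :: LR.rels.map relSymCode) := rfl
  refine ⟨S.op D J, D, I, J, c, hp, S.isPair_iff.2 rfl, hc, ⟨D, J, S.isPair_iff.2 rfl, hne, ?_, ?_, ?_⟩,
    hJ0, ?_, ?_⟩
  · intro p hp
    rcases (hJ p).1 hp with h | h
    · obtain ⟨k, hk, h⟩ := ((hI' p).1 h).2
      refine ⟨k, ?_, h⟩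
      rw [symCodes, List.mem_append] at hk
      rw [sym]
      simp only [List.mem_append, List.mem_cons]
      tauto
    · rcases (hP p).1 h with h | h
      · exact ⟨relSymCode uniSym, by simp [sym], _, S.isPair_iff.2 h⟩
      · exact ⟨relSymCode modSym, by simp [sym], _, S.isPair_iff.2 h⟩
  · intro s hs
    obtain ⟨r, h1, h2⟩ := hf s (h.1 s hs)
    refine ⟨r, fun y => ?_, h2⟩
    rw [← hJ0 _ (List.mem_append_left _ (List.mem_map_of_mem hs)), h1]
  · intro s hs
    rcases List.mem_cons.1 hs with rfl | hs
    · refine ⟨ru, hJu, fun q hq => (hT1 q).1 ((hru q).1 hq).1⟩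
    rcases List.mem_cons.1 hs with rfl | hs
    · refine ⟨rm, hJm, fun q hq => (hT3 q).1 ((hrm q).1 hq).1⟩
    obtain ⟨r, h1, h2⟩ := hr s (h.2 s hs)
    refine ⟨r, fun y => ?_, h2⟩
    rw [← hJ0 _ (List.mem_append_right _ (List.mem_map_of_mem hs)), h1]
  · rintro r hr a q ⟨ha, hq⟩
    obtain rfl := (hJu r).1 hr
    rw [hru]
    constructor
    · rintro ⟨-, w, hw, h⟩
      obtain rfl := S.isTuple_inj hw hq
      exact h
    · exact fun h => ⟨(hT1 q).2 ⟨_, fun i => by fin_cases i; exact ha, hq⟩, _, hq, h⟩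
  · rintro r hr w q ⟨hw, hq⟩
    obtain rfl := (hJm r).1 hr
    rw [hrm]
    constructor
    · rintro ⟨-, w, hw, h⟩
      obtain rfl := S.isTuple_inj hw hq
      exact h
    · exact fun h => ⟨(hT3 q).2 ⟨_, hw, hq⟩, _, hq, h⟩

end

end Str
end Multiverse

namespace Multiverse

variable {M : Type}

namespace Str
variable (S : Str M)

/-! ### Codes of standard terms and formulas -/

section
variable [hS : S.IsBasic]

theorem add_numI (m n : ℕ) : S.add (S.numI m) (S.numI n) = S.numI (m + n) := by
  induction n with
  | zero => exact S.add_zeroI (S.isNat_numI m)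
  | succ n ih => rw [numI, S.add_sucI (S.isNat_numI m) (S.isNat_numI n), ih]; rfl

theorem mul_numI (m n : ℕ) : S.mul (S.numI m) (S.numI n) = S.numI (m * n) := by
  induction n with
  | zero => exact S.mul_zeroI (S.isNat_numI m)
  | succ n ih => rw [numI, S.mul_sucI (S.isNat_numI m) (S.isNat_numI n), ih, add_numI]; rfl

theorem prI_numI (m n : ℕ) : S.prI (S.numI m) (S.numI n) = S.numI (pr m n) := by
  simp only [prI, pr, add_numI, mul_numI]

theorem listI_numI (l : List ℕ) : S.listI (l.map S.numI) = S.numI (listCode l) := by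
  induction l with
  | nil => rfl
  | cons a l ih => simp only [List.map_cons, listI, ih, prI_numI]; rfl

theorem listI_ofFn_numI {n : ℕ} (w : Fin n → ℕ) :
    S.listI (List.ofFn fun i => S.numI (w i)) = S.numI (listCode (List.ofFn w)) := by
  rw [← listI_numI, List.map_ofFn]
  rfl

theorem varI_numI (n : ℕ) : S.varI (S.numI n) = S.numI (codeT (v n)) := S.prI_numI 0 n

theorem appI_numI (a f : ℕ) (ts : Fin a → Tm) :
    S.appI a f (List.ofFn fun i => S.numI (codeT (ts i))) = S.numI (codeT (fn a f ts)) := by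
  rw [appI, listI_ofFn_numI, prI_numI, prI_numI, prI_numI]
  rfl

theorem relI'_numI (a R : ℕ) (ts : Fin a → Tm) :
    S.relI' a R (List.ofFn fun i => S.numI (codeT (ts i))) = S.numI (code (.rel a R ts)) := by
  rw [relI', listI_ofFn_numI, prI_numI, prI_numI, prI_numI]
  rfl

theorem eqI_numI (t u : Tm) : S.eqI (S.numI (codeT t)) (S.numI (codeT u)) = S.numI (code (t ≐ u)) := by
  rw [eqI, prI_numI, prI_numI]; rfl

theorem negI_numI (φ : Fml) : S.negI (S.numI (code φ)) = S.numI (code (.neg φ)) := S.prI_numI 2 _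

theorem andI_numI (φ ψ : Fml) :
    S.andI (S.numI (code φ)) (S.numI (code ψ)) = S.numI (code (φ ⋏ ψ)) := by
  rw [andI, prI_numI, prI_numI]; rfl

theorem allI_numI (x : ℕ) (φ : Fml) :
    S.allI (S.numI x) (S.numI (code φ)) = S.numI (code (.all x φ)) := by
  rw [allI, prI_numI, prI_numI]; rfl

theorem stageI_numI (k : ℕ) (χ : Fml) :
    S.stageI (S.numI (code χ)) (S.numI (codeT (num k))) = S.numI (code (stage k χ)) := by
  rw [stageI, impI, varI_numI, eqI_numI, negI_numI, andI_numI, negI_numI, allI_numI]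
  rfl

variable {K : Lang}

theorem isTerm_code {t : Tm} (ht : InLangT K t) : S.IsTerm K (S.numI (codeT t)) := by
  induction t with
  | var n => rw [← varI_numI]; exact .var (S.isNat_numI n)
  | @func a f ts ih =>
    rw [← appI_numI]
    exact IsTerm.app (s := (a, f)) ht.1 fun i => ih i (ht.2 i)

theorem isForm_code {φ : Fml} (hφ : φ.In K) : S.IsForm K (S.numI (code φ)) := by
  induction φ with
  | eq t u => rw [← eqI_numI]; exact .eq (S.isTerm_code hφ.1) (S.isTerm_code hφ.2)
  | @rel a R ts =>
    rw [← relI'_numI]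
    exact IsForm.rel (s := (a, R)) hφ.1 fun i => S.isTerm_code (hφ.2 i)
  | neg φ ih => rw [← negI_numI]; exact (ih hφ).neg
  | and φ ψ ih1 ih2 => rw [← andI_numI]; exact (ih1 hφ.1).and (ih2 hφ.2)
  | all x φ ih => rw [← allI_numI]; exact .all (S.isNat_numI x) (ih hφ)

theorem numI_mem {i k : ℕ} (h : i < k) : S.E (S.numI i) (S.numI k) := by
  induction k with
  | zero => omega
  | succ k ih =>
    rw [numI, mem_suc]
    rcases Nat.lt_succ_iff_lt_or_eq.1 h with h | rfl
    exacts [.inl (ih h), .inr rfl]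

/-- At a standard numeral the witnessing function is computed by an induction outside the structure,
so the basic axioms suffice. -/
theorem isNumCode_numI {k : ℕ} {c : M} (h : S.IsNumCode (S.numI k) c) : c = S.numI (codeT (num k)) := by
  obtain ⟨g, h1, h2, h3, h4⟩ := h
  have key : ∀ i ≤ k, S.PairMem (S.numI i) (S.numI (codeT (num i))) g := by
    intro i hi
    induction i with
    | zero =>
      have := S.appI_numI 0 0 ![]
      rw [List.ofFn_zero] at this
      change S.PairMem S.zero (S.numI (codeT (fn 0 0 ![]))) g
      rwa [← this]
    | succ i ih =>
      have := S.appI_numI 1 0 ![num i]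
      rw [List.ofFn_succ, List.ofFn_zero] at this
      change S.PairMem (S.suc (S.numI i)) (S.numI (codeT (fn 1 0 ![num i]))) g
      rw [← this]
      exact h3 _ _ ⟨S.numI_mem hi, ih (by omega)⟩
  exact h1 _ _ _ ⟨h4, key k le_rfl⟩

end

/-! ### The external counterpart of an internal structure -/

open Classical in
/-- The structure with the domain `D` and the interpretation function `I`, seen from outside. -/
noncomputable def innerStr (D I : M) [Nonempty {d // S.E d D}] : Str {d // S.E d D} where
  fnI a f w := Classical.epsilon fun d => ∃ q y, S.IsTuple a q (fun i => (w i).1) ∧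
    S.PairMem (S.numI (funSymCode (a, f))) y I ∧ S.PairMem q d.1 y
  relI a R w := ∃ q y, S.IsTuple a q (fun i => (w i).1) ∧
    S.PairMem (S.numI (relSymCode (a, R))) y I ∧ S.E q y

section
variable [hS : S.IsBasic] {K : Lang} {D I : M} [Nonempty {d // S.E d D}]

/-- The choice in `innerStr` is harmless because an operation has exactly one value at each tuple.
-/
theorem innerStr_fnI (hU : S.IsStructOn K D I) {a f : ℕ} (hf : (a, f) ∈ K.funs)
    (w : Fin a → {d // S.E d D}) (d : M) :
    (∃ q y, S.IsTuple a q (fun i => (w i).1) ∧ S.PairMem (S.numI (funSymCode (a, f))) y I ∧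
      S.PairMem q d y) ↔ d = ((S.innerStr D I).fnI a f w).1 := by
  obtain ⟨r, hr, hop⟩ := hU.2.2.1 _ hf
  obtain ⟨q, hq⟩ := S.isTuple_exists fun i => (w i).1
  obtain ⟨e, he⟩ := hop.2 _ q ⟨fun i => (w i).2, hq⟩
  have key : ∀ d, (∃ q y, S.IsTuple a q (fun i => (w i).1) ∧
      S.PairMem (S.numI (funSymCode (a, f))) y I ∧ S.PairMem q d y) ↔ d = e := by
    intro d
    constructor
    · rintro ⟨q', y, hq', hy, h⟩
      obtain rfl := S.isTuple_unique hq hq'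
      obtain rfl := (hr y).1 hy
      exact (he d).1 h
    · rintro rfl
      exact ⟨q, r, hq, (hr r).2 rfl, (he d).2 rfl⟩
  have hD := S.op_range hop ((he e).2 rfl)
  have h1 := Classical.epsilon_spec (p := fun d : {d // S.E d D} => ∃ q y,
    S.IsTuple a q (fun i => (w i).1) ∧ S.PairMem (S.numI (funSymCode (a, f))) y I ∧
    S.PairMem q d.1 y) ⟨⟨e, hD⟩, (key e).2 rfl⟩
  rw [key, ← (key _).1 h1]
  rfl

/-- The external assignment given by an internal one. -/
noncomputable def asg (D f : M) [Nonempty {d // S.E d D}] : ℕ → {d // S.E d D} :=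
  fun n => Classical.epsilon fun d => S.PairMem (S.numI n) d.1 f

theorem pairMem_numI {f : M} (hf : S.IsVA f D) (n : ℕ) (d : M) :
    S.PairMem (S.numI n) d f ↔ d = (S.asg D f n).1 := by
  obtain ⟨e, he⟩ := hf.2 _ (S.isNat_numI n)
  have hD := S.VA_range hf ((he e).2 rfl)
  have h1 := Classical.epsilon_spec (p := fun d : {d // S.E d D} => S.PairMem (S.numI n) d.1 f)
    ⟨⟨e, hD⟩, (he e).2 rfl⟩
  rw [he, ← (he _).1 h1]
  rfl

theorem asg_eq_iff {f : M} (hf : S.IsVA f D) (n : ℕ) (d : {d // S.E d D}) :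
    S.asg D f n = d ↔ S.PairMem (S.numI n) d.1 f := by
  rw [S.pairMem_numI hf, Subtype.ext_iff]
  exact eq_comm

theorem tripleMem_code {ev f : M} (hU : S.IsStructOn K D I) (hev : S.EvalClauses K D I ev)
    (hf : S.IsVA f D) {t : Tm} (ht : InLangT K t) (d : M) :
    S.TripleMem (S.numI (codeT t)) f d ev ↔ d = ((S.innerStr D I).val (S.asg D f) t).1 := by
  induction t generalizing d with
  | var n => rw [← varI_numI, (hev f hf).1 _ d (S.isNat_numI n), S.pairMem_numI hf]; rfl
  | @func a g ts ih =>
    rw [← appI_numI, (hev f hf).2 (a, g) ht.1 _ (fun i => S.isTerm_code (ht.2 i)) d]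
    simp only [fun i d => ih i (ht.2 i) d]
    rw [Str.val, ← S.innerStr_fnI hU ht.1]
    constructor
    · rintro ⟨z, hz, h⟩
      obtain rfl : z = _ := funext hz
      exact h
    · exact fun h => ⟨_, fun j => rfl, h⟩

theorem asg_agreeOff {f g : M} (hf : S.IsVA f D) (hg : S.IsVA g D) {x : ℕ}
    (h : S.AgreeOff g f (S.numI x)) : S.asg D g = Function.update (S.asg D f) x (S.asg D g x) := by
  funext n
  by_cases hn : n = x
  · subst hn; simp
  · rw [Function.update_of_ne hn, S.asg_eq_iff hg, h _ ⟨S.isNat_numI n, fun e => hn (S.numI_inj e)⟩,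
      ← S.asg_eq_iff hf]

/-- Variable assignments into `D` exist and can be changed at one argument. -/
def HasVA (S : Str M) : Prop :=
  (∀ D d, S.E d D → ∃ f, S.IsVA f D) ∧
  ∀ D f x d, S.IsVA f D → S.IsNat x → S.E d D → ∃ g, S.IsVA g D ∧ S.AgreeOff g f x ∧ S.PairMem x d g

/-- Internal satisfaction of a standard formula coincides with truth seen from outside. The
quantifier case rests on `HasVA`: changing the value of one variable outside is matched by an
internal assignment. -/
theorem pairMem_code (hva : S.HasVA) {ev sa : M} (hU : S.IsStructOn K D I)
    (hev : S.EvalClauses K D I ev) (hsa : S.SatClauses K D I ev sa) {φ : Fml} (hφ : φ.In K) :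
    ∀ {f : M}, S.IsVA f D →
      (S.PairMem (S.numI (code φ)) f sa ↔ (S.innerStr D I).Sat (S.asg D f) φ) := by
  induction φ with
  | eq t u =>
    intro f hf
    rw [← eqI_numI, (hsa f hf).1 _ _ ⟨S.isTerm_code hφ.1, S.isTerm_code hφ.2⟩]
    simp only [S.tripleMem_code hU hev hf hφ.1, S.tripleMem_code hU hev hf hφ.2]
    rw [sat_eq, Subtype.ext_iff]
    simp
  | @rel a R ts =>
    intro f hf
    rw [← relI'_numI, (hsa f hf).2.1 (a, R) hφ.1 _ fun i => S.isTerm_code (hφ.2 i)]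
    simp only [fun i d => S.tripleMem_code hU hev hf (hφ.2 i) d]
    rw [sat_rel]
    constructor
    · rintro ⟨z, hz, h⟩
      obtain rfl : z = _ := funext hz
      exact h
    · exact fun h => ⟨_, fun j => rfl, h⟩
  | neg φ ih =>
    intro f hf
    rw [← negI_numI, (hsa f hf).2.2.1 _ (S.isForm_code (φ := φ) hφ), ih hφ hf]
    rfl
  | and φ ψ ih1 ih2 =>
    intro f hf
    rw [← andI_numI, (hsa f hf).2.2.2.1 _ _ ⟨S.isForm_code hφ.1, S.isForm_code hφ.2⟩, ih1 hφ.1 hf,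
      ih2 hφ.2 hf]
    rfl
  | all x φ ih =>
    intro f hf
    rw [← allI_numI, (hsa f hf).2.2.2.2 _ _ ⟨S.isForm_code (φ := φ) hφ, S.isNat_numI x⟩, sat_all]
    constructor
    · intro h d
      obtain ⟨g, hg, h1, h2⟩ := hva.2 D f (S.numI x) d.1 hf (S.isNat_numI x) d.2
      have := (ih hφ hg).1 (h g ⟨hg, h1⟩)
      rwa [S.asg_agreeOff hf hg h1, (S.asg_eq_iff hg x d).2 h2] at this
    · rintro h g ⟨hg, h1⟩
      rw [ih hφ hg, S.asg_agreeOff hf hg h1]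
      exact h _

/-- Every external assignment is given, at finitely many variables, by an internal one. -/
theorem exists_asg (hva : S.HasVA) (s : ℕ → {d // S.E d D}) (A : Finset ℕ) :
    ∃ f, S.IsVA f D ∧ ∀ n ∈ A, S.asg D f n = s n := by
  induction A using Finset.induction with
  | empty =>
    obtain ⟨f, hf⟩ := hva.1 D (s 0).1 (s 0).2
    exact ⟨f, hf, by simp⟩
  | insert x A hx ih =>
    obtain ⟨f, hf, h⟩ := ih
    obtain ⟨g, hg, h1, h2⟩ := hva.2 D f (S.numI x) (s x).1 hf (S.isNat_numI x) (s x).2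
    refine ⟨g, hg, fun n hn => ?_⟩
    rw [S.asg_agreeOff hf hg h1]
    by_cases hnx : n = x
    · subst hnx
      rw [Function.update_self, S.asg_eq_iff hg]
      exact h2
    · rw [Function.update_of_ne hnx]
      exact h n (Finset.mem_of_mem_insert_of_ne hn hnx)

/-- Not every external assignment is internal, but only the finitely many free variables of φ
matter. -/
theorem forall_asg_iff (hva : S.HasVA) (φ : Fml) :
    (∀ f, S.IsVA f D → (S.innerStr D I).Sat (S.asg D f) φ) ↔ (S.innerStr D I).Valid φ := by
  refine ⟨fun h s => ?_, fun h f _ => h _⟩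
  obtain ⟨f, hf, h'⟩ := S.exists_asg hva s φ.fv
  exact ((S.innerStr D I).sat_congr φ h').1 (h f hf)

end

end Str
end Multiverse

namespace Multiverse

variable {M : Type}

/-! ### Finitely many facts that suffice to reason about the universes -/

namespace Str
variable (S : Str M)

/-- `Uni` holds of `n`, `U`. -/
def UniAt (Uni : Fml) (n U : M) : Prop := S.Sat (lst (fun _ => n) [n, U]) Uni

/-- `Mod` holds of `n`, `U`, `φ`, `f`. -/
def ModAt (Mod : Fml) (n U φ f : M) : Prop := S.Sat (lst (fun _ => n) [n, U, φ, f]) Mod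

theorem sat_iff_uniAt {Uni : Fml} (h : Uni.fv ⊆ {0, 1}) (s : ℕ → M) :
    S.Sat s Uni ↔ S.UniAt Uni (s 0) (s 1) := by
  refine S.sat_congr _ fun n hn => ?_
  have := h hn
  simp only [Finset.mem_insert, Finset.mem_singleton] at this
  rcases this with rfl | rfl <;> simp

theorem sat_iff_modAt {Mod : Fml} (h : Mod.fv ⊆ {0, 1, 2, 3}) (s : ℕ → M) :
    S.Sat s Mod ↔ S.ModAt Mod (s 0) (s 1) (s 2) (s 3) := by
  refine S.sat_congr _ fun n hn => ?_
  have := h hn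
  simp only [Finset.mem_insert, Finset.mem_singleton] at this
  rcases this with rfl | rfl | rfl | rfl <;> simp

/-- Satisfaction in `K`-structures obeys Tarski's conditions. -/
def HasSat (K : Lang) : Prop := ∀ U D I, S.IsPair U D I ∧ S.IsStruct K U → ∃ ev sa,
  S.EvalClauses K D I ev ∧ S.SatClauses K D I ev sa ∧
    ∀ φ f, S.SatI K U φ f ↔ S.IsForm K φ ∧ S.IsVA f D ∧ S.PairMem φ f sa

/-- The facts about the universes that are used in every theory `T_k`. -/
structure Suff (LT LR : Lang) (Uni Mod₀ Mod : Fml) : Prop extends S.IsBasic where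
  va : S.HasVA
  sat_T : S.HasSat LT
  sat_R : S.HasSat LR.um
  uni_struct : ∀ n U, S.IsNat n ∧ S.UniAt Uni n U → S.IsStruct LT U
  uni_anti : ∀ n U, S.IsNat n ∧ S.UniAt Uni (S.suc n) U → S.UniAt Uni n U
  exists_expansion : ∀ n U, S.IsNat n ∧ S.IsStruct LT U →
    ∃ V, S.IsExpansion LT LR (S.numI (code Uni)) (S.numI (code Mod)) U n V
  revision : ∀ n U φ f, S.ModAt Mod n U φ f ↔ S.IsNat n ∧ S.UniAt Uni n U ∧ S.IsForm LR.um φ ∧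
    S.IsVAof f U ∧ (n = S.zero → S.ModAt Mod₀ n U φ f) ∧ ∀ m, S.IsNat m ∧ n = S.suc m → ∃ V,
      S.IsExpansion LT LR (S.numI (code Uni)) (S.numI (code Mod)) U m V ∧ S.SatI LR.um V φ f

end Str

def vaFact : Fml := .all 0 (.all 1 (v 1 ∊ v 0 ⇛ .ex 2 (isVA.at [v 2, v 0])))

def updateFact : Fml :=
  .all 0 (.all 1 (.all 2 (.all 3 (isVA.at [v 1, v 0] ⋏ isNat.at [v 2] ⋏ v 3 ∊ v 0 ⇛
    .ex 4 (isVA.at [v 4, v 0] ⋏ agreeOff.at [v 4, v 1, v 2] ⋏ pairMem.at [v 2, v 3, v 4])))))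

def satFact (K : Lang) : Fml :=
  .all 0 (.all 1 (.all 2 (isPair.at [v 0, v 1, v 2] ⋏ (isStruct K).at [v 0] ⇛
    .ex 3 (.ex 4 ((evalClauses K).at [v 1, v 2, v 3] ⋏ (satClauses K).at [v 1, v 2, v 3, v 4] ⋏
      .all 5 (.all 6 ((sat K).at [v 0, v 5, v 6] ⟚
        ((isForm K).at [v 5] ⋏ isVA.at [v 6, v 1] ⋏ pairMem.at [v 5, v 6, v 4]))))))))

def uniFact (LT : Lang) (Uni : Fml) : Fml :=
  .all 0 (.all 1 (isNat.at [v 0] ⋏ Uni ⇛ (isStruct LT).at [v 1]))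

def antiFact (Uni : Fml) : Fml :=
  isNat.at [v 0] ⋏ Uni.at [succT (v 0), v 1] ⇛ Uni.at [v 0, v 1]

def expansionFact (LT LR : Lang) (Uni Mod : Fml) : Fml :=
  .all 0 (.all 1 (isNat.at [v 0] ⋏ (isStruct LT).at [v 1] ⇛
    .ex 2 ((isExpansion LT LR Uni Mod).at [v 1, v 0, v 2])))

/-- The facts as formulas. -/
def facts (LT LR : Lang) (Uni Mod₀ Mod : Fml) : List Fml :=
  vaFact :: updateFact :: satFact LT :: satFact LR.um :: uniFact LT Uni :: antiFact Uni ::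
    expansionFact LT LR Uni Mod :: revisionEquiv LT LR Uni Mod₀ Mod :: basicAx

theorem facts_in {LT LR : Lang} {Uni Mod₀ Mod : Fml} (hU : Uni.In baseLang) (h0 : Mod₀.In baseLang)
    (hM : Mod.In baseLang) : ∀ φ ∈ facts LT LR Uni Mod₀ Mod, φ.In baseLang := by
  intro φ h
  simp only [facts, basicAx, List.mem_cons] at h
  rcases h with rfl | rfl | rfl | rfl | rfl | rfl | rfl | rfl | rfl | rfl | rfl | h
  · simp [vaFact]
  · simp [updateFact]
  · simp [satFact]
  · simp [satFact]
  · simp [uniFact, hU]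
  · simp [antiFact, hU]
  · simp [expansionFact, isExpansion_eq, in_isExpansionT]
  · exact in_revisionEquiv hU h0 hM
  · simp [extAx]
  · simp [pairAx]
  · simp [foundAx]
  · simp only [arithAx, List.mem_cons, List.not_mem_nil, or_false] at h
    rcases h with rfl | rfl | rfl | rfl | rfl | rfl | rfl <;> simp

namespace Str
variable (S : Str M) {LT LR : Lang} {Uni Mod₀ Mod : Fml}

theorem valid_revisionEquiv (hU : Uni.fv ⊆ {0, 1}) (h0 : Mod₀.fv ⊆ {0, 1, 2, 3})
    (hM : Mod.fv ⊆ {0, 1, 2, 3}) :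
    S.Valid (revisionEquiv LT LR Uni Mod₀ Mod) ↔ ∀ n U φ f, S.ModAt Mod n U φ f ↔
      S.IsNat n ∧ S.UniAt Uni n U ∧ S.IsForm LR.um φ ∧
      S.IsVAof f U ∧ (n = S.zero → S.ModAt Mod₀ n U φ f) ∧ ∀ m, S.IsNat m ∧ n = S.suc m → ∃ V,
        S.IsExpansion LT LR (S.numI (code Uni)) (S.numI (code Mod)) U m V ∧ S.SatI LR.um V φ f := by
  simp only [Valid, sat_revisionEquiv, S.sat_iff_uniAt hU, S.sat_iff_modAt h0, S.sat_iff_modAt hM]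
  constructor
  · exact fun h n U φ f => by simpa using h (lst (fun _ => n) [n, U, φ, f])
  · exact fun h s => h _ _ _ _

/-- The list of formulas is what a theory can prove and what the rule NEC* can transport into
universes; the semantic form is what arguments about a structure use. -/
theorem valid_facts_iff (hU : Uni.fv ⊆ {0, 1}) (h0 : Mod₀.fv ⊆ {0, 1, 2, 3})
    (hM : Mod.fv ⊆ {0, 1, 2, 3}) :
    (∀ φ ∈ facts LT LR Uni Mod₀ Mod, S.Valid φ) ↔ S.Suff LT LR Uni Mod₀ Mod := by
  have : Nonempty M := ⟨S.zero⟩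
  have e1 : S.Valid vaFact ↔ ∀ D d, S.E d D → ∃ f, S.IsVA f D := by
    simp [Valid, vaFact, sat_at]
  have e2 : S.Valid updateFact ↔ ∀ D f x d, S.IsVA f D → S.IsNat x → S.E d D →
      ∃ g, S.IsVA g D ∧ S.AgreeOff g f x ∧ S.PairMem x d g := by
    simp [Valid, updateFact, sat_at]
  have e3 : ∀ K, S.Valid (satFact K) ↔ S.HasSat K := by
    intro K; simp [Valid, satFact, sat_at, HasSat]
  have e4 : S.Valid (uniFact LT Uni) ↔ ∀ n U, S.IsNat n ∧ S.UniAt Uni n U → S.IsStruct LT U := by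
    simp [Valid, uniFact, sat_at, S.sat_iff_uniAt hU]
  have e5 : S.Valid (antiFact Uni) ↔
      ∀ n U, S.IsNat n ∧ S.UniAt Uni (S.suc n) U → S.UniAt Uni n U := by
    simp only [Valid, antiFact, sat_at, S.sat_iff_uniAt hU, sat_imp, sat_and, sat_isNat]
    simp
    constructor
    · exact fun h n U h1 h2 => by simpa using h (lst (fun _ => n) [n, U]) h1 h2
    · exact fun h s => h _ _
  have e6 : S.Valid (expansionFact LT LR Uni Mod) ↔ ∀ n U, S.IsNat n ∧ S.IsStruct LT U →
      ∃ V, S.IsExpansion LT LR (S.numI (code Uni)) (S.numI (code Mod)) U n V := by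
    have : ∀ s : ℕ → M, S.Sat s (isExpansion LT LR Uni Mod) ↔
        S.IsExpansion LT LR (S.numI (code Uni)) (S.numI (code Mod)) (s 0) (s 1) (s 2) := by
      intro s
      rw [isExpansion_eq, S.sat_isExpansionT _ _ _ _ _ fun s' _ => by simp, val_num]
    simp [Valid, expansionFact, sat_at, this]
  simp only [facts, List.forall_mem_cons, e1, e2, e3, e4, e5, e6,
    S.valid_revisionEquiv hU h0 hM]
  constructor
  · rintro ⟨h1, h2, h3, h4, h5, h6, h7, h8, h9⟩
    exact { valid := h9, va := ⟨h1, h2⟩, sat_T := h3, sat_R := h4, uni_struct := h5, uni_anti := h6, exists_expansion := h7, revision := h8 }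
  · intro h
    exact ⟨h.va.1, h.va.2, h.sat_T, h.sat_R, h.uni_struct, h.uni_anti, h.exists_expansion,
      h.revision, h.valid⟩

end Str
end Multiverse

namespace Multiverse

variable {M : Type}

/-- The syntactic assumptions on the languages and on the formulas `Uni`, `Mod₀`, `Mod`. -/
structure Setting (LT LR : Lang) (Uni Mod₀ Mod : Fml) : Prop where
  base_sub : baseLang.Sub LR
  sub : LR.Sub LT
  uni_notMem : uniSym ∉ LT.rels
  mod_notMem : modSym ∉ LT.rels
  uni_in : Uni.In baseLang
  uni_fv : Uni.fv ⊆ {0, 1}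
  mod₀_in : Mod₀.In baseLang
  mod₀_fv : Mod₀.fv ⊆ {0, 1, 2, 3}
  mod_in : Mod.In baseLang
  mod_fv : Mod.fv ⊆ {0, 1, 2, 3}

theorem Lang.Sub.trans {K L N : Lang} (h : K.Sub L) (h' : L.Sub N) : K.Sub N :=
  ⟨fun s hs => h'.1 s (h.1 s hs), fun s hs => h'.2 s (h.2 s hs)⟩

theorem Lang.Sub.refl (K : Lang) : K.Sub K := ⟨fun _ h => h, fun _ h => h⟩

theorem Lang.Sub.um {K L : Lang} (h : K.Sub L) : K.um.Sub L.um := by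
  refine ⟨h.1, fun s hs => ?_⟩
  rcases List.mem_cons.1 hs with rfl | hs
  · exact List.mem_cons_self
  rcases List.mem_cons.1 hs with rfl | hs
  · exact List.mem_cons_of_mem _ List.mem_cons_self
  · exact List.mem_cons_of_mem _ (List.mem_cons_of_mem _ (h.2 s hs))

theorem Lang.sub_um (K : Lang) : K.Sub K.um :=
  ⟨fun _ h => h, fun _ h => List.mem_cons_of_mem _ (List.mem_cons_of_mem _ h)⟩

/-! ### The interpretations `I_k` -/

theorem interp_rel {Uni Mod : Fml} {k a R : ℕ} {ts : Fin a → Tm} (h : (a, R) ≠ uniSym)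
    (h' : (a, R) ≠ modSym) : interp Uni Mod k (.rel a R ts) = .rel a R ts := by
  unfold interp
  split
  · simp_all
  · simp_all [uniSym]
  · simp_all [modSym]
  · exact Eq.symm ‹_›
  all_goals simp_all

theorem inLangT_um {K : Lang} {t : Tm} : InLangT K.um t ↔ InLangT K t := by
  induction t with
  | var n => exact Iff.rfl
  | func f ts ih => simp only [InLangT, ih]; rfl

theorem interp_in {Uni Mod : Fml} (hU : Uni.In baseLang) (hM : Mod.In baseLang) {K : Lang}
    (hK : baseLang.Sub K) {k : ℕ} {φ : Fml} (hφ : φ.In K.um) : (interp Uni Mod k φ).In K := by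
  induction φ with
  | eq t u => exact ⟨inLangT_um.1 hφ.1, inLangT_um.1 hφ.2⟩
  | @rel a R ts =>
    have ht := fun i => inLangT_um.1 (hφ.2 i)
    by_cases h1 : (a, R) = uniSym
    · obtain ⟨rfl, rfl⟩ := Prod.mk.inj h1
      refine Fml.In.at ((in_stage hU).mono hK) fun t h => ?_
      simp only [List.mem_cons, List.not_mem_nil, or_false] at h
      rcases h with rfl | rfl
      exacts [trivial, ht 0]
    by_cases h2 : (a, R) = modSym
    · obtain ⟨rfl, rfl⟩ := Prod.mk.inj h2
      refine Fml.In.at ((in_stage hM).mono hK) fun t h => ?_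
      simp only [List.mem_cons, List.not_mem_nil, or_false] at h
      rcases h with rfl | rfl | rfl | rfl
      exacts [trivial, ht 0, ht 1, ht 2]
    rw [interp_rel h1 h2]
    refine ⟨?_, ht⟩
    have := hφ.1
    simp only [Lang.um, List.mem_cons] at this
    tauto
  | neg φ ih => exact ih hφ
  | and φ ψ ih1 ih2 => exact ⟨ih1 hφ.1, ih2 hφ.2⟩
  | all x φ ih => exact ih hφ

namespace Str
variable (S : Str M)

/-- The structure `S` with `P`, `Q` as the meaning of `Uni`, `Mod`. -/
def withUM (P : M → Prop) (Q : M → M → M → Prop) : Str M where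
  fnI := S.fnI
  relI a R w := match a, R, w with
    | 1, 0, w => P (w 0)
    | 3, 0, w => Q (w 0) (w 1) (w 2)
    | a, R, w => S.relI a R w

theorem withUM_rel {P : M → Prop} {Q : M → M → M → Prop} {a R : ℕ} {w : Fin a → M}
    (h : (a, R) ≠ uniSym) (h' : (a, R) ≠ modSym) : (S.withUM P Q).relI a R w ↔ S.relI a R w := by
  unfold withUM
  dsimp only
  split <;> simp_all [uniSym, modSym]

theorem val_withUM (P : M → Prop) (Q : M → M → M → Prop) (s : ℕ → M) (t : Tm) :
    (S.withUM P Q).val s t = S.val s t := by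
  induction t with
  | var n => rfl
  | func f ts ih => simp only [val, ih]; rfl

theorem sat_stage (s : ℕ → M) (k : ℕ) (χ : Fml) :
    S.Sat s (stage k χ) ↔ S.Sat (Function.update s 0 (S.numI k)) χ := by
  simp [stage]

/-- `S` with the meaning that the stage `n` gives to `Uni` and `Mod`. -/
def atStage (Uni Mod : Fml) (n : M) : Str M := S.withUM (S.UniAt Uni n) (S.ModAt Mod n)

/-- Translating a formula amounts to changing the meaning of two symbols in the structure, so the
logical axioms, Tr^□ and the compositional axioms can all be examined in `atStage`. -/
theorem sat_interp {Uni Mod : Fml} (hU : Uni.fv ⊆ {0, 1}) (hM : Mod.fv ⊆ {0, 1, 2, 3}) (k : ℕ)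
    (φ : Fml) : ∀ s : ℕ → M,
    S.Sat s (interp Uni Mod k φ) ↔ (S.atStage Uni Mod (S.numI k)).Sat s φ := by
  induction φ with
  | eq t u => intro s; simp only [interp, sat_eq, atStage, val_withUM]
  | @rel a R ts =>
    intro s
    by_cases h1 : (a, R) = uniSym
    · obtain ⟨rfl, rfl⟩ := Prod.mk.inj h1
      rw [interp, sat_at, sat_stage, S.sat_iff_uniAt hU, sat_rel]
      simp only [atStage, val_withUM]
      rfl
    by_cases h2 : (a, R) = modSym
    · obtain ⟨rfl, rfl⟩ := Prod.mk.inj h2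
      rw [interp, sat_at, sat_stage, S.sat_iff_modAt hM, sat_rel]
      simp only [atStage, val_withUM]
      rfl
    rw [interp_rel h1 h2, sat_rel, sat_rel, atStage, S.withUM_rel h1 h2]
    simp only [val_withUM]
  | neg φ ih => intro s; simp only [interp, sat_neg, ih]
  | and φ ψ ih1 ih2 => intro s; simp only [interp, sat_and, ih1, ih2]
  | all x φ ih => intro s; simp only [interp, sat_all, ih]

/-- Two structures that agree on the symbols of `K` satisfy the same formulas of `K`. -/
theorem val_congr_str {S S' : Str M} {K : Lang}
    (hf : ∀ a f w, (a, f) ∈ K.funs → S.fnI a f w = S'.fnI a f w) (s : ℕ → M) {t : Tm}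
    (ht : InLangT K t) : S.val s t = S'.val s t := by
  induction t with
  | var n => rfl
  | func f ts ih => simp only [val, hf _ _ _ ht.1, fun i => ih i (ht.2 i)]

theorem sat_congr_str {S S' : Str M} {K : Lang}
    (hf : ∀ a f w, (a, f) ∈ K.funs → S.fnI a f w = S'.fnI a f w)
    (hr : ∀ a R w, (a, R) ∈ K.rels → (S.relI a R w ↔ S'.relI a R w)) {φ : Fml} (hφ : φ.In K) :
    ∀ s : ℕ → M, S.Sat s φ ↔ S'.Sat s φ := by
  induction φ with
  | eq t u =>
    intro s
    simp only [sat_eq, val_congr_str hf s hφ.1, val_congr_str hf s hφ.2]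
  | rel a R ts =>
    intro s
    rw [sat_rel, sat_rel, hr _ _ _ hφ.1]
    simp only [fun i => val_congr_str hf s (hφ.2 i)]
  | neg φ ih => intro s; simp only [sat_neg, ih hφ]
  | and φ ψ ih1 ih2 => intro s; simp only [sat_and, ih1 hφ.1, ih2 hφ.2]
  | all x φ ih => intro s; simp only [sat_all, ih hφ]

/-! ### Truth in the universes -/

/-- The formula `φ` is true in the internal structure `U`, seen from outside. -/
def Holds (U : M) (φ : Fml) : Prop := ∀ D I, S.IsPair U D I →
  ∀ _ : Nonempty {d // S.E d D}, (S.innerStr D I).Valid φ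

/-- Truth in `U` is closed under logical consequence. -/
theorem Holds.mono {U : M} {Γ : Set Fml} {ψ : Fml} (h : ∀ φ ∈ Γ, S.Holds U φ)
    (hψ : ∀ (N : Type) (S' : Str N), (∀ φ ∈ Γ, S'.Valid φ) → S'.Valid ψ) : S.Holds U ψ :=
  fun D I hp hne => hψ _ _ fun φ hφ => h φ hφ D I hp hne

section
variable {S}

theorem satI_code [S.IsBasic] (hva : S.HasVA) {K : Lang} (hK : S.HasSat K) {U D I : M}
    (hp : S.IsPair U D I) (hU : S.IsStructOn K D I) [Nonempty {d // S.E d D}] {φ : Fml} (hφ : φ.In K)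
    {f : M} (hf : S.IsVA f D) :
    S.SatI K U (S.numI (code φ)) f ↔ (S.innerStr D I).Sat (S.asg D f) φ := by
  obtain ⟨ev, sa, hev, hsa, h⟩ := hK U D I ⟨hp, D, I, hp, hU⟩
  rw [h, S.pairMem_code hva hU hev hsa hφ hf]
  exact ⟨fun h => h.2.2, fun h => ⟨S.isForm_code hφ, hf, h⟩⟩

theorem isVAof_iff [S.IsBasic] {U D I : M} (hp : S.IsPair U D I) (f : M) :
    S.IsVAof f U ↔ S.IsVA f D := by
  constructor
  · rintro ⟨D', I', hp', h⟩
    obtain ⟨rfl, -⟩ := S.op_inj.1 ((S.isPair_iff.1 hp).symm.trans (S.isPair_iff.1 hp'))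
    exact h
  · exact fun h => ⟨D, I, hp, h⟩

theorem isStructOn_of_isStruct [S.IsBasic] {K : Lang} {U D I : M} (hp : S.IsPair U D I)
    (hU : S.IsStruct K U) : S.IsStructOn K D I := by
  obtain ⟨D', I', hp', h⟩ := hU
  obtain ⟨rfl, rfl⟩ := S.op_inj.1 ((S.isPair_iff.1 hp).symm.trans (S.isPair_iff.1 hp'))
  exact h

theorem holds_iff [S.IsBasic] {U D I : M} (hp : S.IsPair U D I) [h : Nonempty {d // S.E d D}]
    (φ : Fml) : S.Holds U φ ↔ (S.innerStr D I).Valid φ := by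
  refine ⟨fun h' => h' D I hp h, fun h' D' I' hp' hne => ?_⟩
  obtain ⟨rfl, rfl⟩ := S.op_inj.1 ((S.isPair_iff.1 hp).symm.trans (S.isPair_iff.1 hp'))
  exact h'

theorem forall_satI_iff [S.IsBasic] (hva : S.HasVA) {K : Lang} (hK : S.HasSat K) {U : M}
    (hU : S.IsStruct K U) {φ : Fml} (hφ : φ.In K) :
    (∀ f, S.IsVAof f U → S.SatI K U (S.numI (code φ)) f) ↔ S.Holds U φ := by
  obtain ⟨D, I, hp, hU⟩ := hU
  have : Nonempty {d // S.E d D} := let ⟨d, hd⟩ := hU.1; ⟨⟨d, hd⟩⟩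
  rw [holds_iff hp, ← S.forall_asg_iff hva]
  simp only [isVAof_iff hp]
  exact forall_congr' fun f => imp_congr_right fun hf => satI_code hva hK hp hU hφ hf

variable {LT LR : Lang} {Uni Mod₀ Mod : Fml}

/-- Every universe is an internal structure, and there internal truth of a standard formula under
all internal assignments is validity seen from outside. -/
theorem Suff.valid_allModel (hS : S.Suff LT LR Uni Mod₀ Mod) (H : Setting LT LR Uni Mod₀ Mod) (k : ℕ)
    {φ : Fml} (hφ : φ.In LT) :
    S.Valid (allModel LT Uni k φ) ↔ ∀ U, S.UniAt Uni (S.numI k) U → S.Holds U φ := by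
  have := hS.toIsBasic
  have : Nonempty M := ⟨S.zero⟩
  simp only [Valid, allModel, sat_all, sat_imp, sat_stage, S.sat_iff_uniAt H.uni_fv, sat_at, sat_models]
  simp
  refine forall_congr' fun U => imp_congr_right fun hU => ?_
  rw [← forall_satI_iff hS.va hS.sat_T (hS.uni_struct _ U ⟨S.isNat_numI k, hU⟩) hφ]

/-- The expansion of a universe at the stage `k` is the universe with the meaning that the stage `k`
gives to `Uni` and `Mod` in it. -/
theorem Suff.satI_expansion (hS : S.Suff LT LR Uni Mod₀ Mod) (H : Setting LT LR Uni Mod₀ Mod)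
    {k : ℕ} {U V D I : M} (hp : S.IsPair U D I) (hU : S.IsStructOn LT D I)
    (hV : S.IsExpansion LT LR (S.numI (code Uni)) (S.numI (code Mod)) U (S.numI k) V)
    [Nonempty {d // S.E d D}] {φ : Fml} (hφ : φ.In LR.um) {g : M} (hg : S.IsVA g D) :
    S.SatI LR.um V (S.numI (code φ)) g ↔
      (S.innerStr D I).Sat (S.asg D g) (interp Uni Mod k φ) := by
  have := hS.toIsBasic
  obtain ⟨D', I', J, c, hp1, hp', hc, hV, h1, h2, h3⟩ := hV
  obtain ⟨rfl, rfl⟩ := S.op_inj.1 ((S.isPair_iff.1 hp).symm.trans (S.isPair_iff.1 hp1))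
  -- Since the stage is standard, its numeral code is the standard one; the expansion thus uses the
  -- extension of an actual formula, `stage k Uni` or `stage k Mod`, whose numeral is evaluated
  -- inside the universe.
  obtain rfl := S.isNumCode_numI hc
  have hV := isStructOn_of_isStruct hp' hV
  rw [satI_code hS.va hS.sat_R hp' hV hφ hg, sat_interp _ H.uni_fv H.mod_fv]
  generalize S.asg D g = s
  refine sat_congr_str (K := LR.um) (fun a f w hf => ?_) (fun a R w hR => ?_) hφ s
  · have e : ∀ d, S.PairMem (S.numI (funSymCode (a, f))) d I ↔ _ :=
      h1 _ (List.mem_append_left _ (List.mem_map_of_mem hf))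
    change (S.innerStr D J).fnI a f w = (S.innerStr D I).fnI a f w
    simp only [innerStr, e]
  · have two : ∀ {χ : Fml}, χ.In baseLang → (stage k χ).In LT :=
      fun h => (in_stage h).mono (H.base_sub.trans H.sub)
    rcases List.mem_cons.1 hR with h | hR
    · obtain ⟨rfl, rfl⟩ := Prod.mk.inj h
      obtain ⟨r, hr, -⟩ := hV.2.2.2 uniSym List.mem_cons_self
      obtain ⟨q, hq⟩ := S.isTuple_exists fun i => (w i).1
      have e : (fun i => (w i).1) = ![(w 0).1] := by funext i; fin_cases i; rfl
      have e1 : (S.innerStr D J).relI 1 0 w ↔ S.E q r := by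
        constructor
        · rintro ⟨q', y, hq', hy, h⟩
          obtain rfl := S.isTuple_unique hq hq'
          obtain rfl := (hr y).1 hy
          exact h
        · exact fun h => ⟨q, r, hq, (hr r).2 rfl, h⟩
      rw [e1, h2 r ((hr r).2 rfl) _ q ⟨(w 0).2, e ▸ hq⟩, stageI_numI]
      change _ ↔ (S.innerStr D I).UniAt Uni _ (w 0)
      constructor
      · rintro ⟨f, hf, h4, h5⟩
        rw [satI_code hS.va hS.sat_T hp hU (two H.uni_in) hf, sat_stage,
          sat_iff_uniAt _ H.uni_fv] at h5
        rw [← (S.asg_eq_iff hf 1 (w 0)).2 h4]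
        simpa using h5
      · intro h
        obtain ⟨f, hf, h4⟩ := S.exists_asg hS.va (fun _ => w 0) {1}
        have h4 := h4 1 (by simp)
        refine ⟨f, hf, (S.asg_eq_iff hf 1 (w 0)).1 h4, ?_⟩
        rw [satI_code hS.va hS.sat_T hp hU (two H.uni_in) hf, sat_stage, sat_iff_uniAt _ H.uni_fv]
        simpa [h4] using h
    rcases List.mem_cons.1 hR with h | hR
    · obtain ⟨rfl, rfl⟩ := Prod.mk.inj h
      obtain ⟨r, hr, -⟩ := hV.2.2.2 modSym (List.mem_cons_of_mem _ List.mem_cons_self)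
      obtain ⟨q, hq⟩ := S.isTuple_exists fun i => (w i).1
      have e1 : (S.innerStr D J).relI 3 0 w ↔ S.E q r := by
        constructor
        · rintro ⟨q', y, hq', hy, h⟩
          obtain rfl := S.isTuple_unique hq hq'
          obtain rfl := (hr y).1 hy
          exact h
        · exact fun h => ⟨q, r, hq, (hr r).2 rfl, h⟩
      rw [e1, h3 r ((hr r).2 rfl) _ q ⟨fun i => (w i).2, hq⟩, stageI_numI]
      change _ ↔ (S.innerStr D I).ModAt Mod _ (w 0) (w 1) (w 2)
      constructor
      · rintro ⟨f, hf, h4, h5, h6, h7⟩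
        rw [satI_code hS.va hS.sat_T hp hU (two H.mod_in) hf, sat_stage,
          sat_iff_modAt _ H.mod_fv] at h7
        rw [← (S.asg_eq_iff hf 1 (w 0)).2 h4, ← (S.asg_eq_iff hf 2 (w 1)).2 h5,
          ← (S.asg_eq_iff hf 3 (w 2)).2 h6]
        simpa using h7
      · intro h
        -- The three arguments are placed at x₁, x₂, x₃. The entry at x₀ is a dummy, because `stage`
        -- overrides that variable.
        obtain ⟨f, hf, h4⟩ := S.exists_asg hS.va (lst s [w 0, w 0, w 1, w 2]) {1, 2, 3}
        have h5 := h4 1 (by simp)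
        have h6 := h4 2 (by simp)
        have h7 := h4 3 (by simp)
        simp only [lst_one, lst_two, lst_three] at h5 h6 h7
        refine ⟨f, hf, (S.asg_eq_iff hf 1 _).1 h5, (S.asg_eq_iff hf 2 _).1 h6,
          (S.asg_eq_iff hf 3 _).1 h7, ?_⟩
        rw [satI_code hS.va hS.sat_T hp hU (two H.mod_in) hf, sat_stage, sat_iff_modAt _ H.mod_fv]
        simpa [h5, h6, h7] using h
    · have e : ∀ d, S.PairMem (S.numI (relSymCode (a, R))) d I ↔ _ :=
        h1 _ (List.mem_append_right _ (List.mem_map_of_mem hR))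
      rw [atStage, withUM_rel _ (fun h => H.uni_notMem (h ▸ H.sub.2 _ hR))
        (fun h => H.mod_notMem (h ▸ H.sub.2 _ hR))]
      simp only [innerStr, e]

theorem sat_atStage_base (S : Str M) {n : M} {φ : Fml} (hφ : φ.In baseLang) (s : ℕ → M) :
    (S.atStage Uni Mod n).Sat s φ ↔ S.Sat s φ :=
  sat_congr_str (S := S.atStage Uni Mod n) (S' := S) (K := baseLang) (fun _ _ _ _ => rfl) (fun a R w h => S.withUM_rel
    (by rintro h'; rw [h'] at h; simp [baseLang, uniSym] at h)
    (by rintro h'; rw [h'] at h; simp [baseLang, modSym] at h)) hφ s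

theorem sat_atStage_uniR (S : Str M) {n : M} (t : Tm) (s : ℕ → M) :
    (S.atStage Uni Mod n).Sat s (uniR t) ↔ S.UniAt Uni n (S.val s t) := by
  rw [uniR, sat_rel]
  simp only [atStage, val_withUM]
  rfl

theorem sat_atStage_modR (S : Str M) {n : M} (t u w : Tm) (s : ℕ → M) :
    (S.atStage Uni Mod n).Sat s (modR t u w) ↔
      S.ModAt Mod n (S.val s t) (S.val s u) (S.val s w) := by
  rw [modR, sat_rel]
  simp only [atStage, val_withUM]
  rfl

section
variable {n : M}

theorem atStage_isNat {x : M} : (S.atStage Uni Mod n).IsNat x ↔ S.IsNat x := Iff.rfl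
theorem atStage_isForm {K : Lang} {φ : M} :
    (S.atStage Uni Mod n).IsForm K φ ↔ S.IsForm K φ := by
  simpa using sat_atStage_base (Uni := Uni) (Mod := Mod) (n := n) S (in_isForm K) fun _ => φ
theorem atStage_isVAof {f U : M} : (S.atStage Uni Mod n).IsVAof f U ↔ S.IsVAof f U := Iff.rfl
theorem atStage_pairMem {x y r : M} :
    (S.atStage Uni Mod n).PairMem x y r ↔ S.PairMem x y r := Iff.rfl
theorem atStage_agreeOff {f g x : M} :
    (S.atStage Uni Mod n).AgreeOff f g x ↔ S.AgreeOff f g x := Iff.rfl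

end

/-- At stage k+1 the defining equivalence makes `Mod` truth in an expansion, which `satI_expansion`
converts into truth of I_k(φ) in the universe. The conversion works for every expansion, so its
uniqueness plays no role here. -/
theorem Suff.valid_interp_box (hS : S.Suff LT LR Uni Mod₀ Mod) (H : Setting LT LR Uni Mod₀ Mod)
    (k : ℕ) {φ : Fml} (hφ : φ.In LR.um) : S.Valid (interp Uni Mod (k + 1) (box φ)) ↔
      ∀ U, S.UniAt Uni (S.numI (k + 1)) U → S.Holds U (interp Uni Mod k φ) := by
  have := hS.toIsBasic
  have : Nonempty M := ⟨S.zero⟩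
  have e : S.Valid (interp Uni Mod (k + 1) (box φ)) ↔ ∀ U, S.UniAt Uni (S.numI (k + 1)) U →
      ∀ f, S.IsVAof f U → S.ModAt Mod (S.numI (k + 1)) U (S.numI (code φ)) f := by
    simp only [Valid, sat_interp _ H.uni_fv H.mod_fv, box, sat_all, sat_imp, sat_atStage_uniR,
      sat_atStage_modR, sat_atStage_base S (Fml.In.at in_isVAof (ts := [v 3, v 1]) (by simp)), sat_at]
    simp
  rw [e]
  refine forall_congr' fun U => imp_congr_right fun hUni => ?_
  have hst := hS.uni_struct _ U ⟨S.isNat_numI (k + 1), hUni⟩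
  obtain ⟨V, hV⟩ := hS.exists_expansion _ U ⟨S.isNat_numI k, hst⟩
  obtain ⟨D, I, hp, hU⟩ := hst
  have : Nonempty {d // S.E d D} := let ⟨d, hd⟩ := hU.1; ⟨⟨d, hd⟩⟩
  rw [holds_iff hp, ← S.forall_asg_iff hS.va]
  simp only [isVAof_iff hp]
  refine forall_congr' fun f => imp_congr_right fun hf => ?_
  rw [hS.revision]
  constructor
  · rintro ⟨-, -, -, -, -, h⟩
    obtain ⟨V', hV', h⟩ := h _ ⟨S.isNat_numI k, rfl⟩
    exact (hS.satI_expansion H hp hU hV' hφ hf).1 h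
  · intro h
    refine ⟨S.isNat_numI _, hUni, S.isForm_code hφ, ⟨D, I, hp, hf⟩,
      fun h => (S.suc_ne_zero _ h).elim, fun m hm => ⟨V, ?_, ?_⟩⟩
    · rw [← S.suc_inj hm.2]; exact hV
    · exact (hS.satI_expansion H hp hU hV hφ hf).2 h

theorem Suff.uniAt_of_le (hS : S.Suff LT LR Uni Mod₀ Mod) {m n : ℕ} (h : m ≤ n) {U : M}
    (hU : S.UniAt Uni (S.numI n) U) : S.UniAt Uni (S.numI m) U := by
  induction n, h using Nat.le_induction with
  | base => exact hU
  | succ n _ ih => exact ih (hS.uni_anti _ U ⟨S.isNat_numI n, hU⟩)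

end

end Str
end Multiverse

namespace Multiverse

set_option linter.unusedSimpArgs false

variable {M : Type}

namespace Str
variable (S : Str M)

/-! ### Uniqueness of expansions -/

section
variable [hS : S.IsZF]

/-- Here n may be nonstandard, so the comparison of the two functions is an induction inside the
model. -/
theorem isNumCode_unique {n c c' : M} (hn : S.IsNat n) (h : S.IsNumCode n c)
    (h' : S.IsNumCode n c') : c = c' := by
  obtain ⟨g, h1, h2, h3, h4⟩ := h
  obtain ⟨g', h1', h2', h3', h4'⟩ := h'
  have key : ∀ {i}, S.IsNat i → S.E i (S.suc n) → ∃ x, S.PairMem i x g ∧ S.PairMem i x g' := by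
    intro i hi
    refine S.nat_induction (fun i => S.E i (S.suc n) → ∃ x, S.PairMem i x g ∧ S.PairMem i x g')
      ?_ ?_ hi
    · exact fun _ => ⟨_, h2, h2'⟩
    · intro i hi ih hin
      have hi' : S.E i n := by
        rcases S.mem_suc.1 hin with h | h
        · exact S.nat_trans hn h (S.mem_suc.2 (.inr rfl))
        · rw [← h]; exact S.mem_suc.2 (.inr rfl)
      obtain ⟨x, hx, hx'⟩ := ih (S.mem_suc.2 (.inl hi'))
      exact ⟨_, h3 i x ⟨hi', hx⟩, h3' i x ⟨hi', hx'⟩⟩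
  obtain ⟨x, hx, hx'⟩ := key hn (S.mem_suc.2 (.inr rfl))
  rw [h1 _ _ _ ⟨h4, hx⟩, h1' _ _ _ ⟨h4', hx'⟩]

theorem interp_ext {K : Lang} {D J J' : M} (hJ : S.IsStructOn K D J) 
    (h : ∀ k ∈ symCodes K, ∀ r, S.PairMem (S.numI k) r J → S.PairMem (S.numI k) r J') {p : M}
    (hp : S.E p J) : S.E p J' := by
  obtain ⟨k, hk, r, hr⟩ := hJ.2.1 p hp
  obtain ⟨p', hp', h⟩ := h k hk r ⟨p, hr, hp⟩
  rwa [S.isPair_iff.1 hr, ← S.isPair_iff.1 hp']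

/-- The defining equivalence asks only for some expansion, and the compositional axiom for negation
would fail if two expansions disagreed. Every symbol has a determined value, and the interpretation
functions contain nothing but pairs for symbols, so extensionality applies. -/
theorem isExpansion_unique {LT LR : Lang} {U n u m V V' : M} (hn : S.IsNat n)
    (h : S.IsExpansion LT LR u m U n V) (h' : S.IsExpansion LT LR u m U n V') : V = V' := by
  obtain ⟨D, I, J, c, hp, hV, hc, hs, h1, h2, h3⟩ := h
  obtain ⟨D', I', J', c', hp', hV', hc', hs', h1', h2', h3'⟩ := h'
  obtain ⟨rfl, rfl⟩ := S.op_inj.1 ((S.isPair_iff.1 hp).symm.trans (S.isPair_iff.1 hp'))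
  obtain rfl := S.isNumCode_unique hn hc hc'
  have hs := isStructOn_of_isStruct hV hs
  have hs' := isStructOn_of_isStruct hV' hs'
  rw [S.isPair_iff.1 hV, S.isPair_iff.1 hV']
  congr 1
  have key : ∀ k ∈ symCodes LR.um, ∀ r, S.PairMem (S.numI k) r J ↔ S.PairMem (S.numI k) r J' := by
    intro k hk
    have : k ∈ symCodes LR ∨ k = relSymCode uniSym ∨ k = relSymCode modSym := by
      simp only [symCodes, Lang.um, List.map_cons, List.mem_append, List.mem_cons] at hk ⊢
      tauto
    rcases this with hk | rfl | rfl
    · exact fun r => (h1 k hk r).symm.trans (h1' k hk r)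
    · obtain ⟨r, hr, hrel⟩ := hs.2.2.2 uniSym List.mem_cons_self
      obtain ⟨r', hr', hrel'⟩ := hs'.2.2.2 uniSym List.mem_cons_self
      have e : ∀ w : Fin 1 → M, w = ![w 0] := fun w => by funext i; fin_cases i; rfl
      have : r = r' := by
        refine S.ext fun q => ⟨fun hq => ?_, fun hq => ?_⟩
        · obtain ⟨w, hw, ht⟩ : ∃ w : Fin 1 → M, (∀ i, S.E (w i) D) ∧ S.IsTuple 1 q w := hrel q hq
          rw [e w] at ht
          exact (h2' r' ((hr' _).2 rfl) _ q ⟨hw 0, ht⟩).2 ((h2 r ((hr _).2 rfl) _ q ⟨hw 0, ht⟩).1 hq)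
        · obtain ⟨w, hw, ht⟩ : ∃ w : Fin 1 → M, (∀ i, S.E (w i) D) ∧ S.IsTuple 1 q w := hrel' q hq
          rw [e w] at ht
          exact (h2 r ((hr _).2 rfl) _ q ⟨hw 0, ht⟩).2 ((h2' r' ((hr' _).2 rfl) _ q ⟨hw 0, ht⟩).1 hq)
      intro y
      rw [hr, hr', this]
    · obtain ⟨r, hr, hrel⟩ := hs.2.2.2 modSym (List.mem_cons_of_mem _ List.mem_cons_self)
      obtain ⟨r', hr', hrel'⟩ := hs'.2.2.2 modSym (List.mem_cons_of_mem _ List.mem_cons_self)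
      have : r = r' := by
        refine S.ext fun q => ⟨fun hq => ?_, fun hq => ?_⟩
        · obtain ⟨w, hw⟩ := hrel q hq
          exact (h3' r' ((hr' _).2 rfl) _ q hw).2 ((h3 r ((hr _).2 rfl) _ q hw).1 hq)
        · obtain ⟨w, hw⟩ := hrel' q hq
          exact (h3 r ((hr _).2 rfl) _ q hw).2 ((h3' r' ((hr' _).2 rfl) _ q hw).1 hq)
      intro y
      rw [hr, hr', this]
  exact S.ext fun p => ⟨S.interp_ext hs fun k hk r => (key k hk r).1,
    S.interp_ext hs' fun k hk r => (key k hk r).2⟩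

variable {S} {LT LR : Lang} {Uni Mod₀ Mod : Fml}

/-- On each universe, `Mod` at a successor stage is satisfaction in one fixed structure with the
same assignments; the compositional axioms are then Tarski's clauses. The stage may be nonstandard,
as needed when it becomes a variable. -/
theorem Suff.modAt_suc (hS : S.Suff LT LR Uni Mod₀ Mod) {U m : M} (hm : S.IsNat m)
    (hU : S.UniAt Uni (S.suc m) U) : ∃ D J ev sa, (∀ f, S.IsVAof f U ↔ S.IsVA f D) ∧
      S.EvalClauses LR.um D J ev ∧ S.SatClauses LR.um D J ev sa ∧
      ∀ φ f, S.ModAt Mod (S.suc m) U φ f ↔ S.IsForm LR.um φ ∧ S.IsVA f D ∧ S.PairMem φ f sa := by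
  obtain ⟨V, hV⟩ := hS.exists_expansion m U ⟨hm, hS.uni_struct _ U ⟨hm.suc, hU⟩⟩
  obtain ⟨D, I, J, c, hp, hp', -, hst, -⟩ := id hV
  obtain ⟨ev, sa, hev, hsa, h⟩ := hS.sat_R V D J ⟨hp', hst⟩
  refine ⟨D, J, ev, sa, isVAof_iff hp, hev, hsa, fun φ f => ?_⟩
  rw [hS.revision, ← h, isVAof_iff hp]
  constructor
  · rintro ⟨-, -, -, -, -, h'⟩
    obtain ⟨V', hV', h'⟩ := h' m ⟨hm, rfl⟩
    rwa [S.isExpansion_unique hm hV hV']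
  · intro h'
    obtain ⟨h4, h5, -⟩ := (h φ f).1 h'
    refine ⟨hm.suc, hU, h4, h5, fun h => (S.suc_ne_zero _ h).elim, fun k hk => ⟨V, ?_, h'⟩⟩
    rw [← S.suc_inj hk.2]
    exact hV

/-! ### The compositional axioms at positive stages -/

theorem Suff.valid_cmEq (hS : S.Suff LT LR Uni Mod₀ Mod) {m : M} (hm : S.IsNat m) :
    (S.atStage Uni Mod (S.suc m)).Valid cmEq := by
  intro s
  simp only [cmEq, sat_all, sat_imp, sat_iff, sat_atStage_uniR, sat_atStage_modR]
  simp [atStage_isNat, atStage_isForm, atStage_isVAof, atStage_pairMem,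
    atStage_agreeOff, sat_at]
  intro U hU f hf x y hx hy
  obtain ⟨D, J, ev, sa, h1, hev, hsa, h2⟩ := hS.modAt_suc hm hU
  have hf := (h1 f).1 hf
  have ht : S.IsTerm LR.um (S.varI x) := .var hx
  have hu : S.IsTerm LR.um (S.varI y) := .var hy
  rw [h2, (hsa f hf).1 _ _ ⟨ht, hu⟩]
  simp only [(hev f hf).1 _ _ hx, (hev f hf).1 _ _ hy]
  exact ⟨fun h => h.2.2, fun h => ⟨.eq ht hu, hf, h⟩⟩

theorem Suff.valid_cmNeg (hS : S.Suff LT LR Uni Mod₀ Mod) {m : M} (hm : S.IsNat m) {L' : Lang}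
    (hL : L'.Sub LR) : (S.atStage Uni Mod (S.suc m)).Valid (cmNeg L'.um) := by
  intro s
  simp only [cmNeg, sat_all, sat_imp, sat_iff, sat_neg, sat_atStage_uniR, sat_atStage_modR]
  simp [atStage_isNat, atStage_isForm, atStage_isVAof, atStage_pairMem,
    atStage_agreeOff, sat_at]
  intro U hU φ hφ f hf
  obtain ⟨D, J, ev, sa, h1, hev, hsa, h2⟩ := hS.modAt_suc hm hU
  have hf := (h1 f).1 hf
  have hφ := hφ.mono hL.um
  rw [h2, h2, (hsa f hf).2.2.1 φ hφ]
  have := hφ.neg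
  tauto

theorem Suff.valid_cmAnd (hS : S.Suff LT LR Uni Mod₀ Mod) {m : M} (hm : S.IsNat m) {L' : Lang}
    (hL : L'.Sub LR) : (S.atStage Uni Mod (S.suc m)).Valid (cmAnd L'.um) := by
  intro s
  simp only [cmAnd, sat_all, sat_imp, sat_iff, sat_and, sat_atStage_uniR, sat_atStage_modR]
  simp [atStage_isNat, atStage_isForm, atStage_isVAof, atStage_pairMem,
    atStage_agreeOff, sat_at]
  intro U hU φ ψ hφ hψ f hf
  obtain ⟨D, J, ev, sa, h1, hev, hsa, h2⟩ := hS.modAt_suc hm hU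
  have hf := (h1 f).1 hf
  have hφ := hφ.mono hL.um
  have hψ := hψ.mono hL.um
  rw [h2, h2, h2, (hsa f hf).2.2.2.1 φ ψ ⟨hφ, hψ⟩]
  have := hφ.and hψ
  tauto

theorem Suff.valid_cmAll (hS : S.Suff LT LR Uni Mod₀ Mod) {m : M} (hm : S.IsNat m) {L' : Lang}
    (hL : L'.Sub LR) : (S.atStage Uni Mod (S.suc m)).Valid (cmAll L'.um) := by
  intro s
  simp only [cmAll, sat_all, sat_imp, sat_iff, sat_and, sat_atStage_uniR, sat_atStage_modR]
  simp [atStage_isNat, atStage_isForm, atStage_isVAof, atStage_pairMem,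
    atStage_agreeOff, sat_at]
  intro U hU φ hφ f hf x hx
  obtain ⟨D, J, ev, sa, h1, hev, hsa, h2⟩ := hS.modAt_suc hm hU
  have hf := (h1 f).1 hf
  have hφ := hφ.mono hL.um
  simp only [h1, h2, (hsa f hf).2.2.2.2 φ x ⟨hφ, hx⟩]
  constructor
  · exact fun h g hg h' => ⟨hφ, hg, h.2.2 g ⟨hg, h'⟩⟩
  · exact fun h => ⟨.all hx hφ, hf, fun g hg => (h g hg.1 hg.2).2.2⟩

end

end Str
end Multiverse

namespace Multiverse

variable {M : Type}

/-! ### Models of `T_ω` -/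

section
variable {LT LR : Lang} {T : ℕ → Set Fml} {Uni Mod₀ Mod : Fml}

theorem IsRevisionParameters.setting (hpar : IsRevisionParameters LT LR T Uni Mod₀)
    (hM : Mod.In baseLang) (hM' : Mod.fv ⊆ {0, 1, 2, 3}) : Setting LT LR Uni Mod₀ Mod where
  base_sub := hpar.base_sub
  sub := hpar.sub
  uni_notMem := hpar.uni_notMem
  mod_notMem := hpar.mod_notMem
  uni_in := hpar.uni_in
  uni_fv := hpar.uni_fv
  mod₀_in := hpar.mod_in
  mod₀_fv := hpar.mod_fv.trans (by decide)
  mod_in := hM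
  mod_fv := hM'

theorem suff_of_valid (hpar : IsRevisionParameters LT LR T Uni Mod₀)
    (hMod : IsRevisionFormula LT (unionTheory T) LT LR Uni Mod₀ Mod) (S : Str M) [S.IsZF]
    (hS : ∀ φ ∈ unionTheory T, S.Valid φ) : S.Suff LT LR Uni Mod₀ Mod := by
  have H := hpar.setting hMod.1 hMod.2.1
  have hva : S.HasVA := ⟨fun D d hd => S.exists_VA_const hd,
    fun D f x d hf hx hd => S.exists_VA_update hf hx hd⟩
  have hsat : ∀ K, S.HasSat K := fun K U D I h =>
    S.exists_sat h.1 (Str.isStructOn_of_isStruct h.1 h.2)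
  have h0 : ∀ U, S.UniAt Uni S.zero U → S.IsStruct LT U := by
    intro U
    have := hpar.uni_struct.sound S (fun ψ h _ => hS ψ h) fun _ => U
    simpa [Str.sat_at, S.sat_iff_uniAt H.uni_fv, Str.numI] using this
  have ha : ∀ n U, S.IsNat n ∧ S.UniAt Uni (S.suc n) U → S.UniAt Uni n U := by
    intro n U
    have := hpar.uni_anti.sound S (fun ψ h _ => hS ψ h) (lst (fun _ => n) [n, U])
    simpa [Str.sat_at, S.sat_iff_uniAt H.uni_fv] using this
  -- The parameters provide the structure condition at stage 0 only; the descending chain of stages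
  -- carries it to every n by induction inside the model.
  have hu : ∀ n U, S.IsNat n ∧ S.UniAt Uni n U → S.IsStruct LT U := by
    rintro n U ⟨hn, hU⟩
    have inst : DP S fun p : Unit × M => S.UniAt Uni p.2 U :=
      DP.congr (fun x => by rw [S.sat_iff_uniAt H.uni_fv]; simp) (DP.ofList (S := S) H.uni_in
        [fun p : Unit × M => p.2, fun _ => U] (by simp [DT.p2, DT.const]))
    exact h0 U (S.nat_induction (fun n => S.UniAt Uni n U → S.UniAt Uni S.zero U) id
      (fun n hn ih h => ih (ha n U ⟨hn, h⟩)) hn hU)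
  exact {
    valid := fun φ h => Str.IsZF.valid φ (basicAx_subset φ h)
    va := hva
    sat_T := hsat LT
    sat_R := hsat LR.um
    uni_struct := hu
    uni_anti := ha
    exists_expansion := fun n U h =>
      S.exists_isExpansion H.sub H.uni_notMem H.mod_notMem h.2 h.1 _ _
    revision := (S.valid_revisionEquiv H.uni_fv H.mod₀_fv H.mod_fv).1
      (hMod.2.2.sound S fun ψ h _ => hS ψ h) }

end

/-! ### The stage as a variable -/

/-- The bound variables. -/
def Fml.bv : Fml → Finset ℕ
  | .eq _ _ => ∅
  | .rel _ _ _ => ∅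
  | .neg φ => φ.bv
  | .and φ ψ => φ.bv ∪ ψ.bv
  | .all x φ => insert x φ.bv

/-- The interpretation `I_k`, with the variable `c` for `k`. -/
def interpV (Uni Mod : Fml) (c : ℕ) : Fml → Fml
  | .eq t s => .eq t s
  | .rel 1 0 ts => Uni.at [v c, ts 0]
  | .rel 3 0 ts => Mod.at [v c, ts 0, ts 1, ts 2]
  | .rel a R ts => .rel a R ts
  | .neg φ => .neg (interpV Uni Mod c φ)
  | .and φ ψ => .and (interpV Uni Mod c φ) (interpV Uni Mod c ψ)
  | .all x φ => .all x (interpV Uni Mod c φ)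

section
variable {Uni Mod : Fml} {c : ℕ}

theorem interpV_rel {a R : ℕ} {ts : Fin a → Tm} (h : (a, R) ≠ uniSym)
    (h' : (a, R) ≠ modSym) : interpV Uni Mod c (.rel a R ts) = .rel a R ts := by
  unfold interpV
  split
  · simp_all
  · simp_all [uniSym]
  · simp_all [modSym]
  · exact Eq.symm ‹_›
  all_goals simp_all

theorem interpV_in (hU : Uni.In baseLang) (hM : Mod.In baseLang) {φ : Fml} (hφ : φ.In baseLang.um) :
    (interpV Uni Mod c φ).In baseLang := by
  induction φ with
  | eq t u => exact ⟨inLangT_um.1 hφ.1, inLangT_um.1 hφ.2⟩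
  | @rel a R ts =>
    have ht := fun i => inLangT_um.1 (hφ.2 i)
    by_cases h1 : (a, R) = uniSym
    · obtain ⟨rfl, rfl⟩ := Prod.mk.inj h1
      refine Fml.In.at hU fun t h => ?_
      simp only [List.mem_cons, List.not_mem_nil, or_false] at h
      rcases h with rfl | rfl
      exacts [trivial, ht 0]
    by_cases h2 : (a, R) = modSym
    · obtain ⟨rfl, rfl⟩ := Prod.mk.inj h2
      refine Fml.In.at hM fun t h => ?_
      simp only [List.mem_cons, List.not_mem_nil, or_false] at h
      rcases h with rfl | rfl | rfl | rfl
      exacts [trivial, ht 0, ht 1, ht 2]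
    rw [interpV_rel h1 h2]
    refine ⟨?_, ht⟩
    have := hφ.1
    simp only [Lang.um, List.mem_cons] at this
    tauto
  | neg φ ih => exact ih hφ
  | and φ ψ ih1 ih2 => exact ⟨ih1 hφ.1, ih2 hφ.2⟩
  | all x φ ih => exact ih hφ

theorem fv_at_subset {χ : Fml} {ts : List Tm} {A : Finset ℕ} (hχ : ∀ n ∈ χ.fv, n < ts.length)
    (h : ∀ t ∈ ts, t.varFinset ⊆ A) : (χ.at ts).fv ⊆ A := by
  intro n hn
  rw [Fml.at, Fml.fv_subst, Finset.mem_biUnion] at hn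
  obtain ⟨i, hi, hn⟩ := hn
  have hl := hχ i hi
  rw [List.getD_eq_getElem _ _ hl] at hn
  exact h _ (List.getElem_mem hl) hn

theorem fv_interpV (hU : Uni.fv ⊆ {0, 1}) (hM : Mod.fv ⊆ {0, 1, 2, 3}) (φ : Fml) :
    (interpV Uni Mod c φ).fv ⊆ insert c φ.fv := by
  induction φ with
  | eq t u => exact Finset.subset_insert _ _
  | @rel a R ts =>
    have hts : ∀ i, (ts i).varFinset ⊆ insert c (Fml.rel a R ts).fv := fun i n hn =>
      Finset.mem_insert_of_mem (Finset.mem_biUnion.2 ⟨i, Finset.mem_univ _, hn⟩)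
    have hc : (v c).varFinset ⊆ insert c (Fml.rel a R ts).fv := by
      simp [Language.Term.varFinset]
    by_cases h1 : (a, R) = uniSym
    · obtain ⟨rfl, rfl⟩ := Prod.mk.inj h1
      refine fv_at_subset (fun n hn => ?_) fun t h => ?_
      · have := hU hn
        simp only [Finset.mem_insert, Finset.mem_singleton] at this
        simp; omega
      · simp only [List.mem_cons, List.not_mem_nil, or_false] at h
        rcases h with rfl | rfl
        exacts [hc, hts 0]
    by_cases h2 : (a, R) = modSym
    · obtain ⟨rfl, rfl⟩ := Prod.mk.inj h2
      refine fv_at_subset (fun n hn => ?_) fun t h => ?_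
      · have := hM hn
        simp only [Finset.mem_insert, Finset.mem_singleton] at this
        simp; omega
      · simp only [List.mem_cons, List.not_mem_nil, or_false] at h
        rcases h with rfl | rfl | rfl | rfl
        exacts [hc, hts 0, hts 1, hts 2]
    rw [interpV_rel h1 h2]
    exact Finset.subset_insert _ _
  | neg φ ih => exact ih
  | and φ ψ ih1 ih2 =>
    intro n hn
    rcases Finset.mem_union.1 hn with h | h
    · have := ih1 h
      simp only [Fml.fv, Finset.mem_insert, Finset.mem_union] at this ⊢
      tauto
    · have := ih2 h
      simp only [Fml.fv, Finset.mem_insert, Finset.mem_union] at this ⊢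
      tauto
  | all x φ ih =>
    intro n hn
    obtain ⟨h1, h2⟩ := Finset.mem_erase.1 hn
    have := ih h2
    simp only [Fml.fv, Finset.mem_insert, Finset.mem_erase] at this ⊢
    tauto

/-- The variable for the stage must not be bound in φ, since a quantifier over it would change the
stage. -/
theorem Str.sat_interpV (S : Str M) (hU : Uni.fv ⊆ {0, 1}) (hM : Mod.fv ⊆ {0, 1, 2, 3}) {φ : Fml}
    (hc : c ∉ φ.bv) : ∀ s : ℕ → M,
    S.Sat s (interpV Uni Mod c φ) ↔ (S.atStage Uni Mod (s c)).Sat s φ := by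
  induction φ with
  | eq t u => intro s; simp only [interpV, sat_eq, atStage, val_withUM]
  | @rel a R ts =>
    intro s
    by_cases h1 : (a, R) = uniSym
    · obtain ⟨rfl, rfl⟩ := Prod.mk.inj h1
      rw [interpV, sat_at, S.sat_iff_uniAt hU, sat_rel]
      simp only [atStage, val_withUM]
      rfl
    by_cases h2 : (a, R) = modSym
    · obtain ⟨rfl, rfl⟩ := Prod.mk.inj h2
      rw [interpV, sat_at, S.sat_iff_modAt hM, sat_rel]
      simp only [atStage, val_withUM]
      rfl
    rw [interpV_rel h1 h2, sat_rel, sat_rel, atStage, S.withUM_rel h1 h2]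
    simp only [val_withUM]
  | neg φ ih => intro s; simp only [interpV, sat_neg, ih hc]
  | and φ ψ ih1 ih2 =>
    simp only [Fml.bv, Finset.mem_union, not_or] at hc
    intro s; simp only [interpV, sat_and, ih1 hc.1, ih2 hc.2]
  | all x φ ih =>
    simp only [Fml.bv, Finset.mem_insert, not_or] at hc
    intro s; simp only [interpV, sat_all, ih hc.2, Function.update_of_ne hc.1]

/-- Separation and Replacement for the formulas with `Uni` and `Mod` hold at all stages. -/
theorem Str.valid_sep_rep (S : Str M) [hS : S.IsZF] (hU : Uni.fv ⊆ {0, 1})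
    (hM : Mod.fv ⊆ {0, 1, 2, 3}) (hUi : Uni.In baseLang) (hMi : Mod.In baseLang) {θ : Fml}
    (hθ : θ ∈ Sep baseLang.um ∪ Rep baseLang.um) (n : M) : (S.atStage Uni Mod n).Valid θ := by
  intro s
  let c := fresh (θ.bv ∪ θ.fv)
  have hc : c ∉ θ.bv ∪ θ.fv := fresh_notMem _
  rw [Finset.mem_union, not_or] at hc
  -- The translation of an instance is an instance in the language of set theory, with the stage as
  -- a further parameter. Freshness of c keeps it apart from the two set variables of the schema.
  have key : interpV Uni Mod c θ ∈ ZF := by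
    rcases hθ with ⟨φ, x, a, b, hφ, hnd, ha, hb, rfl⟩ | ⟨φ, x, y, a, b, hφ, hnd, ha, hb, rfl⟩
    · refine .inl (.inr ⟨interpV Uni Mod c φ, x, a, b, interpV_in hUi hMi hφ, hnd, fun h => ?_,
        fun h => ?_, rfl⟩)
      · rcases Finset.mem_insert.1 (fv_interpV hU hM φ h) with h | h
        · exact hc.1 (by rw [← h]; simp [sepAx, Fml.bv])
        · exact ha h
      · rcases Finset.mem_insert.1 (fv_interpV hU hM φ h) with h | h
        · exact hc.1 (by rw [← h]; simp [sepAx, Fml.bv, Fml.ex])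
        · exact hb h
    · refine .inr ⟨interpV Uni Mod c φ, x, y, a, b, interpV_in hUi hMi hφ, hnd, fun h => ?_,
        fun h => ?_, rfl⟩
      · rcases Finset.mem_insert.1 (fv_interpV hU hM φ h) with h | h
        · exact hc.1 (by rw [← h]; simp [repAx, Fml.bv])
        · exact ha h
      · rcases Finset.mem_insert.1 (fv_interpV hU hM φ h) with h | h
        · exact hc.1 (by rw [← h]; simp [repAx, Fml.bv, Fml.ex, Fml.imp])
        · exact hb h
  have := hS.valid _ key (Function.update s c n)
  rw [S.sat_interpV hU hM hc.1, Function.update_self] at this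
  refine ((S.atStage Uni Mod n).sat_congr θ fun i hi => ?_).1 this
  rw [Function.update_of_ne]
  rintro rfl
  exact hc.2 hi

end

/-! ### Theorems of all late theories -/

theorem exists_stage_of_finite {α : Type} {Q : ℕ → α → Prop} {Γ : Set α} (hΓ : Γ.Finite)
    (h : ∀ φ ∈ Γ, ∃ A, ∀ k, A ≤ k → Q k φ) : ∃ A, ∀ k, A ≤ k → ∀ φ ∈ Γ, Q k φ := by
  induction Γ, hΓ using Set.Finite.induction_on with
  | empty => exact ⟨0, fun k _ φ h => absurd h (Set.notMem_empty _)⟩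
  | @insert a Γ _ _ ih =>
    obtain ⟨A, hA⟩ := ih fun φ hφ => h φ (.inr hφ)
    obtain ⟨B, hB⟩ := h a (.inl rfl)
    refine ⟨max A B, fun k hk φ hφ => ?_⟩
    rcases hφ with rfl | hφ
    · exact hB k (by omega)
    · exact hA k (by omega) φ hφ

section
variable {LT LR : Lang} {T : ℕ → Set Fml} {Uni Mod₀ Mod : Fml}

/-- A theorem of `T_ω` in all of whose models `φ` is true. -/
theorem proves_unionTheory (hZF : ∀ φ ∈ ZF, Proves LT (unionTheory T) φ)
    (hT : ∀ n, ∀ φ ∈ T n, φ.In LT) {φ : Fml} (hφ : φ.In LT)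
    (h : ∀ (M : Type) (S : Str M), S.IsZF → (∀ ψ ∈ unionTheory T, S.Valid ψ) → S.Valid φ) :
    Proves LT (unionTheory T) φ := by
  refine proves_of_valid hφ fun M S _ hS => ?_
  have hS' : ∀ ψ ∈ unionTheory T, S.Valid ψ := fun ψ hψ => hS ψ hψ (by
    obtain ⟨n, hn⟩ := hψ
    exact hT n ψ hn)
  exact h M S ⟨fun ψ hψ => (hZF ψ hψ).sound S fun χ hχ _ => hS' χ hχ⟩ hS'

/-- Each fact holds in all models of T_ω and is therefore one of its theorems; as the list is
finite, all late theories prove the whole list. -/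
theorem exists_stage_facts (hpar : IsRevisionParameters LT LR T Uni Mod₀)
    (hZF : ∀ φ ∈ ZF, Proves LT (unionTheory T) φ)
    (hMod : IsRevisionFormula LT (unionTheory T) LT LR Uni Mod₀ Mod) :
    ∃ A, ∀ k, A ≤ k → ∀ φ ∈ facts LT LR Uni Mod₀ Mod, Proves LT (T k) φ := by
  have H := hpar.setting hMod.1 hMod.2.1
  refine exists_stage_of_finite (Γ := {φ | φ ∈ facts LT LR Uni Mod₀ Mod})
    (List.finite_toSet _) fun φ hφ => Proves.exists_stage hpar.theory_succ ?_
  refine proves_unionTheory hZF hpar.theory_in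
    ((facts_in H.uni_in H.mod₀_in H.mod_in φ hφ).mono (H.base_sub.trans H.sub)) fun M S _ hS => ?_
  exact (S.valid_facts_iff H.uni_fv H.mod₀_fv H.mod_fv).2 (suff_of_valid hpar hMod S hS) φ hφ

/-- What is true at all positive stages is a theorem of all late theories. -/
theorem exists_stage_interp (hpar : IsRevisionParameters LT LR T Uni Mod₀)
    (hZF : ∀ φ ∈ ZF, Proves LT (unionTheory T) φ)
    (hMod : IsRevisionFormula LT (unionTheory T) LT LR Uni Mod₀ Mod) {θ : Fml}
    (hθ : θ.In baseLang.um)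
    (h : ∀ (M : Type) (S : Str M), S.IsZF → S.Suff LT LR Uni Mod₀ Mod → ∀ n, S.IsNat n →
      (S.atStage Uni Mod (S.suc n)).Valid θ) :
    ∃ A, ∀ k, A ≤ k → Proves LT (T k) (interp Uni Mod k θ) := by
  have H := hpar.setting hMod.1 hMod.2.1
  have hL := H.base_sub.trans H.sub
  let c := fresh (θ.bv ∪ θ.fv)
  have hc : c ∉ θ.bv ∪ θ.fv := fresh_notMem _
  rw [Finset.mem_union, not_or] at hc
  -- One formula covers all positive stages, so compactness gives a bound that does not depend on
  -- the stage. Stage 0 is excluded because `Mod₀` need not be compositional.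
  let χ := isNat.at [v c] ⋏ .neg (v c ≐ zeroT) ⇛ interpV Uni Mod c θ
  have hχ : Proves LT (unionTheory T) χ := by
    have hχ : χ.In baseLang := by simp [χ, interpV_in H.uni_in H.mod_in hθ]
    refine proves_unionTheory hZF hpar.theory_in (hχ.mono hL) fun M S _ hS s => ?_
    simp only [χ, Str.sat_imp, Str.sat_and, Str.sat_at, Str.sat_isNat, Str.sat_neg, Str.sat_eq,
      S.sat_interpV H.uni_fv H.mod_fv hc.1]
    simp
    intro h1 h2
    rcases S.nat_cases h1 with h3 | ⟨n, hn, h3⟩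
    · exact absurd h3 h2
    · rw [h3]
      exact h M S ‹_› (suff_of_valid hpar hMod S hS) n hn s
  obtain ⟨A, hA⟩ := hχ.exists_stage hpar.theory_succ
  obtain ⟨B, hB⟩ := exists_stage_facts hpar hZF hMod
  -- The summand 1 makes k positive; the basic axioms among the facts then ensure that the numeral
  -- of k differs from 0 in every model of T_k.
  refine ⟨A + B + 1, fun k hk => proves_of_valid ((interp_in H.uni_in H.mod_in
    (Lang.Sub.refl _) hθ).mono hL) fun M S _ hS s => ?_⟩
  have hF := (S.valid_facts_iff H.uni_fv H.mod₀_fv H.mod_fv).1 fun φ hφ =>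
    (hB k (by omega) φ hφ).sound S hS
  have := hF.toIsBasic
  have h1 := (hA k (by omega)).sound S hS (Function.update s c (S.numI k))
  simp only [χ, Str.sat_imp, Str.sat_and, Str.sat_at, Str.sat_isNat, Str.sat_neg, Str.sat_eq,
    S.sat_interpV H.uni_fv H.mod_fv hc.1] at h1
  simp only [Str.val_var, List.map, lst_zero, Function.update_self, Str.val_zeroT] at h1
  rw [S.sat_interp H.uni_fv H.mod_fv]
  have h2 := h1 ⟨S.isNat_numI k, by
    obtain ⟨j, rfl⟩ : ∃ j, k = j + 1 := ⟨k - 1, by omega⟩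
    exact S.suc_ne_zero _⟩
  refine ((S.atStage Uni Mod (S.numI k)).sat_congr θ fun i hi => ?_).1 h2
  rw [Function.update_of_ne]
  rintro rfl
  exact hc.2 hi

theorem zf_in {φ : Fml} (h : φ ∈ ZF) : φ.In baseLang := by
  rcases h with (h | ⟨φ, x, a, b, hφ, -, -, -, rfl⟩) | ⟨φ, x, y, a, b, hφ, -, -, -, rfl⟩
  · simp only [arithAx, List.mem_cons, List.not_mem_nil, or_false] at h
    rcases h with (rfl | rfl | rfl | rfl | rfl | rfl) | rfl | rfl | rfl | rfl | rfl | rfl | rfl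
    · simp [extAx]
    · simp [pairAx]
    · simp [unionAx]
    · simp [powerAx]
    · simp [infAx]
    · simp [foundAx]
    all_goals simp
  · simp [sepAx, hφ]
  · simp [repAx, hφ]

theorem cmMinus_in {L' : Lang} {θ : Fml} (h : θ ∈ CMminus L') : θ.In baseLang.um := by
  have hb : ∀ {φ : Fml}, φ.In baseLang → φ.In baseLang.um := fun h => h.mono baseLang.sub_um
  have hm : ∀ {t u : Tm}, InLangT baseLang t → InLangT baseLang u → (t ∊ u).In baseLang.um :=
    fun h1 h2 => hb (in_mem.2 ⟨h1, h2⟩)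
  have hu : ∀ {t : Tm}, InLangT baseLang t → (uniR t).In baseLang.um := fun h =>
    ⟨List.mem_cons_self, fun i => inLangT_um.2 (by fin_cases i; exact h)⟩
  have hmod : ∀ {t u w : Tm}, InLangT baseLang t → InLangT baseLang u → InLangT baseLang w →
      (modR t u w).In baseLang.um := fun h1 h2 h3 =>
    ⟨List.mem_cons_of_mem _ List.mem_cons_self, fun i => inLangT_um.2 (by
      fin_cases i; exacts [h1, h2, h3])⟩
  rcases h with ((h | ⟨φ, x, a, b, hφ, -, -, -, rfl⟩) | ⟨φ, x, y, a, b, hφ, -, -, -, rfl⟩) |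
    rfl | rfl | rfl | rfl
  · exact hb (zf_in h)
  · simp [sepAx, hφ, hm]
  · simp [repAx, hφ, hm]
  · simp [cmEq, hu, hmod, hb]
  · simp [cmNeg, hu, hmod, hb]
  · simp [cmAnd, hu, hmod, hb]
  · simp [cmAll, hu, hmod, hb]

theorem exists_stage_cmMinus (hpar : IsRevisionParameters LT LR T Uni Mod₀)
    (hZF : ∀ φ ∈ ZF, Proves LT (unionTheory T) φ)
    (hMod : IsRevisionFormula LT (unionTheory T) LT LR Uni Mod₀ Mod) {L' : Lang} (hL : L'.Sub LR)
    {θ : Fml} (hθ : θ ∈ CMminus L') :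
    ∃ A, ∀ k, A ≤ k → Proves LT (T k) (interp Uni Mod k θ) := by
  have H := hpar.setting hMod.1 hMod.2.1
  refine exists_stage_interp hpar hZF hMod (cmMinus_in hθ) fun M S _ hS n hn => ?_
  rcases hθ with ((h | h) | h) | rfl | rfl | rfl | rfl
  · exact fun s => (Str.sat_atStage_base S (zf_in h) s).2 (Str.IsZF.valid θ h s)
  · exact S.valid_sep_rep H.uni_fv H.mod_fv H.uni_in H.mod_in (.inl h) _
  · exact S.valid_sep_rep H.uni_fv H.mod_fv H.uni_in H.mod_in (.inr h) _
  · exact hS.valid_cmEq hn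
  · exact hS.valid_cmNeg hn hL
  · exact hS.valid_cmAnd hn hL
  · exact hS.valid_cmAll hn hL

end

end Multiverse

namespace Multiverse

/-! ### Necessitation and co-necessitation under the interpretations -/

section
variable {LT LR L' : Lang} {T : ℕ → Set Fml} {Uni Mod₀ Mod : Fml}

theorem Proves.mono_stage {L : Lang} (hin : ∀ n, ∀ φ ∈ T n, Proves L (T (n + 1)) φ) {m n : ℕ}
    (h : m ≤ n) {φ : Fml} (hφ : Proves L (T m) φ) : Proves L (T n) φ := by
  induction n, h using Nat.le_induction with
  | base => exact hφ
  | succ n _ ih => exact ih.trans fun ψ hψ _ => hin n ψ hψ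

theorem Proves.toUnion {L : Lang} {n : ℕ} {φ : Fml} (h : Proves L (T n) φ) :
    Proves L (unionTheory T) φ := h.trans fun ψ hψ hL => .ax ψ ⟨n, hψ⟩ hL

/-- The theory `T_k` proves the facts about the universes. -/
def HasFacts (LT LR : Lang) (T : ℕ → Set Fml) (Uni Mod₀ Mod : Fml) (A : ℕ) : Prop :=
  ∀ k, A ≤ k → ∀ φ ∈ facts LT LR Uni Mod₀ Mod, Proves LT (T k) φ

theorem suff_of_facts {M : Type} (H : Setting LT LR Uni Mod₀ Mod) {A k : ℕ}
    (hA : HasFacts LT LR T Uni Mod₀ Mod A) (hk : A ≤ k) (S : Str M)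
    (hS : ∀ ψ ∈ T k, ψ.In LT → S.Valid ψ) : S.Suff LT LR Uni Mod₀ Mod :=
  (S.valid_facts_iff H.uni_fv H.mod₀_fv H.mod_fv).1 fun φ hφ => (hA k hk φ hφ).sound S hS

theorem Setting.interp_in (H : Setting LT LR Uni Mod₀ Mod) {φ : Fml} (hφ : φ.In LR.um) (k : ℕ) :
    (interp Uni Mod k φ).In LR := Multiverse.interp_in H.uni_in H.mod_in H.base_sub hφ

theorem Setting.allModel_in (H : Setting LT LR Uni Mod₀ Mod) (k : ℕ) (φ : Fml) :
    (allModel LT Uni k φ).In LR := (in_allModel H.uni_in k φ).mono H.base_sub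

theorem box_in (φ : Fml) : (box φ).In baseLang.um := by
  have hu : (uniR (v 1)).In baseLang.um := ⟨List.mem_cons_self, fun i => by fin_cases i; trivial⟩
  have hm : (modR (v 1) (num (code φ)) (v 3)).In baseLang.um :=
    ⟨List.mem_cons_of_mem _ List.mem_cons_self, fun i => inLangT_um.2 (by
      fin_cases i; exacts [trivial, inLangT_num _, trivial])⟩
  have hv : isVAof.In baseLang.um := in_isVAof.mono baseLang.sub_um
  simp [box, hu, hm, hv]

theorem interp_logicalAx (H : Setting LT LR Uni Mod₀ Mod) {Γ : Set Fml} {φ : Fml}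
    (h : LogicalAx φ) (hφ : φ.In LR.um) (k : ℕ) : Proves LT Γ (interp Uni Mod k φ) :=
  proves_of_valid ((H.interp_in hφ k).mono H.sub) fun _ S _ _ s =>
    (S.sat_interp H.uni_fv H.mod_fv k φ s).2 (Str.valid_logicalAx _ h s)

/-- The interpretations preserve provability. -/
theorem interp_proves (H : Setting LT LR Uni Mod₀ Mod) {Γ Δ : Set Fml} {k : ℕ} {φ : Fml}
    (h : Proves LR.um Γ φ) (hΓ : ∀ ψ ∈ Γ, Proves LT Δ (interp Uni Mod k ψ)) :
    Proves LT Δ (interp Uni Mod k φ) := by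
  induction h with
  | ax φ h _ => exact hΓ φ h
  | logic φ h hφ => exact interp_logicalAx H h hφ k
  | mp φ ψ _ _ ih1 ih2 => exact .mp _ _ ih1 ih2
  | gen φ x _ ih => exact .gen _ x ih

/-- NEC* yields truth of I_k(φ) in all universes of stage k+1, and the facts in T_{k+1} identify
this with the translated Tr^□. -/
theorem nec_step (H : Setting LT LR Uni Mod₀ Mod) (hnec : AdmitsNec LT LR T Uni) {A k : ℕ}
    (hA : HasFacts LT LR T Uni Mod₀ Mod A) (hk : A ≤ k + 1) {φ : Fml} (hφ : φ.In LR.um)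
    (h : Proves LT (T k) (interp Uni Mod k φ)) :
    Proves LT (T (k + 1)) (interp Uni Mod (k + 1) (box φ)) := by
  have hin := H.interp_in hφ k
  have h1 := hnec k _ hin h
  refine proves_of_valid ((H.interp_in ((box_in φ).mono H.base_sub.um) _).mono H.sub)
    fun M S _ hS => ?_
  have hF := suff_of_facts H hA hk S hS
  rw [hF.valid_interp_box H k hφ, ← hF.valid_allModel H (k + 1) (hin.mono H.sub)]
  exact h1.sound S hS

/-- Universes of stage m are universes of stage k+1, so the translated Tr^□ gives truth of I_k(φ) in
all of them, and CONEC* applies at m. The theory may lie far above the stage, unlike in `nec_step`.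
-/
theorem conec_step (H : Setting LT LR Uni Mod₀ Mod) (hconec : AdmitsConec LT LR T Uni) {A k m : ℕ}
    (hA : HasFacts LT LR T Uni Mod₀ Mod A) (hm : A ≤ m) (hk : k + 1 ≤ m) {φ : Fml}
    (hφ : φ.In LR.um) (h : Proves LT (T m) (interp Uni Mod (k + 1) (box φ))) :
    Proves LT (T (m + 1)) (interp Uni Mod k φ) := by
  obtain ⟨n, rfl⟩ : ∃ n, m = n + 1 := ⟨m - 1, by omega⟩
  have hin := H.interp_in hφ k
  refine hconec n _ hin (proves_of_valid ((H.allModel_in _ _).mono H.sub) fun M S _ hS => ?_)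
  have hF := suff_of_facts H hA hm S hS
  rw [hF.valid_allModel H (n + 1) (hin.mono H.sub)]
  exact fun U hU => (hF.valid_interp_box H k hφ).1 (h.sound S hS) U (hF.uniAt_of_le hk hU)

/-- Finitely many theorems have a common bound, and one interpretation beyond it serves all of their
consequences. -/
theorem locallyInterprets_of (H : Setting LT LR Uni Mod₀ Mod) {Thms : Set Fml}
    (h : ∀ φ ∈ Thms, ∃ B, ∀ k, B ≤ k → Proves LT (unionTheory T) (interp Uni Mod k φ)) :
    LocallyInterprets LT (unionTheory T) LR.um Thms (Set.range (interp Uni Mod)) := by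
  intro Φ hΦ hsub
  obtain ⟨B, hB⟩ := exists_stage_of_finite hΦ fun φ hφ => h φ (hsub hφ)
  exact ⟨_, ⟨B, rfl⟩, fun φ hφ => interp_proves H hφ (hB B le_rfl)⟩

/-! ### Proofs with necessitation or with co-necessitation only -/

/-- The invariant ties the index of the theory to the stage, as NEC* requires; necessitation shifts
both by one. -/
theorem nec_interpreted (H : Setting LT LR Uni Mod₀ Mod) (hnec : AdmitsNec LT LR T Uni)
    {A : ℕ} (hA : HasFacts LT LR T Uni Mod₀ Mod A) (hL : L'.Sub LR) {Ax : Set Fml}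
    (hAx : ∀ φ ∈ Ax, ∃ B, ∀ k, B ≤ k → Proves LT (T k) (interp Uni Mod k φ))
    {ρ : List (Fml × Label)} (h : IsProof LR.um Ax (Sent L'.um) ∅ ρ) :
    ∀ φ ∈ ρ.map Prod.fst, ∃ B, ∀ k, B ≤ k → Proves LT (T k) (interp Uni Mod k φ) := by
  induction h with
  | nil => simp
  | ax ρ φ _ hφ _ ih =>
    rw [List.map_cons, List.forall_mem_cons]
    exact ⟨hAx φ hφ, ih⟩
  | logic ρ φ _ hφ hin ih =>
    rw [List.map_cons, List.forall_mem_cons]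
    exact ⟨⟨0, fun k _ => interp_logicalAx H hφ hin k⟩, ih⟩
  | mp ρ φ ψ _ h1 h2 ih =>
    rw [List.map_cons, List.forall_mem_cons]
    obtain ⟨B, hB⟩ := ih _ h1
    obtain ⟨C, hC⟩ := ih _ h2
    exact ⟨⟨B + C, fun k hk => .mp _ _ (hB k (by omega)) (hC k (by omega))⟩, ih⟩
  | gen ρ φ x _ h1 ih =>
    rw [List.map_cons, List.forall_mem_cons]
    obtain ⟨B, hB⟩ := ih _ h1
    exact ⟨⟨B, fun k hk => .gen _ x (hB k hk)⟩, ih⟩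
  | nec ρ φ _ h1 h2 ih =>
    rw [List.map_cons, List.forall_mem_cons]
    obtain ⟨B, hB⟩ := ih _ h1
    refine ⟨⟨A + B + 1, fun k hk => ?_⟩, ih⟩
    obtain ⟨k, rfl⟩ : ∃ n, k = n + 1 := ⟨k - 1, by omega⟩
    exact nec_step H hnec hA (by omega) (h2.1.mono hL.um) (hB k (by omega))
  | conec ρ φ _ _ h2 _ => exact absurd h2 (Set.notMem_empty _)

/-- Co-necessitation lowers the stage and raises the theory, so the invariant refers to T_ω; each
application descends to a suitable T_m by compactness. -/
theorem conec_interpreted (H : Setting LT LR Uni Mod₀ Mod) (hconec : AdmitsConec LT LR T Uni)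
    (hT : ∀ n, ∀ φ ∈ T n, Proves LT (T (n + 1)) φ)
    {A : ℕ} (hA : HasFacts LT LR T Uni Mod₀ Mod A) (hL : L'.Sub LR) {Ax : Set Fml}
    (hAx : ∀ φ ∈ Ax, ∃ B, ∀ k, B ≤ k → Proves LT (T k) (interp Uni Mod k φ))
    {ρ : List (Fml × Label)} (h : IsProof LR.um Ax ∅ (Sent L'.um) ρ) :
    ∀ φ ∈ ρ.map Prod.fst,
      ∃ B, ∀ k, B ≤ k → Proves LT (unionTheory T) (interp Uni Mod k φ) := by
  induction h with
  | nil => simp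
  | ax ρ φ _ hφ _ ih =>
    rw [List.map_cons, List.forall_mem_cons]
    obtain ⟨B, hB⟩ := hAx φ hφ
    exact ⟨⟨B, fun k hk => (hB k hk).toUnion⟩, ih⟩
  | logic ρ φ _ hφ hin ih =>
    rw [List.map_cons, List.forall_mem_cons]
    exact ⟨⟨0, fun k _ => interp_logicalAx H hφ hin k⟩, ih⟩
  | mp ρ φ ψ _ h1 h2 ih =>
    rw [List.map_cons, List.forall_mem_cons]
    obtain ⟨B, hB⟩ := ih _ h1
    obtain ⟨C, hC⟩ := ih _ h2
    exact ⟨⟨B + C, fun k hk => .mp _ _ (hB k (by omega)) (hC k (by omega))⟩, ih⟩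
  | gen ρ φ x _ h1 ih =>
    rw [List.map_cons, List.forall_mem_cons]
    obtain ⟨B, hB⟩ := ih _ h1
    exact ⟨⟨B, fun k hk => .gen _ x (hB k hk)⟩, ih⟩
  | nec ρ φ _ _ h2 _ => exact absurd h2 (Set.notMem_empty _)
  | conec ρ φ _ h1 h2 ih =>
    rw [List.map_cons, List.forall_mem_cons]
    obtain ⟨B, hB⟩ := ih _ h1
    refine ⟨⟨B, fun k hk => ?_⟩, ih⟩
    obtain ⟨C, hC⟩ := (hB (k + 1) (by omega)).exists_stage hT
    -- This m is late enough for the facts and for the premise, and it is at least k + 1, the stage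
    -- of the premise.
    exact (conec_step H hconec hA (m := A + C + k + 1) (by omega) (by omega) (h2.1.mono hL.um)
      (hC _ (by omega))).toUnion

/-! ### Proofs with both rules -/

/-- All facts, as one formula. -/
def factsF (LT LR : Lang) (Uni Mod₀ Mod : Fml) : Fml := conjs (facts LT LR Uni Mod₀ Mod)

/-- `θ` holds and is preserved by `j` successive relativizations to the universes of the stages
`k + 1, …, k + j`, from the inside out; and so are the facts. -/
def nested (LT LR : Lang) (Uni Mod₀ Mod : Fml) (k : ℕ) : ℕ → Fml → Fml
  | 0, θ => factsF LT LR Uni Mod₀ Mod ⋏ θ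
  | j + 1, θ => factsF LT LR Uni Mod₀ Mod ⋏
      allModel LT Uni (k + j + 1) (nested LT LR Uni Mod₀ Mod k j θ)

/-- Layers are added on the outside by definition, but the rules of the system act on the innermost
one, of stage k+1; this identity exposes it. -/
theorem nested_succ (k j : ℕ) (θ : Fml) : nested LT LR Uni Mod₀ Mod k (j + 1) θ =
    nested LT LR Uni Mod₀ Mod (k + 1) j
      (allModel LT Uni (k + 1) (factsF LT LR Uni Mod₀ Mod ⋏ θ)) := by
  induction j with
  | zero => rfl
  | succ j ih =>
    rw [nested, ih, nested]
    congr 2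
    omega

theorem Setting.factsF_in (H : Setting LT LR Uni Mod₀ Mod) :
    (factsF LT LR Uni Mod₀ Mod).In LR :=
  (in_conjs.2 (facts_in H.uni_in H.mod₀_in H.mod_in)).mono H.base_sub

theorem Setting.nested_in (H : Setting LT LR Uni Mod₀ Mod) (k j : ℕ) {θ : Fml} (hθ : θ.In LR) :
    (nested LT LR Uni Mod₀ Mod k j θ).In LR := by
  cases j with
  | zero => exact ⟨H.factsF_in, hθ⟩
  | succ j => exact ⟨H.factsF_in, H.allModel_in _ _⟩

theorem Str.valid_factsF {M : Type} (S : Str M) (H : Setting LT LR Uni Mod₀ Mod) :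
    S.Valid (factsF LT LR Uni Mod₀ Mod) ↔ S.Suff LT LR Uni Mod₀ Mod := by
  rw [← S.valid_facts_iff H.uni_fv H.mod₀_fv H.mod_fv]
  simp only [Valid, factsF, sat_conjs]
  exact ⟨fun h φ hφ s => h s φ hφ, fun h s φ hφ => h φ hφ s⟩

theorem Str.valid_and {M : Type} (S : Str M) {φ ψ : Fml} :
    S.Valid (φ ⋏ ψ) ↔ S.Valid φ ∧ S.Valid ψ :=
  ⟨fun h => ⟨fun s => (h s).1, fun s => (h s).2⟩, fun h s => ⟨h.1 s, h.2 s⟩⟩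

/-- Because each layer carries the facts, a consequence valid in all structures with the facts may
be drawn at the bottom and carried outward. A nonempty Γ guarantees that the facts are available. -/
theorem nested_valid_mono (H : Setting LT LR Uni Mod₀ Mod) {Γ : Set Fml} (hne : Γ.Nonempty)
    (hΓ : ∀ φ ∈ Γ, φ.In LR) {ψ : Fml} (hψ : ψ.In LR)
    (h : ∀ (M : Type) (S : Str M), S.Suff LT LR Uni Mod₀ Mod → (∀ φ ∈ Γ, S.Valid φ) → S.Valid ψ)
    (k j : ℕ) : ∀ (M : Type) (S : Str M),
    (∀ φ ∈ Γ, S.Valid (nested LT LR Uni Mod₀ Mod k j φ)) →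
      S.Valid (nested LT LR Uni Mod₀ Mod k j ψ) := by
  induction j with
  | zero =>
    intro M S hS
    simp only [nested, S.valid_and] at hS ⊢
    obtain ⟨χ, hχ⟩ := hne
    have hF := (hS χ hχ).1
    exact ⟨hF, h M S ((S.valid_factsF H).1 hF) fun φ hφ => (hS φ hφ).2⟩
  | succ j ih =>
    intro M S hS
    simp only [nested, S.valid_and] at hS ⊢
    obtain ⟨χ, hχ⟩ := hne
    have hF := (hS χ hχ).1
    have hF' := (S.valid_factsF H).1 hF
    refine ⟨hF, (hF'.valid_allModel H _ ((H.nested_in k j hψ).mono H.sub)).2 fun U hU => ?_⟩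
    refine Str.Holds.mono (Γ := nested LT LR Uni Mod₀ Mod k j '' Γ) S ?_ fun N S' hS' =>
      ih N S' fun φ hφ => hS' _ ⟨φ, hφ, rfl⟩
    rintro _ ⟨φ, hφ, rfl⟩
    exact (hF'.valid_allModel H _ ((H.nested_in k j (hΓ φ hφ)).mono H.sub)).1 (hS φ hφ).2 U hU

theorem nested_mono (H : Setting LT LR Uni Mod₀ Mod) {Δ : Set Fml} {Γ : Set Fml} (hne : Γ.Nonempty)
    (hΓ : ∀ φ ∈ Γ, φ.In LR) {ψ : Fml} (hψ : ψ.In LR)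
    (h : ∀ (M : Type) (S : Str M), S.Suff LT LR Uni Mod₀ Mod → (∀ φ ∈ Γ, S.Valid φ) → S.Valid ψ)
    {k j : ℕ} (hp : ∀ φ ∈ Γ, Proves LT Δ (nested LT LR Uni Mod₀ Mod k j φ)) :
    Proves LT Δ (nested LT LR Uni Mod₀ Mod k j ψ) :=
  proves_of_valid ((H.nested_in k j hψ).mono H.sub) fun M S _ hS =>
    nested_valid_mono H hne hΓ hψ h k j M S fun φ hφ => (hp φ hφ).sound S hS

theorem Proves.and {L : Lang} {Δ : Set Fml} {φ ψ : Fml} (h : Proves L Δ φ) (h' : Proves L Δ ψ) :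
    Proves L Δ (φ ⋏ ψ) :=
  proves_of_valid ⟨h.inLang, h'.inLang⟩ fun _ S _ hS =>
    S.valid_and.2 ⟨h.sound S hS, h'.sound S hS⟩

theorem Proves.right {L : Lang} {Δ : Set Fml} {φ ψ : Fml} (h : Proves L Δ (φ ⋏ ψ)) :
    Proves L Δ ψ :=
  proves_of_valid h.inLang.2 fun _ S _ hS => (S.valid_and.1 (h.sound S hS)).2

theorem proves_factsF (H : Setting LT LR Uni Mod₀ Mod) {A k : ℕ}
    (hA : HasFacts LT LR T Uni Mod₀ Mod A) (hk : A ≤ k) :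
    Proves LT (T k) (factsF LT LR Uni Mod₀ Mod) :=
  proves_of_valid (H.factsF_in.mono H.sub) fun _ S _ hS =>
    (S.valid_factsF H).2 (suff_of_facts H hA hk S hS)

/-- Each additional layer costs one use of NEC*; the theory index k + i matches the outermost stage
throughout. -/
theorem nested_raise (H : Setting LT LR Uni Mod₀ Mod) (hnec : AdmitsNec LT LR T Uni) {A k : ℕ}
    (hA : HasFacts LT LR T Uni Mod₀ Mod A) (hk : A ≤ k) {θ : Fml} (hθ : θ.In LR) {i j : ℕ}
    (hij : i ≤ j) (h : Proves LT (T (k + i)) (nested LT LR Uni Mod₀ Mod k i θ)) :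
    Proves LT (T (k + j)) (nested LT LR Uni Mod₀ Mod k j θ) := by
  induction j, hij using Nat.le_induction with
  | base => exact h
  | succ j _ ih =>
    exact (proves_factsF H hA (by omega)).and (hnec _ _ (H.nested_in k j hθ) ih)

/-- CONEC* removes the outermost layer, and the growth of the theory index is irrelevant because the
result is wanted in T_ω only. -/
theorem nested_strip (H : Setting LT LR Uni Mod₀ Mod) (hconec : AdmitsConec LT LR T Uni)
    (hT : ∀ n, ∀ φ ∈ T n, Proves LT (T (n + 1)) φ) {A k : ℕ}
    (hA : HasFacts LT LR T Uni Mod₀ Mod A) {θ : Fml} (hθ : θ.In LR) (j : ℕ) :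
    ∀ m, Proves LT (T m) (nested LT LR Uni Mod₀ Mod k j θ) → Proves LT (unionTheory T) θ := by
  induction j with
  | zero => exact fun m h => h.right.toUnion
  | succ j ih =>
    intro m h
    have hin := H.nested_in k j hθ
    -- The layer of stage k+j+1 is weakened to the later stage m+A+k+j+1, where the facts are
    -- available and the theory extends T_m.
    refine ih (m + A + k + j + 2) (hconec (m + A + k + j) _ hin ?_)
    refine proves_of_valid ((H.allModel_in _ _).mono H.sub) fun M S _ hS => ?_
    have hF := suff_of_facts H hA (by omega) S hS
    rw [hF.valid_allModel H _ (hin.mono H.sub)]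
    have h2 := (h.right.mono_stage hT (show m ≤ m + A + k + j + 1 by omega)).sound S hS
    rw [hF.valid_allModel H _ (hin.mono H.sub)] at h2
    exact fun U hU => h2 U (hF.uniAt_of_le (by omega) hU)

/-- The depth j records the applications of CONEC* still owed. Modus ponens raises its premises to a
common depth; necessitation adds an outer layer by NEC* and absorbs the innermost one into Tr^□;
co-necessitation unfolds Tr^□ into a new innermost layer. -/
theorem nec_conec_interpreted (H : Setting LT LR Uni Mod₀ Mod) (hnec : AdmitsNec LT LR T Uni)
    {A : ℕ} (hA : HasFacts LT LR T Uni Mod₀ Mod A) (hL : L'.Sub LR) {Ax : Set Fml}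
    (hAx : ∀ φ ∈ Ax, ∃ B, ∀ k, B ≤ k → Proves LT (T k) (interp Uni Mod k φ))
    {ρ : List (Fml × Label)} (h : IsProof LR.um Ax (Sent L'.um) (Sent L'.um) ρ) :
    ∀ φ ∈ ρ.map Prod.fst, φ.In LR.um ∧ ∃ j B, ∀ k, B ≤ k →
      Proves LT (T (k + j)) (nested LT LR Uni Mod₀ Mod k j (interp Uni Mod k φ)) := by
  induction h with
  | nil => simp
  | ax ρ φ _ hφ hin ih =>
    rw [List.map_cons, List.forall_mem_cons]
    obtain ⟨B, hB⟩ := hAx φ hφ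
    exact ⟨⟨hin, 0, A + B, fun k hk => (proves_factsF H hA (by omega)).and (hB k (by omega))⟩, ih⟩
  | logic ρ φ _ hφ hin ih =>
    rw [List.map_cons, List.forall_mem_cons]
    exact ⟨⟨hin, 0, A, fun k hk => (proves_factsF H hA hk).and (interp_logicalAx H hφ hin k)⟩, ih⟩
  | mp ρ φ ψ _ h1 h2 ih =>
    rw [List.map_cons, List.forall_mem_cons]
    obtain ⟨i1, j1, B, hB⟩ := ih _ h1
    obtain ⟨i2, j2, C, hC⟩ := ih _ h2
    have hψ : ψ.In LR.um := (Fml.in_imp.1 i2).2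
    refine ⟨⟨hψ, j1 + j2, A + B + C, fun k hk => ?_⟩, ih⟩
    refine nested_mono H (Γ := {interp Uni Mod k φ, interp Uni Mod k (.imp φ ψ)}) ⟨_, .inl rfl⟩
      ?_ (H.interp_in hψ k) (fun M S _ hS s => ?_) ?_
    · rintro _ (rfl | rfl)
      exacts [H.interp_in i1 k, H.interp_in i2 k]
    · exact (S.sat_imp s _ _).1 (hS _ (.inr rfl) s) (hS _ (.inl rfl) s)
    · rintro _ (rfl | rfl)
      · exact nested_raise H hnec hA (by omega) (H.interp_in i1 k) (by omega) (hB k (by omega))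
      · exact nested_raise H hnec hA (by omega) (H.interp_in i2 k) (by omega) (hC k (by omega))
  | gen ρ φ x _ h1 ih =>
    rw [List.map_cons, List.forall_mem_cons]
    obtain ⟨i1, j, B, hB⟩ := ih _ h1
    refine ⟨⟨i1, j, B, fun k hk => ?_⟩, ih⟩
    refine nested_mono H (Γ := {interp Uni Mod k φ}) (ψ := .all x (interp Uni Mod k φ)) ⟨_, rfl⟩
      ?_ (H.interp_in i1 k) (fun M S _ hS s d => hS _ rfl _) ?_
    · rintro _ rfl
      exact H.interp_in i1 k
    · rintro _ rfl
      exact hB k hk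
  | nec ρ φ _ h1 h2 ih =>
    rw [List.map_cons, List.forall_mem_cons]
    obtain ⟨i1, j, B, hB⟩ := ih _ h1
    have hb : (box φ).In LR.um := (box_in φ).mono H.base_sub.um
    refine ⟨⟨hb, j, A + B + 1, fun k hk => ?_⟩, ih⟩
    obtain ⟨k, rfl⟩ : ∃ n, k = n + 1 := ⟨k - 1, by omega⟩
    have hi := H.interp_in i1 k
    have hfi : (factsF LT LR Uni Mod₀ Mod ⋏ interp Uni Mod k φ).In LT :=
      Fml.In.mono H.sub (φ := _ ⋏ _) ⟨H.factsF_in, hi⟩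
    -- With the extra layer, the innermost one says that I_k(φ) holds in the universes of stage k+1,
    -- which is the translated Tr^□; the depth above it is again j.
    have h3 := nested_raise H hnec hA (by omega) hi (Nat.le_succ j) (hB k (by omega))
    rw [nested_succ, show k + j.succ = k + 1 + j by omega] at h3
    refine nested_mono H (Γ := {_}) ⟨_, rfl⟩ ?_ (H.interp_in hb _) (fun M S hF hS => ?_)
      (fun _ hφ => by rw [hφ]; exact h3)
    · rintro _ rfl
      exact H.allModel_in _ _
    · rw [hF.valid_interp_box H k i1]
      intro U hU
      refine Str.Holds.mono S (Γ := {_}) (fun _ hφ => by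
        rw [hφ]
        exact (hF.valid_allModel H (k + 1) hfi).1
          (hS _ rfl) U hU) fun N S' hS' => (S'.valid_and.1 (hS' _ rfl)).2
  | conec ρ φ _ h1 h2 ih =>
    rw [List.map_cons, List.forall_mem_cons]
    obtain ⟨i1, j, B, hB⟩ := ih _ h1
    have hφ : φ.In LR.um := h2.1.mono hL.um
    refine ⟨⟨hφ, j + 1, A + B, fun k hk => ?_⟩, ih⟩
    have hi := H.interp_in hφ k
    have hfi : (factsF LT LR Uni Mod₀ Mod ⋏ interp Uni Mod k φ).In LT :=
      Fml.In.mono H.sub (φ := _ ⋏ _) ⟨H.factsF_in, hi⟩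
    have hff : (factsF LT LR Uni Mod₀ Mod ⋏ factsF LT LR Uni Mod₀ Mod).In LT :=
      Fml.In.mono H.sub (φ := _ ⋏ _) ⟨H.factsF_in, H.factsF_in⟩
    -- The new innermost layer must contain the facts. They are proved in T_k, raised through the
    -- same stages, and combined there with I_k(φ).
    have h3 := nested_raise H hnec hA (k := k) (by omega) H.factsF_in (Nat.zero_le (j + 1))
      ((proves_factsF H hA (by omega)).and (proves_factsF H hA (by omega)))
    rw [nested_succ, show k + (j + 1) = k + 1 + j by omega] at h3 ⊢
    refine nested_mono H (Γ := {_, _}) ⟨_, .inl rfl⟩ ?_ (H.allModel_in _ _) (fun M S hF hS => ?_)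
      (fun _ hφ => by
        rcases hφ with hφ | hφ <;> rw [hφ]
        exacts [h3, hB (k + 1) (by omega)])
    · rintro _ (rfl | rfl)
      exacts [H.allModel_in _ _, H.interp_in i1 _]
    · rw [hF.valid_allModel H (k + 1) hfi]
      intro U hU
      have h4 := (hF.valid_allModel H (k + 1) hff).1
        (hS _ (.inl rfl)) U hU
      have h5 := (hF.valid_interp_box H k hφ).1 (hS _ (.inr rfl)) U hU
      refine Str.Holds.mono S (Γ := {_, _}) (fun _ hφ => by
        rcases hφ with hφ | hφ <;> rw [hφ]
        exacts [h4, h5]) fun N S' hS' => S'.valid_and.2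
          ⟨(S'.valid_and.1 (hS' _ (.inl rfl))).1, hS' _ (.inr rfl)⟩

/-! ### Proofs in which necessitation precedes co-necessitation -/

theorem NecBeforeConec.tail {p : Fml × Label} {ρ : List (Fml × Label)}
    (h : NecBeforeConec (p :: ρ)) : NecBeforeConec ρ :=
  fun ρ₁ φ ρ₂ e => h (p :: ρ₁) φ ρ₂ (by rw [e]; rfl)

theorem numConec_eq_zero {ρ : List (Fml × Label)} (h : ∀ ψ, (ψ, Label.conec) ∉ ρ) :
    numConec ρ = 0 := by
  rw [numConec, List.countP_eq_zero]
  rintro ⟨ψ, l⟩ hp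
  cases l with
  | conec => exact absurd hp (h ψ)
  | _ => simp

/-- As long as no co-necessitation has occurred, theory and stage have equal indices, as NEC*
demands. Each co-necessitation uses its premise one stage higher and adds one to the theory index,
whence the factor 2. -/
theorem nec_before_conec_interpreted (H : Setting LT LR Uni Mod₀ Mod)
    (hnec : AdmitsNec LT LR T Uni) (hconec : AdmitsConec LT LR T Uni)
    (hT : ∀ n, ∀ φ ∈ T n, Proves LT (T (n + 1)) φ)
    {A : ℕ} (hA : HasFacts LT LR T Uni Mod₀ Mod A) (hL : L'.Sub LR) {Γ : Set Fml}
    (hΓ : ∀ k, A ≤ k → ∀ φ ∈ Γ, Proves LT (T k) (interp Uni Mod k φ))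
    {ρ : List (Fml × Label)} (h : IsProof LR.um Γ (Sent L'.um) (Sent L'.um) ρ)
    (hρ : NecBeforeConec ρ) :
    ∀ φ ∈ ρ.map Prod.fst, ∀ k, numNec ρ + 1 ≤ k →
      Proves LT (T (2 * numConec ρ + k + A)) (interp Uni Mod (k + A) φ) := by
  have low : ∀ {k m φ}, k ≤ m → Proves LT (T k) φ → Proves LT (T m) φ :=
    fun h => Proves.mono_stage hT h
  induction h with
  | nil => simp
  | ax ρ φ _ hφ hin ih =>
    rw [List.map_cons, List.forall_mem_cons]
    have e1 : numNec ((φ, .ax) :: ρ) = numNec ρ := by simp [numNec]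
    have e2 : numConec ((φ, .ax) :: ρ) = numConec ρ := by simp [numConec]
    rw [e1, e2]
    exact ⟨fun k _ => low (by omega) (hΓ (k + A) (by omega) φ hφ), ih hρ.tail⟩
  | logic ρ φ _ hφ hin ih =>
    rw [List.map_cons, List.forall_mem_cons]
    have e1 : numNec ((φ, .logic) :: ρ) = numNec ρ := by simp [numNec]
    have e2 : numConec ((φ, .logic) :: ρ) = numConec ρ := by simp [numConec]
    rw [e1, e2]
    exact ⟨fun k _ => interp_logicalAx H hφ hin _, ih hρ.tail⟩
  | mp ρ φ ψ _ h1 h2 ih =>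
    rw [List.map_cons, List.forall_mem_cons]
    have e1 : numNec ((ψ, .logic) :: ρ) = numNec ρ := by simp [numNec]
    have e2 : numConec ((ψ, .logic) :: ρ) = numConec ρ := by simp [numConec]
    rw [e1, e2]
    exact ⟨fun k hk => .mp _ _ (ih hρ.tail _ h1 k hk) (ih hρ.tail _ h2 k hk), ih hρ.tail⟩
  | gen ρ φ x _ h1 ih =>
    rw [List.map_cons, List.forall_mem_cons]
    have e1 : numNec ((.all x φ, .logic) :: ρ) = numNec ρ := by simp [numNec]
    have e2 : numConec ((.all x φ, .logic) :: ρ) = numConec ρ := by simp [numConec]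
    rw [e1, e2]
    exact ⟨fun k hk => .gen _ x (ih hρ.tail _ h1 k hk), ih hρ.tail⟩
  | nec ρ φ _ h1 h2 ih =>
    rw [List.map_cons, List.forall_mem_cons]
    have e1 : numNec ((box φ, .nec) :: ρ) = numNec ρ + 1 := by simp [numNec]
    have e2 : numConec ((box φ, .nec) :: ρ) = numConec ρ := by simp [numConec]
    -- The order of the rules enters here only: before a necessitation the theory has not yet moved
    -- above the stage.
    have e3 : numConec ρ = 0 := numConec_eq_zero (hρ [] (box φ) ρ rfl)
    have ih := ih hρ.tail
    rw [e1, e2, e3] at *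
    refine ⟨fun k hk => ?_, fun ψ hψ k hk => ih ψ hψ k (by omega)⟩
    obtain ⟨k, rfl⟩ : ∃ n, k = n + 1 := ⟨k - 1, by omega⟩
    have := nec_step H hnec hA (k := k + A) (by omega) (h2.1.mono hL.um)
      (low (by omega) (ih φ h1 k (by omega)))
    rw [show k + 1 + A = k + A + 1 by omega]
    exact low (by omega) this
  | conec ρ φ _ h1 h2 ih =>
    rw [List.map_cons, List.forall_mem_cons]
    have e1 : numNec ((φ, .conec) :: ρ) = numNec ρ := by simp [numNec]
    have e2 : numConec ((φ, .conec) :: ρ) = numConec ρ + 1 := by simp [numConec]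
    rw [e1, e2]
    have ih := ih hρ.tail
    refine ⟨fun k hk => ?_, fun ψ hψ k hk => low (by omega) (ih ψ hψ k hk)⟩
    have h3 := ih _ h1 (k + 1) (by omega)
    rw [show k + 1 + A = k + A + 1 by omega] at h3
    exact low (by omega) (conec_step H hconec hA (by omega) (by omega) (h2.1.mono hL.um) h3)

end

end Multiverse

namespace Multiverse

variable {M : Type}

/-! ### Existence of revision formulas -/

theorem varFinset_num (n : ℕ) : (num n).varFinset = ∅ := by
  induction n with
  | zero => exact Finset.biUnion_empty
  | succ n ih =>
    refine Finset.eq_empty_of_forall_notMem fun i hi => ?_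
    obtain ⟨j, -, hj⟩ := Finset.mem_biUnion.1 hi
    fin_cases j
    exact absurd (ih ▸ hj : i ∈ (∅ : Finset ℕ)) (Finset.notMem_empty i)

/-- The code of `∀ x₁₃ (x₁₃ = c → γ)`, where `x₁₃` stands for the code of `γ` and `x₁₄` for the code
of the numeral `c`. -/
def diagC : Tm := allC (num 13) (impC (eqC (varC (num 13)) (v 14)) (v 13))

theorem inLangT_diagC : InLangT baseLang diagC := by simp [diagC]

theorem Str.val_diagC (S : Str M) [S.IsZF] (γ : Fml) (n : ℕ) {s : ℕ → M}
    (h : s 13 = S.numI (code γ)) (h' : s 14 = S.numI (codeT (num n))) :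
    S.val s diagC = S.numI (code (.all 13 (v 13 ≐ num n ⇛ γ))) := by
  rw [diagC, val_allC, val_impC, val_eqC, val_varC, val_var, val_var, val_num, h, h', impI,
    varI_numI, eqI_numI, negI_numI, andI_numI, negI_numI, allI_numI, Fml.imp]

/-- Read as a formula in x₁₃, γ asserts β of the code that results from inserting the numeral of x₁₃
into the formula coded by x₁₃; the numeral code is produced by `isNumCode`. -/
theorem exists_diagonal_base {β : Fml} (hβ : β.In baseLang) :
    ∃ γ : Fml, γ.In baseLang ∧ γ.fv ⊆ {0, 1, 2, 3, 13} ∧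
      ∀ (M : Type) (S : Str M) (s : ℕ → M), ∃ s' : ℕ → M, (∀ i, i < 4 ∨ i = 13 → s' i = s i) ∧
        (S.Sat s γ ↔ ∃ y, S.IsNumCode (s 13) y ∧
          S.Sat (Function.update (Function.update s' 14 y) 13
            (S.val (Function.update s' 14 y) diagC)) β) := by
  -- Collapsing all superfluous variables to x₀ bounds the free variables without computing those of
  -- β. The assignment s' reflects the collapse.
  obtain ⟨σ, hσ, hσ'⟩ : ∃ σ : ℕ → Tm, (∀ i, i < 4 ∨ i = 13 → σ i = v i) ∧
      ∀ i, ¬ (i < 4 ∨ i = 13) → σ i = v 0 :=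
    ⟨fun i => if i < 4 ∨ i = 13 then v i else v 0, fun i h => if_pos h, fun i h => if_neg h⟩
  have hσL : ∀ i, InLangT baseLang (σ i) := by
    intro i
    by_cases h : i < 4 ∨ i = 13
    · rw [hσ i h]; exact inLangT_var _
    · rw [hσ' i h]; exact inLangT_var _
  obtain ⟨α, hα⟩ : ∃ α, α = Fml.ex 14 (isNumCode.at [v 13, v 14] ⋏ β.subst1 13 diagC) := ⟨_, rfl⟩
  refine ⟨α.subst σ, Fml.In.subst (fun n _ => hσL n) ?_, fun i hi => ?_, fun M S s => ?_⟩
  · rw [hα, Fml.in_ex, Fml.in_and]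
    exact ⟨in_isNumCode.at (by simp), hβ.subst1 inLangT_diagC⟩
  · rw [Fml.fv_subst] at hi
    obtain ⟨n, -, hn⟩ := Finset.mem_biUnion.1 hi
    by_cases h : n < 4 ∨ n = 13
    · rw [hσ n h] at hn
      obtain rfl := Finset.mem_singleton.1 hn
      simp only [Finset.mem_insert, Finset.mem_singleton]
      omega
    · rw [hσ' n h] at hn
      obtain rfl := Finset.mem_singleton.1 hn
      simp
  · have hs : ∀ i, i < 4 ∨ i = 13 → S.val s (σ i) = s i := fun i hi => by
      rw [hσ i hi, Str.val_var]
    refine ⟨fun i => S.val s (σ i), hs, ?_⟩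
    rw [Str.sat_subst, hα, Str.sat_ex]
    refine exists_congr fun y => ?_
    rw [Str.sat_and, Str.sat_subst1, Str.sat_at, Str.sat_isNumCode, List.map, List.map, List.map,
      lst_zero, lst_one, Str.val_var, Str.val_var, Function.update_self,
      Function.update_of_ne (by decide), hs 13 (.inr rfl)]

/-- The diagonal lemma: self-reference in the variable `x₁₃`, with the parameters `x₀, …, x₃`. -/
theorem exists_diagonal {β : Fml} (hβ : β.In baseLang) :
    ∃ Mod : Fml, Mod.In baseLang ∧ Mod.fv ⊆ {0, 1, 2, 3} ∧
      ∀ (M : Type) (S : Str M), S.IsZF → ∀ s : ℕ → M, ∃ s' : ℕ → M,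
        (∀ i < 4, s' i = s i) ∧ s' 13 = S.numI (code Mod) ∧ (S.Sat s Mod ↔ S.Sat s' β) := by
  obtain ⟨γ, hγ, hγv, h⟩ := exists_diagonal_base hβ
  obtain ⟨n, hn⟩ : ∃ n, n = code γ := ⟨_, rfl⟩
  -- The fixed point is γ applied to its own code n, so the code it speaks about is its own.
  refine ⟨.all 13 (v 13 ≐ num n ⇛ γ), ?_, fun i hi => ?_, fun M S hS s => ?_⟩
  · rw [Fml.in_all, Fml.in_imp, Fml.in_eq]
    exact ⟨⟨inLangT_var _, inLangT_num _⟩, hγ⟩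
  · simp only [Fml.imp, Fml.fv, varFinset_num, Finset.mem_erase, Finset.mem_union,
      Finset.notMem_empty, or_false] at hi
    obtain ⟨h13, hi | hi⟩ := hi
    · exact absurd (Finset.mem_singleton.1 hi) h13
    · have := hγv hi
      simp only [Finset.mem_insert, Finset.mem_singleton] at this ⊢
      omega
  · obtain ⟨s₂, h2, h3⟩ := h M S (Function.update s 13 (S.numI n))
    obtain ⟨c, hc⟩ : ∃ c, c = S.numI (codeT (num n)) := ⟨_, rfl⟩
    have hcode : ∀ y, S.IsNumCode (S.numI n) y ↔ y = c := by
      intro y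
      rw [hc]
      refine ⟨S.isNumCode_numI, ?_⟩
      rintro rfl
      obtain ⟨y, hy⟩ := S.exists_isNumCode (S.isNat_numI n)
      rwa [S.isNumCode_numI hy] at hy
    have ht := S.val_diagC γ n (s := Function.update s₂ 14 c)
      (by rw [Function.update_of_ne (by decide), h2 13 (.inr rfl), Function.update_self, hn])
      (by rw [Function.update_self, hc])
    refine ⟨Function.update (Function.update s₂ 14 c) 13 (S.val (Function.update s₂ 14 c) diagC),
      fun i hi => ?_, ?_, ?_⟩
    · rw [Function.update_of_ne (by omega), Function.update_of_ne (by omega), h2 i (.inl hi)]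
      exact Function.update_of_ne (by omega) _ _
    · rw [Function.update_self, ht]
    · rw [Function.update_self] at h3
      simp only [hcode, exists_eq_left] at h3
      rw [← h3]
      simp only [Str.sat_all, Str.sat_imp, Str.sat_eq, Str.val_var, Str.val_num,
        Function.update_self, forall_eq]

/-- The formula β is the right-hand side of the equivalence with x₁₃ in place of the code of `Mod`;
the fixed point gives x₁₃ the value of that code. -/
theorem exists_isRevisionFormula {LT LR : Lang} {Uni Mod₀ : Fml} (hU : Uni.In baseLang)
    (hU' : Uni.fv ⊆ {0, 1}) (h0 : Mod₀.In baseLang) (h0' : Mod₀.fv ⊆ {1, 2, 3}) :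
    ∃ Mod, IsRevisionFormula baseLang ZF LT LR Uni Mod₀ Mod := by
  let β : Fml := isNat.at [v 0] ⋏ Uni ⋏ (isForm LR.um).at [v 2] ⋏ isVAof.at [v 3, v 1] ⋏
    (v 0 ≐ zeroT ⇛ Mod₀) ⋏
    .all 4 (isNat.at [v 4] ⋏ v 0 ≐ succT (v 4) ⇛
      .ex 5 ((isExpansionT LT LR Uni (v 13)).at [v 1, v 4, v 5] ⋏
        (sat LR.um).at [v 5, v 2, v 3]))
  have hβ : β.In baseLang := by
    have := (in_isExpansionT LT LR Uni (inLangT_var 13)).at (ts := [v 1, v 4, v 5]) (by simp)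
    simp [β, hU, h0, this]
  obtain ⟨Mod, h1, h2, h3⟩ := exists_diagonal hβ
  refine ⟨Mod, h1, h2, proves_of_valid (in_revisionEquiv hU h0 h1) fun M S _ hS s => ?_⟩
  have hZ : S.IsZF := ⟨fun φ hφ => hS φ hφ (zf_in hφ)⟩
  obtain ⟨s', h4, h13, h⟩ := h3 M S hZ s
  have e0 := h4 0 (by omega)
  have e1 := h4 1 (by omega)
  have e2 := h4 2 (by omega)
  have e3 := h4 3 (by omega)
  have eU : S.Sat s' Uni ↔ S.Sat s Uni := S.sat_congr _ fun n hn => h4 n (by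
    have := hU' hn
    simp only [Finset.mem_insert, Finset.mem_singleton] at this
    omega)
  have e0' : S.Sat s' Mod₀ ↔ S.Sat s Mod₀ := S.sat_congr _ fun n hn => h4 n (by
    have := h0' hn
    simp only [Finset.mem_insert, Finset.mem_singleton] at this
    omega)
  have hE : ∀ r : ℕ → M, S.Sat r (isExpansionT LT LR Uni (v 13)) ↔
      S.IsExpansion LT LR (S.numI (code Uni)) (r 13) (r 0) (r 1) (r 2) := fun r =>
    S.sat_isExpansionT r LT LR Uni (v 13) fun r' hr => hr 13 le_rfl
  have l13 : ∀ (r : ℕ → M) a b c, lst r [a, b, c] 13 = r 13 := fun _ _ _ _ => rfl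
  rw [S.sat_revisionEquiv, h]
  simp [β, Str.sat_at, hE, l13, e0, e1, e2, e3, eU, e0', h13]

end Multiverse

/-! ### The main lemma -/

theorem mainTheorem1
    (LT LR : Lang) (T : ℕ → Set Fml) (Uni Mod₀ : Fml)
    (hpar : IsRevisionParameters LT LR T Uni Mod₀)
    (hZF : ∀ φ ∈ ZF, Proves LT (unionTheory T) φ) :
    -- the revision-semantic formula exists, provably in ZF
    (∃ Mod : Fml, IsRevisionFormula baseLang ZF LT LR Uni Mod₀ Mod) ∧
    -- and for every such formula, every language `L'` between the language of set theory and `LR`,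
    -- and every theory `S` whose finite parts are eventually interpreted by `I_k` in `T_k`:
    ∀ Mod : Fml, IsRevisionFormula LT (unionTheory T) LT LR Uni Mod₀ Mod →
    ∀ L' : Lang, baseLang.Sub L' → L'.Sub LR →
    ∀ S : Set Fml, (∀ φ ∈ S, φ.In LR.um) →
    (∀ Γ : Set Fml, Γ.Finite → Γ ⊆ S →
      ∃ A : ℕ, ∀ k, A ≤ k → ∀ φ ∈ Γ, Proves LT (T k) (interp Uni Mod k φ)) →
    -- (a)
    (AdmitsNec LT LR T Uni →
      LocallyInterprets LT (unionTheory T) LR.um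
        (SystemThms LR.um (CMminus L' ∪ S) (Sent L'.um) ∅) (Set.range (interp Uni Mod))) ∧
    -- (b)
    (AdmitsConec LT LR T Uni →
      LocallyInterprets LT (unionTheory T) LR.um
        (SystemThms LR.um (CMminus L' ∪ S) ∅ (Sent L'.um)) (Set.range (interp Uni Mod))) ∧
    -- (c)
    (AdmitsNec LT LR T Uni → AdmitsConec LT LR T Uni →
      LocallyInterprets LT (unionTheory T) LR.um
        (SystemThms LR.um (CMminus L' ∪ S) (Sent L'.um) (Sent L'.um))
        (Set.range (interp Uni Mod))) ∧
    -- (d) the finer bound, for proofs with all applications of NEC before those of CONEC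
    (AdmitsNec LT LR T Uni → AdmitsConec LT LR T Uni →
      ∀ Γ : Set Fml, Γ.Finite → Γ ⊆ CMminus L' ∪ S →
        ∃ A' : ℕ, 1 ≤ A' ∧
          (∀ k, A' ≤ k → ∀ φ ∈ Γ, Proves LT (T k) (interp Uni Mod k φ)) ∧
          ∀ (ψ : Fml) (l : Label) (ρ : List (Fml × Label)),
            IsProof LR.um Γ (Sent L'.um) (Sent L'.um) ((ψ, l) :: ρ) →
            NecBeforeConec ((ψ, l) :: ρ) →
            ∀ k, numNec ((ψ, l) :: ρ) + 1 ≤ k →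
              Proves LT (T (2 * numConec ((ψ, l) :: ρ) + k + A'))
                (interp Uni Mod (k + A') ψ)) := by
  refine ⟨exists_isRevisionFormula hpar.uni_in hpar.uni_fv hpar.mod_in hpar.mod_fv, ?_⟩
  intro Mod hMod L' _ hL S _ hS
  have H := hpar.setting hMod.1 hMod.2.1
  have hT := hpar.theory_succ
  obtain ⟨A, hA⟩ := exists_stage_facts hpar hZF hMod
  have hAx : ∀ φ ∈ CMminus L' ∪ S,
      ∃ B, ∀ k, B ≤ k → Proves LT (T k) (interp Uni Mod k φ) := by
    rintro φ (hφ | hφ)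
    · exact exists_stage_cmMinus hpar hZF hMod hL hφ
    -- Singletons are enough, since bounds for finite sets are recombined by maxima.
    · obtain ⟨B, hB⟩ := hS {φ} (Set.finite_singleton φ) (Set.singleton_subset_iff.2 hφ)
      exact ⟨B, fun k hk => hB k hk φ rfl⟩
  refine ⟨fun hnec => ?_, fun hconec => ?_, fun hnec hconec => ?_, fun hnec hconec Γ hΓ hsub => ?_⟩
  · refine locallyInterprets_of H fun φ hφ => ?_
    obtain ⟨l, ρ, hρ⟩ := hφ
    obtain ⟨B, hB⟩ := nec_interpreted H hnec hA hL hAx hρ φ List.mem_cons_self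
    exact ⟨B, fun k hk => (hB k hk).toUnion⟩
  · refine locallyInterprets_of H fun φ hφ => ?_
    obtain ⟨l, ρ, hρ⟩ := hφ
    exact conec_interpreted H hconec hT hA hL hAx hρ φ List.mem_cons_self
  · refine locallyInterprets_of H fun φ hφ => ?_
    obtain ⟨l, ρ, hρ⟩ := hφ
    obtain ⟨hin, j, B, hB⟩ := nec_conec_interpreted H hnec hA hL hAx hρ φ List.mem_cons_self
    exact ⟨B, fun k hk => nested_strip H hconec hT hA (H.interp_in hin k) j _ (hB k hk)⟩
  · obtain ⟨B, hB⟩ := exists_stage_of_finite hΓ fun φ hφ => hAx φ (hsub hφ)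
    -- The bound lies beyond that of the facts and that of the axioms in Γ, and the summand 1 makes
    -- it positive.
    have hB' : ∀ k, A + B + 1 ≤ k → ∀ φ ∈ Γ, Proves LT (T k) (interp Uni Mod k φ) :=
      fun k hk => hB k (by omega)
    exact ⟨A + B + 1, by omega, hB', fun ψ l ρ hρ hb k hk =>
      nec_before_conec_interpreted H hnec hconec hT (fun k hk => hA k (by omega)) hL hB' hρ hb ψ
        List.mem_cons_self k hk⟩
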